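/- **Setting.** Let $1<p<\infty$, let $X=L^p(\mathbb R)$ (complex-valued functions), let $\mathcal L(X)$ be the bounded linear operators on $X$, and $\mathbb N=\{1,2,\dots\}$. On $X$ put $P_n=\chi_{[-n,n]}I$, $(V_su)(x)=u(x-s)$, $(U_tu)(x)=e^{itx}u(x)$, $(Z_nu)(x)=n^{-1/p}u(x/n)$. *$\mathcal P$-notions.* $K\in\mathcal L(X)$ is $\mathcal P$-compact, $K\in\mathcal K(X,\mathcal P)$, if $\|K(I-P_n)\|\to0$ and $\|(I-P_n)K\|\to0$. $\mathcal L(X,\mathcal P)$ is the set of $A\in\mathcal L(X)$ with $AK,KA\in\mathcal K(X,\mathcal P)$ for all $K\in\mathcal K(X,\mathcal P)$. $A\in\mathcal L(X,\mathcal P)$ is $\mathcal P$-Fredholm if there is $B\in\mathcal L(X)$ with $AB-I,\ BA-I\in\mathcal K(X,\mathcal P)$. A sequence $(A_n)$ converges $\mathcal P$-strongly to $S\in\mathcal L(X,\mathcal P)$ if $\|K(A_n-S)\|+\|(A_n-S)K\|\to0$ for all $K\in\mathcal K(X,\mathcal P)$; it converges $*$-strongly to $S$ if $A_n\to S$ and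 $A_n^*\to S^*$ strongly. *Structured sequences.* $\mathcal F$ is the Banach algebra of bounded sequences $\{A_n\}_{n\in\mathbb N}$ in $\mathcal L(X)$ with the supremum norm. Let $T_{\mathcal P}=\{-,c,+\}$, $T=T_{\mathcal P}\cup\mathbb R$, and $E_n^{\pm}(A)=V_{\pm n}AV_{\mp n}$, $E_n^c(A)=A$, $E_n^t(A)=U_{-t}Z_nAZ_n^{-1}U_t$ for $t\in\mathbb R$. For strictly increasing $h:\mathbb N\to\mathbb N$ let $\mathcal F_h$ be the set of bounded sequences $\{A_{h_n}\}_{n}$ of operators indexed along $h$, and let $\mathcal F^T_h$ (the $T$-structured ones) be those for which, for each $t\in T$, $(E^t_{h_n})^{-1}(A_{h_n})$ has a limit, $\mathcal P$-strong (with limit $\mathsf W^t$ in $\mathcal L(X,\mathcal P)$) if $t\in T_{\mathcal P}$, and $*$-strong if $t\in\mathbb R$. Let $\mathcal J^T_h$ be the smallest closed subspace of $\mathcal F_h$ containing all sequences tending to $0$ in norm and all $\{E^t_{h_n}(K)\}$ with $K\in\mathcal K(X,\mathcal P)$, $t\in T_{\mathcal P}$, or $K$ compact, $t\in\mathbb R$.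 For $\mathbb A\in\mathcal F$ let $\mathbb A_h=\{A_{h_n}\}$ and let $\mathbf H_{\mathbb A}$ be the set of strictly increasing $g$ with $\mathbb A_g\in\mathcal F^T_g$. *Function algebras.* $\dot{\mathbb R}$ is the one-point compactification of $\mathbb R$. In $L^\infty(\mathbb R)$: $PC^\lambda$ ($\lambda\in\dot{\mathbb R}$) consists of the functions continuous on $\dot{\mathbb R}\setminus\{\lambda\}$ with finite one-sided limits at $\lambda$; $SO^\lambda$ of those bounded and continuous on $\dot{\mathbb R}\setminus\{\lambda\}$ such that for each $r\in(0,1)$ the essential oscillation over $\lambda+([-x,-rx]\cup[rx,x])$ tends to $0$ as $x\to+0$ (if $\lambda\in\mathbb R$), or over $[-x,-rx]\cup[rx,x]$ as $x\to+\infty$ (if $\lambda=\infty$). $[\,\cdot\,]$ denotes the smallest closed subalgebra of $L^\infty(\mathbb R)$ containing the given sets; $PC=[PC^\lambda:\lambda\in\dot{\mathbb R}]$, $SO=[SO^\lambda:\lambda\in\dot{\mathbb R}]$. $BUC$ is the set of bounded uniformly continuous functions, and $L^\infty_0$ the set of $a\in L^\infty(\mathbb R)$ with $\lim_{x\to\pm\infty}a(x)=0$.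 *Multipliers.* With $(Fu)(x)=\int u(t)e^{itx}dt$, $M^r$ is the set of $b\in L^\infty(\mathbb R)$ for which $F^{-1}bF$ is $L^r$-bounded on $L^2\cap L^r$; $W^0(b)$ is its extension to $L^r(\mathbb R)$ and $\|b\|_{M^r}=\|W^0(b)\|$. $M^{\langle2\rangle}=M^2$, and for $p\ne2$, $M^{\langle p\rangle}$ is the set of $b$ that lie in $M^r$ for all $r$ in some neighbourhood of $p$ (in $(1,\infty)$). $\mathcal B_p$ is the closure of $\mathcal B\cap M^{\langle p\rangle}$ in $M^p$. *Finite section algebra.* $\mathcal A_1$ is the smallest closed subalgebra of $\mathcal F$ containing the constant sequences $\{aI\}$, $a\in[PC,SO,L^\infty_0]$; $\{W^0(b)\}$, $b\in[PC^\lambda,SO,BUC]_p$, $\lambda\in\mathbb R$; $\{K\}$, $K\in\mathcal K(X,\mathcal P)$; and the sequence $\{P_n\}$. $\mathcal F_{\mathcal A_1}$ is the smallest closed subalgebra of $\mathcal F$ containing all $\{P_nA_nP_n+(I-P_n)\}$ with $\{A_n\}\in\mathcal A_1$. **Proposition.** Let $\mathbb A\in\mathcal F_{\mathcal A_1}$ and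 suppose that all snapshots $\mathsf W^t(\mathbb A_g)$, $t\in T_{\mathcal P}=\{-,c,+\}$, $g\in\mathbf H_{\mathbb A}$, are $\mathcal P$-Fredholm. Then every $T$-structured subsequence $\mathbb A_g$ ($g\in\mathbf H_{\mathbb A}$) has a subsequence $\mathbb A_h$, $h=g\circ k$ with $k$ strictly increasing, which is $\mathcal J^T$-Fredholm: $\mathbb A_h\in\mathcal F^T_h$ and $\mathbb A_h+\mathcal J^T_h$ is invertible in $\mathcal F^T_h/\mathcal J^T_h$. -/

import Mathlib

open scoped ENNReal

noncomputable section

namespace FiniteSection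

open MeasureTheory Filter Topology Set FourierTransform

/-! ### Function algebras in `L^∞(ℝ)`

Elements of `L^∞(ℝ)` are represented by functions `ℝ → ℂ`; all the classes `linfAlg S` below are
stable under almost everywhere equality. -/

/-- The smallest closed subalgebra of `L^∞(ℝ)` containing `S`: the closure, with respect to the
essential supremum norm, of the algebra generated by `S`. -/
def linfAlg (S : Set (ℝ → ℂ)) : Set (ℝ → ℂ) :=
  {a | MemLp a ⊤ volume ∧
    ∀ ε : ℝ, 0 < ε → ∃ b ∈ Algebra.adjoin ℂ S, eLpNorm (a - b) ⊤ volume ≤ ENNReal.ofReal ε}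

/-- The essential oscillation `ess sup {|f t - f s| : t, s ∈ I}`. -/
def essOsc (f : ℝ → ℂ) (I : Set ℝ) : ℝ≥0∞ :=
  essSup (fun z : ℝ × ℝ => ‖f z.1 - f z.2‖ₑ) ((volume.restrict I).prod (volume.restrict I))

/-- Continuity on the one-point compactification of `ℝ` with the finite point `c` removed. -/
def ContinuousOffPoint (c : ℝ) (f : ℝ → ℂ) : Prop :=
  ContinuousOn f {c}ᶜ ∧ ∃ l : ℂ, Tendsto f (cocompact ℝ) (𝓝 l)

/-- `PC^c` for a finite point `c`. -/
def pcAt (c : ℝ) : Set (ℝ → ℂ) :=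
  {f | ContinuousOffPoint c f ∧
    (∃ l : ℂ, Tendsto f (𝓝[<] c) (𝓝 l)) ∧ ∃ l : ℂ, Tendsto f (𝓝[>] c) (𝓝 l)}

/-- `PC^∞`. -/
def pcInfty : Set (ℝ → ℂ) :=
  {f | Continuous f ∧ (∃ l : ℂ, Tendsto f atBot (𝓝 l)) ∧ ∃ l : ℂ, Tendsto f atTop (𝓝 l)}

/-- `SO^c` for a finite point `c`. -/
def soAt (c : ℝ) : Set (ℝ → ℂ) :=
  {f | ContinuousOffPoint c f ∧ MemLp f ⊤ volume ∧
    ∀ r ∈ Ioo (0 : ℝ) 1,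
      Tendsto (fun x : ℝ => essOsc f (Icc (c - x) (c - r * x) ∪ Icc (c + r * x) (c + x)))
        (𝓝[>] 0) (𝓝 0)}

/-- `SO^∞`. -/
def soInfty : Set (ℝ → ℂ) :=
  {f | Continuous f ∧ MemLp f ⊤ volume ∧
    ∀ r ∈ Ioo (0 : ℝ) 1,
      Tendsto (fun x : ℝ => essOsc f (Icc (-x) (-(r * x)) ∪ Icc (r * x) x)) atTop (𝓝 0)}

/-- Piecewise continuous functions. -/
def pc : Set (ℝ → ℂ) := linfAlg ((⋃ c : ℝ, pcAt c) ∪ pcInfty)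

/-- Slowly oscillating functions. -/
def so : Set (ℝ → ℂ) := linfAlg ((⋃ c : ℝ, soAt c) ∪ soInfty)

/-- Bounded uniformly continuous functions. -/
def buc : Set (ℝ → ℂ) := {f | UniformContinuous f ∧ ∃ C : ℝ, ∀ x, ‖f x‖ ≤ C}

/-- `L^∞_0`: (representatives of) essentially bounded functions with limit zero at `±∞`. -/
def linfZero : Set (ℝ → ℂ) :=
  {f | MemLp f ⊤ volume ∧ Tendsto f atBot (𝓝 0) ∧ Tendsto f atTop (𝓝 0)}

/-! ### Operators on `L^p(ℝ)` -/

section Operators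

variable (p : ℝ≥0∞) [Fact (1 ≤ p)]

/-- The space `X = L^p(ℝ)` of complex valued functions. -/
abbrev X : Type := Lp ℂ p (volume : Measure ℝ)

/-- The bounded linear operators on `X`. -/
abbrev Op : Type := X p →L[ℂ] X p

/-- The multiplication operator `a I` with `a ∈ L^∞(ℝ)`. -/
def mulOp (a : ℝ → ℂ) (ha : MemLp a ⊤ volume) : Op p :=
  (ContinuousLinearMap.mul ℂ ℂ).holderL volume ⊤ p p (ha.toLp a)

theorem mulOp_coeFn (a : ℝ → ℂ) (ha : MemLp a ⊤ volume) (u : X p) :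
    mulOp p a ha u =ᵐ[volume] fun x => a x * u x := by
  have h := (ContinuousLinearMap.mul ℂ ℂ).coeFn_holder (r := p) (ha.toLp a) u
  filter_upwards [h, ha.coeFn_toLp] with x hx hx'
  rw [mulOp, ContinuousLinearMap.holderL_apply_apply, hx, hx']
  rfl

theorem memLp_indicator (s : Set ℝ) (hs : MeasurableSet s) :
    MemLp (s.indicator fun _ => (1 : ℂ)) ⊤ (volume : Measure ℝ) :=
  (memLp_top_const (1 : ℂ)).indicator hs

/-- The projections `P_n = χ_{[-n,n]} I`. -/
def proj (n : ℕ+) : Op p :=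
  mulOp p ((Icc (-(n : ℝ)) n).indicator fun _ => 1) (memLp_indicator _ measurableSet_Icc)

/-- The shifts `(V_s u)(x) = u(x - s)`. -/
def shift (s : ℝ) : Op p :=
  (Lp.compMeasurePreservingₗᵢ ℂ (fun x : ℝ => x - s)
    (measurePreserving_sub_right volume s)).toContinuousLinearMap

theorem memLp_character (t : ℝ) :
    MemLp (fun x : ℝ => Complex.exp (Complex.I * t * x)) ⊤ volume := by
  refine memLp_top_of_bound (by fun_prop) 1 (Eventually.of_forall fun x => ?_)
  rw [Complex.norm_exp]
  simp

/-- The modulations `(U_t u)(x) = e^{itx} u(x)`. -/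
def modulation (t : ℝ) : Op p :=
  mulOp p (fun x : ℝ => Complex.exp (Complex.I * t * x)) (memLp_character t)

theorem map_div_volume (c : ℝ) (hc : 0 < c) :
    Measure.map (fun x : ℝ => x / c) volume = ENNReal.ofReal c • volume := by
  have h := Real.map_volume_mul_right (inv_ne_zero hc.ne')
  simpa [div_eq_mul_inv, abs_of_pos hc] using h

theorem memLp_dilate {q : ℝ≥0∞} {u : ℝ → ℂ} (hu : MemLp u q volume) (c : ℝ) (hc : 0 < c) :
    MemLp (fun x => u (x / c)) q volume := by
  refine MemLp.comp_of_map (f := fun x : ℝ => x / c) ?_ (by fun_prop)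
  rw [map_div_volume c hc]
  exact hu.smul_measure ENNReal.ofReal_ne_top

theorem eLpNorm_dilate {q : ℝ≥0∞} {u : ℝ → ℂ} (hu : MemLp u q volume) (c : ℝ) (hc : 0 < c) :
    eLpNorm (fun x => u (x / c)) q volume =
      ENNReal.ofReal c ^ (1 / q).toReal * eLpNorm u q volume := by
  have hc0 : ENNReal.ofReal c ≠ 0 := by simpa using hc
  have h := eLpNorm_map_measure (p := q) (μ := (volume : Measure ℝ)) (f := fun x : ℝ => x / c)
    (g := u) (by rw [map_div_volume c hc]; exact hu.1.smul_measure _) (by fun_prop)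
  rw [map_div_volume c hc, eLpNorm_smul_measure_of_ne_zero hc0] at h
  exact h.symm

/-- The normalized dilations `u ↦ c^{-1/p} u(x / c)`, for `c > 0`. -/
def dilation (c : ℝ) (hc : 0 < c) : Op p :=
  LinearMap.mkContinuous
    { toFun := fun u => ((c ^ (-(1 / p.toReal)) : ℝ) : ℂ) •
        (memLp_dilate (Lp.memLp u) c hc).toLp (fun x => u (x / c))
      map_add' := fun u v => by
        rw [← smul_add, ← MemLp.toLp_add]
        congr 1
        refine MemLp.toLp_congr _ _ ?_
        have h : Measure.QuasiMeasurePreserving (fun x : ℝ => x / c) volume volume :=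
          ⟨by fun_prop, by rw [map_div_volume c hc]; exact Measure.smul_absolutelyContinuous⟩
        exact h.ae (Lp.coeFn_add u v)
      map_smul' := fun k u => by
        rw [RingHom.id_apply, smul_comm k, ← MemLp.toLp_const_smul k]
        congr 1
        refine MemLp.toLp_congr _ _ ?_
        have h : Measure.QuasiMeasurePreserving (fun x : ℝ => x / c) volume volume :=
          ⟨by fun_prop, by rw [map_div_volume c hc]; exact Measure.smul_absolutelyContinuous⟩
        exact h.ae (Lp.coeFn_smul k u) }
    (‖((c ^ (-(1 / p.toReal)) : ℝ) : ℂ)‖ * (ENNReal.ofReal c ^ (1 / p).toReal).toReal)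
    (fun u => by
      have h : ‖(memLp_dilate (Lp.memLp u) c hc).toLp (fun x => u (x / c))‖ =
          (ENNReal.ofReal c ^ (1 / p).toReal).toReal * ‖u‖ := by
        rw [Lp.norm_toLp, eLpNorm_dilate (Lp.memLp u) c hc, ENNReal.toReal_mul, Lp.norm_def]
      change ‖((c ^ (-(1 / p.toReal)) : ℝ) : ℂ) •
        (memLp_dilate (Lp.memLp u) c hc).toLp (fun x => u (x / c))‖ ≤ _
      rw [norm_smul, h, mul_assoc])

theorem dilation_coeFn (c : ℝ) (hc : 0 < c) (u : X p) :
    dilation p c hc u =ᵐ[volume]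
      fun x => ((c ^ (-(1 / p.toReal)) : ℝ) : ℂ) * u (x / c) := by
  have h := Lp.coeFn_smul ((c ^ (-(1 / p.toReal)) : ℝ) : ℂ)
    ((memLp_dilate (Lp.memLp u) c hc).toLp (fun x => u (x / c)))
  filter_upwards [h, (memLp_dilate (Lp.memLp u) c hc).coeFn_toLp] with x hx hx'
  refine hx.trans ?_
  simp only [Pi.smul_apply, hx', smul_eq_mul]

/-- `(Z_n u)(x) = n^{-1/p} u(x / n)`. -/
def zOp (n : ℕ+) : Op p := dilation p (n : ℝ) (by exact_mod_cast n.pos)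

/-- `(Z_n^{-1} u)(x) = n^{1/p} u(n x)`. -/
def zInv (n : ℕ+) : Op p := dilation p ((n : ℝ)⁻¹) (inv_pos.2 (by exact_mod_cast n.pos))

theorem dilation_comp (c d : ℝ) (hc : 0 < c) (hd : 0 < d) (h : c * d = 1) :
    dilation p c hc * dilation p d hd = 1 := by
  ext u
  have hq : Measure.QuasiMeasurePreserving (fun x : ℝ => x / c) volume volume :=
    ⟨by fun_prop, by rw [map_div_volume c hc]; exact Measure.smul_absolutelyContinuous⟩
  filter_upwards [dilation_coeFn p c hc (dilation p d hd u), hq.ae (dilation_coeFn p d hd u)]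
    with x hx hx'
  refine hx.trans ?_
  rw [hx', ← mul_assoc, ← Complex.ofReal_mul, ← Real.mul_rpow hc.le hd.le, h, div_div, h]
  simp

theorem zOp_mul_zInv (n : ℕ+) : zOp p n * zInv p n = 1 :=
  dilation_comp p _ _ _ _ (mul_inv_cancel₀ (by exact_mod_cast n.pos.ne'))

theorem zInv_mul_zOp (n : ℕ+) : zInv p n * zOp p n = 1 :=
  dilation_comp p _ _ _ _ (inv_mul_cancel₀ (by exact_mod_cast n.pos.ne'))

end Operators

/-! ### Fourier multipliers -/

theorem memLp_top_rescale {b : ℝ → ℂ} (hb : MemLp b ⊤ volume) :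
    MemLp (fun x : ℝ => b (-(2 * Real.pi * x))) ⊤ volume := by
  have h1 : MemLp (fun x : ℝ => b (-x)) ⊤ volume :=
    hb.comp_measurePreserving (Measure.measurePreserving_neg volume)
  have h2 := memLp_dilate h1 (2 * Real.pi)⁻¹ (by positivity)
  simpa [div_eq_mul_inv, mul_comm] using h2

/-- The convolution operator `F⁻¹ b F` on `L²(ℝ)`, where `(F u)(x) = ∫ u(t) e^{itx} dt`. In terms of
Mathlib's transform `(𝓕 u)(ξ) = ∫ u(t) e^{-2πitξ} dt` one has `(F u)(x) = (𝓕 u)(-x / 2π)`, whence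
`F⁻¹ b F = 𝓕⁻¹ b(-2π ·) 𝓕`. -/
def convTwo (b : ℝ → ℂ) (hb : MemLp b ⊤ volume) (u : X 2) : X 2 :=
  𝓕⁻ (mulOp 2 (fun x : ℝ => b (-(2 * Real.pi * x))) (memLp_top_rescale hb) (𝓕 u))

/-- `b ∈ L^∞(ℝ)` is a Fourier multiplier on `L^r(ℝ)` with multiplier norm at most `C`:
`‖F⁻¹ b F u‖_r ≤ C ‖u‖_r` for all `u ∈ L²(ℝ) ∩ L^r(ℝ)`. -/
def MultiplierBound (r : ℝ≥0∞) (b : ℝ → ℂ) (C : ℝ) : Prop :=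
  ∃ hb : MemLp b ⊤ volume, ∀ u : X 2, MemLp u r volume →
    eLpNorm (convTwo b hb u) r volume ≤ ENNReal.ofReal C * eLpNorm u r volume

/-- The set `M^r` of Fourier multipliers on `L^r(ℝ)`. -/
def multiplier (r : ℝ≥0∞) : Set (ℝ → ℂ) := {b | ∃ C : ℝ, MultiplierBound r b C}

/-- `M^{<p>}`: the multipliers on `L^r(ℝ)` for all `r` in a neighbourhood of `p ≠ 2`, and
`M^{<2>} = M^2`. -/
def stableMultiplier (p : ℝ≥0∞) : Set (ℝ → ℂ) :=
  {b | (p = 2 → b ∈ multiplier 2) ∧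
    (p ≠ 2 → ∃ δ : ℝ, 0 < δ ∧ ∀ r : ℝ, 1 < r → |r - p.toReal| < δ →
      b ∈ multiplier (ENNReal.ofReal r))}

/-- `B_p`: the closure in `M^p` of `B ∩ M^{<p>}`. -/
def multClosure (p : ℝ≥0∞) (B : Set (ℝ → ℂ)) : Set (ℝ → ℂ) :=
  {b | b ∈ multiplier p ∧
    ∀ ε : ℝ, 0 < ε → ∃ b' ∈ B ∩ stableMultiplier p, MultiplierBound p (b - b') ε}

section Framework

variable (p : ℝ≥0∞) [Fact (1 ≤ p)]

/-- `A = W⁰(b)` on `L^p(ℝ)`: the bounded operator that coincides with `F⁻¹ b F` on the dense subset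
`L²(ℝ) ∩ L^p(ℝ)`. -/
def IsConvolution (b : ℝ → ℂ) (A : Op p) : Prop :=
  ∃ hb : MemLp b ⊤ volume, ∀ (u : X p) (v : X 2), (u : ℝ → ℂ) =ᵐ[volume] v →
    (A u : ℝ → ℂ) =ᵐ[volume] convTwo b hb v

/-! ### The `𝒫`-framework -/

/-- The `𝒫`-compact operators. -/
def pCompact : Set (Op p) :=
  {K | Tendsto (fun n : ℕ+ => ‖K * (1 - proj p n)‖) atTop (𝓝 0) ∧
    Tendsto (fun n : ℕ+ => ‖(1 - proj p n) * K‖) atTop (𝓝 0)}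

/-- The operators which are compatible with the `𝒫`-compact operators. -/
def pBounded : Set (Op p) :=
  {A | ∀ K ∈ pCompact p, A * K ∈ pCompact p ∧ K * A ∈ pCompact p}

/-- `𝒫`-Fredholm operators. -/
def PFredholm (A : Op p) : Prop :=
  A ∈ pBounded p ∧ ∃ B : Op p, A * B - 1 ∈ pCompact p ∧ B * A - 1 ∈ pCompact p

variable {p} in
/-- The `𝒫`-strong convergence `A_n → S` to an operator `S` compatible with `𝒫`. -/
def PStrongLimit (A : ℕ+ → Op p) (S : Op p) : Prop :=
  S ∈ pBounded p ∧ ∀ K ∈ pCompact p,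
    Tendsto (fun n => ‖K * (A n - S)‖ + ‖(A n - S) * K‖) atTop (𝓝 0)

variable {p} in
/-- The `*`-strong convergence `A_n → S`: strong convergence of `A_n` to `S` and of the adjoints
`φ ↦ φ ∘ A_n` on the dual space to the adjoint of `S`. -/
def StarStrongLimit (A : ℕ+ → Op p) (S : Op p) : Prop :=
  (∀ u : X p, Tendsto (fun n => A n u) atTop (𝓝 (S u))) ∧
    ∀ φ : X p →L[ℂ] ℂ, Tendsto (fun n => φ.comp (A n)) atTop (𝓝 (φ.comp S))

/-! ### Sequence algebras -/

/-- The Banach algebra `ℱ` of all bounded sequences `(A_n)`, `n = 1, 2, …`, of operators, with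
entrywise operations and the supremum norm. -/
abbrev BddSeq : Type := BoundedContinuousFunction ℕ+ (Op p)

instance : IsTopologicalRing (BddSeq p) :=
  @NonUnitalSeminormedRing.toIsTopologicalRing (BddSeq p) inferInstance

instance : IsSemitopologicalSemiring (BddSeq p) := by
  have : IsTopologicalRing (BddSeq p) := inferInstance
  infer_instance

variable {p} in
/-- The subsequence `A_g`. -/
def subseq (A : BddSeq p) (g : ℕ+ → ℕ+) : BddSeq p :=
  A.compContinuous ⟨g, continuous_of_discreteTopology⟩

/-- The index set `T_𝒫 = {-, c, +}`. -/
inductive Direction : Type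
  | minus
  | center
  | plus

/-- The index set `T = T_𝒫 ∪ ℝ`. -/
abbrev Index : Type := Direction ⊕ ℝ

variable {p} in
/-- The transformation `E_n^t`. -/
def lift : Index → ℕ+ → Op p → Op p
  | .inl .minus, n, A => shift p (-(n : ℝ)) * A * shift p n
  | .inl .center, _, A => A
  | .inl .plus, n, A => shift p n * A * shift p (-(n : ℝ))
  | .inr t, n, A => modulation p (-t) * zOp p n * A * zInv p n * modulation p t

variable {p} in
/-- The inverse transformation `(E_n^t)⁻¹`. -/
def unlift : Index → ℕ+ → Op p → Op p
  | .inl .minus, n, A => shift p n * A * shift p (-(n : ℝ))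
  | .inl .center, _, A => A
  | .inl .plus, n, A => shift p (-(n : ℝ)) * A * shift p n
  | .inr t, n, A => zInv p n * modulation p t * A * modulation p (-t) * zOp p n

variable {p} in
/-- `S` is the snapshot with index `t` of the sequence `A`, whose `n`-th entry belongs to the
position `h n`: the `𝒫`-strong limit (for `t ∈ T_𝒫`), respectively the `*`-strong limit (for
`t ∈ ℝ`), of `(E_{h n}^t)⁻¹ (A_n)`. -/
def IsSnapshot (h : ℕ+ → ℕ+) (A : BddSeq p) (S : Op p) : Index → Prop
  | .inl t => PStrongLimit (fun n => unlift (.inl t) (h n) (A n)) S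
  | .inr t => StarStrongLimit (fun n => unlift (.inr t) (h n) (A n)) S

/-- The set `ℱ_h^T` of `T`-structured sequences along `h`. -/
def structured (h : ℕ+ → ℕ+) : Set (BddSeq p) :=
  {A | ∀ t : Index, ∃ S : Op p, IsSnapshot h A S t}

/-- The set `𝒦^t` of `𝒫`-compact operators (`t ∈ T_𝒫`), respectively compact operators
(`t ∈ ℝ`). -/
def compactClass : Index → Set (Op p)
  | .inl _ => pCompact p
  | .inr _ => {K | IsCompactOperator K}

/-- `𝒥_h^T`: the smallest closed subspace of the space of bounded sequences along `h` that contains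
all `(E_{h n}^t (K))`, `K ∈ 𝒦^t`, `t ∈ T`, and all sequences tending to zero in norm. -/
def compactSeq (h : ℕ+ → ℕ+) : Submodule ℂ (BddSeq p) :=
  (Submodule.span ℂ
    ({J | ∃ t : Index, ∃ K ∈ compactClass p t, ∀ n, J n = lift t (h n) K} ∪
      {G | Tendsto (fun n => ‖G n‖) atTop (𝓝 0)})).topologicalClosure

variable {p} in
/-- `𝒥_h^T`-Fredholmness: `A ∈ ℱ_h^T` and the coset `A + 𝒥_h^T` is invertible in
`ℱ_h^T / 𝒥_h^T`. -/
def JFredholm (h : ℕ+ → ℕ+) (A : BddSeq p) : Prop :=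
  A ∈ structured p h ∧
    ∃ B ∈ structured p h, A * B - 1 ∈ compactSeq p h ∧ B * A - 1 ∈ compactSeq p h

/-! ### The algebras of finite section sequences -/

/-- The algebra `𝒜₁`: the smallest closed subalgebra of `ℱ` containing the constant sequences of
the multiplication operators `a I`, `a ∈ [PC, SO, L^∞_0]`, of the convolution operators `W⁰(b)`,
`b ∈ [PC^c, SO, BUC]_p`, `c ∈ ℝ`, and of the `𝒫`-compact operators, and the sequence `(P_n)`. -/
def algOne : Subalgebra ℂ (BddSeq p) :=
  (Algebra.adjoin ℂ
    ({A | ∃ a ∈ linfAlg (pc ∪ so ∪ linfZero), ∃ ha : MemLp a ⊤ volume, ∀ n, A n = mulOp p a ha} ∪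
      {A | ∃ c : ℝ, ∃ b ∈ multClosure p (linfAlg (pcAt c ∪ so ∪ buc)), ∃ W : Op p,
        IsConvolution p b W ∧ ∀ n, A n = W} ∪
      {A | ∃ K ∈ pCompact p, ∀ n, A n = K} ∪
      {A | ∀ n, A n = proj p n})).topologicalClosure

/-- The algebra `ℱ_{𝒜₁}`: the smallest closed algebra containing all finite section sequences
`(P_n A_n P_n + (I - P_n))` with `(A_n) ∈ 𝒜₁`. -/
def finiteSectionAlg : Subalgebra ℂ (BddSeq p) :=
  (Algebra.adjoin ℂ
    {B | ∃ A ∈ algOne p, ∀ n, B n = proj p n * A n * proj p n + (1 - proj p n)}).topologicalClosure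

end Framework

end FiniteSection

end

open scoped ENNReal

noncomputable section

namespace FiniteSection

open MeasureTheory Filter Topology Set FourierTransform
open Complex (I exp)
open ENNReal (ofReal)
open Real (two_pi_pos)

section Basics

variable (p : ℝ≥0∞) [Fact (1 ≤ p)]

lemma memLp_top_mul {a b : ℝ → ℂ} (ha : MemLp a ⊤ (volume : Measure ℝ)) (hb : MemLp b ⊤) :
    MemLp (fun x => a x * b x) ⊤ := hb.mul ha

lemma mulOp_congr {a b : ℝ → ℂ} (ha : MemLp a ⊤) (hb : MemLp b ⊤)
    (h : a =ᵐ[volume] b) : mulOp p a ha = mulOp p b hb := by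
  ext u
  filter_upwards [mulOp_coeFn p a ha u, mulOp_coeFn p b hb u, h] with x h1 h2 h3
  rw [h1, h2, h3]

lemma mulOp_mul {a b : ℝ → ℂ} (ha : MemLp a ⊤) (hb : MemLp b ⊤)
    (hab : MemLp (fun x => a x * b x) ⊤) :
    mulOp p a ha * mulOp p b hb = mulOp p (fun x => a x * b x) hab := by
  ext u
  filter_upwards [mulOp_coeFn p a ha (mulOp p b hb u), mulOp_coeFn p b hb u,
    mulOp_coeFn p _ hab u] with x h1 h2 h3
  rw [mul_apply_eq_comp, h1, h2, h3, mul_assoc]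

lemma mulOp_add {a b : ℝ → ℂ} (ha : MemLp a ⊤) (hb : MemLp b ⊤)
    (hab : MemLp (fun x => a x + b x) ⊤) :
    mulOp p a ha + mulOp p b hb = mulOp p (fun x => a x + b x) hab := by
  ext u
  filter_upwards [mulOp_coeFn p a ha u, mulOp_coeFn p b hb u,
    mulOp_coeFn p _ hab u, Lp.coeFn_add (mulOp p a ha u) (mulOp p b hb u)] with x h1 h2 h3 h4
  rw [add_apply, h4, Pi.add_apply, h1, h2, h3, add_mul]

lemma mulOp_sub {a b : ℝ → ℂ} (ha : MemLp a ⊤) (hb : MemLp b ⊤)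
    (hab : MemLp (fun x => a x - b x) ⊤) :
    mulOp p a ha - mulOp p b hb = mulOp p (fun x => a x - b x) hab := by
  ext u
  filter_upwards [mulOp_coeFn p a ha u, mulOp_coeFn p b hb u,
    mulOp_coeFn p _ hab u, Lp.coeFn_sub (mulOp p a ha u) (mulOp p b hb u)] with x h1 h2 h3 h4
  rw [sub_apply, h4, Pi.sub_apply, h1, h2, h3, sub_mul]

lemma mulOp_smul {a : ℝ → ℂ} (c : ℂ) (ha : MemLp a ⊤)
    (hab : MemLp (fun x => c * a x) ⊤) :
    c • mulOp p a ha = mulOp p (fun x => c * a x) hab := by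
  ext u
  filter_upwards [mulOp_coeFn p a ha u, 
    mulOp_coeFn p _ hab u, Lp.coeFn_smul c (mulOp p a ha u)] with x h1 h3 h4
  rw [smul_apply, h4, Pi.smul_apply, h1, h3, smul_eq_mul, mul_assoc]

lemma mulOp_const (c : ℂ) (h : MemLp (fun _ : ℝ => c) ⊤) :
    mulOp p (fun _ => c) h = c • 1 := by
  ext u
  filter_upwards [mulOp_coeFn p _ h u, Lp.coeFn_smul c u] with x h1 h2
  rw [h1]
  exact h2.symm

lemma mulOp_one (h : MemLp (fun _ : ℝ => (1 : ℂ)) ⊤) : mulOp p (fun _ => 1) h = 1 := by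
  rw [mulOp_const, one_smul]

lemma one_sub_mulOp {a : ℝ → ℂ} (ha : MemLp a ⊤)
    (hab : MemLp (fun x => 1 - a x) ⊤) :
    1 - mulOp p a ha = mulOp p (fun x => 1 - a x) hab := by
  rw [← mulOp_one p (memLp_top_const 1), mulOp_sub]

lemma mulOp_zero (h : MemLp (fun _ : ℝ => (0 : ℂ)) ⊤) : mulOp p (fun _ => 0) h = 0 := by
  rw [mulOp_const, zero_smul]

lemma mulOp_comm {a b : ℝ → ℂ} (ha : MemLp a ⊤) (hb : MemLp b ⊤) :
    mulOp p a ha * mulOp p b hb = mulOp p b hb * mulOp p a ha := by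
  rw [mulOp_mul p ha hb (memLp_top_mul ha hb), mulOp_mul p hb ha (memLp_top_mul hb ha)]
  exact mulOp_congr p _ _ (.of_forall fun x => mul_comm _ _)

lemma mulOp_apply_norm_le {a : ℝ → ℂ} (ha : MemLp a ⊤) {C : ℝ}
    (h : ∀ᵐ x, ‖a x‖ ≤ C) (u : X p) : ‖mulOp p a ha u‖ ≤ C * ‖u‖ := by
  refine Lp.norm_le_mul_norm_of_ae_le_mul ?_
  filter_upwards [mulOp_coeFn p a ha u, h] with x h1 h2
  rw [h1, norm_mul]
  gcongr

lemma mulOp_norm_le {a : ℝ → ℂ} (ha : MemLp a ⊤) {C : ℝ} (hC : 0 ≤ C)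
    (h : ∀ᵐ x, ‖a x‖ ≤ C) : ‖mulOp p a ha‖ ≤ C :=
  ContinuousLinearMap.opNorm_le_bound _ hC (mulOp_apply_norm_le p ha h)

lemma memLp_top_of_norm_le {a : ℝ → ℂ} (ha : AEStronglyMeasurable a) {C : ℝ}
    (h : ∀ x, ‖a x‖ ≤ C) : MemLp a ⊤ (volume : Measure ℝ) :=
  memLp_top_of_bound ha C (.of_forall h)

lemma shift_coeFn (s : ℝ) (u : X p) : shift p s u =ᵐ[volume] fun x => u (x - s) :=
  Lp.coeFn_compMeasurePreserving u (measurePreserving_sub_right volume s)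

lemma shift_norm_le (s : ℝ) : ‖shift p s‖ ≤ 1 :=
  LinearIsometry.norm_toContinuousLinearMap_le _

lemma qmp_sub (s : ℝ) : Measure.QuasiMeasurePreserving (fun x : ℝ => x - s) volume volume :=
  (measurePreserving_sub_right volume s).quasiMeasurePreserving

lemma qmp_div (c : ℝ) (hc : 0 < c) :
    Measure.QuasiMeasurePreserving (fun x : ℝ => x / c) volume volume :=
  ⟨by fun_prop, by rw [map_div_volume c hc]; exact Measure.smul_absolutelyContinuous⟩

lemma memLp_shift {q : ℝ≥0∞} {a : ℝ → ℂ} (ha : MemLp a q) (s : ℝ) :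
    MemLp (fun x => a (x - s)) q :=
  ha.comp_measurePreserving (measurePreserving_sub_right volume s)

lemma shift_mul_shift (s t : ℝ) : shift p s * shift p t = shift p (s + t) := by
  ext u
  filter_upwards [shift_coeFn p s (shift p t u), shift_coeFn p (s + t) u,
    (qmp_sub s).ae (shift_coeFn p t u)] with x h1 h2 h3
  rw [mul_apply_eq_comp, h1, h2, h3, sub_sub]

lemma shift_zero : shift p 0 = 1 := by
  ext u
  filter_upwards [shift_coeFn p 0 u] with x h1
  rw [h1, sub_zero]; rfl

lemma shift_mul_neg (s : ℝ) : shift p s * shift p (-s) = 1 := by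
  rw [shift_mul_shift, add_neg_cancel, shift_zero]

lemma shift_neg_mul (s : ℝ) : shift p (-s) * shift p s = 1 := by
  rw [shift_mul_shift, neg_add_cancel, shift_zero]

lemma shift_mulOp (s : ℝ) {a : ℝ → ℂ} (ha : MemLp a ⊤) :
    shift p s * mulOp p a ha = mulOp p (fun x => a (x - s)) (memLp_shift ha s) * shift p s := by
  ext u
  filter_upwards [shift_coeFn p s (mulOp p a ha u), shift_coeFn p s u,
    mulOp_coeFn p _ (memLp_shift ha s) (shift p s u),
    (qmp_sub s).ae (mulOp_coeFn p a ha u)] with x h1 h2 h3 h4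
  rw [mul_apply_eq_comp, mul_apply_eq_comp, h1, h3, h4, h2]

lemma dilation_mulOp (c : ℝ) (hc : 0 < c) {a : ℝ → ℂ} (ha : MemLp a ⊤) :
    dilation p c hc * mulOp p a ha =
      mulOp p (fun x => a (x / c)) (memLp_dilate ha c hc) * dilation p c hc := by
  ext u
  filter_upwards [dilation_coeFn p c hc (mulOp p a ha u), dilation_coeFn p c hc u,
    mulOp_coeFn p _ (memLp_dilate ha c hc) (dilation p c hc u),
    (qmp_div c hc).ae (mulOp_coeFn p a ha u)] with x h1 h2 h3 h4
  rw [mul_apply_eq_comp, mul_apply_eq_comp, h1, h3, h4, h2]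
  ring

lemma dilation_norm_le (c : ℝ) (hc : 0 < c) : ‖dilation p c hc‖ ≤ 1 := by
  refine (LinearMap.mkContinuous_norm_le _ (by positivity) _).trans (le_of_eq ?_)
  have hp0 : p ≠ 0 := (zero_lt_one.trans_le (Fact.out : (1 : ℝ≥0∞) ≤ p)).ne'
  rw [← ENNReal.toReal_rpow, ENNReal.toReal_ofReal hc.le, Complex.norm_real, Real.norm_eq_abs,
    abs_of_pos (by positivity), ENNReal.toReal_div, ENNReal.toReal_one, Real.rpow_neg hc.le,
    inv_mul_cancel₀ (by positivity)]

lemma modulation_coeFn (t : ℝ) (u : X p) :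
    modulation p t u =ᵐ[volume] fun x => exp (I * t * x) * u x :=
  mulOp_coeFn p _ _ u

lemma modulation_norm_le (t : ℝ) : ‖modulation p t‖ ≤ 1 := by
  refine mulOp_norm_le p _ zero_le_one (.of_forall fun x => ?_)
  rw [Complex.norm_exp]
  simp

lemma modulation_mul (s t : ℝ) : modulation p s * modulation p t = modulation p (s + t) := by
  rw [modulation, modulation, mulOp_mul p _ _ (memLp_top_mul (memLp_character s)
    (memLp_character t)), modulation]
  refine mulOp_congr p _ _ (.of_forall fun x => ?_)
  simp only
  rw [← Complex.exp_add]
  congr 1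
  push_cast
  ring

lemma modulation_zero : modulation p 0 = 1 := by
  rw [modulation, ← mulOp_one p (memLp_top_const 1)]
  exact mulOp_congr p _ _ (.of_forall fun x => by simp)

lemma modulation_mul_neg (s : ℝ) : modulation p s * modulation p (-s) = 1 := by
  rw [modulation_mul, add_neg_cancel, modulation_zero]

lemma modulation_neg_mul (s : ℝ) : modulation p (-s) * modulation p s = 1 := by
  rw [modulation_mul, neg_add_cancel, modulation_zero]

lemma modulation_mulOp (s : ℝ) {a : ℝ → ℂ} (ha : MemLp a ⊤) :
    modulation p s * mulOp p a ha = mulOp p a ha * modulation p s := mulOp_comm p _ _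

end Basics

section Convergence

variable {p : ℝ≥0∞} [Fact (1 ≤ p)]

lemma exponent_ne_zero : p ≠ 0 := (zero_lt_one.trans_le (Fact.out : (1 : ℝ≥0∞) ≤ p)).ne'

lemma exponent_pos (hp' : p ≠ ⊤) : 0 < p.toReal :=
  ENNReal.toReal_pos exponent_ne_zero hp'

lemma enorm_rpow_eq_lintegral (hp' : p ≠ ⊤) (u : X p) :
    ‖u‖ₑ ^ p.toReal = ∫⁻ x, ‖u x‖ₑ ^ p.toReal := by
  rw [Lp.enorm_def, eLpNorm_eq_lintegral_rpow_enorm_toReal exponent_ne_zero hp', one_div,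
    ENNReal.rpow_inv_rpow (exponent_pos hp').ne']

lemma tendsto_zero_of_enorm_rpow (hp' : p ≠ ⊤) {ι : Type*} {l : Filter ι} {f : ι → X p}
    (h : Tendsto (fun i => ‖f i‖ₑ ^ p.toReal) l (𝓝 0)) : Tendsto f l (𝓝 0) := by
  have hpos := exponent_pos hp'
  rw [tendsto_zero_iff_norm_tendsto_zero]
  have h2 := h.ennrpow_const (p.toReal)⁻¹
  rw [ENNReal.zero_rpow_of_pos (inv_pos.2 hpos)] at h2
  simp_rw [ENNReal.rpow_rpow_inv hpos.ne'] at h2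
  have h3 := (ENNReal.tendsto_toReal ENNReal.zero_ne_top).comp h2
  simpa [Function.comp_def] using h3

lemma mulOp_tendsto_zero (hp' : p ≠ ⊤) {ι : Type*} {l : Filter ι} [l.IsCountablyGenerated]
    {a : ι → ℝ → ℂ} (ha : ∀ i, MemLp (a i) ⊤) {C : ℝ} (hC : ∀ i, ∀ᵐ x, ‖a i x‖ ≤ C)
    (h : ∀ᵐ x, Tendsto (fun i => a i x) l (𝓝 0)) (u : X p) :
    Tendsto (fun i => mulOp p (a i) (ha i) u) l (𝓝 0) := by
  have hpos := exponent_pos hp'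
  refine tendsto_zero_of_enorm_rpow hp' ?_
  have h0 : (0 : ℝ≥0∞) = ∫⁻ x : ℝ, (0 : ℝ≥0∞) := by simp
  have hcongr : ∀ i, ‖mulOp p (a i) (ha i) u‖ₑ ^ p.toReal =
      ∫⁻ x, (‖a i x‖ₑ * ‖u x‖ₑ) ^ p.toReal := fun i => by
    rw [enorm_rpow_eq_lintegral hp']
    refine lintegral_congr_ae ?_
    filter_upwards [mulOp_coeFn p _ (ha i) u] with x h1
    rw [h1, enorm_mul]
  simp_rw [hcongr]
  rw [h0]
  refine tendsto_lintegral_filter_of_dominated_convergence'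
    (fun x => (ofReal C * ‖u x‖ₑ) ^ p.toReal) ?_ ?_ ?_ ?_
  · exact .of_forall fun i =>
      (((ha i).1.enorm).mul (Lp.aestronglyMeasurable u).enorm).pow_const _
  · refine .of_forall fun i => ?_
    filter_upwards [hC i] with x h2
    gcongr
    rw [← ofReal_norm]
    exact ENNReal.ofReal_le_ofReal h2
  · simp_rw [ENNReal.mul_rpow_of_nonneg _ _ hpos.le]
    rw [lintegral_const_mul'']
    · rw [← enorm_rpow_eq_lintegral hp']
      exact ENNReal.mul_ne_top (by finiteness) (by finiteness)
    · exact (Lp.aestronglyMeasurable _).enorm.pow_const _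
  · filter_upwards [h] with x hx
    have h1 : Tendsto (fun i => ‖a i x‖ₑ * ‖u x‖ₑ) l (𝓝 0) := by
      have := ENNReal.Tendsto.mul_const (b := ‖u x‖ₑ) hx.enorm (Or.inr enorm_ne_top)
      simpa using this
    have := h1.ennrpow_const p.toReal
    rwa [ENNReal.zero_rpow_of_pos hpos] at this

/-- The operator of multiplication by the characteristic function of a measurable set. -/
def chi (p : ℝ≥0∞) [Fact (1 ≤ p)] (s : Set ℝ) (hs : MeasurableSet s) : Op p :=
  mulOp p (s.indicator fun _ => 1) (memLp_indicator s hs)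

lemma indicator_one_mul (s t : Set ℝ) (x : ℝ) :
    s.indicator (fun _ => (1 : ℂ)) x * t.indicator (fun _ => (1 : ℂ)) x =
      (s ∩ t).indicator (fun _ => (1 : ℂ)) x := by
  by_cases hs : x ∈ s <;> by_cases ht : x ∈ t <;> simp [hs, ht]

lemma chi_mul {s t : Set ℝ} (hs : MeasurableSet s) (ht : MeasurableSet t) :
    chi p s hs * chi p t ht = chi p (s ∩ t) (hs.inter ht) := by
  rw [chi, chi, mulOp_mul p _ _ (memLp_top_mul (memLp_indicator s hs) (memLp_indicator t ht)), chi]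
  exact mulOp_congr p _ _ (.of_forall fun x => indicator_one_mul s t x)

lemma norm_indicator_one_le (s : Set ℝ) (x : ℝ) : ‖s.indicator (fun _ => (1 : ℂ)) x‖ ≤ 1 := by
  by_cases hs : x ∈ s <;> simp [hs]

lemma chi_norm_le {s : Set ℝ} (hs : MeasurableSet s) : ‖chi p s hs‖ ≤ 1 :=
  mulOp_norm_le p _ zero_le_one (.of_forall (norm_indicator_one_le s))

lemma one_sub_chi {s : Set ℝ} (hs : MeasurableSet s) : 1 - chi p s hs = chi p sᶜ hs.compl := by
  rw [chi, one_sub_mulOp p _ ((memLp_top_const 1).sub (memLp_indicator s hs)), chi]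
  refine mulOp_congr p _ _ (.of_forall fun x => ?_)
  by_cases hs : x ∈ s <;> simp [hs]

lemma chi_empty : chi p ∅ MeasurableSet.empty = 0 := by
  rw [chi, ← mulOp_zero p (memLp_top_const 0)]
  exact mulOp_congr p _ _ (.of_forall fun x => by simp)

lemma chi_congr {s t : Set ℝ} (hs : MeasurableSet s) (ht : MeasurableSet t) (h : s = t) :
    chi p s hs = chi p t ht := by subst h; rfl

lemma enorm_chi_rpow (hp' : p ≠ ⊤) {s : Set ℝ} (hs : MeasurableSet s) (u : X p) :
    ‖chi p s hs u‖ₑ ^ p.toReal = ∫⁻ x in s, ‖u x‖ₑ ^ p.toReal := by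
  rw [enorm_rpow_eq_lintegral hp', ← lintegral_indicator hs]
  refine lintegral_congr_ae ?_
  filter_upwards [mulOp_coeFn p _ (memLp_indicator s hs) u] with x hx
  rw [chi, hx]
  by_cases h : x ∈ s
  · simp [h]
  · simp [h, exponent_pos hp']

lemma enorm_rpow_split (hp' : p ≠ ⊤) {s : Set ℝ} (hs : MeasurableSet s) (u : X p) :
    ‖u‖ₑ ^ p.toReal = ‖chi p s hs u‖ₑ ^ p.toReal + ‖chi p sᶜ hs.compl u‖ₑ ^ p.toReal := by
  rw [enorm_chi_rpow hp', enorm_chi_rpow hp', enorm_rpow_eq_lintegral hp', lintegral_add_compl _ hs]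

lemma chi_tendsto_zero (hp' : p ≠ ⊤) {E : ℕ → Set ℝ} (hE : ∀ n, MeasurableSet (E n))
    (hanti : Antitone E) (hnull : volume (⋂ n, E n) = 0) (u : X p) :
    Tendsto (fun n => chi p (E n) (hE n) u) atTop (𝓝 0) := by
  refine mulOp_tendsto_zero hp' _ (fun n => .of_forall (norm_indicator_one_le _)) ?_ u
  filter_upwards [compl_mem_ae_iff.2 hnull] with x hx
  simp only [mem_compl_iff, mem_iInter, not_forall] at hx
  obtain ⟨n, hn⟩ := hx
  refine tendsto_const_nhds.congr' ?_
  filter_upwards [eventually_ge_atTop n] with m hm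
  rw [indicator_of_notMem fun h => hn (hanti hm h)]

lemma gliding_hump (hp' : p ≠ ⊤) (φ : X p →L[ℂ] ℂ) {E : ℕ → Set ℝ}
    (hE : ∀ n, MeasurableSet (E n)) (hanti : Antitone E) (hnull : volume (⋂ n, E n) = 0)
    {δ : ℝ} (h : ∀ n, δ < ‖φ.comp (chi p (E n) (hE n))‖) (N : ℕ) :
    ∀ n, ∃ w : X p, chi p (E n) (hE n) w = w ∧ ‖w‖ₑ ^ p.toReal ≤ N ∧ N * δ ≤ (φ w).re := by
  have hpos := exponent_pos hp'
  induction N with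
  | zero => exact fun n => ⟨0, by simp, by simp [hpos], by simp⟩
  | succ N ih =>
    intro n
    obtain ⟨v, hv1, hv⟩ := ContinuousLinearMap.exists_lt_apply_of_lt_opNorm _ (h n)
    obtain ⟨θ, hθ, hθv⟩ : ∃ θ : ℂ, ‖θ‖ = 1 ∧ δ < (φ (chi p (E n) (hE n) (θ • v))).re := by
      obtain ⟨θ, hθ, h2⟩ := RCLike.exists_norm_eq_mul_self (φ (chi p (E n) (hE n) v))
      refine ⟨θ, hθ, ?_⟩
      rw [map_smul, map_smul, smul_eq_mul, ← h2]
      simpa using hv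
    set v' := θ • v
    have hv1' : ‖v'‖ ≤ 1 := by rw [norm_smul, hθ, one_mul]; exact hv1.le
    have hlim : Tendsto (fun m => (φ (chi p (E n) (hE n) v' - chi p (E m) (hE m) v')).re) atTop
        (𝓝 (φ (chi p (E n) (hE n) v' - 0)).re) :=
      (Complex.continuous_re.comp φ.continuous).continuousAt.tendsto.comp
        (tendsto_const_nhds.sub (chi_tendsto_zero hp' hE hanti hnull v'))
    rw [sub_zero] at hlim
    obtain ⟨m, hm, hnm⟩ := ((hlim.eventually (lt_mem_nhds hθv)).and (eventually_ge_atTop n)).exists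
    obtain ⟨w, hw1, hw2, hw3⟩ := ih m
    set z := chi p (E n) (hE n) v' - chi p (E m) (hE m) v'
    have hmn : E m ⊆ E n := hanti hnm
    have e1 : chi p (E n) (hE n) * chi p (E m) (hE m) = chi p (E m) (hE m) := by
      rw [chi_mul]; exact chi_congr _ _ (inter_eq_right.2 hmn)
    have e2 : chi p (E m) (hE m) * chi p (E n) (hE n) = chi p (E m) (hE m) := by
      rw [chi_mul]; exact chi_congr _ _ (inter_eq_left.2 hmn)
    have e3 : ∀ k, chi p (E k) (hE k) * chi p (E k) (hE k) = chi p (E k) (hE k) := fun k => by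
      rw [chi_mul]; exact chi_congr _ _ (inter_self _)
    have f1 : ∀ u, chi p (E n) (hE n) (chi p (E m) (hE m) u) = chi p (E m) (hE m) u := fun u => by
      rw [← mul_apply_eq_comp, e1]
    have f2 : ∀ u, chi p (E m) (hE m) (chi p (E n) (hE n) u) = chi p (E m) (hE m) u := fun u => by
      rw [← mul_apply_eq_comp, e2]
    have f3 : ∀ k u, chi p (E k) (hE k) (chi p (E k) (hE k) u) = chi p (E k) (hE k) u :=
      fun k u => by rw [← mul_apply_eq_comp, e3]
    have hz : chi p (E m) (hE m) z = 0 := by simp only [z, map_sub, f2, f3, sub_self]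
    have hz' : ‖z‖ ≤ 1 := by
      have : z = chi p (E m)ᶜ (hE m).compl (chi p (E n) (hE n) v') := by
        rw [← one_sub_chi (hE m), sub_apply, one_apply_eq_self, f2]
      rw [this]
      refine ((chi p _ _).le_of_opNorm_le (chi_norm_le _) _).trans ?_
      rw [one_mul]
      refine ((chi p _ _).le_of_opNorm_le (chi_norm_le _) _).trans ?_
      rwa [one_mul]
    refine ⟨w + z, ?_, ?_, ?_⟩
    · rw [map_add]
      congr 1
      · rw [← hw1, f1]
      · simp only [z, map_sub, f1, f3]
    · rw [enorm_rpow_split hp' (hE m), map_add, hz, add_zero, hw1, map_add]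
      have hw4 : chi p (E m)ᶜ (hE m).compl w = 0 := by
        rw [← one_sub_chi (hE m), sub_apply, one_apply_eq_self, hw1, sub_self]
      rw [hw4, zero_add, Nat.cast_add, Nat.cast_one]
      refine add_le_add hw2 ?_
      refine ENNReal.rpow_le_one ?_ hpos.le
      refine le_trans (b := ‖z‖ₑ) ?_ ?_
      · rw [← ofReal_norm, ← ofReal_norm]
        refine ENNReal.ofReal_le_ofReal ?_
        simpa using (chi p _ _).le_of_opNorm_le (chi_norm_le (hE m).compl) z
      · rw [← ofReal_norm]
        exact ENNReal.ofReal_le_one.2 hz'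
    · rw [map_add, Complex.add_re]
      push_cast
      linarith

lemma functional_chi_tendsto_zero (hp : 1 < p) (hp' : p ≠ ⊤) (φ : X p →L[ℂ] ℂ) {E : ℕ → Set ℝ}
    (hE : ∀ n, MeasurableSet (E n)) (hanti : Antitone E) (hnull : volume (⋂ n, E n) = 0) :
    Tendsto (fun n => ‖φ.comp (chi p (E n) (hE n))‖) atTop (𝓝 0) := by
  have hpos := exponent_pos hp'
  have hp1 : 1 < p.toReal := by
    rw [← ENNReal.toReal_one]; exact (ENNReal.toReal_lt_toReal ENNReal.one_ne_top hp').2 hp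
  have hmono : Antitone fun n => ‖φ.comp (chi p (E n) (hE n))‖ := fun n m hnm => by
    have e1 : chi p (E m) (hE m) = chi p (E n) (hE n) * chi p (E m) (hE m) := by
      rw [chi_mul]; exact chi_congr _ _ (inter_eq_right.2 (hanti hnm)).symm
    change ‖φ.comp (chi p (E m) (hE m))‖ ≤ _
    rw [e1]
    have : φ.comp (chi p (E n) (hE n) * chi p (E m) (hE m)) =
      (φ.comp (chi p (E n) (hE n))).comp (chi p (E m) (hE m)) := rfl
    rw [this]
    refine (ContinuousLinearMap.opNorm_comp_le _ _).trans ?_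
    exact mul_le_of_le_one_right (norm_nonneg _) (chi_norm_le _)
  rw [Metric.tendsto_atTop]
  intro δ hδ
  by_contra! hcon
  have hall : ∀ n, δ / 2 < ‖φ.comp (chi p (E n) (hE n))‖ := fun n => by
    obtain ⟨m, hm, hm2⟩ := hcon n
    rw [Real.dist_eq, sub_zero, abs_norm] at hm2
    linarith [hmono hm]
  have hbound : ∀ N : ℕ, (N : ℝ) * (δ / 2) ≤ ‖φ‖ * (N : ℝ) ^ (p.toReal)⁻¹ := fun N => by
    obtain ⟨w, -, hw2, hw3⟩ := gliding_hump hp' φ hE hanti hnull hall N 0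
    have hw4 : ‖w‖ ≤ (N : ℝ) ^ (p.toReal)⁻¹ := by
      have h1 := ENNReal.rpow_le_rpow hw2 (inv_nonneg.2 hpos.le)
      rw [ENNReal.rpow_rpow_inv hpos.ne', ← ofReal_norm] at h1
      have h2 := ENNReal.toReal_mono (by finiteness) h1
      rwa [ENNReal.toReal_ofReal (norm_nonneg _), ← ENNReal.toReal_rpow,
        ENNReal.toReal_natCast] at h2
    calc (N : ℝ) * (δ / 2) ≤ (φ w).re := hw3
      _ ≤ ‖φ w‖ := Complex.re_le_norm _
      _ ≤ ‖φ‖ * ‖w‖ := φ.le_opNorm w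
      _ ≤ _ := by gcongr
  have hlim : Tendsto (fun N : ℕ => (N : ℝ) ^ (1 - (p.toReal)⁻¹)) atTop atTop :=
    (tendsto_rpow_atTop (sub_pos.2 (inv_lt_one_of_one_lt₀ hp1))).comp tendsto_natCast_atTop_atTop
  obtain ⟨N, hN, hN1⟩ := ((hlim.eventually_gt_atTop (‖φ‖ / (δ / 2))).and
    (eventually_gt_atTop 0)).exists
  have hNp : (0 : ℝ) < N := by exact_mod_cast hN1
  rw [Real.rpow_sub hNp, Real.rpow_one, div_lt_div_iff₀ (by positivity) (by positivity)] at hN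
  linarith [hbound N]

lemma functional_mulOp_tendsto_zero (hp : 1 < p) (hp' : p ≠ ⊤) (φ : X p →L[ℂ] ℂ)
    {a : ℕ+ → ℝ → ℂ} (ha : ∀ n, MemLp (a n) ⊤) {C : ℝ} (hC : ∀ n, ∀ᵐ x, ‖a n x‖ ≤ C)
    (h : ∀ᵐ x, Tendsto (fun n => a n x) atTop (𝓝 0)) :
    Tendsto (fun n => ‖φ.comp (mulOp p (a n) (ha n))‖) atTop (𝓝 0) := by
  set b : ℕ+ → ℝ → ℂ := fun n => (ha n).1.mk
  have hb : ∀ n, Measurable (b n) := fun n => (ha n).1.stronglyMeasurable_mk.measurable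
  have hab : ∀ᵐ x, ∀ n, a n x = b n x := ae_all_iff.2 fun n => (ha n).1.ae_eq_mk
  have hC' : ∀ᵐ x, ∀ n, ‖a n x‖ ≤ C := ae_all_iff.2 hC
  have hC0 : 0 ≤ C := by
    obtain ⟨x, hx⟩ := hC'.exists
    exact (norm_nonneg _).trans (hx 1)
  rw [Metric.tendsto_atTop]
  intro ε hε
  set η : ℝ := ε / (2 * (‖φ‖ + 1))
  have hη : 0 < η := by positivity
  set E : ℕ → Set ℝ := fun n => ⋃ m : ℕ+, ⋃ _ : n ≤ m, {x | η < ‖b m x‖}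
  have hE : ∀ n, MeasurableSet (E n) := fun n =>
    MeasurableSet.iUnion fun m => MeasurableSet.iUnion fun _ =>
      measurableSet_lt measurable_const (hb m).norm
  have hanti : Antitone E := fun n n' hn x hx => by
    simp only [E, mem_iUnion] at hx ⊢
    obtain ⟨m, hm, hx⟩ := hx
    exact ⟨m, hn.trans hm, hx⟩
  have hnull : volume (⋂ n, E n) = 0 := by
    rw [← compl_compl (⋂ n, E n), ← mem_ae_iff]
    filter_upwards [h, hab] with x hx hx2 hxE
    have h1 : ∀ᶠ n in atTop, ‖b n x‖ < η := by
      have := hx.norm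
      rw [norm_zero] at this
      filter_upwards [this.eventually (gt_mem_nhds hη)] with n hn
      rwa [← hx2]
    obtain ⟨N, hN⟩ := eventually_atTop.1 h1
    have := mem_iInter.1 hxE N
    simp only [E, mem_iUnion] at this
    obtain ⟨m, hm, hx⟩ := this
    exact absurd (hN m (by exact_mod_cast hm)) (not_lt.2 (le_of_lt hx))
  have hlim := functional_chi_tendsto_zero hp hp' φ hE hanti hnull
  obtain ⟨N, hN⟩ := (hlim.eventually (gt_mem_nhds (show 0 < ε / (2 * (C + 1)) by positivity))).exists
  refine ⟨⟨N + 1, N.succ_pos⟩, fun n hn => ?_⟩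
  have hn' : N ≤ n := by
    have : N + 1 ≤ (n : ℕ) := by exact_mod_cast hn
    omega
  rw [Real.dist_eq, sub_zero, abs_norm]
  have hsplit : φ.comp (mulOp p (a n) (ha n)) =
      (φ.comp (chi p (E N) (hE N))).comp (mulOp p (a n) (ha n)) +
      φ.comp (chi p (E N)ᶜ (hE N).compl * mulOp p (a n) (ha n)) := by
    ext u
    rw [← one_sub_chi (hE N)]
    simp
  have hsmall : ‖chi p (E N)ᶜ (hE N).compl * mulOp p (a n) (ha n)‖ ≤ η := by
    rw [chi, mulOp_mul p _ _ (memLp_top_mul (memLp_indicator _ (hE N).compl) (ha n))]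
    refine mulOp_norm_le p _ hη.le ?_
    filter_upwards [hab] with x hx
    by_cases hxE : x ∈ E N
    · simp [hxE, hη.le]
    · have : ‖b n x‖ ≤ η := by
        by_contra hcon
        push Not at hcon
        exact hxE (mem_iUnion.2 ⟨n, mem_iUnion.2 ⟨hn', hcon⟩⟩)
      simpa [hxE, hx n] using this
  calc ‖φ.comp (mulOp p (a n) (ha n))‖
      ≤ ‖(φ.comp (chi p (E N) (hE N))).comp (mulOp p (a n) (ha n))‖ +
        ‖φ.comp (chi p (E N)ᶜ (hE N).compl * mulOp p (a n) (ha n))‖ := by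
        conv_lhs => rw [hsplit]
        exact norm_add_le _ _
    _ ≤ ε / (2 * (C + 1)) * C + ‖φ‖ * η := by
        refine add_le_add ?_ ?_
        · refine (ContinuousLinearMap.opNorm_comp_le _ _).trans ?_
          exact mul_le_mul hN.le (mulOp_norm_le p _ hC0 (hC n)) (norm_nonneg _) (by positivity)
        · refine (ContinuousLinearMap.opNorm_comp_le _ _).trans ?_
          exact mul_le_mul_of_nonneg_left hsmall (norm_nonneg _)
    _ < ε / 2 + ε / 2 := by
        refine add_lt_add ?_ ?_
        · rw [div_mul_eq_mul_div, div_lt_div_iff₀ (by positivity) (by positivity)]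
          nlinarith
        · simp only [η]
          rw [mul_div_assoc', div_lt_div_iff₀ (by positivity) (by positivity)]
          nlinarith [norm_nonneg φ]
    _ = ε := by ring

/-- Bounded functions with bounded support. -/
structure NiceFun (g : ℝ → ℂ) : Prop where
  meas : StronglyMeasurable g
  bdd : ∃ C : ℝ, ∀ x, ‖g x‖ ≤ C
  supp : ∃ R : ℝ, ∀ x, R < |x| → g x = 0

lemma NiceFun.memLp {g : ℝ → ℂ} (hg : NiceFun g) (q : ℝ≥0∞) : MemLp g q := by
  obtain ⟨C, hC⟩ := hg.bdd
  obtain ⟨R, hR⟩ := hg.supp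
  have h1 : MemLp g ⊤ (volume : Measure ℝ) :=
    memLp_top_of_bound hg.meas.aestronglyMeasurable C (.of_forall hC)
  refine h1.mono_exponent_of_measure_support_ne_top (s := Icc (-R) R) ?_ (by simp) le_top
  intro x hx
  refine hR x ?_
  by_contra hcon
  push Not at hcon
  exact hx (abs_le.1 hcon)

/-- The functional `u ↦ ∫ g u` for `g` in the dual space of `L^p`. -/
def lpFunctional (p : ℝ≥0∞) [Fact (1 ≤ p)] (g : ℝ → ℂ)
    (hg : MemLp g (ENNReal.conjExponent p)) : X p →L[ℂ] ℂ :=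
  have : ENNReal.HolderConjugate (ENNReal.conjExponent p) p :=
    (ENNReal.HolderConjugate.conjExponent (Fact.out : 1 ≤ p)).symm
  have : Fact (1 ≤ ENNReal.conjExponent p) :=
    ⟨ENNReal.HolderConjugate.one_le (p := ENNReal.conjExponent p) (q := p)⟩
  (ContinuousLinearMap.mul ℂ ℂ).lpPairing volume (ENNReal.conjExponent p) p (hg.toLp g)

lemma lpFunctional_apply {g : ℝ → ℂ} (hg : MemLp g (ENNReal.conjExponent p)) (u : X p) :
    lpFunctional p g hg u = ∫ x, g x * u x := by
  rw [lpFunctional, ContinuousLinearMap.lpPairing_eq_integral]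
  refine integral_congr_ae ?_
  filter_upwards [hg.coeFn_toLp] with x hx
  rw [hx]; rfl

/-- The functional `u ↦ ∫ g u` for a bounded function `g` with bounded support. -/
def pairing (p : ℝ≥0∞) [Fact (1 ≤ p)] (g : ℝ → ℂ) (hg : NiceFun g) : X p →L[ℂ] ℂ :=
  lpFunctional p g (hg.memLp _)

lemma pairing_apply {g : ℝ → ℂ} (hg : NiceFun g) (u : X p) :
    pairing p g hg u = ∫ x, g x * u x := lpFunctional_apply _ u

lemma hasSum_chi (hp' : p ≠ ⊤) (v : X p) {f : ℕ → Set ℝ} (hf : ∀ i, MeasurableSet (f i))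
    (hd : Pairwise (Function.onFun Disjoint f)) :
    HasSum (fun i => chi p (f i) (hf i) v) (chi p (⋃ i, f i) (MeasurableSet.iUnion hf) v) := by
  have hU := MeasurableSet.iUnion hf
  have hm : ∀ F : Finset ℕ, MemLp (fun x => (⋃ i, f i).indicator (fun _ => (1 : ℂ)) x -
      ∑ i ∈ F, (f i).indicator (fun _ => (1 : ℂ)) x) ⊤ := fun F =>
    (memLp_indicator _ hU).sub (memLp_finsetSum F fun i _ => memLp_indicator _ (hf i))
  have hval : ∀ x (F : Finset ℕ) (j : ℕ), x ∈ f j →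
      (⋃ i, f i).indicator (fun _ => (1 : ℂ)) x - ∑ i ∈ F, (f i).indicator (fun _ => (1 : ℂ)) x =
        if j ∈ F then 0 else 1 := fun x F j hj => by
    have h1 : ∀ i, (f i).indicator (fun _ => (1 : ℂ)) x = if i = j then 1 else 0 := fun i => by
      by_cases hij : i = j
      · subst hij; simp [hj]
      · have : x ∉ f i := fun hx => Set.disjoint_left.1 (hd hij) hx hj
        simp [this, hij]
    simp_rw [h1]
    rw [Finset.sum_ite_eq', indicator_of_mem (mem_iUnion.2 ⟨j, hj⟩)]
    split_ifs <;> simp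
  have hlim := mulOp_tendsto_zero (p := p) hp' (l := atTop) hm (C := 1)
    (fun F => .of_forall fun x => ?_) (.of_forall fun x => ?_) v
  · have heq : ∀ F : Finset ℕ, mulOp p _ (hm F) v =
        chi p (⋃ i, f i) hU v - ∑ i ∈ F, chi p (f i) (hf i) v := fun F => by
      ext
      have h2 : ∀ᵐ x, ∀ i, chi p (f i) (hf i) v x = (f i).indicator (fun _ => 1) x * v x :=
        ae_all_iff.2 fun i => mulOp_coeFn p _ (memLp_indicator _ (hf i)) v
      filter_upwards [mulOp_coeFn p _ (hm F) v, mulOp_coeFn p _ (memLp_indicator _ hU) v, h2,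
        Lp.coeFn_sub (chi p (⋃ i, f i) hU v) (∑ i ∈ F, chi p (f i) (hf i) v),
        Lp.coeFn_finsetSum F fun i => chi p (f i) (hf i) v] with x h1 h3 h2 h4 h5
      rw [h1, h4, Pi.sub_apply, h5, Finset.sum_apply, chi, h3, sub_mul, Finset.sum_mul]
      simp_rw [h2]
    have := (tendsto_const_nhds (x := chi p (⋃ i, f i) hU v)).sub hlim
    simp_rw [heq, sub_sub_cancel, sub_zero] at this
    exact this
  · by_cases hx : ∃ j, x ∈ f j
    · obtain ⟨j, hj⟩ := hx
      rw [hval x F j hj]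
      split_ifs <;> simp
    · push Not at hx
      simp [hx]
  · by_cases hx : ∃ j, x ∈ f j
    · obtain ⟨j, hj⟩ := hx
      refine tendsto_const_nhds.congr' ?_
      filter_upwards [eventually_ge_atTop {j}] with F hF
      rw [hval x F j hj, if_pos (by simpa using hF)]
    · push Not at hx
      simp [hx]

lemma chi_null (s : Set ℝ) (hs : MeasurableSet s) (h : volume s = 0) : chi p s hs = 0 := by
  rw [chi, ← mulOp_zero p (memLp_top_const 0)]
  refine mulOp_congr p _ _ ?_
  filter_upwards [compl_mem_ae_iff.2 h] with x hx
  exact indicator_of_notMem hx _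

open Classical in
/-- The signed measure `E ↦ ψ (χ_E v)` for a continuous real functional `ψ`. -/
def functionalMeasure (hp' : p ≠ ⊤) (ψ : X p → ℝ) (hψ : Continuous ψ)
    (hadd : ∀ u v, ψ (u + v) = ψ u + ψ v) (v : X p) : SignedMeasure ℝ where
  measureOf' s := if hs : MeasurableSet s then ψ (chi p s hs v) else 0
  empty' := by
    have : ψ 0 = 0 := by simpa using hadd 0 0
    rw [dif_pos MeasurableSet.empty, chi_empty, zero_apply, this]
  not_measurable' s hs := by rw [dif_neg hs]
  m_iUnion' f hf hd := by
    have h := (hasSum_chi hp' v hf hd).map (AddMonoidHom.mk' ψ hadd) hψ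
    rw [dif_pos (MeasurableSet.iUnion hf)]
    simp_rw [dif_pos (hf _)]
    exact h

lemma exists_density_real (hp' : p ≠ ⊤) (ψ : X p → ℝ) (hψ : Continuous ψ)
    (hadd : ∀ u v, ψ (u + v) = ψ u + ψ v) (v : X p) :
    ∃ g : ℝ → ℝ, Measurable g ∧ Integrable g ∧
      ∀ s (hs : MeasurableSet s), ψ (chi p s hs v) = ∫ x in s, g x := by
  set ν := functionalMeasure hp' ψ hψ hadd v
  have hν : ∀ s (hs : MeasurableSet s), ν s = ψ (chi p s hs v) := fun s hs => by
    classical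
    exact dif_pos hs
  have hac : ν ≪ᵥ (volume : Measure ℝ).toENNRealVectorMeasure := by
    refine VectorMeasure.AbsolutelyContinuous.mk fun s hs h => ?_
    rw [Measure.toENNRealVectorMeasure_apply_measurable hs] at h
    rw [hν s hs, chi_null s hs h, zero_apply]
    simpa using hadd 0 0
  have hrn := SignedMeasure.withDensityᵥ_rnDeriv_eq ν volume hac
  refine ⟨ν.rnDeriv volume, SignedMeasure.measurable_rnDeriv _ _,
    SignedMeasure.integrable_rnDeriv _ _, fun s hs => ?_⟩
  rw [← hν s hs]
  conv_lhs => rw [← hrn]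
  exact withDensityᵥ_apply (SignedMeasure.integrable_rnDeriv _ _) hs

lemma exists_density (hp' : p ≠ ⊤) (φ : X p →L[ℂ] ℂ) (v : X p) :
    ∃ g : ℝ → ℂ, Measurable g ∧ Integrable g ∧
      ∀ s (hs : MeasurableSet s), φ (chi p s hs v) = ∫ x in s, g x := by
  obtain ⟨g1, hm1, hi1, h1⟩ := exists_density_real hp' (fun u => (φ u).re)
    (Complex.continuous_re.comp φ.continuous) (fun u v => by simp) v
  obtain ⟨g2, hm2, hi2, h2⟩ := exists_density_real hp' (fun u => (φ u).im)
    (Complex.continuous_im.comp φ.continuous) (fun u v => by simp) v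
  refine ⟨fun x => (g1 x : ℂ) + (g2 x : ℂ) * I, by fun_prop,
    hi1.ofReal.add (hi2.ofReal.mul_const _), fun s hs => ?_⟩
  have i1 : Integrable (fun x => (g1 x : ℂ)) (volume.restrict s) := hi1.ofReal.integrableOn
  have i2 : Integrable (fun x => (g2 x : ℂ) * I) (volume.restrict s) :=
    (hi2.ofReal.mul_const _).integrableOn
  have e1 : ∫ x in s, (g1 x : ℂ) = ((∫ x in s, g1 x : ℝ) : ℂ) := integral_ofReal
  have e2 : ∫ x in s, (g2 x : ℂ) = ((∫ x in s, g2 x : ℝ) : ℂ) := integral_ofReal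
  rw [integral_add i1 i2, integral_mul_const, e1, e2, ← h1 s hs, ← h2 s hs]
  exact (Complex.re_add_im _).symm

lemma chi_indicatorConstLp {s t : Set ℝ} (hs : MeasurableSet s) (ht : MeasurableSet t)
    (hμt : volume t ≠ ⊤) (c : ℂ) :
    chi p s hs (indicatorConstLp p ht hμt c) = indicatorConstLp p (hs.inter ht)
      (measure_ne_top_of_subset inter_subset_right hμt) c := by
  ext
  filter_upwards [mulOp_coeFn p _ (memLp_indicator s hs) (indicatorConstLp p ht hμt c),
    indicatorConstLp_coeFn (p := p) (hs := ht) (hμs := hμt) (c := c),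
    indicatorConstLp_coeFn (p := p) (hs := hs.inter ht)
      (hμs := measure_ne_top_of_subset inter_subset_right hμt) (c := c)] with x h1 h2 h3
  rw [chi, h1, h2, h3]
  by_cases hx : x ∈ s <;> by_cases hx' : x ∈ t <;> simp [hx, hx']

lemma smul_indicatorConstLp_one {t : Set ℝ} (ht : MeasurableSet t) (hμt : volume t ≠ ⊤) (c : ℂ) :
    c • indicatorConstLp p ht hμt (1 : ℂ) = indicatorConstLp p ht hμt c := by
  ext
  filter_upwards [indicatorConstLp_coeFn (p := p) (hs := ht) (hμs := hμt) (c := c),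
    indicatorConstLp_coeFn (p := p) (hs := ht) (hμs := hμt) (c := (1 : ℂ)),
    Lp.coeFn_smul c (indicatorConstLp p ht hμt (1 : ℂ))] with x h1 h2 h3
  rw [h3, Pi.smul_apply, h1, h2]
  by_cases hx : x ∈ t <;> simp [hx]

lemma comp_chi_eq_pairing (hp' : p ≠ ⊤) (φ : X p →L[ℂ] ℂ) {M E : Set ℝ} (hM : MeasurableSet M)
    (hMv : volume M ≠ ⊤) (hE : MeasurableSet E) (hEM : E ⊆ M) {g : ℝ → ℂ}
    (hg : ∀ s (hs : MeasurableSet s), φ (chi p s hs (indicatorConstLp p hM hMv 1)) = ∫ x in s, g x)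
    (hnice : NiceFun (E.indicator g)) : φ.comp (chi p E hE) = pairing p _ hnice := by
  ext u
  refine Lp.induction hp' (motive := fun u => φ.comp (chi p E hE) u = pairing p _ hnice u)
    ?_ ?_ ?_ u
  · intro c s hs hμs
    rw [Lp.simpleFunc.coe_indicatorConst, pairing_apply, ContinuousLinearMap.comp_apply,
      chi_indicatorConstLp]
    have e1 : indicatorConstLp p (hE.inter hs)
        (measure_ne_top_of_subset inter_subset_right hμs.ne) c =
        c • chi p (E ∩ s) (hE.inter hs) (indicatorConstLp p hM hMv 1) := by
      rw [chi_indicatorConstLp, smul_indicatorConstLp_one]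
      congr 1
      exact (inter_eq_left.2 fun x hx => hEM hx.1 : E ∩ s ∩ M = E ∩ s).symm
    rw [e1, map_smul, hg, smul_eq_mul, ← integral_const_mul, ← integral_indicator (hE.inter hs)]
    refine integral_congr_ae ?_
    filter_upwards [indicatorConstLp_coeFn (p := p) (hs := hs) (hμs := hμs.ne) (c := c)] with x hx
    rw [hx]
    by_cases h1 : x ∈ E <;> by_cases h2 : x ∈ s <;> simp [h1, h2, mul_comm]
  · intro f g' hf hg' _ h1 h2
    rw [map_add, map_add, h1, h2]
  · exact isClosed_eq (ContinuousLinearMap.continuous _) (ContinuousLinearMap.continuous _)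

lemma chi_diff {M E : Set ℝ} (hM : MeasurableSet M) (hE : MeasurableSet E) (hEM : E ⊆ M) :
    chi p (M \ E) (hM.diff hE) = chi p M hM - chi p E hE := by
  have h3 : chi p (M \ E) (hM.diff hE) = chi p M hM * chi p Eᶜ hE.compl := by
    rw [chi_mul]; exact chi_congr _ _ rfl
  rw [h3, ← one_sub_chi hE, mul_sub, mul_one, chi_mul,
    chi_congr (hM.inter hE) hE (inter_eq_right.2 hEM)]

lemma exists_pairing_approx (hp : 1 < p) (hp' : p ≠ ⊤) (φ : X p →L[ℂ] ℂ) {ε : ℝ} (hε : 0 < ε) :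
    ∃ (g : ℝ → ℂ) (hg : NiceFun g), ‖φ - pairing p g hg‖ ≤ ε := by
  have hIcc : ∀ k : ℕ, MeasurableSet (Icc (-(k : ℝ)) k) := fun k => measurableSet_Icc
  obtain ⟨R, hR⟩ : ∃ R : ℕ, ‖φ.comp (chi p (Icc (-(R : ℝ)) R)ᶜ (hIcc R).compl)‖ < ε / 2 := by
    refine ((functional_chi_tendsto_zero hp hp' φ (fun k => (hIcc k).compl) ?_ ?_).eventually
      (gt_mem_nhds (half_pos hε))).exists
    · intro m n hmn
      have : (m : ℝ) ≤ n := by exact_mod_cast hmn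
      exact compl_subset_compl.2 (Icc_subset_Icc (neg_le_neg this) this)
    · rw [show (⋂ n : ℕ, (Icc (-(n : ℝ)) n)ᶜ) = ∅ by
        ext x
        simp only [mem_iInter, mem_empty_iff_false, iff_false, not_forall, mem_compl_iff, not_not]
        obtain ⟨n, hn⟩ := exists_nat_ge |x|
        exact ⟨n, abs_le.1 hn⟩]
      exact measure_empty
  set M := Icc (-(R : ℝ)) R
  have hMv : volume M ≠ ⊤ := by simp [M]
  obtain ⟨g, hgm, hgi, hg⟩ := exists_density hp' φ (indicatorConstLp p (hIcc R) hMv 1)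
  set E : ℕ → Set ℝ := fun k => M ∩ {x | ‖g x‖ ≤ k}
  have hE : ∀ k, MeasurableSet (E k) := fun k =>
    (hIcc R).inter (measurableSet_le hgm.norm measurable_const)
  have hD : ∀ k, MeasurableSet (M \ E k) := fun k => (hIcc R).diff (hE k)
  obtain ⟨k, hk⟩ : ∃ k : ℕ, ‖φ.comp (chi p (M \ E k) (hD k))‖ < ε / 2 := by
    refine ((functional_chi_tendsto_zero hp hp' φ hD ?_ ?_).eventually
      (gt_mem_nhds (half_pos hε))).exists
    · intro m n hmn x hx
      have : (m : ℝ) ≤ n := by exact_mod_cast hmn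
      exact ⟨hx.1, fun h => hx.2 ⟨h.1, le_trans h.2 this⟩⟩
    · rw [show (⋂ n : ℕ, M \ E n) = ∅ by
        ext x
        simp only [mem_iInter, mem_empty_iff_false, iff_false, not_forall]
        obtain ⟨n, hn⟩ := exists_nat_ge ‖g x‖
        exact ⟨n, fun h => h.2 ⟨h.1, hn⟩⟩]
      exact measure_empty
  have hnice : NiceFun ((E k).indicator g) := by
    refine ⟨(hgm.indicator (hE k)).stronglyMeasurable, ⟨k, fun x => ?_⟩, ⟨R, fun x hx => ?_⟩⟩
    · by_cases h : x ∈ E k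
      · rw [indicator_of_mem h]; exact h.2
      · rw [indicator_of_notMem h]; simp
    · refine indicator_of_notMem (fun h => ?_) _
      exact absurd (abs_le.2 h.1) (not_le.2 hx)
  refine ⟨_, hnice, ?_⟩
  have hrep := comp_chi_eq_pairing hp' φ (hIcc R) hMv (hE k) (fun x hx => hx.1) hg hnice
  have hsum : φ - pairing p _ hnice = φ.comp (chi p Mᶜ (hIcc R).compl) +
      φ.comp (chi p (M \ E k) (hD k)) := by
    rw [← hrep, chi_diff (hIcc R) (hE k) (fun x hx => hx.1), ← one_sub_chi (hIcc R)]
    ext u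
    simp
  rw [hsum]
  exact (norm_add_le _ _).trans (by linarith)

lemma proj_eq_chi (n : ℕ+) : proj p n = chi p (Icc (-(n : ℝ)) n) measurableSet_Icc := rfl

lemma norm_proj_le (n : ℕ+) : ‖proj p n‖ ≤ 1 := chi_norm_le measurableSet_Icc

lemma norm_one_sub_proj_le (n : ℕ+) : ‖1 - proj p n‖ ≤ 1 := by
  rw [proj_eq_chi, one_sub_chi measurableSet_Icc]; exact chi_norm_le measurableSet_Icc.compl

lemma proj_mul_proj {m n : ℕ+} (h : m ≤ n) : proj p m * proj p n = proj p m := by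
  have h' : (m : ℝ) ≤ n := by exact_mod_cast h
  rw [proj_eq_chi, proj_eq_chi, chi_mul]
  exact chi_congr _ _ (inter_eq_left.2 (Icc_subset_Icc (neg_le_neg h') h'))

lemma proj_mul_proj' {m n : ℕ+} (h : m ≤ n) : proj p n * proj p m = proj p m := by
  have h' : (m : ℝ) ≤ n := by exact_mod_cast h
  rw [proj_eq_chi, proj_eq_chi, chi_mul]
  exact chi_congr _ _ (inter_eq_right.2 (Icc_subset_Icc (neg_le_neg h') h'))

lemma proj_mul_one_sub {m n : ℕ+} (h : m ≤ n) : proj p m * (1 - proj p n) = 0 := by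
  rw [mul_sub, mul_one, proj_mul_proj h, sub_self]

lemma one_sub_mul_proj {m n : ℕ+} (h : m ≤ n) : (1 - proj p n) * proj p m = 0 := by
  rw [sub_mul, one_mul, proj_mul_proj' h, sub_self]

lemma eventually_indicator_one (x : ℝ) :
    ∀ᶠ n : ℕ+ in atTop, (Icc (-(n : ℝ)) n).indicator (fun _ => (1 : ℂ)) x = 1 := by
  obtain ⟨N, hN⟩ := exists_nat_ge |x|
  filter_upwards [eventually_ge_atTop (⟨N + 1, N.succ_pos⟩ : ℕ+)] with n hn
  have h1 : N + 1 ≤ (n : ℕ) := by exact_mod_cast hn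
  have h2 : (N : ℝ) ≤ n := by exact_mod_cast (Nat.le_succ N).trans h1
  have hx : x ∈ Icc (-(n : ℝ)) n := abs_le.1 (hN.trans h2)
  exact indicator_of_mem hx _

lemma one_sub_proj_tendsto (hp' : p ≠ ⊤) (u : X p) :
    Tendsto (fun n : ℕ+ => (1 - proj p n : Op p) u) atTop (𝓝 0) := by
  have hm : ∀ n : ℕ+, MemLp ((Icc (-(n : ℝ)) n)ᶜ.indicator fun _ => (1 : ℂ)) ⊤ :=
    fun n => memLp_indicator _ measurableSet_Icc.compl
  have := mulOp_tendsto_zero (p := p) (l := (atTop : Filter ℕ+)) hp' hm (C := 1)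
    (fun n => .of_forall fun x => norm_indicator_one_le _ _)
    (.of_forall fun x => tendsto_const_nhds.congr' ?_) u
  · refine this.congr fun n => ?_
    rw [proj_eq_chi, one_sub_chi measurableSet_Icc, chi]
  · filter_upwards [eventually_indicator_one x] with n hn
    rw [indicator_compl, Pi.sub_apply, hn, sub_self]

lemma functional_one_sub_proj_tendsto (hp : 1 < p) (hp' : p ≠ ⊤) (φ : X p →L[ℂ] ℂ) :
    Tendsto (fun n => ‖φ.comp (1 - proj p n)‖) atTop (𝓝 0) := by
  have hm : ∀ n : ℕ+, MemLp ((Icc (-(n : ℝ)) n)ᶜ.indicator fun _ => (1 : ℂ)) ⊤ :=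
    fun n => memLp_indicator _ measurableSet_Icc.compl
  have := functional_mulOp_tendsto_zero hp hp' φ hm (C := 1)
    (fun n => .of_forall fun x => norm_indicator_one_le _ _)
    (.of_forall fun x => tendsto_const_nhds.congr' ?_)
  · refine this.congr fun n => ?_
    rw [proj_eq_chi, one_sub_chi measurableSet_Icc, chi]
  · filter_upwards [eventually_indicator_one x] with n hn
    rw [indicator_compl, Pi.sub_apply, hn, sub_self]

/-- A one-sided squeeze used throughout: a sequence of norms dominated up to `ε` tends to zero. -/
lemma null_of_eventually_le {ι : Type*} {l : Filter ι} {f : ι → ℝ} (h0 : ∀ i, 0 ≤ f i)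
    (h : ∀ ε : ℝ, 0 < ε → ∀ᶠ i in l, f i ≤ ε) : Tendsto f l (𝓝 0) := by
  rw [Metric.tendsto_nhds]
  intro ε hε
  filter_upwards [h (ε / 2) (half_pos hε)] with i hi
  rw [Real.dist_eq, sub_zero, abs_of_nonneg (h0 i)]
  linarith

lemma eventually_le_of_null {ι : Type*} {l : Filter ι} {f : ι → ℝ}
    (h : Tendsto f l (𝓝 0)) {ε : ℝ} (hε : 0 < ε) : ∀ᶠ i in l, f i ≤ ε :=
  (h.eventually (gt_mem_nhds hε)).mono fun _ => le_of_lt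

lemma norm_mul_le_of_le {R : Type*} [SeminormedRing R] {a b : R} {x y : ℝ} (ha : ‖a‖ ≤ x)
    (hb : ‖b‖ ≤ y) : ‖a * b‖ ≤ x * y :=
  (norm_mul_le a b).trans (mul_le_mul ha hb (norm_nonneg _) ((norm_nonneg _).trans ha))

lemma zero_mem_pCompact : (0 : Op p) ∈ pCompact p := by
  constructor <;> simp

lemma add_mem_pCompact {K L : Op p} (hK : K ∈ pCompact p) (hL : L ∈ pCompact p) :
    K + L ∈ pCompact p := by
  constructor
  · refine squeeze_zero (fun n => norm_nonneg _) (fun n => ?_) (by simpa using hK.1.add hL.1)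
    rw [add_mul]; exact norm_add_le _ _
  · refine squeeze_zero (fun n => norm_nonneg _) (fun n => ?_) (by simpa using hK.2.add hL.2)
    rw [mul_add]; exact norm_add_le _ _

lemma smul_mem_pCompact {K : Op p} (c : ℂ) (hK : K ∈ pCompact p) : c • K ∈ pCompact p := by
  constructor
  · simp_rw [smul_mul_assoc, norm_smul]; simpa using hK.1.const_mul ‖c‖
  · simp_rw [mul_smul_comm, norm_smul]; simpa using hK.2.const_mul ‖c‖

lemma pCompact_of_approx {K : Op p} (h : ∀ ε : ℝ, 0 < ε → ∃ L ∈ pCompact p, ‖K - L‖ ≤ ε) :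
    K ∈ pCompact p := by
  constructor
  · refine null_of_eventually_le (fun n => norm_nonneg _) fun ε hε => ?_
    obtain ⟨L, hL, hKL⟩ := h (ε / 2) (half_pos hε)
    filter_upwards [eventually_le_of_null hL.1 (half_pos hε)] with n hn
    calc ‖K * (1 - proj p n)‖ = ‖(K - L) * (1 - proj p n) + L * (1 - proj p n)‖ := by
          rw [← add_mul, sub_add_cancel]
      _ ≤ ε / 2 * 1 + ε / 2 :=
          (norm_add_le _ _).trans (add_le_add (norm_mul_le_of_le hKL (norm_one_sub_proj_le n)) hn)
      _ = ε := by ring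
  · refine null_of_eventually_le (fun n => norm_nonneg _) fun ε hε => ?_
    obtain ⟨L, hL, hKL⟩ := h (ε / 2) (half_pos hε)
    filter_upwards [eventually_le_of_null hL.2 (half_pos hε)] with n hn
    calc ‖(1 - proj p n) * K‖ = ‖(1 - proj p n) * (K - L) + (1 - proj p n) * L‖ := by
          rw [← mul_add, sub_add_cancel]
      _ ≤ 1 * (ε / 2) + ε / 2 :=
          (norm_add_le _ _).trans (add_le_add (norm_mul_le_of_le (norm_one_sub_proj_le n) hKL) hn)
      _ = ε := by ring

lemma proj_mem_pCompact (m : ℕ+) : proj p m ∈ pCompact p := by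
  constructor <;> refine tendsto_const_nhds.congr' ?_
  · filter_upwards [eventually_ge_atTop m] with n hn
    rw [proj_mul_one_sub hn, norm_zero]
  · filter_upwards [eventually_ge_atTop m] with n hn
    rw [one_sub_mul_proj hn, norm_zero]

lemma pBounded_iff {A : Op p} : A ∈ pBounded p ↔
    ∀ m, Tendsto (fun n => ‖(1 - proj p n) * A * proj p m‖) atTop (𝓝 0) ∧
      Tendsto (fun n => ‖proj p m * A * (1 - proj p n)‖) atTop (𝓝 0) := by
  constructor
  · intro h m
    obtain ⟨h1, h2⟩ := h _ (proj_mem_pCompact m)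
    refine ⟨?_, h2.1⟩
    simp_rw [mul_assoc]
    exact h1.2
  · intro h K hK
    refine ⟨⟨?_, ?_⟩, ⟨?_, ?_⟩⟩
    · refine squeeze_zero (fun n => norm_nonneg _) (fun n => ?_)
        (by simpa using hK.1.const_mul ‖A‖)
      rw [mul_assoc]; exact norm_mul_le _ _
    · refine null_of_eventually_le (fun n => norm_nonneg _) fun ε hε => ?_
      have hA : 0 < 2 * (‖A‖ + 1) := by positivity
      have hK' : 0 < 2 * (‖K‖ + 1) := by positivity
      obtain ⟨m, hm⟩ := (eventually_le_of_null hK.2 (div_pos hε hA)).exists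
      filter_upwards [eventually_le_of_null (h m).1 (div_pos hε hK')] with n hn
      calc ‖(1 - proj p n) * (A * K)‖
          = ‖(1 - proj p n) * A * proj p m * K + (1 - proj p n) * (A * ((1 - proj p m) * K))‖ := by
            congr 1; noncomm_ring
        _ ≤ ε / (2 * (‖K‖ + 1)) * ‖K‖ + 1 * (‖A‖ * (ε / (2 * (‖A‖ + 1)))) :=
            (norm_add_le _ _).trans (add_le_add (norm_mul_le_of_le hn le_rfl)
              (norm_mul_le_of_le (norm_one_sub_proj_le n) (norm_mul_le_of_le le_rfl hm)))
        _ ≤ ε / 2 + ε / 2 := by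
            have h3 := norm_nonneg K
            have h4 := norm_nonneg A
            refine add_le_add ?_ ?_
            · rw [div_mul_eq_mul_div, div_le_div_iff₀ (by positivity) (by positivity)]; nlinarith
            · rw [one_mul, mul_div_assoc', div_le_div_iff₀ (by positivity) (by positivity)]
              nlinarith
        _ = ε := by ring
    · refine null_of_eventually_le (fun n => norm_nonneg _) fun ε hε => ?_
      have hA : 0 < 2 * (‖A‖ + 1) := by positivity
      have hK' : 0 < 2 * (‖K‖ + 1) := by positivity
      obtain ⟨m, hm⟩ := (eventually_le_of_null hK.1 (div_pos hε hA)).exists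
      filter_upwards [eventually_le_of_null (h m).2 (div_pos hε hK')] with n hn
      calc ‖K * A * (1 - proj p n)‖
          = ‖K * (proj p m * A * (1 - proj p n)) + K * (1 - proj p m) * (A * (1 - proj p n))‖ := by
            congr 1; noncomm_ring
        _ ≤ ‖K‖ * (ε / (2 * (‖K‖ + 1))) + ε / (2 * (‖A‖ + 1)) * (‖A‖ * 1) :=
            (norm_add_le _ _).trans (add_le_add (norm_mul_le_of_le le_rfl hn)
              (norm_mul_le_of_le hm (norm_mul_le_of_le le_rfl (norm_one_sub_proj_le n))))
        _ ≤ ε / 2 + ε / 2 := by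
            have h3 := norm_nonneg K
            have h4 := norm_nonneg A
            refine add_le_add ?_ ?_
            · rw [mul_div_assoc', div_le_div_iff₀ (by positivity) (by positivity)]; nlinarith
            · rw [mul_one, div_mul_eq_mul_div, div_le_div_iff₀ (by positivity) (by positivity)]
              nlinarith
        _ = ε := by ring
    · refine squeeze_zero (fun n => norm_nonneg _) (fun n => ?_)
        (by simpa using hK.2.mul_const ‖A‖)
      rw [← mul_assoc]; exact norm_mul_le _ _

lemma mul_mem_pBounded {A B : Op p} (hA : A ∈ pBounded p) (hB : B ∈ pBounded p) :
    A * B ∈ pBounded p := fun K hK => by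
  refine ⟨?_, ?_⟩
  · rw [mul_assoc]; exact (hA _ (hB K hK).1).1
  · rw [← mul_assoc]; exact (hB _ (hA K hK).2).2

lemma add_mem_pBounded {A B : Op p} (hA : A ∈ pBounded p) (hB : B ∈ pBounded p) :
    A + B ∈ pBounded p := fun K hK => by
  refine ⟨?_, ?_⟩
  · rw [add_mul]; exact add_mem_pCompact (hA K hK).1 (hB K hK).1
  · rw [mul_add]; exact add_mem_pCompact (hA K hK).2 (hB K hK).2

lemma smul_one_mem_pBounded (c : ℂ) : c • (1 : Op p) ∈ pBounded p := fun K hK => by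
  refine ⟨?_, ?_⟩
  · rw [smul_mul_assoc, one_mul]; exact smul_mem_pCompact c hK
  · rw [mul_smul_comm, mul_one]; exact smul_mem_pCompact c hK

lemma pBounded_of_approx {A : Op p} (h : ∀ ε : ℝ, 0 < ε → ∃ B ∈ pBounded p, ‖A - B‖ ≤ ε) :
    A ∈ pBounded p := fun K hK => by
  have key : ∀ ε : ℝ, 0 < ε → ∃ B ∈ pBounded p, ‖A - B‖ * ‖K‖ ≤ ε := fun ε hε => by
    obtain ⟨B, hB, hAB⟩ := h (ε / (‖K‖ + 1)) (by positivity)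
    refine ⟨B, hB, (mul_le_mul_of_nonneg_right hAB (norm_nonneg K)).trans ?_⟩
    rw [div_mul_eq_mul_div, div_le_iff₀ (by positivity)]
    nlinarith [norm_nonneg K]
  refine ⟨pCompact_of_approx fun ε hε => ?_, pCompact_of_approx fun ε hε => ?_⟩
  · obtain ⟨B, hB, hAB⟩ := key ε hε
    refine ⟨B * K, (hB K hK).1, ?_⟩
    rw [← sub_mul]; exact (norm_mul_le _ _).trans hAB
  · obtain ⟨B, hB, hAB⟩ := key ε hε
    refine ⟨K * B, (hB K hK).2, ?_⟩
    rw [← mul_sub, ]; exact (norm_mul_le _ _).trans ((mul_comm _ _).trans_le hAB)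

lemma pCompact_subset_pBounded {K : Op p} (hK : K ∈ pCompact p) : K ∈ pBounded p := by
  rw [pBounded_iff]
  refine fun m => ⟨?_, ?_⟩
  · refine squeeze_zero (fun n => norm_nonneg _) (fun n => ?_) hK.2
    exact (norm_mul_le_of_le le_rfl (norm_proj_le m)).trans (mul_one _).le
  · refine squeeze_zero (fun n => norm_nonneg _) (fun n => ?_) hK.1
    rw [mul_assoc]
    exact (norm_mul_le_of_le (norm_proj_le m) le_rfl).trans (one_mul _).le

lemma mulOp_mem_pBounded {a : ℝ → ℂ} (ha : MemLp a ⊤) : mulOp p a ha ∈ pBounded p := by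
  rw [pBounded_iff]
  refine fun m => ⟨?_, ?_⟩ <;> refine tendsto_const_nhds.congr' ?_
  · filter_upwards [eventually_ge_atTop m] with n hn
    have hc : mulOp p a ha * proj p m = proj p m * mulOp p a ha := mulOp_comm p _ _
    rw [mul_assoc, hc, ← mul_assoc, one_sub_mul_proj hn, zero_mul, norm_zero]
  · filter_upwards [eventually_ge_atTop m] with n hn
    have hc : mulOp p a ha * proj p m = proj p m * mulOp p a ha := mulOp_comm p _ _
    rw [← hc, mul_assoc, proj_mul_one_sub hn, mul_zero, norm_zero]

lemma enorm_sum_chi_rpow (hp' : p ≠ ⊤) {t : ℕ → Set ℝ} (ht : ∀ k, MeasurableSet (t k))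
    (hd : Pairwise (Function.onFun Disjoint t)) (w : ℕ → X p) (N : ℕ) :
    ‖∑ k ∈ Finset.range N, chi p (t k) (ht k) (w k)‖ₑ ^ p.toReal ≤
      ∑ k ∈ Finset.range N, ‖chi p (t k) (ht k) (w k)‖ₑ ^ p.toReal := by
  have hpos := exponent_pos hp'
  induction N with
  | zero => simp [hpos]
  | succ N ih =>
    have hz : ∀ k ∈ Finset.range N, chi p (t N) (ht N) (chi p (t k) (ht k) (w k)) = 0 :=
      fun k hk => by
        have hkN : N ≠ k := (Finset.mem_range.1 hk).ne'
        rw [← mul_apply_eq_comp, chi_mul, chi_congr ((ht N).inter (ht k)) MeasurableSet.empty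
          (Set.disjoint_iff_inter_eq_empty.1 (hd hkN)), chi_empty, zero_apply]
    have hs : chi p (t N) (ht N) (∑ k ∈ Finset.range N, chi p (t k) (ht k) (w k)) = 0 := by
      rw [map_sum]; exact Finset.sum_eq_zero hz
    have hi : chi p (t N) (ht N) (chi p (t N) (ht N) (w N)) = chi p (t N) (ht N) (w N) := by
      rw [← mul_apply_eq_comp, chi_mul, chi_congr ((ht N).inter (ht N)) (ht N) (inter_self _)]
    rw [Finset.sum_range_succ, Finset.sum_range_succ, enorm_rpow_split hp' (ht N), map_add, hs,
      zero_add, hi, ← one_sub_chi (ht N), sub_apply, one_apply_eq_self, map_add, hs, hi, zero_add,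
      add_sub_cancel_right, add_comm]
    gcongr

lemma sum_enorm_chi_rpow_le (hp' : p ≠ ⊤) {s : ℕ → Set ℝ} (hs : ∀ k, MeasurableSet (s k))
    (hd : Pairwise (Function.onFun Disjoint s)) (u : X p) (N : ℕ) :
    ∑ k ∈ Finset.range N, ‖chi p (s k) (hs k) u‖ₑ ^ p.toReal ≤ ‖u‖ₑ ^ p.toReal := by
  simp_rw [enorm_chi_rpow hp']
  rw [← lintegral_biUnion_finset (fun i _ j _ hij => hd hij) (fun k _ => hs k),
    enorm_rpow_eq_lintegral hp']
  exact setLIntegral_le_lintegral _ _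

lemma norm_sum_chi_mul_chi_le (hp' : p ≠ ⊤) {s t : ℕ → Set ℝ} (hs : ∀ k, MeasurableSet (s k))
    (ht : ∀ k, MeasurableSet (t k)) (hds : Pairwise (Function.onFun Disjoint s))
    (hdt : Pairwise (Function.onFun Disjoint t)) (A : Op p) (N : ℕ) :
    ‖∑ k ∈ Finset.range N, chi p (t k) (ht k) * A * chi p (s k) (hs k)‖ ≤ ‖A‖ := by
  have hpos := exponent_pos hp'
  refine ContinuousLinearMap.opNorm_le_bound _ (norm_nonneg _) fun u => ?_
  have h1 : ‖(∑ k ∈ Finset.range N, chi p (t k) (ht k) * A * chi p (s k) (hs k)) u‖ₑ ^ p.toReal ≤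
      (‖A‖ₑ * ‖u‖ₑ) ^ p.toReal := by
    rw [sum_apply]
    refine (enorm_sum_chi_rpow hp' ht hdt (fun k => A (chi p (s k) (hs k) u)) N).trans ?_
    rw [ENNReal.mul_rpow_of_nonneg _ _ hpos.le]
    refine le_trans ?_ (mul_le_mul_right (sum_enorm_chi_rpow_le hp' hs hds u N) _)
    rw [Finset.mul_sum]
    refine Finset.sum_le_sum fun k _ => ?_
    rw [← ENNReal.mul_rpow_of_nonneg _ _ hpos.le]
    gcongr
    have h2 : ‖chi p (t k) (ht k) (A (chi p (s k) (hs k) u))‖ ≤ ‖A‖ * ‖chi p (s k) (hs k) u‖ := by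
      refine ((chi p _ _).le_of_opNorm_le (chi_norm_le _) _).trans ?_
      rw [one_mul]; exact A.le_opNorm _
    rw [← ofReal_norm, ← ofReal_norm, ← ofReal_norm, ← ENNReal.ofReal_mul (norm_nonneg _)]
    exact ENNReal.ofReal_le_ofReal h2
  have h3 := (ENNReal.rpow_le_rpow_iff hpos).1 h1
  rw [← ofReal_norm, ← ofReal_norm, ← ofReal_norm, ← ENNReal.ofReal_mul (norm_nonneg _)] at h3
  exact (ENNReal.ofReal_le_ofReal_iff (by positivity)).1 h3

lemma exists_sparse {A : Op p} (hA : A ∈ pBounded p) {η : ℝ} (hη : 0 < η) (m : ℕ+) :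
    ∃ e : ℕ → ℕ+, m ≤ e 0 ∧ StrictMono e ∧
      ∀ k, ‖(1 - proj p (e (k + 1))) * A * proj p (e k)‖ ≤ η ∧
        ‖proj p (e k) * A * (1 - proj p (e (k + 1)))‖ ≤ η := by
  have h : ∀ m : ℕ+, ∃ M, m < M ∧ ‖(1 - proj p M) * A * proj p m‖ ≤ η ∧
      ‖proj p m * A * (1 - proj p M)‖ ≤ η := fun m => by
    obtain ⟨h1, h2⟩ := pBounded_iff.1 hA m
    exact ((eventually_gt_atTop m).and ((eventually_le_of_null h1 hη).and
      (eventually_le_of_null h2 hη))).exists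
  choose f hf using h
  have hs : ∀ k, f^[k + 1] m = f (f^[k] m) := fun k => Function.iterate_succ_apply' f k m
  refine ⟨fun k => f^[k] m, le_rfl, strictMono_nat_of_lt_succ fun k => ?_, fun k => ?_⟩
  · rw [hs]; exact (hf _).1
  · simp only [hs]; exact (hf _).2

lemma norm_sum_rings_le (hp' : p ≠ ⊤) {e : ℕ → ℕ+} (he : StrictMono e) (A : Op p) (N i j : ℕ) :
    ‖∑ k ∈ Finset.range N, (proj p (e (k + i + 1)) - proj p (e (k + i))) * A *
      (proj p (e (k + j + 1)) - proj p (e (k + j)))‖ ≤ ‖A‖ := by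
  set S : ℕ → Set ℝ := fun k => Icc (-(e (k + 1) : ℝ)) (e (k + 1)) \ Icc (-(e k : ℝ)) (e k)
  have hsub : ∀ {k l : ℕ}, k ≤ l → Icc (-(e k : ℝ)) (e k) ⊆ Icc (-(e l : ℝ)) (e l) := by
    intro k l h
    have h' : (e k : ℝ) ≤ e l := by exact_mod_cast he.monotone h
    exact Icc_subset_Icc (neg_le_neg h') h'
  have hS : ∀ k, MeasurableSet (S k) := fun k => measurableSet_Icc.diff measurableSet_Icc
  have hR : ∀ k, proj p (e (k + 1)) - proj p (e k) = chi p (S k) (hS k) := fun k =>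
    (chi_diff measurableSet_Icc measurableSet_Icc (hsub k.le_succ)).symm
  have hd : Pairwise (Function.onFun Disjoint S) := by
    have : ∀ k l, k < l → Disjoint (S k) (S l) := fun k l hkl =>
      Set.disjoint_left.2 fun x hx hx' => hx'.2 (hsub hkl hx.1)
    intro k l hkl
    rcases lt_or_gt_of_ne hkl with h | h
    · exact this k l h
    · exact (this l k h).symm
  simp_rw [hR]
  exact norm_sum_chi_mul_chi_le hp' (fun k => hS (k + j)) (fun k => hS (k + i))
    (fun k l hkl => hd fun h => hkl (by simpa using h))
    (fun k l hkl => hd fun h => hkl (by simpa using h)) A N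

lemma exists_almost_commuting (hp' : p ≠ ⊤) {A : Op p} (hA : A ∈ pBounded p) (m : ℕ+) {ε : ℝ}
    (hε : 0 < ε) : ∃ (F : Op p) (M : ℕ+), ‖F‖ ≤ 1 ∧ F * proj p m = proj p m ∧
      proj p m * F = proj p m ∧ F * (1 - proj p M) = 0 ∧ (1 - proj p M) * F = 0 ∧
      ‖A * F - F * A‖ ≤ ε := by
  obtain ⟨e, he0, hmono, he⟩ := exists_sparse hA (show 0 < ε / 8 by positivity) m
  obtain ⟨N, hN⟩ := exists_nat_gt (4 * ‖A‖ / ε)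
  have hN0 : (0 : ℝ) < N := lt_of_le_of_lt (by positivity) hN
  have hNC : (N : ℂ) ≠ 0 := by exact_mod_cast hN0.ne'
  have hmle : ∀ k, m ≤ e k := fun k => he0.trans (hmono.monotone k.zero_le)
  set P : ℕ → Op p := fun k => proj p (e k)
  have hcard : ∀ B : Op p, (N : ℂ)⁻¹ • ∑ k ∈ Finset.range N, B = B := fun B => by
    rw [Finset.sum_const, Finset.card_range, ← Nat.cast_smul_eq_nsmul ℂ, smul_smul,
      inv_mul_cancel₀ hNC, one_smul]
  have hnorm : ∀ (f : ℕ → Op p) (C : ℝ), (∀ k, ‖f k‖ ≤ C) →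
      ‖∑ k ∈ Finset.range N, f k‖ ≤ N * C := fun f C hf => by
    refine (norm_sum_le_of_le _ fun k _ => hf k).trans (le_of_eq ?_)
    simp
  have hNinv : ‖(N : ℂ)⁻¹‖ = (N : ℝ)⁻¹ := by simp
  refine ⟨(N : ℂ)⁻¹ • ∑ k ∈ Finset.range N, P (k + 1), e N, ?_, ?_, ?_, ?_, ?_, ?_⟩
  · rw [norm_smul, hNinv, inv_mul_le_iff₀ hN0]
    exact hnorm _ _ fun k => norm_proj_le _
  · rw [smul_mul_assoc, Finset.sum_mul, Finset.sum_congr rfl fun k _ => proj_mul_proj' (hmle _)]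
    exact hcard _
  · rw [mul_smul_comm, Finset.mul_sum, Finset.sum_congr rfl fun k _ => proj_mul_proj (hmle _)]
    exact hcard _
  · rw [smul_mul_assoc, Finset.sum_mul, Finset.sum_congr rfl fun k hk =>
      proj_mul_one_sub (hmono.monotone (Finset.mem_range.1 hk)), Finset.sum_const_zero, smul_zero]
  · rw [mul_smul_comm, Finset.mul_sum, Finset.sum_congr rfl fun k hk =>
      one_sub_mul_proj (hmono.monotone (Finset.mem_range.1 hk)), Finset.sum_const_zero, smul_zero]
  · have hPP : ∀ k, P k * P (k + 1) = P k := fun k => proj_mul_proj (hmono.monotone k.le_succ)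
    have hPP' : ∀ k, P (k + 1) * P k = P k := fun k => proj_mul_proj' (hmono.monotone k.le_succ)
    have hPi : ∀ k, P k * P k = P k := fun k => proj_mul_proj le_rfl
    have hR : ∀ k, ‖P (k + 1) - P k‖ ≤ 1 := fun k => by
      have : P (k + 1) - P k = P (k + 1) * (1 - P k) := by rw [mul_sub, mul_one, hPP']
      rw [this]
      exact (norm_mul_le_of_le (norm_proj_le _) (norm_one_sub_proj_le _)).trans (one_mul _).le
    set E : ℕ → Op p := fun k => (1 - P (k + 1)) * A * P k +
      (1 - P (k + 2)) * A * P (k + 1) * (P (k + 1) - P k) -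
      (P k * A * (1 - P (k + 1)) + (P (k + 1) - P k) * (P (k + 1) * A * (1 - P (k + 2))))
    have hE : ∀ k, ‖E k‖ ≤ ε / 2 := fun k => by
      have h1 := (he k).1
      have h2 := norm_mul_le_of_le (he (k + 1)).1 (hR k)
      have h3 := (he k).2
      have h4 := norm_mul_le_of_le (hR k) (he (k + 1)).2
      refine (norm_sub_le_of_le (norm_add_le_of_le h1 h2) (norm_add_le_of_le h3 h4)).trans ?_
      linarith
    have hcomm : ∀ k, A * P (k + 1) - P (k + 1) * A = E k +
        (P (k + 1 + 1) - P (k + 1)) * A * (P (k + 0 + 1) - P (k + 0)) -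
        (P (k + 0 + 1) - P (k + 0)) * A * (P (k + 1 + 1) - P (k + 1)) := fun k => by
      have e1 : P (k + 1) * (P (k + 1) - P k) = P (k + 1) - P k := by rw [mul_sub, hPi, hPP']
      have e2 : (P (k + 1) - P k) * P (k + 1) = P (k + 1) - P k := by rw [sub_mul, hPi, hPP]
      simp only [E, add_zero]
      rw [mul_assoc _ (P (k + 1)), e1, ← mul_assoc (P (k + 1) - P k) _, ← mul_assoc _ (P (k + 1)),
        e2]
      noncomm_ring
    have hsum : A * (N : ℂ)⁻¹ • ∑ k ∈ Finset.range N, P (k + 1) -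
        ((N : ℂ)⁻¹ • ∑ k ∈ Finset.range N, P (k + 1)) * A = (N : ℂ)⁻¹ •
        (∑ k ∈ Finset.range N, E k + ∑ k ∈ Finset.range N,
          (P (k + 1 + 1) - P (k + 1)) * A * (P (k + 0 + 1) - P (k + 0)) -
        ∑ k ∈ Finset.range N, (P (k + 0 + 1) - P (k + 0)) * A * (P (k + 1 + 1) - P (k + 1))) := by
      rw [mul_smul_comm, smul_mul_assoc, ← smul_sub, Finset.mul_sum, Finset.sum_mul,
        ← Finset.sum_sub_distrib, ← Finset.sum_add_distrib, ← Finset.sum_sub_distrib]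
      simp_rw [hcomm]
    rw [hsum, norm_smul, hNinv, inv_mul_le_iff₀ hN0]
    refine (norm_sub_le_of_le (norm_add_le_of_le (hnorm _ _ hE)
      (norm_sum_rings_le hp' hmono A N 1 0)) (norm_sum_rings_le hp' hmono A N 0 1)).trans ?_
    rw [div_lt_iff₀ hε] at hN
    linarith

lemma regulariser_mem_pBounded (hp' : p ≠ ⊤) {A B : Op p} (hA : A ∈ pBounded p)
    (h1 : A * B - 1 ∈ pCompact p) (h2 : B * A - 1 ∈ pCompact p) : B ∈ pBounded p := by
  set K := A * B - 1 with hK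
  set L := B * A - 1 with hL
  have hBK : B * K = L * B := by rw [hK, hL]; noncomm_ring
  have key : ∀ (m : ℕ+) (ε : ℝ), 0 < ε → ∃ (F : Op p) (M : ℕ+), F * proj p m = proj p m ∧
      proj p m * F = proj p m ∧ F * (1 - proj p M) = 0 ∧ (1 - proj p M) * F = 0 ∧
      ‖B * F - F * B‖ ≤ ε := by
    intro m ε hε
    have hb := norm_nonneg B
    set η := ε / (5 * (‖B‖ + 1)) with hη_def
    have hη : 0 < η := by positivity
    obtain ⟨m', hm', hm1, hm2⟩ := ((eventually_ge_atTop m).and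
      ((eventually_le_of_null h1.2 hη).and
      (eventually_le_of_null h2.1 hη))).exists
    obtain ⟨F, M, hF1, hFm, hmF, hFM, hMF, hAF⟩ := exists_almost_commuting hp' hA m'
      (show 0 < η / (‖B‖ + 1) by positivity)
    have hone : ‖1 - F‖ ≤ 2 := by
      have h0 : ‖(1 : Op p)‖ ≤ 1 := ContinuousLinearMap.norm_id_le
      exact (norm_sub_le_of_le h0 hF1).trans (by norm_num)
    refine ⟨F, M, ?_, ?_, hFM, hMF, ?_⟩
    · rw [← proj_mul_proj' hm', ← mul_assoc, hFm]
    · rw [← proj_mul_proj hm', mul_assoc, hmF]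
    · have e1 : B * F - F * B = -(B * (A * F - F * A) * B) + B * ((1 - F) * ((1 - proj p m') * K))
          - (L * (1 - proj p m')) * (1 - F) * B := by
        have a1 : (1 - F) * ((1 - proj p m') * K) = (1 - F) * K := by
          have : (1 - F) * (1 - proj p m') = 1 - F := by
            rw [mul_sub, mul_one, sub_mul, one_mul, hFm, sub_self, sub_zero]
          rw [← mul_assoc, this]
        have a2 : (L * (1 - proj p m')) * (1 - F) = L * (1 - F) := by
          have : (1 - proj p m') * (1 - F) = 1 - F := by
            rw [sub_mul, one_mul, mul_sub, mul_one, hmF, sub_self, sub_zero]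
          rw [mul_assoc, this]
        rw [a1, a2]
        have a3 : B * (A * F - F * A) * B = F * B - B * F + L * F * B - B * F * K := by
          rw [hK, hL]; noncomm_ring
        have a4 : B * ((1 - F) * K) - L * (1 - F) * B = L * F * B - B * F * K := by
          calc B * ((1 - F) * K) - L * (1 - F) * B = (B * K - L * B) + (L * F * B - B * F * K) := by
                noncomm_ring
            _ = _ := by rw [hBK, sub_self, zero_add]
        rw [add_sub_assoc, a4, a3]
        abel
      rw [e1]
      have b1 : ‖-(B * (A * F - F * A) * B)‖ ≤ ‖B‖ * (η / (‖B‖ + 1)) * ‖B‖ := by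
        rw [norm_neg]
        exact norm_mul_le_of_le (norm_mul_le_of_le le_rfl hAF) le_rfl
      have b2 := norm_mul_le_of_le (le_refl ‖B‖) (norm_mul_le_of_le hone hm1)
      have b3 := norm_mul_le_of_le (norm_mul_le_of_le hm2 hone) (le_refl ‖B‖)
      refine (norm_sub_le_of_le (norm_add_le_of_le b1 b2) b3).trans ?_
      have c1 : η / (‖B‖ + 1) * ‖B‖ ≤ η := by
        rw [div_mul_eq_mul_div, div_le_iff₀ (by positivity)]; nlinarith
      have c2 : ‖B‖ * (η / (‖B‖ + 1)) * ‖B‖ ≤ η * ‖B‖ := by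
        rw [mul_comm ‖B‖]; exact mul_le_mul_of_nonneg_right c1 hb
      have c3 : 5 * η * ‖B‖ ≤ ε := by
        have : 5 * (‖B‖ + 1) * η = ε := by rw [hη_def]; field_simp
        nlinarith
      linarith
  rw [pBounded_iff]
  have hle : ∀ ε : ℝ, 0 < ε → ∀ x : ℝ, x ≤ 1 * ε * 1 → x ≤ ε := fun ε _ x hx => by linarith
  refine fun m => ⟨null_of_eventually_le (fun _ => norm_nonneg _) fun ε hε => ?_,
    null_of_eventually_le (fun _ => norm_nonneg _) fun ε hε => ?_⟩
  · obtain ⟨F, M, hFm, hmF, hFM, hMF, hBF⟩ := key m ε hε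
    filter_upwards [eventually_ge_atTop M] with n hn
    have hnF : (1 - proj p n) * F = 0 := by
      have : (1 - proj p n) * (1 - proj p M) = 1 - proj p n := by
        rw [mul_sub, mul_one, one_sub_mul_proj hn, sub_zero]
      rw [← this, mul_assoc, hMF, mul_zero]
    have e : (1 - proj p n) * B * proj p m = (1 - proj p n) * (B * F - F * B) * proj p m := by
      have : (1 - proj p n) * (B * F - F * B) * proj p m =
        (1 - proj p n) * B * (F * proj p m) - ((1 - proj p n) * F) * B * proj p m := by
        noncomm_ring
      rw [this, hFm, hnF, zero_mul, zero_mul, sub_zero]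
    rw [e]
    exact hle ε hε _ (norm_mul_le_of_le (norm_mul_le_of_le (norm_one_sub_proj_le n) hBF)
      (norm_proj_le m))
  · obtain ⟨F, M, hFm, hmF, hFM, hMF, hBF⟩ := key m ε hε
    filter_upwards [eventually_ge_atTop M] with n hn
    have hnF : F * (1 - proj p n) = 0 := by
      have : (1 - proj p M) * (1 - proj p n) = 1 - proj p n := by
        rw [sub_mul, one_mul, proj_mul_one_sub hn, sub_zero]
      rw [← this, ← mul_assoc, hFM, zero_mul]
    have e : proj p m * B * (1 - proj p n) = -(proj p m * (B * F - F * B) * (1 - proj p n)) := by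
      have : -(proj p m * (B * F - F * B) * (1 - proj p n)) =
        (proj p m * F) * B * (1 - proj p n) - proj p m * B * (F * (1 - proj p n)) := by
        noncomm_ring
      rw [this, hmF, hnF, mul_zero, sub_zero]
    rw [e, norm_neg]
    exact hle ε hε _ (norm_mul_le_of_le (norm_mul_le_of_le (norm_proj_le m) hBF)
      (norm_one_sub_proj_le n))

end Convergence

section Conjugation

variable (p : ℝ≥0∞) [Fact (1 ≤ p)]

/-- The left factor of `E_n^t`. -/
def conjL : Index → ℕ+ → Op p
  | .inl .minus, n => shift p (-(n : ℝ))
  | .inl .center, _ => 1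
  | .inl .plus, n => shift p n
  | .inr t, n => modulation p (-t) * zOp p n

/-- The right factor of `E_n^t`. -/
def conjR : Index → ℕ+ → Op p
  | .inl .minus, n => shift p n
  | .inl .center, _ => 1
  | .inl .plus, n => shift p (-(n : ℝ))
  | .inr t, n => zInv p n * modulation p t

variable {p}

lemma lift_eq (t : Index) (n : ℕ+) (A : Op p) : lift t n A = conjL p t n * A * conjR p t n := by
  rcases t with (_ | _ | _) | t <;> simp [lift, conjL, conjR, mul_assoc]

lemma unlift_eq (t : Index) (n : ℕ+) (A : Op p) :
    unlift t n A = conjR p t n * A * conjL p t n := by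
  rcases t with (_ | _ | _) | t <;> simp [unlift, conjL, conjR, mul_assoc]

lemma conjL_mul_conjR (t : Index) (n : ℕ+) : conjL p t n * conjR p t n = 1 := by
  rcases t with (_ | _ | _) | t
  · exact shift_neg_mul p _
  · exact mul_one _
  · exact shift_mul_neg p _
  · calc conjL p (.inr t) n * conjR p (.inr t) n
        = modulation p (-t) * (zOp p n * zInv p n) * modulation p t := by
          simp only [conjL, conjR, mul_assoc]
      _ = 1 := by rw [zOp_mul_zInv, mul_one, modulation_neg_mul]

lemma conjR_mul_conjL (t : Index) (n : ℕ+) : conjR p t n * conjL p t n = 1 := by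
  rcases t with (_ | _ | _) | t
  · exact shift_mul_neg p _
  · exact mul_one _
  · exact shift_neg_mul p _
  · calc conjR p (.inr t) n * conjL p (.inr t) n
        = zInv p n * (modulation p t * modulation p (-t)) * zOp p n := by
          simp only [conjL, conjR, mul_assoc]
      _ = 1 := by rw [modulation_mul_neg, mul_one, zInv_mul_zOp]

lemma norm_one_le : ‖(1 : Op p)‖ ≤ 1 := ContinuousLinearMap.norm_id_le

lemma norm_conjL_le (t : Index) (n : ℕ+) : ‖conjL p t n‖ ≤ 1 := by
  rcases t with (_ | _ | _) | t
  · exact shift_norm_le p _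
  · exact norm_one_le
  · exact shift_norm_le p _
  · exact (norm_mul_le_of_le (modulation_norm_le p _) (dilation_norm_le p _ _)).trans (mul_one _).le

lemma norm_conjR_le (t : Index) (n : ℕ+) : ‖conjR p t n‖ ≤ 1 := by
  rcases t with (_ | _ | _) | t
  · exact shift_norm_le p _
  · exact norm_one_le
  · exact shift_norm_le p _
  · exact (norm_mul_le_of_le (dilation_norm_le p _ _) (modulation_norm_le p _)).trans (mul_one _).le

lemma conj_sandwich {R : Type*} [Ring R] {c d : R} (h : d * c = 1) (A B : R) :
    c * A * d * (c * B * d) = c * (A * B) * d := by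
  calc c * A * d * (c * B * d) = c * A * (d * c) * B * d := by noncomm_ring
    _ = _ := by rw [h]; noncomm_ring

lemma lift_mul (t : Index) (n : ℕ+) (A B : Op p) :
    lift t n (A * B) = lift t n A * lift t n B := by
  simp only [lift_eq, conj_sandwich (conjR_mul_conjL t n)]

lemma unlift_mul (t : Index) (n : ℕ+) (A B : Op p) :
    unlift t n (A * B) = unlift t n A * unlift t n B := by
  simp only [unlift_eq, conj_sandwich (conjL_mul_conjR t n)]

lemma lift_add (t : Index) (n : ℕ+) (A B : Op p) :
    lift t n (A + B) = lift t n A + lift t n B := by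
  simp only [lift_eq, mul_add, add_mul]

lemma unlift_add (t : Index) (n : ℕ+) (A B : Op p) :
    unlift t n (A + B) = unlift t n A + unlift t n B := by
  simp only [unlift_eq, mul_add, add_mul]

lemma lift_sub (t : Index) (n : ℕ+) (A B : Op p) :
    lift t n (A - B) = lift t n A - lift t n B := by
  simp only [lift_eq, mul_sub, sub_mul]

lemma unlift_sub (t : Index) (n : ℕ+) (A B : Op p) :
    unlift t n (A - B) = unlift t n A - unlift t n B := by
  simp only [unlift_eq, mul_sub, sub_mul]

lemma lift_smul (t : Index) (n : ℕ+) (c : ℂ) (A : Op p) : lift t n (c • A) = c • lift t n A := by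
  simp only [lift_eq, mul_smul_comm, smul_mul_assoc]

lemma unlift_smul (t : Index) (n : ℕ+) (c : ℂ) (A : Op p) :
    unlift t n (c • A) = c • unlift t n A := by
  simp only [unlift_eq, mul_smul_comm, smul_mul_assoc]

lemma lift_one (t : Index) (n : ℕ+) : lift t n (1 : Op p) = 1 := by
  rw [lift_eq, mul_one, conjL_mul_conjR]

lemma unlift_one (t : Index) (n : ℕ+) : unlift t n (1 : Op p) = 1 := by
  rw [unlift_eq, mul_one, conjR_mul_conjL]

lemma unlift_lift (t : Index) (n : ℕ+) (A : Op p) : unlift t n (lift t n A) = A := by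
  rw [unlift_eq, lift_eq]
  calc _ = (conjR p t n * conjL p t n) * A * (conjR p t n * conjL p t n) := by noncomm_ring
    _ = A := by rw [conjR_mul_conjL, one_mul, mul_one]

lemma lift_unlift (t : Index) (n : ℕ+) (A : Op p) : lift t n (unlift t n A) = A := by
  rw [unlift_eq, lift_eq]
  calc _ = (conjL p t n * conjR p t n) * A * (conjL p t n * conjR p t n) := by noncomm_ring
    _ = A := by rw [conjL_mul_conjR, one_mul, mul_one]

lemma norm_lift_le (t : Index) (n : ℕ+) (A : Op p) : ‖lift t n A‖ ≤ ‖A‖ := by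
  rw [lift_eq]
  refine (norm_mul_le_of_le (norm_mul_le_of_le (norm_conjL_le t n) le_rfl)
    (norm_conjR_le t n)).trans (le_of_eq ?_)
  ring

lemma norm_unlift_le (t : Index) (n : ℕ+) (A : Op p) : ‖unlift t n A‖ ≤ ‖A‖ := by
  rw [unlift_eq]
  refine (norm_mul_le_of_le (norm_mul_le_of_le (norm_conjR_le t n) le_rfl)
    (norm_conjL_le t n)).trans (le_of_eq ?_)
  ring

end Conjugation

section Compact

variable {E : Type*} [NormedAddCommGroup E] [NormedSpace ℂ E]

lemma exists_finite_net {K : E →L[ℂ] E} (hK : IsCompactOperator K) {ε : ℝ} (hε : 0 < ε) :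
    ∃ s : Set E, s.Finite ∧ ∀ u : E, ‖u‖ ≤ 1 → ∃ c ∈ s, ‖K u - c‖ ≤ ε := by
  have h := hK.isCompact_closure_image_closedBall (𝕜₁ := ℂ) 1
  obtain ⟨s, hs, hcov⟩ := Metric.totallyBounded_iff.1 h.totallyBounded ε hε
  refine ⟨s, hs, fun u hu => ?_⟩
  have := hcov (subset_closure (mem_image_of_mem K (mem_closedBall_zero_iff.2 hu)))
  simp only [mem_iUnion] at this
  obtain ⟨c, hc, hd⟩ := this
  exact ⟨c, hc, by rw [← dist_eq_norm]; exact (Metric.mem_ball.1 hd).le⟩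

lemma norm_mul_compact_tendsto {K : E →L[ℂ] E} (hK : IsCompactOperator K) {B : ℕ+ → E →L[ℂ] E}
    {C : ℝ} (hC : ∀ n, ‖B n‖ ≤ C) (hB : ∀ u, Tendsto (fun n => B n u) atTop (𝓝 0)) :
    Tendsto (fun n => ‖B n * K‖) atTop (𝓝 0) := by
  have hC0 : 0 ≤ C := (norm_nonneg _).trans (hC 1)
  refine null_of_eventually_le (fun _ => norm_nonneg _) fun ε hε => ?_
  obtain ⟨s, hs, hnet⟩ := exists_finite_net hK (show 0 < ε / (2 * (C + 1)) by positivity)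
  have hev : ∀ᶠ n in atTop, ∀ c ∈ s, ‖B n c‖ ≤ ε / 2 :=
    (hs.eventually_all).2 fun c _ =>
      eventually_le_of_null (tendsto_zero_iff_norm_tendsto_zero.1 (hB c)) (half_pos hε)
  filter_upwards [hev] with n hn
  refine ContinuousLinearMap.opNorm_le_of_unit_norm hε.le fun u hu => ?_
  obtain ⟨c, hc, hd⟩ := hnet u hu.le
  have e : (B n * K) u = B n (K u - c) + B n c := by rw [map_sub, sub_add_cancel]; rfl
  rw [e]
  refine (norm_add_le_of_le ((B n).le_of_opNorm_le_of_le (hC n) hd) (hn c hc)).trans ?_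
  have : C * (ε / (2 * (C + 1))) ≤ ε / 2 := by
    rw [mul_div_assoc', div_le_div_iff₀ (by positivity) (by positivity)]; nlinarith
  linarith

lemma norm_compact_mul_tendsto {K : E →L[ℂ] E} (hK : IsCompactOperator K) {B : ℕ+ → E →L[ℂ] E}
    {C : ℝ} (hC : ∀ n, ‖B n‖ ≤ C)
    (hB : ∀ φ : E →L[ℂ] ℂ, Tendsto (fun n => ‖φ.comp (B n)‖) atTop (𝓝 0)) :
    Tendsto (fun n => ‖K * B n‖) atTop (𝓝 0) := by
  have hC0 : 0 ≤ C := (norm_nonneg _).trans (hC 1)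
  refine null_of_eventually_le (fun _ => norm_nonneg _) fun ε hε => ?_
  set η := ε / (4 * (C + 1))
  have hη : 0 < η := by positivity
  obtain ⟨s, hs, hnet⟩ := exists_finite_net hK hη
  choose ψ hψ hψ' using fun c : E => exists_dual_vector'' ℂ c
  have hev : ∀ᶠ n in atTop, ∀ c ∈ s, ‖((ψ c).comp K).comp (B n)‖ ≤ ε / 2 :=
    (hs.eventually_all).2 fun c _ => eventually_le_of_null (hB _) (half_pos hε)
  filter_upwards [hev] with n hn
  refine ContinuousLinearMap.opNorm_le_of_unit_norm hε.le fun u hu => ?_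
  have hKv : ∀ v : E, ‖v‖ ≤ 1 → ∃ c ∈ s, ‖K v‖ ≤ ‖ψ c (K v)‖ + 2 * η := fun v hv => by
    obtain ⟨c, hc, hd⟩ := hnet v hv
    refine ⟨c, hc, ?_⟩
    have h1 : ‖c‖ = ‖ψ c c‖ := by rw [hψ' c]; simp
    have h2 : ‖ψ c (K v - c)‖ ≤ 1 * η := (ψ c).le_of_opNorm_le_of_le (hψ c) hd
    have h3 : ‖ψ c c‖ ≤ ‖ψ c (K v)‖ + ‖ψ c (K v - c)‖ := by
      have : ψ c c = ψ c (K v) - ψ c (K v - c) := by rw [← map_sub, sub_sub_cancel]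
      rw [this]; exact norm_sub_le _ _
    have h4 : ‖K v‖ ≤ ‖K v - c‖ + ‖c‖ := by
      conv_lhs => rw [← sub_add_cancel (K v) c]
      exact norm_add_le _ _
    linarith
  set r : ℝ := C + 1
  have hr : 0 < r := by positivity
  set v := ((r⁻¹ : ℝ) : ℂ) • B n u
  have hrn : ‖((r⁻¹ : ℝ) : ℂ)‖ = r⁻¹ := by
    rw [Complex.norm_real, Real.norm_of_nonneg (inv_pos.2 hr).le]
  have hv : ‖v‖ ≤ 1 := by
    rw [norm_smul, hrn, inv_mul_le_iff₀ hr, mul_one]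
    have := (B n).le_of_opNorm_le_of_le (hC n) hu.le
    linarith
  obtain ⟨c, hc, hcv⟩ := hKv v hv
  have e1 : ‖K v‖ = r⁻¹ * ‖(K * B n) u‖ := by rw [map_smul, norm_smul, hrn]; rfl
  have e2 : ‖ψ c (K v)‖ ≤ r⁻¹ * (ε / 2) := by
    rw [map_smul, map_smul, norm_smul, hrn]
    refine mul_le_mul_of_nonneg_left ?_ (inv_pos.2 hr).le
    have := (((ψ c).comp K).comp (B n)).le_of_opNorm_le_of_le (hn c hc) hu.le
    rwa [mul_one] at this
  rw [e1] at hcv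
  have e3 : r * (2 * η) = ε / 2 := by simp only [η, r]; field_simp; norm_num
  have e4 := mul_le_mul_of_nonneg_left (hcv.trans (add_le_add_left e2 _)) hr.le
  rw [mul_add, e3, ← mul_assoc, ← mul_assoc, mul_inv_cancel₀ hr.ne'] at e4
  linarith

end Compact

section Snapshots

variable {p : ℝ≥0∞} [Fact (1 ≤ p)]

/-- `B n → S` in the sense attached to the index `t`. -/
def IndexLimit (t : Index) (B : ℕ+ → Op p) (S : Op p) : Prop :=
  match t with
  | .inl _ => PStrongLimit B S
  | .inr _ => StarStrongLimit B S

lemma isSnapshot_iff {h : ℕ+ → ℕ+} {A : BddSeq p} {S : Op p} {t : Index} :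
    IsSnapshot h A S t ↔ IndexLimit t (fun n => unlift t (h n) (A n)) S := by
  cases t <;> rfl

lemma PStrongLimit.proj_left {B : ℕ+ → Op p} {S : Op p} (hB : PStrongLimit B S) {K : Op p}
    (hK : K ∈ pCompact p) : Tendsto (fun n => ‖K * (B n - S)‖) atTop (𝓝 0) :=
  squeeze_zero (fun _ => norm_nonneg _) (fun _ => le_add_of_nonneg_right (norm_nonneg _))
    (hB.2 K hK)

lemma PStrongLimit.proj_right {B : ℕ+ → Op p} {S : Op p} (hB : PStrongLimit B S) {K : Op p}
    (hK : K ∈ pCompact p) : Tendsto (fun n => ‖(B n - S) * K‖) atTop (𝓝 0) :=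
  squeeze_zero (fun _ => norm_nonneg _) (fun _ => le_add_of_nonneg_left (norm_nonneg _)) (hB.2 K hK)

lemma pStrongLimit_iff {B : ℕ+ → Op p} {S : Op p} : PStrongLimit B S ↔ S ∈ pBounded p ∧
    ∀ K ∈ pCompact p, Tendsto (fun n => ‖K * (B n - S)‖) atTop (𝓝 0) ∧
      Tendsto (fun n => ‖(B n - S) * K‖) atTop (𝓝 0) :=
  ⟨fun h => ⟨h.1, fun _ hK => ⟨h.proj_left hK, h.proj_right hK⟩⟩,
    fun h => ⟨h.1, fun K hK => by simpa using (h.2 K hK).1.add (h.2 K hK).2⟩⟩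

lemma starStrongLimit_iff {B : ℕ+ → Op p} {S : Op p} : StarStrongLimit B S ↔
    (∀ u, Tendsto (fun n => (B n - S) u) atTop (𝓝 0)) ∧
      ∀ φ : X p →L[ℂ] ℂ, Tendsto (fun n => ‖φ.comp (B n - S)‖) atTop (𝓝 0) := by
  refine and_congr (forall_congr' fun u => ?_) (forall_congr' fun φ => ?_)
  · exact tendsto_sub_nhds_zero_iff.symm
  · rw [tendsto_iff_norm_sub_tendsto_zero]
    simp_rw [ContinuousLinearMap.comp_sub]

lemma PStrongLimit.star (hp : 1 < p) (hp' : p ≠ ⊤) {B : ℕ+ → Op p} {S : Op p} {C : ℝ}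
    (hC : ∀ n, ‖B n - S‖ ≤ C) (h : PStrongLimit B S) : StarStrongLimit B S := by
  have hC0 : 0 ≤ C := (norm_nonneg _).trans (hC 1)
  rw [starStrongLimit_iff]
  refine ⟨fun u => ?_, fun φ => ?_⟩
  · rw [tendsto_zero_iff_norm_tendsto_zero]
    refine null_of_eventually_le (fun _ => norm_nonneg _) fun ε hε => ?_
    obtain ⟨m, hm⟩ := (eventually_le_of_null (tendsto_zero_iff_norm_tendsto_zero.1
      (one_sub_proj_tendsto hp' u)) (show 0 < ε / (2 * (C + 1)) by positivity)).exists
    filter_upwards [eventually_le_of_null (h.proj_right (proj_mem_pCompact m))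
      (show 0 < ε / (2 * (‖u‖ + 1)) by positivity)] with n hn
    have e : (B n - S) u = ((B n - S) * proj p m) u + (B n - S) ((1 - proj p m) u) := by
      rw [mul_apply_eq_comp, ← map_add]
      simp
    rw [e]
    refine (norm_add_le_of_le (ContinuousLinearMap.le_of_opNorm_le _ hn u)
      (ContinuousLinearMap.le_of_opNorm_le_of_le _ (hC n) hm)).trans ?_
    have h1 : ε / (2 * (‖u‖ + 1)) * ‖u‖ ≤ ε / 2 := by
      rw [div_mul_eq_mul_div, div_le_div_iff₀ (by positivity) (by positivity)]
      nlinarith [norm_nonneg u]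
    have h2 : C * (ε / (2 * (C + 1))) ≤ ε / 2 := by
      rw [mul_div_assoc', div_le_div_iff₀ (by positivity) (by positivity)]; nlinarith
    linarith
  · refine null_of_eventually_le (fun _ => norm_nonneg _) fun ε hε => ?_
    obtain ⟨m, hm⟩ := (eventually_le_of_null
      (functional_one_sub_proj_tendsto hp hp' φ)
      (show 0 < ε / (2 * (C + 1)) by positivity)).exists
    filter_upwards [eventually_le_of_null (h.proj_left (proj_mem_pCompact m))
      (show 0 < ε / (2 * (‖φ‖ + 1)) by positivity)] with n hn
    have e : φ.comp (B n - S) = φ.comp (proj p m * (B n - S)) +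
        (φ.comp (1 - proj p m)).comp (B n - S) := by
      ext u
      simp
      abel
    rw [e]
    refine (norm_add_le_of_le ((φ.opNorm_comp_le _).trans (mul_le_mul_of_nonneg_left hn
      (norm_nonneg φ))) ((ContinuousLinearMap.opNorm_comp_le _ _).trans
      (mul_le_mul hm (hC n) (norm_nonneg _) (by positivity)))).trans ?_
    have h1 : ‖φ‖ * (ε / (2 * (‖φ‖ + 1))) ≤ ε / 2 := by
      rw [mul_div_assoc', div_le_div_iff₀ (by positivity) (by positivity)]
      nlinarith [norm_nonneg φ]
    have h2 : ε / (2 * (C + 1)) * C ≤ ε / 2 := by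
      rw [div_mul_eq_mul_div, div_le_div_iff₀ (by positivity) (by positivity)]; nlinarith
    linarith

lemma IndexLimit.star (hp : 1 < p) (hp' : p ≠ ⊤) {t : Index} {B : ℕ+ → Op p} {S : Op p} {C : ℝ}
    (hC : ∀ n, ‖B n - S‖ ≤ C) (h : IndexLimit t B S) : StarStrongLimit B S := by
  cases t with
  | inl t => exact PStrongLimit.star hp hp' hC h
  | inr t => exact h

lemma norm_sub_le_const {B : ℕ+ → Op p} {C : ℝ} (hC : ∀ n, ‖B n‖ ≤ C) (S : Op p) (n : ℕ+) :
    ‖B n - S‖ ≤ C + ‖S‖ := (norm_sub_le _ _).trans (add_le_add_left (hC n) _)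

lemma IndexLimit.norm_le (hp : 1 < p) (hp' : p ≠ ⊤) {t : Index} {B : ℕ+ → Op p} {S : Op p}
    {C : ℝ} (hC : ∀ n, ‖B n‖ ≤ C) (h : IndexLimit t B S) : ‖S‖ ≤ C := by
  have hs := h.star hp hp' (norm_sub_le_const hC S)
  refine ContinuousLinearMap.opNorm_le_bound _ ((norm_nonneg _).trans (hC 1)) fun u => ?_
  exact le_of_tendsto (hs.1 u).norm (.of_forall fun n => (B n).le_of_opNorm_le (hC n) u)

lemma IndexLimit.add {t : Index} {A B : ℕ+ → Op p} {S R : Op p} (hA : IndexLimit t A S)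
    (hB : IndexLimit t B R) : IndexLimit t (fun n => A n + B n) (S + R) := by
  cases t with
  | inl t =>
    rw [IndexLimit, pStrongLimit_iff] at *
    refine ⟨add_mem_pBounded hA.1 hB.1, fun K hK => ⟨?_, ?_⟩⟩
    · refine squeeze_zero (fun _ => norm_nonneg _) (fun n => ?_)
        (by simpa using (hA.2 K hK).1.add (hB.2 K hK).1)
      rw [add_sub_add_comm, mul_add]
      exact norm_add_le _ _
    · refine squeeze_zero (fun _ => norm_nonneg _) (fun n => ?_)
        (by simpa using (hA.2 K hK).2.add (hB.2 K hK).2)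
      rw [add_sub_add_comm, add_mul]
      exact norm_add_le _ _
  | inr t =>
    refine ⟨fun u => by simpa using (hA.1 u).add (hB.1 u), fun φ => ?_⟩
    have := (hA.2 φ).add (hB.2 φ)
    simpa only [ContinuousLinearMap.comp_add] using this

lemma indexLimit_smul_one (t : Index) (c : ℂ) :
    IndexLimit t (fun _ => c • (1 : Op p)) (c • 1) := by
  cases t with
  | inl t => exact ⟨smul_one_mem_pBounded c, fun K hK => by simp⟩
  | inr t => exact ⟨fun u => tendsto_const_nhds, fun φ => tendsto_const_nhds⟩

lemma IndexLimit.mul {t : Index} {A B : ℕ+ → Op p} {S R : Op p} {C D : ℝ}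
    (hC : ∀ n, ‖A n‖ ≤ C) (hD : ∀ n, ‖B n‖ ≤ D)
    (hA : IndexLimit t A S) (hB : IndexLimit t B R) :
    IndexLimit t (fun n => A n * B n) (S * R) := by
  have hC0 : 0 ≤ C := (norm_nonneg _).trans (hC 1)
  have hD0 : 0 ≤ D := (norm_nonneg _).trans (hD 1)
  cases t with
  | inl t =>
    rw [IndexLimit, pStrongLimit_iff] at *
    refine ⟨mul_mem_pBounded hA.1 hB.1, fun K hK => ⟨?_, ?_⟩⟩
    · refine squeeze_zero (fun _ => norm_nonneg _) (fun n => ?_)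
        (by simpa using ((hA.2 K hK).1.mul_const D).add (hB.2 _ (hA.1 K hK).2).1)
      have e : K * (A n * B n - S * R) = K * (A n - S) * B n + K * S * (B n - R) := by noncomm_ring
      rw [e]
      exact norm_add_le_of_le (norm_mul_le_of_le le_rfl (hD n)) le_rfl
    · refine squeeze_zero (fun _ => norm_nonneg _) (fun n => ?_)
        (by simpa using ((hB.2 K hK).2.const_mul C).add (hA.2 _ (hB.1 K hK).1).2)
      have e : (A n * B n - S * R) * K = A n * ((B n - R) * K) + (A n - S) * (R * K) := by
        noncomm_ring
      rw [e]
      exact norm_add_le_of_le (norm_mul_le_of_le (hC n) le_rfl) le_rfl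
  | inr t =>
    rw [IndexLimit, starStrongLimit_iff] at *
    refine ⟨fun u => ?_, fun φ => ?_⟩
    · rw [tendsto_zero_iff_norm_tendsto_zero]
      refine squeeze_zero (fun _ => norm_nonneg _) (fun n => ?_)
        (by simpa using ((hB.1 u).norm.const_mul C).add (hA.1 (R u)).norm)
      have e : (A n * B n - S * R) u = A n ((B n - R) u) + (A n - S) (R u) := by simp
      rw [e]
      exact norm_add_le_of_le ((A n).le_of_opNorm_le (hC n) _) le_rfl
    · refine squeeze_zero (fun _ => norm_nonneg _) (fun n => ?_)
        (by simpa only [zero_mul, zero_add] using ((hA.2 φ).mul_const D).add (hB.2 (φ.comp S)))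
      have e : φ.comp (A n * B n - S * R) = (φ.comp (A n - S)).comp (B n) +
        (φ.comp S).comp (B n - R) := by ext u; simp
      rw [e]
      exact norm_add_le_of_le ((ContinuousLinearMap.opNorm_comp_le _ _).trans
        (mul_le_mul_of_nonneg_left (hD n) (norm_nonneg _))) le_rfl

lemma eventually_le_of_approx {f : ℕ+ → ℝ} {c : ℝ} (hc : 0 ≤ c) (h0 : ∀ n, 0 ≤ f n)
    (h : ∀ ε : ℝ, 0 < ε → ∃ g : ℕ+ → ℝ, Tendsto g atTop (𝓝 0) ∧ ∀ n, f n ≤ g n + ε * c) :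
    Tendsto f atTop (𝓝 0) := by
  refine null_of_eventually_le h0 fun ε hε => ?_
  obtain ⟨g, hg, hfg⟩ := h (ε / (2 * (c + 1))) (by positivity)
  filter_upwards [eventually_le_of_null hg (half_pos hε)] with n hn
  have : ε / (2 * (c + 1)) * c ≤ ε / 2 := by
    rw [div_mul_eq_mul_div, div_le_div_iff₀ (by positivity) (by positivity)]; nlinarith
  linarith [hfg n]

lemma indexLimit_of_approx {t : Index} {A : ℕ+ → Op p} {S : Op p}
    (h : ∀ ε : ℝ, 0 < ε → ∃ (B : ℕ+ → Op p) (R : Op p), IndexLimit t B R ∧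
      (∀ n, ‖A n - B n‖ ≤ ε) ∧ ‖S - R‖ ≤ ε) : IndexLimit t A S := by
  have hd : ∀ ε : ℝ, 0 < ε → ∃ (B : ℕ+ → Op p) (R : Op p), IndexLimit t B R ∧ ‖S - R‖ ≤ ε ∧
      ∀ n, ‖A n - S - (B n - R)‖ ≤ ε := fun ε hε => by
    obtain ⟨B, R, hB, hAB, hSR⟩ := h (ε / 2) (half_pos hε)
    refine ⟨B, R, hB, hSR.trans (by linarith), fun n => ?_⟩
    rw [sub_sub_sub_comm]
    exact (norm_sub_le_of_le (hAB n) hSR).trans (by linarith)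
  cases t with
  | inl t =>
    rw [IndexLimit, pStrongLimit_iff]
    refine ⟨pBounded_of_approx fun ε hε => ?_, fun K hK => ⟨?_, ?_⟩⟩
    · obtain ⟨B, R, hB, hSR, -⟩ := hd ε hε
      exact ⟨R, hB.1, hSR⟩
    · refine eventually_le_of_approx (norm_nonneg K) (fun _ => norm_nonneg _) fun ε hε => ?_
      obtain ⟨B, R, hB, -, hd⟩ := hd ε hε
      refine ⟨_, PStrongLimit.proj_left hB hK, fun n => ?_⟩
      have e : K * (A n - S) = K * (B n - R) + K * (A n - S - (B n - R)) := by noncomm_ring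
      rw [e, mul_comm ε]
      exact norm_add_le_of_le le_rfl (norm_mul_le_of_le le_rfl (hd n))
    · refine eventually_le_of_approx (norm_nonneg K) (fun _ => norm_nonneg _) fun ε hε => ?_
      obtain ⟨B, R, hB, -, hd⟩ := hd ε hε
      refine ⟨_, PStrongLimit.proj_right hB hK, fun n => ?_⟩
      have e : (A n - S) * K = (B n - R) * K + (A n - S - (B n - R)) * K := by noncomm_ring
      rw [e]
      exact norm_add_le_of_le le_rfl (norm_mul_le_of_le (hd n) le_rfl)
  | inr t =>
    rw [IndexLimit, starStrongLimit_iff]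
    refine ⟨fun u => ?_, fun φ => ?_⟩
    · rw [tendsto_zero_iff_norm_tendsto_zero]
      refine eventually_le_of_approx (norm_nonneg u) (fun _ => norm_nonneg _) fun ε hε => ?_
      obtain ⟨B, R, hB, -, hd⟩ := hd ε hε
      refine ⟨_, by simpa using ((starStrongLimit_iff.1 hB).1 u).norm, fun n => ?_⟩
      have e : (A n - S) u = (B n - R) u + (A n - S - (B n - R)) u := by
        rw [← add_apply, add_sub_cancel]
      rw [e]
      exact norm_add_le_of_le le_rfl (ContinuousLinearMap.le_of_opNorm_le _ (hd n) u)
    · refine eventually_le_of_approx (norm_nonneg φ) (fun _ => norm_nonneg _) fun ε hε => ?_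
      obtain ⟨B, R, hB, -, hd⟩ := hd ε hε
      refine ⟨_, (starStrongLimit_iff.1 hB).2 φ, fun n => ?_⟩
      have e : φ.comp (A n - S) = φ.comp (B n - R) + φ.comp (A n - S - (B n - R)) := by
        rw [← ContinuousLinearMap.comp_add, add_sub_cancel]
      rw [e, mul_comm ε]
      exact norm_add_le_of_le le_rfl ((ContinuousLinearMap.opNorm_comp_le _ _).trans
        (mul_le_mul_of_nonneg_left (hd n) (norm_nonneg _)))

lemma IndexLimit.smul {t : Index} {A : ℕ+ → Op p} {S : Op p} (c : ℂ) (hA : IndexLimit t A S) :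
    IndexLimit t (fun n => c • A n) (c • S) := by
  cases t with
  | inl t =>
    rw [IndexLimit, pStrongLimit_iff] at *
    refine ⟨?_, fun K hK => ⟨?_, ?_⟩⟩
    · rw [← one_mul S, ← smul_mul_assoc]
      exact mul_mem_pBounded (smul_one_mem_pBounded c) hA.1
    · simp_rw [← smul_sub, mul_smul_comm, norm_smul]
      simpa using (hA.2 K hK).1.const_mul ‖c‖
    · simp_rw [← smul_sub, smul_mul_assoc, norm_smul]
      simpa using (hA.2 K hK).2.const_mul ‖c‖
  | inr t =>
    refine ⟨fun u => (hA.1 u).const_smul c, fun φ => ?_⟩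
    have := (hA.2 φ).const_smul c
    simpa only [ContinuousLinearMap.comp_smul] using this

lemma IndexLimit.sub {t : Index} {A B : ℕ+ → Op p} {S R : Op p} (hA : IndexLimit t A S)
    (hB : IndexLimit t B R) : IndexLimit t (fun n => A n - B n) (S - R) := by
  have := hA.add (hB.smul (-1))
  simpa only [neg_smul, one_smul, ← sub_eq_add_neg] using this

/-- Uniform limits of convergent sequences converge. -/
lemma exists_indexLimit_of_approx (hp : 1 < p) (hp' : p ≠ ⊤) {t : Index} {A : ℕ+ → Op p}
    (h : ∀ ε : ℝ, 0 < ε → ∃ (B : ℕ+ → Op p) (R : Op p), IndexLimit t B R ∧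
      ∀ n, ‖A n - B n‖ ≤ ε) : ∃ S, IndexLimit t A S := by
  have hpos : ∀ k : ℕ, (0 : ℝ) < 1 / ((k : ℝ) + 1) := fun k => Nat.one_div_pos_of_nat
  choose B R hB hAB using fun k : ℕ => h (1 / ((k : ℝ) + 1)) (hpos k)
  have hRR : ∀ k l, ‖R k - R l‖ ≤ 1 / ((k : ℝ) + 1) + 1 / ((l : ℝ) + 1) := fun k l => by
    refine ((hB k).sub (hB l)).norm_le hp hp' fun n => ?_
    have e : B k n - B l n = (A n - B l n) - (A n - B k n) := by abel
    rw [e, add_comm]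
    exact norm_sub_le_of_le (hAB l n) (hAB k n)
  have hmono : ∀ {N k : ℕ}, N ≤ k → 1 / ((k : ℝ) + 1) ≤ 1 / ((N : ℝ) + 1) := fun h =>
    Nat.one_div_le_one_div h
  have hcau : CauchySeq R := by
    refine cauchySeq_of_le_tendsto_0 (fun N : ℕ => 1 / ((N : ℝ) + 1) + 1 / ((N : ℝ) + 1))
      (fun k l N hk hl => ?_) ?_
    · rw [dist_eq_norm]
      exact (hRR k l).trans (add_le_add (hmono hk) (hmono hl))
    · simpa using (tendsto_one_div_add_atTop_nhds_zero_nat (𝕜 := ℝ)).add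
        (tendsto_one_div_add_atTop_nhds_zero_nat (𝕜 := ℝ))
  obtain ⟨S, hS⟩ := cauchySeq_tendsto_of_complete hcau
  refine ⟨S, indexLimit_of_approx fun ε hε => ?_⟩
  have h1 := eventually_le_of_null (tendsto_iff_norm_sub_tendsto_zero.1 hS) hε
  have h2 := eventually_le_of_null (tendsto_one_div_add_atTop_nhds_zero_nat (𝕜 := ℝ)) hε
  obtain ⟨k, hk1, hk2⟩ := (h1.and h2).exists
  exact ⟨B k, R k, hB k, fun n => (hAB k n).trans hk2, by rwa [norm_sub_rev]⟩

lemma IndexLimit.of_eventually {t : Index} {B B' : ℕ+ → Op p} {S : Op p} {m : ℕ+ → ℕ+}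
    (hm : Tendsto m atTop atTop) (he : ∀ᶠ n in atTop, B' n = B (m n)) (h : IndexLimit t B S) :
    IndexLimit t B' S := by
  cases t with
  | inl t =>
    refine ⟨h.1, fun K hK => ((h.2 K hK).comp hm).congr' ?_⟩
    filter_upwards [he] with n hn
    simp only [Function.comp_apply, hn]
  | inr t =>
    refine ⟨fun u => ((h.1 u).comp hm).congr' ?_, fun φ => ((h.2 φ).comp hm).congr' ?_⟩ <;>
    · filter_upwards [he] with n hn
      simp only [Function.comp_apply, hn]

lemma exists_inverse_of_bddBelow {S : Op p} {C : ℝ} (hC : 0 ≤ C)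
    (h1 : ∀ u, ‖u‖ ≤ C * ‖S u‖) (h2 : ∀ φ : X p →L[ℂ] ℂ, ‖φ‖ ≤ C * ‖φ.comp S‖) :
    ∃ G : Op p, S * G = 1 ∧ G * S = 1 := by
  have hanti : AntilipschitzWith C.toNNReal S := by
    refine ContinuousLinearMap.antilipschitz_of_bound S fun u => ?_
    rw [Real.coe_toNNReal _ hC]
    exact h1 u
  have hker : LinearMap.ker (S : X p →ₗ[ℂ] X p) = ⊥ := LinearMap.ker_eq_bot.2 hanti.injective
  have hclosed : IsClosed (LinearMap.range (S : X p →ₗ[ℂ] X p) : Set (X p)) := by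
    rw [LinearMap.coe_range]
    exact hanti.isClosed_range S.uniformContinuous
  have := hclosed
  have hrange : LinearMap.range (S : X p →ₗ[ℂ] X p) = ⊤ := by
    by_contra hne
    obtain ⟨v, hv⟩ : ∃ v, v ∉ LinearMap.range (S : X p →ₗ[ℂ] X p) := by
      by_contra hcon
      push Not at hcon
      exact hne (Submodule.eq_top_iff'.2 hcon)
    obtain ⟨φ, hφ, hφv⟩ : ∃ φ : X p →L[ℂ] ℂ, φ v ≠ 0 ∧
        ∀ w ∈ LinearMap.range (S : X p →ₗ[ℂ] X p), φ w = 0 := by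
      obtain ⟨f, hf⟩ := SeparatingDual.exists_ne_zero (R := ℂ)
        (x := (LinearMap.range (S : X p →ₗ[ℂ] X p)).mkQ v)
        (by rwa [Ne, Submodule.mkQ_apply, Submodule.Quotient.mk_eq_zero])
      refine ⟨f.comp (LinearMap.range (S : X p →ₗ[ℂ] X p)).mkQL, hf, fun w hw => ?_⟩
      have : (LinearMap.range (S : X p →ₗ[ℂ] X p)).mkQ w = 0 := by
        rwa [Submodule.mkQ_apply, Submodule.Quotient.mk_eq_zero]
      exact (congrArg f this).trans (map_zero f)
    have hz : φ.comp S = 0 := by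
      ext u
      exact hφv _ ⟨u, rfl⟩
    have := h2 φ
    rw [hz, norm_zero, mul_zero] at this
    rw [norm_le_zero_iff.1 this] at hφ
    exact hφ rfl
  set e := ContinuousLinearEquiv.ofBijective S hker hrange
  have he : ∀ u, e u = S u := fun u => rfl
  refine ⟨e.symm, ?_, ?_⟩
  · ext1 u
    exact e.apply_symm_apply u
  · ext1 u
    exact e.symm_apply_apply u

lemma exists_indexLimit_inverse (hp : 1 < p) (hp' : p ≠ ⊤) {t : Index} {R B : ℕ+ → Op p}
    {S : Op p} {C D : ℝ} (hC : ∀ n, ‖R n‖ ≤ C) (hD : ∀ n, ‖B n‖ ≤ D) (hR : IndexLimit t R S)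
    (h1 : IndexLimit t (fun n => R n * B n - 1) 0) (h2 : IndexLimit t (fun n => B n * R n - 1) 0) :
    ∃ G, IndexLimit t B G := by
  have hC0 : 0 ≤ C := (norm_nonneg _).trans (hC 1)
  have hD0 : 0 ≤ D := (norm_nonneg _).trans (hD 1)
  have hb1 : ∀ n, ‖R n * B n - 1 - 0‖ ≤ C * D + 1 := fun n => by
    rw [sub_zero]; exact norm_sub_le_of_le (norm_mul_le_of_le (hC n) (hD n)) norm_one_le
  have hb2 : ∀ n, ‖B n * R n - 1 - 0‖ ≤ D * C + 1 := fun n => by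
    rw [sub_zero]; exact norm_sub_le_of_le (norm_mul_le_of_le (hD n) (hC n)) norm_one_le
  have s0 := starStrongLimit_iff.1 (hR.star hp hp' (norm_sub_le_const hC S))
  have s1 := starStrongLimit_iff.1 (h1.star hp hp' hb1)
  have s2 := starStrongLimit_iff.1 (h2.star hp hp' hb2)
  simp only [sub_zero] at s1 s2
  obtain ⟨G, hSG, hGS⟩ : ∃ G : Op p, S * G = 1 ∧ G * S = 1 := by
    refine exists_inverse_of_bddBelow hD0 (fun u => ?_) (fun φ => ?_)
    · have hl : Tendsto (fun n => D * ‖S u‖ + D * ‖(R n - S) u‖ + ‖(B n * R n - 1) u‖) atTop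
          (𝓝 (D * ‖S u‖)) := by
        simpa using ((((s0.1 u).norm).const_mul D).const_add (D * ‖S u‖)).add (s2.1 u).norm
      refine ge_of_tendsto' hl fun n => ?_
      have e : u = B n (S u) + B n ((R n - S) u) - (B n * R n - 1) u := by simp
      conv_lhs => rw [e]
      exact norm_sub_le_of_le (norm_add_le_of_le ((B n).le_of_opNorm_le (hD n) _)
        ((B n).le_of_opNorm_le (hD n) _)) le_rfl
    · have hl : Tendsto (fun n => D * ‖φ.comp S‖ + D * ‖φ.comp (R n - S)‖ +
          ‖φ.comp (R n * B n - 1)‖) atTop (𝓝 (D * ‖φ.comp S‖)) := by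
        simpa only [mul_zero, add_zero] using
          (((s0.2 φ).const_mul D).const_add (D * ‖φ.comp S‖)).add (s1.2 φ)
      refine ge_of_tendsto' hl fun n => ?_
      have e : φ = (φ.comp S).comp (B n) + (φ.comp (R n - S)).comp (B n) -
          φ.comp (R n * B n - 1) := by
        ext u
        simp
      conv_lhs => rw [e]
      have hc : ∀ ψ : X p →L[ℂ] ℂ, ‖ψ.comp (B n)‖ ≤ D * ‖ψ‖ := fun ψ =>
        (ContinuousLinearMap.opNorm_comp_le _ _).trans (by
          rw [mul_comm]; exact mul_le_mul_of_nonneg_right (hD n) (norm_nonneg _))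
      exact norm_sub_le_of_le (norm_add_le_of_le (hc _) (hc _)) le_rfl
  refine ⟨G, ?_⟩
  cases t with
  | inl t =>
    have hG : G ∈ pBounded p := regulariser_mem_pBounded hp' hR.1
      (by rw [hSG, sub_self]; exact zero_mem_pCompact)
      (by rw [hGS, sub_self]; exact zero_mem_pCompact)
    rw [IndexLimit, pStrongLimit_iff]
    refine ⟨hG, fun K hK => ⟨?_, ?_⟩⟩
    · have hKG := (hG K hK).2
      have l1 := PStrongLimit.proj_left hR hKG
      have l2 := PStrongLimit.proj_left h1 hKG
      refine squeeze_zero (fun _ => norm_nonneg _) (fun n => ?_)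
        (by simpa only [mul_zero, add_zero, zero_mul] using (l1.mul_const D).add l2)
      have e : K * (B n - G) = K * G * (R n * B n - 1 - 0) - K * G * (R n - S) * B n := by
        have : K * (B n - G) = K * (G * S) * B n - K * G := by rw [hGS]; noncomm_ring
        rw [this]; noncomm_ring
      rw [e, add_comm]
      exact norm_sub_le_of_le le_rfl (norm_mul_le_of_le le_rfl (hD n))
    · have hKG := (hG K hK).1
      have l1 := PStrongLimit.proj_right hR hKG
      have l2 := PStrongLimit.proj_right h2 hKG
      refine squeeze_zero (fun _ => norm_nonneg _) (fun n => ?_)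
        (by simpa only [mul_zero, add_zero, zero_mul] using (l1.const_mul D).add l2)
      have e : (B n - G) * K = (B n * R n - 1 - 0) * (G * K) - B n * ((R n - S) * (G * K)) := by
        have : (B n - G) * K = B n * (S * G) * K - G * K := by rw [hSG]; noncomm_ring
        rw [this]; noncomm_ring
      rw [e, add_comm]
      exact norm_sub_le_of_le le_rfl (norm_mul_le_of_le (hD n) le_rfl)
  | inr t =>
    rw [IndexLimit, starStrongLimit_iff]
    refine ⟨fun u => ?_, fun φ => ?_⟩
    · rw [tendsto_zero_iff_norm_tendsto_zero]
      refine squeeze_zero (fun _ => norm_nonneg _) (fun n => ?_)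
        (by simpa using (((s0.1 (G u)).norm).const_mul D).add (s2.1 (G u)).norm)
      have e : (B n - G) u = (B n * R n - 1) (G u) - B n ((R n - S) (G u)) := by
        have : (B n - G) u = B n ((S * G) u) - G u := by rw [hSG]; simp
        rw [this]; simp
      rw [e, add_comm]
      exact norm_sub_le_of_le le_rfl ((B n).le_of_opNorm_le (hD n) _)
    · refine squeeze_zero (fun _ => norm_nonneg _) (fun n => ?_)
        (by simpa only [mul_zero, add_zero, zero_mul] using
          ((s0.2 (φ.comp G)).mul_const D).add (s1.2 (φ.comp G)))
      have e : φ.comp (B n - G) = (φ.comp G).comp (R n * B n - 1) -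
          ((φ.comp G).comp (R n - S)).comp (B n) := by
        have : φ.comp (B n - G) = φ.comp ((G * S) * B n - G) := by rw [hGS, one_mul]
        rw [this]
        ext u
        simp
      rw [e, add_comm]
      exact norm_sub_le_of_le le_rfl ((ContinuousLinearMap.opNorm_comp_le _ _).trans
        (mul_le_mul_of_nonneg_left (hD n) (norm_nonneg _)))

end Snapshots

section Shortcuts

variable (p : ℝ≥0∞) [Fact (1 ≤ p)]

instance : NormedAddCommGroup (Op p) := inferInstance
instance : SeminormedAddCommGroup (Op p) := inferInstance
instance : NormedRing (Op p) := inferInstance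
instance : SeminormedRing (Op p) := inferInstance
instance : NonUnitalSeminormedRing (Op p) := inferInstance
instance : Ring (Op p) := inferInstance
instance : Semiring (Op p) := inferInstance
instance : NonUnitalNonAssocSemiring (Op p) := inferInstance
instance : AddCommGroup (Op p) := inferInstance
instance : AddCommMonoid (Op p) := inferInstance
instance : AddMonoid (Op p) := inferInstance
instance : AddGroup (Op p) := inferInstance
instance : PseudoMetricSpace (Op p) := inferInstance
instance : MetricSpace (Op p) := inferInstance
instance : TopologicalSpace (Op p) := inferInstance
instance : Module ℂ (Op p) := inferInstance
instance : Algebra ℂ (Op p) := inferInstance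
instance : Sub (Op p) := inferInstance
instance : Add (Op p) := inferInstance
instance : Mul (Op p) := inferInstance
instance : Norm (Op p) := inferInstance
instance : SeminormedAddCommGroup (BddSeq p) := inferInstance
instance : NormedRing (BddSeq p) := inferInstance
instance : SeminormedRing (BddSeq p) := inferInstance
instance : NonUnitalSeminormedRing (BddSeq p) := inferInstance
instance : Ring (BddSeq p) := inferInstance
instance : Semiring (BddSeq p) := inferInstance
instance : NonUnitalNonAssocSemiring (BddSeq p) := inferInstance
instance : AddCommGroup (BddSeq p) := inferInstance
instance : AddCommMonoid (BddSeq p) := inferInstance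
instance : AddMonoid (BddSeq p) := inferInstance
instance : AddGroup (BddSeq p) := inferInstance
instance : PseudoMetricSpace (BddSeq p) := inferInstance
instance : MetricSpace (BddSeq p) := inferInstance
instance : TopologicalSpace (BddSeq p) := inferInstance
instance : Module ℂ (BddSeq p) := inferInstance
instance : Algebra ℂ (BddSeq p) := inferInstance
instance : Sub (BddSeq p) := inferInstance
instance : Add (BddSeq p) := inferInstance
instance : Mul (BddSeq p) := inferInstance
instance : Norm (BddSeq p) := inferInstance

end Shortcuts

section Structured

variable {p : ℝ≥0∞} [Fact (1 ≤ p)] {h : ℕ+ → ℕ+}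

lemma bddSeq_mul_apply (A B : BddSeq p) (n : ℕ+) : (A * B) n = A n * B n := rfl

lemma bddSeq_add_apply (A B : BddSeq p) (n : ℕ+) : (A + B) n = A n + B n := rfl

lemma bddSeq_sub_apply (A B : BddSeq p) (n : ℕ+) : (A - B) n = A n - B n := rfl

lemma bddSeq_one_apply (n : ℕ+) : (1 : BddSeq p) n = 1 := rfl

lemma bddSeq_smul_apply (c : ℂ) (A : BddSeq p) (n : ℕ+) : (c • A) n = c • A n := rfl

lemma bddSeq_dist (A B : BddSeq p) : dist A B = ‖A - B‖ := dist_eq_norm A B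

instance : SeparatelyContinuousMul (BddSeq p) where
  continuous_const_mul := fun {a} => (continuous_mul (M := BddSeq p)).comp
      (Continuous.prodMk_right a)
  continuous_mul_const := fun {a} => (continuous_mul (M := BddSeq p)).comp
      (Continuous.prodMk_left a)

lemma mem_structured_iff {A : BddSeq p} :
    A ∈ structured p h ↔ ∀ t, ∃ S, IndexLimit t (fun n => unlift t (h n) (A n)) S :=
  forall_congr' fun _ => exists_congr fun _ => isSnapshot_iff

lemma norm_unlift_apply_le (A : BddSeq p) (t : Index) (n m : ℕ+) :
    ‖unlift t m (A n)‖ ≤ ‖A‖ := (norm_unlift_le _ _ _).trans (A.norm_coe_le_norm n)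

lemma norm_apply_sub_le (A B : BddSeq p) (n : ℕ+) : ‖A n - B n‖ ≤ ‖A - B‖ :=
  (A - B).norm_coe_le_norm n

lemma norm_le_of_forall {A : BddSeq p} {C : ℝ} (hC : ∀ n, ‖A n‖ ≤ C) : ‖A‖ ≤ C :=
  (BoundedContinuousFunction.norm_le ((norm_nonneg _).trans (hC 1))).2 hC

/-- The `T`-structured sequences along `h` as a subalgebra. -/
def structuredAlg (p : ℝ≥0∞) [Fact (1 ≤ p)] (h : ℕ+ → ℕ+) : Subalgebra ℂ (BddSeq p) where
  carrier := structured p h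
  mul_mem' := fun {A B} hA hB => mem_structured_iff.2 fun t => by
    obtain ⟨S, hS⟩ := mem_structured_iff.1 hA t
    obtain ⟨R, hR⟩ := mem_structured_iff.1 hB t
    refine ⟨S * R, ?_⟩
    have := hS.mul (fun n => norm_unlift_apply_le A t n (h n))
      (fun n => norm_unlift_apply_le B t n (h n)) hR
    simpa only [← unlift_mul, bddSeq_mul_apply] using this
  add_mem' := fun {A B} hA hB => mem_structured_iff.2 fun t => by
    obtain ⟨S, hS⟩ := mem_structured_iff.1 hA t
    obtain ⟨R, hR⟩ := mem_structured_iff.1 hB t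
    refine ⟨S + R, ?_⟩
    simpa only [← unlift_add, bddSeq_add_apply] using hS.add hR
  algebraMap_mem' := fun c => mem_structured_iff.2 fun t => ⟨c • 1, by
    have e : ∀ n, (algebraMap ℂ (BddSeq p) c) n = c • (1 : Op p) := fun n => by
      rw [Algebra.algebraMap_eq_smul_one]; rfl
    simpa only [e, unlift_smul, unlift_one] using indexLimit_smul_one t c⟩

lemma mem_structured_of_approx (hp : 1 < p) (hp' : p ≠ ⊤) {A : BddSeq p}
    (H : ∀ ε : ℝ, 0 < ε → ∃ B ∈ structured p h, ‖A - B‖ ≤ ε) : A ∈ structured p h :=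
  mem_structured_iff.2 fun t => exists_indexLimit_of_approx hp hp' fun ε hε => by
    obtain ⟨B, hB, hAB⟩ := H ε hε
    obtain ⟨R, hR⟩ := mem_structured_iff.1 hB t
    refine ⟨_, R, hR, fun n => ?_⟩
    rw [← unlift_sub]
    exact (norm_unlift_le _ _ _).trans ((norm_apply_sub_le A B n).trans hAB)

lemma isClosed_structuredAlg (hp : 1 < p) (hp' : p ≠ ⊤) :
    IsClosed (structuredAlg p h : Set (BddSeq p)) := by
  refine isClosed_of_closure_subset fun A hA => mem_structured_of_approx hp hp' fun ε hε => ?_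
  obtain ⟨B, hB, hd⟩ := Metric.mem_closure_iff.1 hA ε hε
  exact ⟨B, hB, by rw [← bddSeq_dist]; exact hd.le⟩

lemma structured_of_eventually {h' m : ℕ+ → ℕ+} {A A' : BddSeq p} (hm : Tendsto m atTop atTop)
    (he : ∀ᶠ n in atTop, h' n = h (m n) ∧ A' n = A (m n)) (hA : A ∈ structured p h) :
    A' ∈ structured p h' := mem_structured_iff.2 fun t => by
  obtain ⟨S, hS⟩ := mem_structured_iff.1 hA t
  refine ⟨S, hS.of_eventually hm ?_⟩
  filter_upwards [he] with n hn
  rw [hn.1, hn.2]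

/-- The bounded sequence with entries `B n`. -/
def ofBounded (B : ℕ+ → Op p) (C : ℝ) (hC : ∀ n, ‖B n‖ ≤ C) : BddSeq p :=
  BoundedContinuousFunction.ofNormedAddCommGroupDiscrete B C hC

@[simp]
lemma ofBounded_apply (B : ℕ+ → Op p) (C : ℝ) (hC : ∀ n, ‖B n‖ ≤ C) (n : ℕ+) :
    ofBounded B C hC n = B n := rfl

/-- The sequence `E_{h n}^t (K)`. -/
def liftSeq (t : Index) (h : ℕ+ → ℕ+) (K : Op p) : BddSeq p :=
  ofBounded (fun n => lift t (h n) K) ‖K‖ fun n => norm_lift_le _ _ _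

@[simp]
lemma liftSeq_apply (t : Index) (h : ℕ+ → ℕ+) (K : Op p) (n : ℕ+) :
    liftSeq t h K n = lift t (h n) K := rfl

lemma liftSeq_add (t : Index) (A B : Op p) :
    liftSeq t h (A + B) = liftSeq t h A + liftSeq t h B := by
  ext1 n; exact lift_add _ _ _ _

lemma liftSeq_sub (t : Index) (A B : Op p) :
    liftSeq t h (A - B) = liftSeq t h A - liftSeq t h B := by
  ext1 n; exact lift_sub _ _ _ _

lemma liftSeq_mul (t : Index) (A B : Op p) :
    liftSeq t h (A * B) = liftSeq t h A * liftSeq t h B := by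
  ext1 n; exact lift_mul _ _ _ _

lemma liftSeq_smul (t : Index) (c : ℂ) (A : Op p) : liftSeq t h (c • A) = c • liftSeq t h A := by
  ext1 n; exact lift_smul _ _ _ _

lemma liftSeq_one (t : Index) : liftSeq t h (1 : Op p) = 1 := by
  ext1 n; exact lift_one _ _

lemma norm_liftSeq_le (t : Index) (K : Op p) : ‖liftSeq t h K‖ ≤ ‖K‖ :=
  norm_le_of_forall fun n => norm_lift_le _ _ _

lemma mem_compactSeq_of_sub {A B : BddSeq p} (h1 : A - B ∈ compactSeq p h)
    (h2 : B ∈ compactSeq p h) : A ∈ compactSeq p h :=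
  have e : A - B + B = A := by ext1 n; exact sub_add_cancel (A n) (B n)
  e ▸ (compactSeq p h).add_mem h1 h2

lemma mem_compactSeq_of_null {G : BddSeq p} (hG : Tendsto (fun n => ‖G n‖) atTop (𝓝 0)) :
    G ∈ compactSeq p h :=
  Submodule.le_topologicalClosure _ (Submodule.subset_span (Or.inr hG))

lemma liftSeq_mem_compactSeq {t : Index} {K : Op p} (hK : K ∈ compactClass p t) :
    liftSeq t h K ∈ compactSeq p h :=
  Submodule.le_topologicalClosure _ (Submodule.subset_span (Or.inl ⟨t, K, hK, fun n => rfl⟩))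

lemma isClosed_compactSeq : IsClosed (compactSeq p h : Set (BddSeq p)) :=
  Submodule.isClosed_topologicalClosure _

lemma mem_compactSeq_of_approx {A : BddSeq p}
    (H : ∀ ε : ℝ, 0 < ε → ∃ B ∈ compactSeq p h, ‖A - B‖ ≤ ε) : A ∈ compactSeq p h := by
  refine isClosed_compactSeq.closure_subset (Metric.mem_closure_iff.2 fun ε hε => ?_)
  obtain ⟨B, hB, hd⟩ := H (ε / 2) (half_pos hε)
  exact ⟨B, hB, by rw [bddSeq_dist]; linarith⟩

/-- A closed subspace containing the null sequences and the lifted compact operators contains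
the whole of `𝒥`. -/
lemma compactSeq_le {M : Submodule ℂ (BddSeq p)} (hM : IsClosed (M : Set (BddSeq p)))
    (h1 : ∀ t, ∀ K ∈ compactClass p t, liftSeq t h K ∈ M)
    (h2 : ∀ G : BddSeq p, Tendsto (fun n => ‖G n‖) atTop (𝓝 0) → G ∈ M) : compactSeq p h ≤ M := by
  refine Submodule.topologicalClosure_minimal _ (Submodule.span_le.2 ?_) hM
  rintro J (⟨t, K, hK, hJ⟩ | hJ)
  · have : J = liftSeq t h K := by ext1 n; exact hJ n
    rw [this]; exact h1 t K hK
  · exact h2 J hJ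

lemma compactClass_mul {t : Index} {B : ℕ+ → Op p} {S K : Op p} {C : ℝ} (hC : ∀ n, ‖B n‖ ≤ C)
    (hB : IndexLimit t B S) (hK : K ∈ compactClass p t) :
    (S * K ∈ compactClass p t ∧ K * S ∈ compactClass p t) ∧
      Tendsto (fun n => ‖(B n - S) * K‖) atTop (𝓝 0) ∧
      Tendsto (fun n => ‖K * (B n - S)‖) atTop (𝓝 0) := by
  cases t with
  | inl d => exact ⟨hB.1 K hK, PStrongLimit.proj_right hB hK, PStrongLimit.proj_left hB hK⟩
  | inr t =>
    have hs := starStrongLimit_iff.1 hB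
    exact ⟨⟨IsCompactOperator.clm_comp hK S, IsCompactOperator.comp_clm hK S⟩,
      norm_mul_compact_tendsto hK (norm_sub_le_const hC S) hs.1,
      norm_compact_mul_tendsto hK (norm_sub_le_const hC S) hs.2⟩

lemma mul_mem_compactSeq {A X : BddSeq p} (hA : A ∈ structured p h) (hX : X ∈ compactSeq p h) :
    A * X ∈ compactSeq p h := by
  have : compactSeq p h ≤ (compactSeq p h).comap (LinearMap.mulLeft ℂ A) := by
    refine compactSeq_le (isClosed_compactSeq.preimage (continuous_const_mul A)) ?_ ?_
    · intro t K hK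
      obtain ⟨S, hS⟩ := mem_structured_iff.1 hA t
      obtain ⟨hm, hl, -⟩ := compactClass_mul (fun n => norm_unlift_apply_le A t n (h n)) hS hK
      have e : A * liftSeq t h K - liftSeq t h (S * K) ∈ compactSeq p h := by
        refine mem_compactSeq_of_null (squeeze_zero (fun _ => norm_nonneg _) (fun n => ?_) hl)
        have : (A * liftSeq t h K - liftSeq t h (S * K)) n =
            lift t (h n) ((unlift t (h n) (A n) - S) * K) := by
          rw [sub_mul, lift_sub, lift_mul, lift_unlift, bddSeq_sub_apply, bddSeq_mul_apply,
            liftSeq_apply, liftSeq_apply]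
        rw [this]; exact norm_lift_le _ _ _
      exact mem_compactSeq_of_sub e (liftSeq_mem_compactSeq hm.1)
    · intro G hG
      refine mem_compactSeq_of_null (squeeze_zero (fun _ => norm_nonneg _) (fun n => ?_)
        (by simpa using hG.const_mul ‖A‖))
      exact norm_mul_le_of_le (A.norm_coe_le_norm n) le_rfl
  exact this hX

lemma compactSeq_mul_mem {A X : BddSeq p} (hA : A ∈ structured p h) (hX : X ∈ compactSeq p h) :
    X * A ∈ compactSeq p h := by
  have : compactSeq p h ≤ (compactSeq p h).comap (LinearMap.mulRight ℂ A) := by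
    refine compactSeq_le (isClosed_compactSeq.preimage (continuous_mul_const A)) ?_ ?_
    · intro t K hK
      obtain ⟨S, hS⟩ := mem_structured_iff.1 hA t
      obtain ⟨hm, -, hl⟩ := compactClass_mul (fun n => norm_unlift_apply_le A t n (h n)) hS hK
      have e : liftSeq t h K * A - liftSeq t h (K * S) ∈ compactSeq p h := by
        refine mem_compactSeq_of_null (squeeze_zero (fun _ => norm_nonneg _) (fun n => ?_) hl)
        have : (liftSeq t h K * A - liftSeq t h (K * S)) n =
            lift t (h n) (K * (unlift t (h n) (A n) - S)) := by
          rw [mul_sub, lift_sub, lift_mul, lift_unlift, bddSeq_sub_apply, bddSeq_mul_apply,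
            liftSeq_apply, liftSeq_apply]
        rw [this]; exact norm_lift_le _ _ _
      exact mem_compactSeq_of_sub e (liftSeq_mem_compactSeq hm.2)
    · intro G hG
      refine mem_compactSeq_of_null (squeeze_zero (fun _ => norm_nonneg _) (fun n => ?_)
        (by simpa using hG.mul_const ‖A‖))
      exact norm_mul_le_of_le le_rfl (A.norm_coe_le_norm n)
  exact this hX

lemma subseq_apply (A : BddSeq p) (m : ℕ+ → ℕ+) (n : ℕ+) : subseq A m n = A (m n) := rfl

/-- Passing to a subsequence, as a linear map. -/
def subseqₗ (m : ℕ+ → ℕ+) : BddSeq p →ₗ[ℂ] BddSeq p where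
  toFun := fun X => subseq X m
  map_add' := fun A B => by ext1 n; simp only [subseq_apply, bddSeq_add_apply]
  map_smul' := fun c A => by ext1 n; simp only [subseq_apply, bddSeq_smul_apply, RingHom.id_apply]

lemma subseqₗ_apply (A : BddSeq p) (m : ℕ+ → ℕ+) : subseqₗ m A = subseq A m := rfl

lemma continuous_subseqₗ (m : ℕ+ → ℕ+) : Continuous (subseqₗ m : BddSeq p →ₗ[ℂ] BddSeq p) :=
  BoundedContinuousFunction.continuous_compContinuous _

lemma sub_mem_compactSeq_of_eventuallyEq {A B : BddSeq p} (he : ∀ᶠ n in atTop, A n = B n) :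
    A - B ∈ compactSeq p h := by
  refine mem_compactSeq_of_null (tendsto_const_nhds.congr' ?_)
  filter_upwards [he] with n hn
  rw [bddSeq_sub_apply, hn, sub_self, norm_zero]

lemma compactSeq_of_eventually {h' m : ℕ+ → ℕ+} {A A' : BddSeq p} (hm : Tendsto m atTop atTop)
    (he : ∀ᶠ n in atTop, h' n = h (m n) ∧ A' n = A (m n)) (hA : A ∈ compactSeq p h) :
    A' ∈ compactSeq p h' := by
  have key : compactSeq p h ≤ (compactSeq p h').comap (subseqₗ m) := by
    refine compactSeq_le (isClosed_compactSeq.preimage (continuous_subseqₗ m)) ?_ ?_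
    · intro t K hK
      rw [Submodule.mem_comap, subseqₗ_apply]
      refine mem_compactSeq_of_sub (sub_mem_compactSeq_of_eventuallyEq ?_)
        (liftSeq_mem_compactSeq hK)
      filter_upwards [he] with n hn
      rw [subseq_apply, liftSeq_apply, liftSeq_apply, hn.1]
    · intro G hG
      exact mem_compactSeq_of_null (hG.comp hm)
  refine mem_compactSeq_of_sub (sub_mem_compactSeq_of_eventuallyEq ?_) (key hA)
  filter_upwards [he] with n hn
  rw [subseqₗ_apply, subseq_apply, hn.2]

/-- The position on the scale `n` of the point at which the transformation `E_n^d` is centered. -/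
def Direction.pos : Direction → ℝ
  | .minus => -1
  | .center => 0
  | .plus => 1

lemma Direction.pos_injective : Function.Injective Direction.pos := by
  intro a b hab
  cases a <;> cases b <;> first | rfl | (norm_num [Direction.pos] at hab)

lemma conjL_inl (d : Direction) (n : ℕ+) : conjL p (.inl d) n = shift p (d.pos * n) := by
  cases d <;> simp [conjL, Direction.pos, shift_zero]

lemma conjR_inl (d : Direction) (n : ℕ+) : conjR p (.inl d) n = shift p (-(d.pos * n)) := by
  cases d <;> simp [conjR, Direction.pos, shift_zero]

lemma proj_mul_shift_mul_proj {M m : ℕ+} {s : ℝ} (hs : (M : ℝ) + m < |s|) :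
    proj p M * shift p s * proj p m = 0 := by
  rw [mul_assoc, proj, proj, shift_mulOp, ← mul_assoc,
    mulOp_mul p _ _ (memLp_top_mul (memLp_indicator _ measurableSet_Icc)
      (memLp_shift (memLp_indicator _ measurableSet_Icc) s))]
  rw [mulOp_congr p _ (memLp_top_const 0), mulOp_zero, zero_mul]
  refine .of_forall fun x => ?_
  simp only
  by_cases h1 : x ∈ Icc (-(M : ℝ)) M
  · have h2 : x - s ∉ Icc (-(m : ℝ)) m := fun h2 => by
      rw [mem_Icc, ← abs_le] at h1 h2
      have h3 : |s| ≤ |x| + |x - s| := by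
        have : s = x - (x - s) := by ring
        conv_lhs => rw [this]
        exact abs_sub _ _
      linarith
    rw [indicator_of_notMem h2, mul_zero]
  · rw [indicator_of_notMem h1, zero_mul]

/-- The dilated projection centered at `θ`. -/
lemma proj_mul_conj (d : Direction) (t : ℝ) (m n : ℕ+) :
    proj p m * (conjR p (.inl d) n * conjL p (.inr t) n) =
      (conjR p (.inl d) n * conjL p (.inr t) n) *
        chi p {x | |n * x - d.pos * n| ≤ m} (measurableSet_le (by fun_prop) (by fun_prop)) := by
  have hE : MeasurableSet {x : ℝ | |n * x - d.pos * n| ≤ m} :=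
    measurableSet_le (by fun_prop) (by fun_prop)
  have hn : (0 : ℝ) < n := by exact_mod_cast n.pos
  have e1 := dilation_mulOp p n hn (memLp_indicator _ hE)
  have hd := memLp_dilate (memLp_indicator _ hE) n hn
  have e2 := modulation_mulOp p (-t) hd
  have e3 := shift_mulOp p (-(d.pos * n)) hd
  have e4 : mulOp p _ (memLp_shift hd (-(d.pos * n))) = proj p m := by
    refine mulOp_congr p _ _ (.of_forall fun x => ?_)
    have : n * ((x - -(d.pos * n)) / n) - d.pos * n = x := by rw [mul_div_cancel₀ _ hn.ne']; ring
    simp only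
    by_cases hx : x ∈ Icc (-(m : ℝ)) m
    · rw [indicator_of_mem hx, indicator_of_mem]
      rw [mem_ofPred_eq, this, abs_le]; exact hx
    · rw [indicator_of_notMem hx, indicator_of_notMem]
      rw [mem_ofPred_eq, this, abs_le]; exact hx
  rw [e4] at e3
  rw [conjR_inl, conjL, chi, mul_assoc (shift p _), mul_assoc (modulation p _), zOp, e1,
    ← mul_assoc (modulation p _) (mulOp p _ _), e2, mul_assoc (mulOp p _ _),
    ← mul_assoc (shift p _) (mulOp p _ _), e3, mul_assoc]

lemma pCompact_approx {K : Op p} (hK : K ∈ pCompact p) {ε : ℝ} (hε : 0 < ε) :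
    ∃ m, ‖K - proj p m * K * proj p m‖ ≤ ε := by
  obtain ⟨m, h1, h2⟩ := ((eventually_le_of_null hK.1 (half_pos hε)).and
    (eventually_le_of_null hK.2 (half_pos hε))).exists
  refine ⟨m, ?_⟩
  have e : K - proj p m * K * proj p m = (1 - proj p m) * K + proj p m * (K * (1 - proj p m)) := by
    noncomm_ring
  rw [e]
  exact (norm_add_le_of_le h2 (norm_mul_le_of_le (norm_proj_le m) h1)).trans (by linarith)

lemma unlift_lift_eq (t s : Index) (n : ℕ+) (K : Op p) : unlift t n (lift s n K) =
    (conjR p t n * conjL p s n) * K * (conjR p s n * conjL p t n) := by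
  rw [unlift_eq, lift_eq]; noncomm_ring

lemma norm_conjR_mul_conjL_le (t s : Index) (n : ℕ+) : ‖conjR p t n * conjL p s n‖ ≤ 1 :=
  (norm_mul_le_of_le (norm_conjR_le t n) (norm_conjL_le s n)).trans (mul_one _).le

lemma intertwine_inverse {R : Type*} [Ring R] {a b c q : R} (hab : a * b = 1) (hba : b * a = 1)
    (h : q * b = b * c) : a * q = c * a := by
  calc a * q = a * (q * b) * a := by rw [mul_assoc, mul_assoc, hba, mul_one]
    _ = c * a := by rw [h, ← mul_assoc, hab, one_mul]

lemma conjL_mul_proj_mul (d : Direction) (t : ℝ) (m n : ℕ+) :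
    (conjR p (.inr t) n * conjL p (.inl d) n) * proj p m =
      chi p {x | |n * x - d.pos * n| ≤ m} (measurableSet_le (by fun_prop) (by fun_prop)) *
      (conjR p (.inr t) n * conjL p (.inl d) n) := by
  refine intertwine_inverse ?_ ?_ (proj_mul_conj d t m n)
  · calc _ = conjR p (.inr t) n * (conjL p (.inl d) n * conjR p (.inl d) n) *
          conjL p (.inr t) n := by noncomm_ring
      _ = 1 := by rw [conjL_mul_conjR, mul_one, conjR_mul_conjL]
  · calc _ = conjR p (.inl d) n * (conjL p (.inr t) n * conjR p (.inr t) n) *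
          conjL p (.inl d) n := by noncomm_ring
      _ = 1 := by rw [conjL_mul_conjR, mul_one, conjR_mul_conjL]

/-- Images of `𝒫`-compact operators under the transformation attached to one direction vanish
asymptotically from any other point of view. -/
lemma indexLimit_unlift_lift_pCompact (hp : 1 < p) (hp' : p ≠ ⊤) (hh : Tendsto h atTop atTop)
    {d : Direction} {t : Index} (hd : t ≠ .inl d) {K : Op p} (hK : K ∈ pCompact p) :
    IndexLimit t (fun n => unlift t (h n) (lift (.inl d) (h n) K)) 0 := by
  refine indexLimit_of_approx fun ε hε => ?_
  obtain ⟨m, hm⟩ := pCompact_approx hK hε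
  refine ⟨fun n => unlift t (h n) (lift (.inl d) (h n) (proj p m * K * proj p m)), 0, ?_,
    fun n => ?_, by simpa using hε.le⟩
  swap
  · rw [← unlift_sub, ← lift_sub]
    exact (norm_unlift_le _ _ _).trans ((norm_lift_le _ _ _).trans hm)
  clear hm
  have hreal : Tendsto (fun n => ((h n : ℕ+) : ℝ)) atTop atTop :=
    tendsto_natCast_atTop_atTop.comp (tendsto_PNat_val_atTop_atTop.comp hh)
  cases t with
  | inl d' =>
    have hθ : d.pos ≠ d'.pos := fun e => hd (by rw [Direction.pos_injective e])
    have hlarge : ∀ R : ℝ, ∀ᶠ n in atTop, R < |(d.pos - d'.pos) * (h n : ℕ+)| := fun R => by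
      have := hreal.const_mul_atTop (abs_pos.2 (sub_ne_zero.2 hθ))
      filter_upwards [this.eventually_gt_atTop R] with n hn
      rwa [abs_mul, Nat.abs_cast]
    have e1 : ∀ n, unlift (.inl d') (h n) (lift (.inl d) (h n) (proj p m * K * proj p m)) =
        shift p ((d.pos - d'.pos) * h n) * (proj p m * K * proj p m) *
          shift p (-((d.pos - d'.pos) * h n)) := fun n => by
      rw [unlift_lift_eq, conjR_inl, conjL_inl, conjR_inl, conjL_inl, shift_mul_shift,
        shift_mul_shift]
      congr 3 <;> ring
    rw [IndexLimit, pStrongLimit_iff]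
    refine ⟨pCompact_subset_pBounded zero_mem_pCompact, fun L hL => ⟨?_, ?_⟩⟩
    · refine null_of_eventually_le (fun _ => norm_nonneg _) fun δ hδ => ?_
      obtain ⟨M, hM⟩ := (eventually_le_of_null hL.1
        (show 0 < δ / (‖K‖ + 1) by positivity)).exists
      filter_upwards [hlarge (M + m)] with n hn
      have z := proj_mul_shift_mul_proj (p := p) hn
      have e2 : L * (shift p ((d.pos - d'.pos) * h n) * (proj p m * K * proj p m) *
          shift p (-((d.pos - d'.pos) * h n)) - 0) =
          L * (1 - proj p M) * (shift p ((d.pos - d'.pos) * h n) * (proj p m * K * proj p m) *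
          shift p (-((d.pos - d'.pos) * h n))) +
          L * (proj p M * shift p ((d.pos - d'.pos) * h n) * proj p m) * K * proj p m *
          shift p (-((d.pos - d'.pos) * h n)) := by noncomm_ring
      rw [e1, e2, z, mul_zero, zero_mul, zero_mul, zero_mul, add_zero]
      refine (norm_mul_le_of_le hM (norm_mul_le_of_le (norm_mul_le_of_le (shift_norm_le p _)
        (norm_mul_le_of_le (norm_mul_le_of_le (norm_proj_le m) le_rfl) (norm_proj_le m)))
        (shift_norm_le p _))).trans ?_
      rw [one_mul, mul_one, mul_one, one_mul, div_mul_eq_mul_div, div_le_iff₀ (by positivity)]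
      nlinarith [norm_nonneg K]
    · refine null_of_eventually_le (fun _ => norm_nonneg _) fun δ hδ => ?_
      obtain ⟨M, hM⟩ := (eventually_le_of_null hL.2
        (show 0 < δ / (‖K‖ + 1) by positivity)).exists
      filter_upwards [hlarge (m + M)] with n hn
      rw [← abs_neg] at hn
      have z := proj_mul_shift_mul_proj (p := p) hn
      have e2 : (shift p ((d.pos - d'.pos) * h n) * (proj p m * K * proj p m) *
          shift p (-((d.pos - d'.pos) * h n)) - 0) * L =
          (shift p ((d.pos - d'.pos) * h n) * (proj p m * K * proj p m) *
          shift p (-((d.pos - d'.pos) * h n))) * ((1 - proj p M) * L) +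
          shift p ((d.pos - d'.pos) * h n) * proj p m * K *
          (proj p m * shift p (-((d.pos - d'.pos) * h n)) * proj p M) * L := by noncomm_ring
      rw [e1, e2, z, mul_zero, zero_mul, add_zero]
      refine (norm_mul_le_of_le (norm_mul_le_of_le (norm_mul_le_of_le (shift_norm_le p _)
        (norm_mul_le_of_le (norm_mul_le_of_le (norm_proj_le m) le_rfl) (norm_proj_le m)))
        (shift_norm_le p _)) hM).trans ?_
      rw [one_mul, mul_one, mul_one, one_mul, mul_div_assoc', div_le_iff₀ (by positivity)]
      nlinarith [norm_nonneg K]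
  | inr t =>
    have hlim : ∀ᵐ x : ℝ, Tendsto (fun n => ({x : ℝ | |h n * x - d.pos * h n| ≤ m}.indicator
        (fun _ => (1 : ℂ))) x) atTop (𝓝 0) := by
      filter_upwards [compl_mem_ae_iff.2 (measure_singleton d.pos)] with x hx
      refine tendsto_const_nhds.congr' ?_
      have := hreal.const_mul_atTop (abs_pos.2 (sub_ne_zero.2 hx))
      filter_upwards [this.eventually_gt_atTop (m : ℝ)] with n hn
      rw [indicator_of_notMem]
      rw [mem_ofPred_eq, not_le]
      have e : (h n : ℝ) * x - d.pos * h n = (x - d.pos) * h n := by ring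
      rwa [e, abs_mul, Nat.abs_cast]
    rw [IndexLimit, starStrongLimit_iff]
    simp only [sub_zero, unlift_lift_eq]
    refine ⟨fun u => ?_, fun φ => ?_⟩
    · have := mulOp_tendsto_zero hp' (l := atTop) (fun n : ℕ+ => memLp_indicator
        {x : ℝ | |h n * x - d.pos * h n| ≤ m} (measurableSet_le (by fun_prop) (by fun_prop)))
        (C := 1) (fun n => .of_forall (norm_indicator_one_le _)) hlim u
      rw [tendsto_zero_iff_norm_tendsto_zero] at this ⊢
      refine squeeze_zero (fun _ => norm_nonneg _) (fun n => ?_) (by simpa using this.const_mul ‖K‖)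
      have e : (conjR p (.inr t) (h n) * conjL p (.inl d) (h n)) * (proj p m * K * proj p m) *
          (conjR p (.inl d) (h n) * conjL p (.inr t) (h n)) =
          (conjR p (.inr t) (h n) * conjL p (.inl d) (h n)) * proj p m * K *
          (conjR p (.inl d) (h n) * conjL p (.inr t) (h n)) *
          chi p {x | |h n * x - d.pos * h n| ≤ m}
            (measurableSet_le (by fun_prop) (by fun_prop)) := by
        rw [mul_assoc _ _ (chi p _ _), ← proj_mul_conj d t m (h n)]
        noncomm_ring
      rw [e, mul_apply_eq_comp]
      refine ContinuousLinearMap.le_of_opNorm_le _ ((norm_mul_le_of_le (norm_mul_le_of_le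
        (norm_mul_le_of_le (norm_conjR_mul_conjL_le _ _ _) (norm_proj_le m)) le_rfl)
        (norm_conjR_mul_conjL_le _ _ _)).trans (le_of_eq (by ring))) _
    · have := functional_mulOp_tendsto_zero hp hp' φ (fun n : ℕ+ => memLp_indicator
        {x : ℝ | |h n * x - d.pos * h n| ≤ m} (measurableSet_le (by fun_prop) (by fun_prop)))
        (C := 1) (fun n => .of_forall (norm_indicator_one_le _)) hlim
      refine squeeze_zero (fun _ => norm_nonneg _) (fun n => ?_) (by simpa using this.mul_const ‖K‖)
      have e : (conjR p (.inr t) (h n) * conjL p (.inl d) (h n)) * (proj p m * K * proj p m) *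
          (conjR p (.inl d) (h n) * conjL p (.inr t) (h n)) =
          chi p {x | |h n * x - d.pos * h n| ≤ m} (measurableSet_le (by fun_prop) (by fun_prop)) *
          ((conjR p (.inr t) (h n) * conjL p (.inl d) (h n)) * K * proj p m *
          (conjR p (.inl d) (h n) * conjL p (.inr t) (h n))) := by
        have := conjL_mul_proj_mul (p := p) d t m (h n)
        rw [mul_assoc (proj p m), ← mul_assoc _ (proj p m), this]
        noncomm_ring
      rw [e]
      refine (ContinuousLinearMap.opNorm_comp_le (φ.comp (chi p {x | |h n * x - d.pos * h n| ≤ m}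
        (measurableSet_le (by fun_prop) (by fun_prop)))) _).trans
        (mul_le_mul_of_nonneg_left ?_ (norm_nonneg _))
      exact (norm_mul_le_of_le (norm_mul_le_of_le (norm_mul_le_of_le
        (norm_conjR_mul_conjL_le _ _ _) le_rfl) (norm_proj_le m))
        (norm_conjR_mul_conjL_le _ _ _)).trans (le_of_eq (by ring))

/-- The constant sequences seen from the direction they belong to. -/
lemma indexLimit_unlift_lift_self {d : Direction} {S : Op p} (hS : S ∈ pBounded p) :
    IndexLimit (.inl d) (fun n => unlift (.inl d) (h n) (lift (.inl d) (h n) S)) S := by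
  simp only [unlift_lift]
  exact ⟨hS, fun K _ => by simp⟩

lemma liftSeq_pCompact_mem_structured (hp : 1 < p) (hp' : p ≠ ⊤) (hh : Tendsto h atTop atTop)
    (d : Direction) {K : Op p} (hK : K ∈ pCompact p) : liftSeq (.inl d) h K ∈ structured p h := by
  refine mem_structured_iff.2 fun t => ?_
  by_cases hd : t = .inl d
  · subst hd
    exact ⟨K, indexLimit_unlift_lift_self (pCompact_subset_pBounded hK)⟩
  · exact ⟨0, indexLimit_unlift_lift_pCompact hp hp' hh hd hK⟩

/-- If a lifted operator is structured, then so are its lifted regularisers. -/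
lemma liftSeq_regulariser_mem_structured (hp : 1 < p) (hp' : p ≠ ⊤)
    (hh : Tendsto h atTop atTop) {d : Direction} {S B : Op p} (hS : S ∈ pBounded p)
    (h1 : S * B - 1 ∈ pCompact p) (h2 : B * S - 1 ∈ pCompact p)
    (hs : liftSeq (.inl d) h S ∈ structured p h) : liftSeq (.inl d) h B ∈ structured p h := by
  refine mem_structured_iff.2 fun t => ?_
  by_cases hd : t = .inl d
  · subst hd
    exact ⟨B, indexLimit_unlift_lift_self (regulariser_mem_pBounded hp' hS h1 h2)⟩
  · obtain ⟨S', hS'⟩ := mem_structured_iff.1 hs t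
    have l1 := indexLimit_unlift_lift_pCompact hp hp' hh hd h1
    have l2 := indexLimit_unlift_lift_pCompact hp hp' hh hd h2
    simp only [lift_sub, lift_mul, lift_one, unlift_sub, unlift_mul, unlift_one] at l1 l2
    exact exists_indexLimit_inverse hp hp' (fun n => norm_unlift_apply_le (liftSeq (.inl d) h S) t n (h n))
      (fun n => norm_unlift_apply_le (liftSeq (.inl d) h B) t n (h n)) hS' l1 l2

lemma unlift_inl_mulOp (d : Direction) (n : ℕ+) {a : ℝ → ℂ} (ha : MemLp a ⊤) :
    unlift (.inl d) n (mulOp p a ha) =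
      mulOp p (fun x => a (x - -(d.pos * n))) (memLp_shift ha _) := by
  rw [unlift_eq, conjR_inl, conjL_inl, shift_mulOp, mul_assoc, shift_neg_mul, mul_one]

lemma unlift_inr_mulOp (t : ℝ) (n : ℕ+) {a : ℝ → ℂ} (ha : MemLp a ⊤) :
    unlift (.inr t) n (mulOp p a ha) =
      mulOp p (fun x => a (x / (n : ℝ)⁻¹))
        (memLp_dilate ha _ (inv_pos.2 (by exact_mod_cast n.pos))) := by
  have e : unlift (.inr t) n (mulOp p a ha) =
      zInv p n * (modulation p t * mulOp p a ha) * modulation p (-t) * zOp p n := by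
    rw [unlift]; noncomm_ring
  rw [e, modulation_mulOp, ← mul_assoc, zInv, dilation_mulOp, ← zInv]
  calc _ = mulOp p _ _ * (zInv p n * (modulation p t * modulation p (-t)) * zOp p n) := by
        noncomm_ring
    _ = _ := by rw [modulation_mul_neg, mul_one, zInv_mul_zOp, mul_one]

lemma norm_mulOp_mul_proj_le {a : ℝ → ℂ} (ha : MemLp a ⊤) {m : ℕ+} {ε : ℝ} (hε : 0 ≤ ε)
    (h : ∀ᵐ x : ℝ, |x| ≤ m → ‖a x‖ ≤ ε) : ‖mulOp p a ha * proj p m‖ ≤ ε := by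
  rw [proj, mulOp_mul p _ _ (memLp_top_mul ha (memLp_indicator _ measurableSet_Icc))]
  refine mulOp_norm_le p _ hε ?_
  filter_upwards [h] with x hx
  by_cases hm : x ∈ Icc (-(m : ℝ)) m
  · rw [indicator_of_mem hm, mul_one]
    exact hx (abs_le.2 hm)
  · rw [indicator_of_notMem hm, mul_zero, norm_zero]; exact hε

lemma pStrongLimit_mulOp {a : ℕ+ → ℝ → ℂ} (ha : ∀ n, MemLp (a n) ⊤) {C : ℝ}
    (hC : ∀ n, ∀ᵐ x, ‖a n x‖ ≤ C) {s : ℝ → ℂ} (hs : MemLp s ⊤)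
    (hlim : ∀ m : ℕ+, ∀ ε : ℝ, 0 < ε → ∀ᶠ n in atTop, ∀ᵐ x : ℝ, |x| ≤ m → ‖a n x - s x‖ ≤ ε) :
    PStrongLimit (fun n => mulOp p (a n) (ha n)) (mulOp p s hs) := by
  have hC0 : 0 ≤ C := by
    obtain ⟨x, hx⟩ := (hC 1).exists
    exact (norm_nonneg _).trans hx
  have hb : ∀ n, ‖mulOp p (a n) (ha n) - mulOp p s hs‖ ≤ C + ‖mulOp p s hs‖ := fun n =>
    norm_sub_le_of_le (mulOp_norm_le p _ hC0 (hC n)) le_rfl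
  set D := C + ‖mulOp p s hs‖ with hD
  have hD0 : 0 ≤ D := add_nonneg hC0 (norm_nonneg _)
  have hm : ∀ m : ℕ+, Tendsto (fun n => ‖(mulOp p (a n) (ha n) - mulOp p s hs) * proj p m‖) atTop
      (𝓝 0) := fun m => by
    refine null_of_eventually_le (fun _ => norm_nonneg _) fun ε hε => ?_
    filter_upwards [hlim m ε hε] with n hn
    rw [mulOp_sub p (ha n) hs ((ha n).sub hs)]
    exact norm_mulOp_mul_proj_le _ hε.le hn
  rw [pStrongLimit_iff]
  refine ⟨mulOp_mem_pBounded hs, fun K hK => ⟨?_, ?_⟩⟩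
  · refine eventually_le_of_approx hD0 (fun _ => norm_nonneg _) fun ε hε => ?_
    obtain ⟨m, h1⟩ := (eventually_le_of_null hK.1 hε).exists
    refine ⟨_, by simpa using (hm m).const_mul ‖K‖, fun n => ?_⟩
    have e : K * (mulOp p (a n) (ha n) - mulOp p s hs) =
        K * ((mulOp p (a n) (ha n) - mulOp p s hs) * proj p m) +
        K * (1 - proj p m) * (mulOp p (a n) (ha n) - mulOp p s hs) := by
      have h1 : mulOp p (a n) (ha n) * proj p m = proj p m * mulOp p (a n) (ha n) :=
        mulOp_comm p _ _
      have h2 : mulOp p s hs * proj p m = proj p m * mulOp p s hs := mulOp_comm p _ _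
      rw [sub_mul, h1, h2]; noncomm_ring
    rw [e]
    exact norm_add_le_of_le (norm_mul_le _ _) (norm_mul_le_of_le h1 (hb n))
  · refine eventually_le_of_approx hD0 (fun _ => norm_nonneg _) fun ε hε => ?_
    obtain ⟨m, h1⟩ := (eventually_le_of_null hK.2 hε).exists
    refine ⟨_, by simpa using (hm m).mul_const ‖K‖, fun n => ?_⟩
    have e : (mulOp p (a n) (ha n) - mulOp p s hs) * K =
        (mulOp p (a n) (ha n) - mulOp p s hs) * proj p m * K +
        (mulOp p (a n) (ha n) - mulOp p s hs) * ((1 - proj p m) * K) := by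
      noncomm_ring
    rw [e, mul_comm ε]
    exact norm_add_le_of_le (norm_mul_le _ _) (norm_mul_le_of_le (hb n) h1)

lemma starStrongLimit_mulOp (hp : 1 < p) (hp' : p ≠ ⊤) {a : ℕ+ → ℝ → ℂ}
    (ha : ∀ n, MemLp (a n) ⊤) {C : ℝ} (hC : ∀ n, ∀ᵐ x, ‖a n x‖ ≤ C) {s : ℝ → ℂ}
    (hs : MemLp s ⊤) (hlim : ∀ᵐ x, Tendsto (fun n => a n x) atTop (𝓝 (s x))) :
    StarStrongLimit (fun n => mulOp p (a n) (ha n)) (mulOp p s hs) := by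
  have hs' : ∀ᵐ x, ‖s x‖ ≤ C := by
    filter_upwards [ae_all_iff.2 hC, hlim] with x hx hl
    exact le_of_tendsto hl.norm (.of_forall hx)
  have hb : ∀ n, ∀ᵐ x, ‖a n x - s x‖ ≤ C + C := fun n => by
    filter_upwards [hC n, hs'] with x h1 h2
    exact norm_sub_le_of_le h1 h2
  have hz : ∀ᵐ x, Tendsto (fun n => a n x - s x) atTop (𝓝 0) := by
    filter_upwards [hlim] with x hx
    simpa using hx.sub_const (s x)
  rw [starStrongLimit_iff]
  simp only [fun n => mulOp_sub p (ha n) hs ((ha n).sub hs)]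
  exact ⟨mulOp_tendsto_zero hp' _ hb hz, fun φ => functional_mulOp_tendsto_zero hp hp' φ _ hb hz⟩

/-- The limit of a sequence of multiplication operators in a direction. -/
lemma indexLimit_inl_mulOp {a : ℕ+ → ℝ → ℂ} (ha : ∀ n, MemLp (a n) ⊤) {C : ℝ}
    (hC : ∀ n, ∀ᵐ x, ‖a n x‖ ≤ C) {d : Direction} {s : ℝ → ℂ} (hs : MemLp s ⊤)
    (hlim : ∀ m : ℕ+, ∀ ε : ℝ, 0 < ε → ∀ᶠ n in atTop, ∀ᵐ x : ℝ, |x| ≤ m →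
      ‖a n (x + d.pos * h n) - s x‖ ≤ ε) :
    IndexLimit (.inl d) (fun n => unlift (.inl d) (h n) (mulOp p (a n) (ha n))) (mulOp p s hs) := by
  simp only [unlift_inl_mulOp]
  refine pStrongLimit_mulOp _ (fun n => (qmp_sub _).ae (hC n)) hs ?_
  simpa only [sub_neg_eq_add] using hlim

lemma indexLimit_inr_mulOp (hp : 1 < p) (hp' : p ≠ ⊤) {a : ℕ+ → ℝ → ℂ}
    (ha : ∀ n, MemLp (a n) ⊤) {C : ℝ} (hC : ∀ n, ∀ᵐ x, ‖a n x‖ ≤ C) (t : ℝ) {s : ℝ → ℂ}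
    (hs : MemLp s ⊤)
    (hlim : ∀ᵐ x : ℝ, Tendsto (fun n => a n (x * h n)) atTop (𝓝 (s x))) :
    IndexLimit (.inr t) (fun n => unlift (.inr t) (h n) (mulOp p (a n) (ha n))) (mulOp p s hs) := by
  simp only [unlift_inr_mulOp]
  refine starStrongLimit_mulOp hp hp' _ (fun n => (qmp_div _ (inv_pos.2
    (by exact_mod_cast (h n).pos))).ae (hC n)) hs ?_
  simpa only [div_inv_eq_mul] using hlim

lemma mulSeq_mem_structured (hp : 1 < p) (hp' : p ≠ ⊤) {a : ℕ+ → ℝ → ℂ}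
    (ha : ∀ n, MemLp (a n) ⊤) {C : ℝ} (hC : ∀ n, ∀ᵐ x, ‖a n x‖ ≤ C) {A : BddSeq p}
    (hA : ∀ n, A n = mulOp p (a n) (ha n))
    (hd : ∀ d : Direction, ∃ s : ℝ → ℂ, MemLp s ⊤ ∧ ∀ m : ℕ+, ∀ ε : ℝ, 0 < ε →
      ∀ᶠ n in atTop, ∀ᵐ x : ℝ, |x| ≤ m → ‖a n (x + d.pos * h n) - s x‖ ≤ ε)
    (ht : ∃ s : ℝ → ℂ, MemLp s ⊤ ∧
      ∀ᵐ x : ℝ, Tendsto (fun n => a n (x * h n)) atTop (𝓝 (s x))) : A ∈ structured p h := by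
  refine mem_structured_iff.2 fun t => ?_
  simp only [hA]
  cases t with
  | inl d =>
    obtain ⟨s, hs, hlim⟩ := hd d
    exact ⟨_, indexLimit_inl_mulOp ha hC hs hlim⟩
  | inr t =>
    obtain ⟨s, hs, hlim⟩ := ht
    exact ⟨_, indexLimit_inr_mulOp hp hp' ha hC t hs hlim⟩

lemma tendsto_index (hh : Tendsto h atTop atTop) : Tendsto (fun n => ((h n : ℕ+) : ℝ)) atTop atTop :=
  tendsto_natCast_atTop_atTop.comp (tendsto_PNat_val_atTop_atTop.comp hh)

lemma index_pos (n : ℕ+) : (0 : ℝ) < n := by exact_mod_cast n.pos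

/-- Continuous functions on the one-point compactification of the line. -/
abbrev Test : Type := C(OnePoint ℝ, ℂ)

lemma continuous_test (φ : Test) : Continuous fun x : ℝ => φ x :=
  φ.continuous.comp OnePoint.continuous_coe

lemma memLp_test (φ : Test) (c : ℝ) : MemLp (fun x : ℝ => φ ((x / c : ℝ) : OnePoint ℝ)) ⊤ :=
  memLp_top_of_norm_le (((continuous_test φ).comp (continuous_id.div_const c)).aestronglyMeasurable)
    fun x => φ.norm_coe_le_norm _

/-- The sequence of the multiplications by `φ (x / h n)`. -/
def tst (p : ℝ≥0∞) [Fact (1 ≤ p)] (h : ℕ+ → ℕ+) (φ : Test) : BddSeq p :=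
  ofBounded (fun n => mulOp p _ (memLp_test φ (h n))) ‖φ‖ fun n =>
    mulOp_norm_le p _ (norm_nonneg φ) (.of_forall fun x => φ.norm_coe_le_norm _)

lemma tst_apply (φ : Test) (n : ℕ+) : tst p h φ n = mulOp p _ (memLp_test φ (h n)) := rfl

lemma norm_tst_le (φ : Test) : ‖tst p h φ‖ ≤ ‖φ‖ := norm_le_of_forall fun n =>
  mulOp_norm_le p _ (norm_nonneg φ) (.of_forall fun x => φ.norm_coe_le_norm _)

lemma tst_add (φ ψ : Test) : tst p h (φ + ψ) = tst p h φ + tst p h ψ := by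
  ext1 n
  exact (mulOp_add p _ _ _).symm

lemma tst_sub (φ ψ : Test) : tst p h (φ - ψ) = tst p h φ - tst p h ψ := by
  ext1 n
  exact (mulOp_sub p _ _ _).symm

lemma tst_mul (φ ψ : Test) : tst p h (φ * ψ) = tst p h φ * tst p h ψ := by
  ext1 n
  exact (mulOp_mul p _ _ _).symm

lemma tst_smul (c : ℂ) (φ : Test) : tst p h (c • φ) = c • tst p h φ := by
  ext1 n
  exact (mulOp_smul p _ _ _).symm

lemma tst_one : tst p h 1 = 1 := by
  ext1 n
  exact mulOp_one p _

lemma tst_mem_structured (hp : 1 < p) (hp' : p ≠ ⊤) (hh : Tendsto h atTop atTop) (φ : Test) :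
    tst p h φ ∈ structured p h := by
  have hr := tendsto_index hh
  refine mulSeq_mem_structured hp hp' (fun n => memLp_test φ (h n)) (C := ‖φ‖)
    (fun n => .of_forall fun x => φ.norm_coe_le_norm _) (fun n => rfl)
    (fun d => ⟨fun _ => φ (d.pos : ℝ), memLp_top_const _, fun m ε hε => ?_⟩)
    ⟨fun x => φ (x : ℝ), by simpa using memLp_test φ 1, .of_forall fun x => ?_⟩
  · have hc := Metric.continuousAt_iff.1
      ((continuous_test φ).continuousAt : ContinuousAt _ d.pos) ε hε
    obtain ⟨δ, hδ, hc⟩ := hc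
    have : Tendsto (fun n => (m : ℝ) / h n) atTop (𝓝 0) := tendsto_const_nhds.div_atTop hr
    filter_upwards [this.eventually (gt_mem_nhds hδ)] with n hn
    refine .of_forall fun x hx => ?_
    have hn0 := index_pos (h n)
    have e : (x + d.pos * h n) / h n = d.pos + x / h n := by
      rw [add_div, mul_div_cancel_right₀ _ hn0.ne', add_comm]
    rw [← dist_eq_norm]
    refine (hc ?_).le
    rw [e, Real.dist_eq, add_sub_cancel_left, abs_div, abs_of_pos hn0]
    exact (div_le_div_of_nonneg_right hx hn0.le).trans_lt hn
  · simp only [mul_div_cancel_right₀ _ (index_pos (h _)).ne']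
    exact tendsto_const_nhds

lemma mulOp_mul_tst (φ : Test) {A : BddSeq p} (hA : ∀ n, ∃ (a : ℝ → ℂ) (ha : MemLp a ⊤),
    A n = mulOp p a ha) : A * tst p h φ = tst p h φ * A := by
  ext1 n
  obtain ⟨a, ha, e⟩ := hA n
  rw [bddSeq_mul_apply, bddSeq_mul_apply, e]
  exact mulOp_comm p _ _

end Structured

section AbstractInverse

variable {R : Type*} [NormedRing R] [NormedAlgebra ℂ R] [CompleteSpace R]

lemma exists_inverse_one_add {F : Subalgebra ℂ R} (hF : IsClosed (F : Set R)) {r : R}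
    (hr : r ∈ F) (h : ‖r‖ < 1) : ∃ q ∈ F, (1 + r) * q = 1 ∧ q * (1 + r) = 1 := by
  have h' : ‖-r‖ < 1 := by rwa [norm_neg]
  have hs := summable_geometric_of_norm_lt_one h'
  refine ⟨∑' i, (-r) ^ i, hF.mem_of_tendsto hs.hasSum.tendsto_sum_nat
    (.of_forall fun n => F.sum_mem fun i _ => F.pow_mem (F.neg_mem hr) i), ?_, ?_⟩
  · simpa using mul_neg_geom_series (-r) h'
  · simpa using geom_series_mul_neg (-r) h'

lemma exists_inverse_mod {F : Subalgebra ℂ R} (hF : IsClosed (F : Set R)) {J : Submodule ℂ R}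
    (hl : ∀ a ∈ F, ∀ x ∈ J, a * x ∈ J) (hr : ∀ a ∈ F, ∀ x ∈ J, x * a ∈ J) {A X Y j k : R}
    (hA : A ∈ F) (hX : X ∈ F) (hY : Y ∈ F) (hj : j ∈ J) (hjF : j ∈ F) (hk : k ∈ J) (hkF : k ∈ F)
    (h1 : ‖A * X - 1 - j‖ < 1) (h2 : ‖Y * A - 1 - k‖ < 1) :
    ∃ B ∈ F, A * B - 1 ∈ J ∧ B * A - 1 ∈ J := by
  obtain ⟨q, hq, hq1, -⟩ := exists_inverse_one_add hF
    (F.sub_mem (F.sub_mem (F.mul_mem hA hX) F.one_mem) hjF) h1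
  obtain ⟨s, hs, -, hs2⟩ := exists_inverse_one_add hF
    (F.sub_mem (F.sub_mem (F.mul_mem hY hA) F.one_mem) hkF) h2
  have hB : A * (X * q) - 1 ∈ J := by
    have : A * (X * q) - 1 = j * q := by
      conv_lhs => rw [← hq1]
      noncomm_ring
    rw [this]; exact hr _ hq _ hj
  have hL : s * Y * A - 1 ∈ J := by
    have : s * Y * A - 1 = s * k := by
      conv_lhs => rw [← hs2]
      noncomm_ring
    rw [this]; exact hl _ hs _ hk
  refine ⟨X * q, F.mul_mem hX hq, hB, ?_⟩
  have hLF : s * Y ∈ F := F.mul_mem hs hY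
  have e : X * q * A - 1 = s * Y * (A * (X * q) - 1) * A - (s * Y * A - 1) * (X * q * A)
      + (s * Y * A - 1) := by
    noncomm_ring
  rw [e]
  exact J.add_mem (J.sub_mem (hr _ hA _ (hl _ hLF _ hB))
    (hr _ (F.mul_mem (F.mul_mem hX hq) hA) _ hL)) hL

end AbstractInverse

section LocalPrinciple

variable {p : ℝ≥0∞} [Fact (1 ≤ p)] {h : ℕ+ → ℕ+}

/-- The structured sequences in `𝒥`. -/
def structuredIdeal (p : ℝ≥0∞) [Fact (1 ≤ p)] (h : ℕ+ → ℕ+) : Submodule ℂ (BddSeq p) :=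
  compactSeq p h ⊓ Subalgebra.toSubmodule (structuredAlg p h)

lemma mul_mem_structuredIdeal {A X : BddSeq p} (hA : A ∈ structuredAlg p h)
    (hX : X ∈ structuredIdeal p h) : A * X ∈ structuredIdeal p h :=
  ⟨mul_mem_compactSeq hA hX.1, (structuredAlg p h).mul_mem hA hX.2⟩

lemma structuredIdeal_mul_mem {A X : BddSeq p} (hA : A ∈ structuredAlg p h)
    (hX : X ∈ structuredIdeal p h) : X * A ∈ structuredIdeal p h :=
  ⟨compactSeq_mul_mem hA hX.1, (structuredAlg p h).mul_mem hX.2 hA⟩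

/-- The neighbourhoods (on the scale of the index) which are governed by a direction. -/
def Direction.nhd : Direction → ℝ → Set ℝ
  | .center, _ => Ioo (-1) 1
  | .minus, ε => Ioo (-1 - ε) (-1 + ε)
  | .plus, ε => Ioo (1 - ε) (1 + ε)

lemma Direction.nhd_mono (d : Direction) {ε δ : ℝ} (hεδ : ε ≤ δ) : d.nhd ε ⊆ d.nhd δ := by
  cases d
  · exact Ioo_subset_Ioo (by linarith) (by linarith)
  · exact subset_rfl
  · exact Ioo_subset_Ioo (by linarith) (by linarith)

/-- A test function of norm at most one living in the neighbourhood of a direction. -/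
structure LocalTest (d : Direction) (ε : ℝ) (φ : Test) : Prop where
  norm_le : ‖φ‖ ≤ 1
  eq_zero : ∀ x : ℝ, x ∉ d.nhd ε → φ x = 0

lemma LocalTest.mono {d : Direction} {ε δ : ℝ} (hεδ : ε ≤ δ) {φ : Test} (h : LocalTest d ε φ) :
    LocalTest d δ φ := ⟨h.1, fun x hx => h.2 x fun hx' => hx (d.nhd_mono hεδ hx')⟩

/-- The sequences commuting with all test functions modulo `𝒥`. -/
def LocalType (h : ℕ+ → ℕ+) (A : BddSeq p) : Prop :=
  ∀ φ, A * tst p h φ - tst p h φ * A ∈ compactSeq p h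

/-- Near the points governed by `d`, the sequence `A` looks like the lifted operator `S`. -/
def LocallyEquals (h : ℕ+ → ℕ+) (A : BddSeq p) (d : Direction) (S : Op p) : Prop :=
  ∀ δ : ℝ, 0 < δ → ∃ ε : ℝ, 0 < ε ∧ ∀ φ, LocalTest d ε φ →
    ∃ j ∈ structuredIdeal p h, ‖(A - liftSeq (.inl d) h S) * tst p h φ - j‖ ≤ δ

/-- The operator `S` describes the sequence `A` in the direction `d`. -/
structure Describes (h : ℕ+ → ℕ+) (A : BddSeq p) (d : Direction) (S : Op p) : Prop where
  limit : IndexLimit (.inl d) (fun n => unlift (.inl d) (h n) (A n)) S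
  structured : liftSeq (.inl d) h S ∈ structured p h
  localType : LocalType h (liftSeq (.inl d) h S)
  locally : LocallyEquals h A d S

/-- Structured sequences of local type which are locally described by their snapshots. -/
structure Good (h : ℕ+ → ℕ+) (A : BddSeq p) : Prop where
  structured : A ∈ structured p h
  localType : LocalType h A
  describes : ∀ d, ∃ S, Describes h A d S

lemma LocalType.mem (hp : 1 < p) (hp' : p ≠ ⊤) (hh : Tendsto h atTop atTop) {A : BddSeq p}
    (hs : A ∈ FiniteSection.structured p h) (hA : LocalType h A) (φ : Test) :
    A * tst p h φ - tst p h φ * A ∈ structuredIdeal p h :=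
  have ht := tst_mem_structured hp hp' hh φ
  ⟨hA φ, (structuredAlg p h).sub_mem ((structuredAlg p h).mul_mem hs ht)
    ((structuredAlg p h).mul_mem ht hs)⟩

lemma LocalType.mul (hp : 1 < p) (hp' : p ≠ ⊤) {A B : BddSeq p}
    (hs : A ∈ FiniteSection.structured p h) (hs' : B ∈ FiniteSection.structured p h)
    (hA : LocalType h A) (hB : LocalType h B) : LocalType h (A * B) := fun φ => by
  have e : A * B * tst p h φ - tst p h φ * (A * B) =
      A * (B * tst p h φ - tst p h φ * B) + (A * tst p h φ - tst p h φ * A) * B := by noncomm_ring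
  rw [e]
  exact (compactSeq p h).add_mem (mul_mem_compactSeq hs (hB φ)) (compactSeq_mul_mem hs' (hA φ))

lemma LocalType.add {A B : BddSeq p} (hA : LocalType h A) (hB : LocalType h B) :
    LocalType h (A + B) := fun φ => by
  have e : (A + B) * tst p h φ - tst p h φ * (A + B) =
      (A * tst p h φ - tst p h φ * A) + (B * tst p h φ - tst p h φ * B) := by noncomm_ring
  rw [e]
  exact (compactSeq p h).add_mem (hA φ) (hB φ)

lemma localType_of_approx {A : BddSeq p}
    (H : ∀ ε : ℝ, 0 < ε → ∃ B, LocalType h B ∧ ‖A - B‖ ≤ ε) : LocalType h A := fun φ => by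
  refine mem_compactSeq_of_approx fun ε hε => ?_
  obtain ⟨B, hB, hAB⟩ := H (ε / (2 * (‖φ‖ + 1))) (by positivity)
  refine ⟨_, hB φ, ?_⟩
  have e : A * tst p h φ - tst p h φ * A - (B * tst p h φ - tst p h φ * B) =
      (A - B) * tst p h φ - tst p h φ * (A - B) := by noncomm_ring
  rw [e]
  refine (norm_sub_le_of_le (norm_mul_le_of_le hAB (norm_tst_le φ))
    (norm_mul_le_of_le (norm_tst_le φ) hAB)).trans ?_
  have : ε / (2 * (‖φ‖ + 1)) * ‖φ‖ ≤ ε / 2 := by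
    rw [div_mul_eq_mul_div, div_le_div_iff₀ (by positivity) (by positivity)]
    nlinarith [norm_nonneg φ]
  linarith

lemma Describes.add {A B : BddSeq p} {d : Direction} {S R : Op p} (hA : Describes h A d S)
    (hB : Describes h B d R) : Describes h (A + B) d (S + R) where
  limit := by simpa only [bddSeq_add_apply, unlift_add] using hA.limit.add hB.limit
  structured := by rw [liftSeq_add]; exact (structuredAlg p h).add_mem hA.structured hB.structured
  localType := by rw [liftSeq_add]; exact hA.localType.add hB.localType
  locally := fun δ hδ => by
    obtain ⟨ε, hε, hA'⟩ := hA.locally (δ / 2) (half_pos hδ)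
    obtain ⟨η, hη, hB'⟩ := hB.locally (δ / 2) (half_pos hδ)
    refine ⟨min ε η, lt_min hε hη, fun φ hφ => ?_⟩
    obtain ⟨j, hj, hj'⟩ := hA' φ (hφ.mono (min_le_left _ _))
    obtain ⟨k, hk, hk'⟩ := hB' φ (hφ.mono (min_le_right _ _))
    refine ⟨j + k, (structuredIdeal p h).add_mem hj hk, ?_⟩
    have e : (A + B - liftSeq (.inl d) h (S + R)) * tst p h φ - (j + k) =
        ((A - liftSeq (.inl d) h S) * tst p h φ - j) +
        ((B - liftSeq (.inl d) h R) * tst p h φ - k) := by rw [liftSeq_add]; noncomm_ring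
    rw [e]
    exact (norm_add_le_of_le hj' hk').trans (by linarith)

lemma Describes.mul (hp : 1 < p) (hp' : p ≠ ⊤) (hh : Tendsto h atTop atTop) {A B : BddSeq p}
    {d : Direction} {S R : Op p} (hAs : A ∈ FiniteSection.structured p h)
    (hBs : B ∈ FiniteSection.structured p h) (hA : Describes h A d S) (hB : Describes h B d R) :
    Describes h (A * B) d (S * R) where
  limit := by
    simpa only [bddSeq_mul_apply, unlift_mul] using hA.limit.mul
      (fun n => norm_unlift_apply_le A (.inl d) n (h n))
      (fun n => norm_unlift_apply_le B (.inl d) n (h n)) hB.limit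
  structured := by rw [liftSeq_mul]; exact (structuredAlg p h).mul_mem hA.structured hB.structured
  localType := by
    rw [liftSeq_mul]; exact hA.localType.mul hp hp' hA.structured hB.structured hB.localType
  locally := fun δ hδ => by
    obtain ⟨ε, hε, hA'⟩ := hA.locally (δ / (2 * (‖R‖ + 1))) (by positivity)
    obtain ⟨η, hη, hB'⟩ := hB.locally (δ / (2 * (‖A‖ + 1))) (by positivity)
    refine ⟨min ε η, lt_min hε hη, fun φ hφ => ?_⟩
    obtain ⟨j, hj, hj'⟩ := hA' φ (hφ.mono (min_le_left _ _))
    obtain ⟨k, hk, hk'⟩ := hB' φ (hφ.mono (min_le_right _ _))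
    set SS := liftSeq (.inl d) h S
    set RR := liftSeq (.inl d) h R
    set f := tst p h φ
    have hc := hB.localType.mem hp hp' hh hB.structured φ
    refine ⟨A * k + j * RR + (A - SS) * (RR * f - f * RR), Submodule.add_mem _ (Submodule.add_mem _
      (mul_mem_structuredIdeal hAs hk) (structuredIdeal_mul_mem hB.structured hj))
      (mul_mem_structuredIdeal ((structuredAlg p h).sub_mem hAs hA.structured) hc), ?_⟩
    have e : (A * B - liftSeq (.inl d) h (S * R)) * f -
        (A * k + j * RR + (A - SS) * (RR * f - f * RR)) =
        A * ((B - RR) * f - k) + ((A - SS) * f - j) * RR := by rw [liftSeq_mul]; noncomm_ring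
    rw [e]
    refine (norm_add_le_of_le (norm_mul_le_of_le le_rfl hk')
      (norm_mul_le_of_le hj' (norm_liftSeq_le _ R))).trans ?_
    have h1 : ‖A‖ * (δ / (2 * (‖A‖ + 1))) ≤ δ / 2 := by
      rw [mul_div_assoc', div_le_div_iff₀ (by positivity) (by positivity)]
      nlinarith [norm_nonneg A]
    have h2 : δ / (2 * (‖R‖ + 1)) * ‖R‖ ≤ δ / 2 := by
      rw [div_mul_eq_mul_div, div_le_div_iff₀ (by positivity) (by positivity)]
      nlinarith [norm_nonneg R]
    linarith

lemma localType_smul_one (c : ℂ) : LocalType h (c • (1 : BddSeq p)) := fun φ => by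
  rw [smul_mul_assoc, mul_smul_comm, one_mul, mul_one, sub_self]
  exact (compactSeq p h).zero_mem

lemma good_smul_one (c : ℂ) : Good h (c • (1 : BddSeq p)) where
  structured := (structuredAlg p h).smul_mem (structuredAlg p h).one_mem c
  localType := localType_smul_one c
  describes := fun d => ⟨c • 1, {
    limit := by
      simpa only [bddSeq_smul_apply, bddSeq_one_apply, unlift_smul, unlift_one] using
        indexLimit_smul_one _ c
    structured := by
      rw [liftSeq_smul, liftSeq_one]
      exact (structuredAlg p h).smul_mem (structuredAlg p h).one_mem c
    localType := by rw [liftSeq_smul, liftSeq_one]; exact localType_smul_one c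
    locally := fun δ hδ => ⟨1, one_pos, fun φ hφ => ⟨0, Submodule.zero_mem _, by
      rw [liftSeq_smul, liftSeq_one, sub_self, zero_mul, sub_zero, norm_zero]
      exact hδ.le⟩⟩ }⟩

lemma Good.add {A B : BddSeq p} (hA : Good h A) (hB : Good h B) : Good h (A + B) where
  structured := (structuredAlg p h).add_mem hA.structured hB.structured
  localType := hA.localType.add hB.localType
  describes := fun d => by
    obtain ⟨S, hS⟩ := hA.describes d
    obtain ⟨R, hR⟩ := hB.describes d
    exact ⟨S + R, hS.add hR⟩

lemma Good.mul (hp : 1 < p) (hp' : p ≠ ⊤) (hh : Tendsto h atTop atTop) {A B : BddSeq p}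
    (hA : Good h A) (hB : Good h B) : Good h (A * B) where
  structured := (structuredAlg p h).mul_mem hA.structured hB.structured
  localType := hA.localType.mul hp hp' hA.structured hB.structured hB.localType
  describes := fun d => by
    obtain ⟨S, hS⟩ := hA.describes d
    obtain ⟨R, hR⟩ := hB.describes d
    exact ⟨S * R, hS.mul hp hp' hh hA.structured hB.structured hR⟩

lemma good_of_approx (hp : 1 < p) (hp' : p ≠ ⊤) {A : BddSeq p}
    (H : ∀ ε : ℝ, 0 < ε → ∃ B, Good h B ∧ ‖A - B‖ ≤ ε) : Good h A := by
  have hs : A ∈ structured p h := mem_structured_of_approx hp hp' fun ε hε => by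
    obtain ⟨B, hB, hAB⟩ := H ε hε
    exact ⟨B, hB.structured, hAB⟩
  refine ⟨hs, localType_of_approx fun ε hε => ?_, fun d => ?_⟩
  · obtain ⟨B, hB, hAB⟩ := H ε hε
    exact ⟨B, hB.localType, hAB⟩
  obtain ⟨S, hS⟩ := mem_structured_iff.1 hs (.inl d)
  have key : ∀ ε : ℝ, 0 < ε → ∃ B R, Describes h B d R ∧ ‖A - B‖ ≤ ε ∧
      ‖liftSeq (.inl d) h S - liftSeq (.inl d) h R‖ ≤ ε := fun ε hε => by
    obtain ⟨B, hB, hAB⟩ := H ε hε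
    obtain ⟨R, hR⟩ := hB.describes d
    refine ⟨B, R, hR, hAB, ?_⟩
    rw [← liftSeq_sub]
    refine (norm_liftSeq_le _ _).trans ((hS.sub hR.limit).norm_le hp hp' fun n => ?_)
    rw [← unlift_sub]
    exact (norm_unlift_le _ _ _).trans ((norm_apply_sub_le A B n).trans hAB)
  refine ⟨S, hS, mem_structured_of_approx hp hp' fun ε hε => ?_,
    localType_of_approx fun ε hε => ?_, fun δ hδ => ?_⟩
  · obtain ⟨B, R, hR, -, hd⟩ := key ε hε
    exact ⟨_, hR.structured, hd⟩
  · obtain ⟨B, R, hR, -, hd⟩ := key ε hε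
    exact ⟨_, hR.localType, hd⟩
  · obtain ⟨B, R, hR, hAB, hd⟩ := key (δ / 3) (by positivity)
    obtain ⟨ε, hε, hl⟩ := hR.locally (δ / 3) (by positivity)
    refine ⟨ε, hε, fun φ hφ => ?_⟩
    obtain ⟨j, hj, hj'⟩ := hl φ hφ
    refine ⟨j, hj, ?_⟩
    have e : (A - liftSeq (.inl d) h S) * tst p h φ - j = (A - B) * tst p h φ -
        (liftSeq (.inl d) h S - liftSeq (.inl d) h R) * tst p h φ +
        ((B - liftSeq (.inl d) h R) * tst p h φ - j) := by noncomm_ring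
    rw [e]
    have hφ1 := (norm_tst_le (p := p) (h := h) φ).trans hφ.norm_le
    refine (norm_add_le_of_le (norm_sub_le_of_le (norm_mul_le_of_le hAB hφ1)
      (norm_mul_le_of_le hd hφ1)) hj').trans ?_
    linarith

end LocalPrinciple

section Heredity

variable {p : ℝ≥0∞} [Fact (1 ≤ p)] {h h' m : ℕ+ → ℕ+}

lemma tst_eq_of_index {n k : ℕ+} (hn : h' n = h k) (φ : Test) :
    tst p h' φ n = tst p h φ k := by
  have : ∀ a b : ℕ+, a = b → mulOp p _ (memLp_test φ a) = mulOp p _ (memLp_test φ b) := by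
    rintro a b rfl; rfl
  exact this _ _ hn

lemma liftSeq_eq_of_index {n k : ℕ+} (hn : h' n = h k) (t : Index) (S : Op p) :
    liftSeq t h' S n = liftSeq t h S k := by
  rw [liftSeq_apply, liftSeq_apply, hn]

lemma LocalType.of_eventually {A A' : BddSeq p} (hm : Tendsto m atTop atTop)
    (he : ∀ᶠ n in atTop, h' n = h (m n) ∧ A' n = A (m n)) (hA : LocalType h A) :
    LocalType h' A' := fun φ => by
  refine compactSeq_of_eventually hm ?_ (hA φ)
  filter_upwards [he] with n hn
  refine ⟨hn.1, ?_⟩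
  simp only [bddSeq_sub_apply, bddSeq_mul_apply, hn.2, tst_eq_of_index hn.1]

lemma exists_approx_of_eventually {X X' j : BddSeq p} {δ : ℝ} (hm : Tendsto m atTop atTop)
    (he : ∀ᶠ n in atTop, h' n = h (m n) ∧ X' n = X (m n)) (hj : j ∈ structuredIdeal p h)
    (hd : ‖X - j‖ ≤ δ) : ∃ j' ∈ structuredIdeal p h', ‖X' - j'‖ ≤ δ := by
  have hev : ∀ᶠ n in atTop, h' n = h (m n) ∧ (X' - subseq (X - j) m) n = j (m n) := by
    filter_upwards [he] with n hn
    refine ⟨hn.1, ?_⟩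
    rw [bddSeq_sub_apply, subseq_apply, bddSeq_sub_apply, hn.2]
    abel
  refine ⟨X' - subseq (X - j) m, ⟨compactSeq_of_eventually hm hev hj.1,
    structured_of_eventually hm hev hj.2⟩, ?_⟩
  rw [sub_sub_cancel]
  refine (norm_le_of_forall fun n => ?_).trans hd
  rw [subseq_apply]
  exact (X - j).norm_coe_le_norm _

lemma LocallyEquals.of_eventually {A A' : BddSeq p} {d : Direction} {S : Op p}
    (hm : Tendsto m atTop atTop) (he : ∀ᶠ n in atTop, h' n = h (m n) ∧ A' n = A (m n))
    (hA : LocallyEquals h A d S) : LocallyEquals h' A' d S := fun δ hδ => by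
  obtain ⟨ε, hε, H⟩ := hA δ hδ
  refine ⟨ε, hε, fun φ hφ => ?_⟩
  obtain ⟨j, hj, hjd⟩ := H φ hφ
  refine exists_approx_of_eventually hm ?_ hj hjd
  filter_upwards [he] with n hn
  refine ⟨hn.1, ?_⟩
  rw [bddSeq_mul_apply, bddSeq_mul_apply, bddSeq_sub_apply, bddSeq_sub_apply, hn.2,
    tst_eq_of_index hn.1, liftSeq_eq_of_index hn.1]

lemma Describes.of_eventually {A A' : BddSeq p} {d : Direction} {S : Op p}
    (hm : Tendsto m atTop atTop) (he : ∀ᶠ n in atTop, h' n = h (m n) ∧ A' n = A (m n))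
    (hA : Describes h A d S) : Describes h' A' d S where
  limit := hA.limit.of_eventually hm (by filter_upwards [he] with n hn; rw [hn.1, hn.2])
  structured := structured_of_eventually hm
    (he.mono fun n hn => ⟨hn.1, liftSeq_eq_of_index hn.1 _ _⟩) hA.structured
  localType := hA.localType.of_eventually hm
    (he.mono fun n hn => ⟨hn.1, liftSeq_eq_of_index hn.1 _ _⟩)
  locally := hA.locally.of_eventually hm he

lemma Good.of_eventually {A A' : BddSeq p} (hm : Tendsto m atTop atTop)
    (he : ∀ᶠ n in atTop, h' n = h (m n) ∧ A' n = A (m n)) (hA : Good h A) : Good h' A' where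
  structured := structured_of_eventually hm he hA.structured
  localType := hA.localType.of_eventually hm he
  describes := fun d => by
    obtain ⟨S, hS⟩ := hA.describes d
    exact ⟨S, hS.of_eventually hm he⟩

end Heredity

section Diagonal

lemma le_of_strictMono {k : ℕ+ → ℕ+} (hk : StrictMono k) (n : ℕ+) : n ≤ k n := hk.le_apply

lemma tendsto_of_strictMono {k : ℕ+ → ℕ+} (hk : StrictMono k) : Tendsto k atTop atTop :=
  tendsto_atTop_mono (le_of_strictMono hk) tendsto_id

/-- Countably many properties of index sequences which are asymptotically hereditary, and each of
which holds along a subsequence of any sequence, hold simultaneously along a subsequence. -/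
lemma exists_diagonal {P : ℕ → (ℕ+ → ℕ+) → Prop}
    (hered : ∀ (i : ℕ) (h h' m : ℕ+ → ℕ+), Tendsto m atTop atTop →
      (∀ᶠ n in atTop, h' n = h (m n)) → P i h → P i h')
    (real : ∀ (i : ℕ) (g : ℕ+ → ℕ+), StrictMono g → ∃ k : ℕ+ → ℕ+, StrictMono k ∧ P i (g ∘ k))
    {g : ℕ+ → ℕ+}
    (hg : StrictMono g) : ∃ k : ℕ+ → ℕ+, StrictMono k ∧ ∀ i, P i (g ∘ k) := by
  choose! K hK using real
  have hP := fun i g hg => (hK i g hg).2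
  replace hK := fun i g hg => (hK i g hg).1
  let G : ℕ → {f : ℕ+ → ℕ+ // StrictMono f} := fun i => Nat.rec ⟨id, strictMono_id⟩
    (fun i G => ⟨G.1 ∘ K i (g ∘ G.1), G.2.comp (hK i _ (hg.comp G.2))⟩) i
  have hG : ∀ i, (G (i + 1)).1 = (G i).1 ∘ K i (g ∘ (G i).1) := fun i => rfl
  have hPG : ∀ i, P i (g ∘ (G (i + 1)).1) := fun i => hP i _ (hg.comp (G i).2)
  have hr : ∀ i j, i ≤ j → ∃ r, StrictMono r ∧ (G j).1 = (G i).1 ∘ r := fun i j hij => by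
    induction j, hij using Nat.le_induction with
    | base => exact ⟨id, strictMono_id, rfl⟩
    | succ j hij ih =>
      obtain ⟨r, hr, e⟩ := ih
      exact ⟨r ∘ K j (g ∘ (G j).1), hr.comp (hK j _ (hg.comp (G j).2)), by
        rw [hG, e, Function.comp_assoc]⟩
  choose! r hr1 hr2 using hr
  refine ⟨fun n => (G n).1 n, strictMono_of_lt_add_one fun n _ => ?_, fun i => ?_⟩
  · have e : (G ((n + 1 : ℕ+) : ℕ)).1 = (G n).1 ∘ K n (g ∘ (G n).1) := by
      rw [PNat.add_coe, PNat.one_coe, hG]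
    change (G n).1 n < (G ((n + 1 : ℕ+) : ℕ)).1 (n + 1)
    rw [e]
    exact (G n).2 ((PNat.lt_add_right n 1).trans_le (le_of_strictMono (hK _ _ (hg.comp (G n).2)) _))
  · have hle : ∀ᶠ n : ℕ+ in atTop, i + 1 ≤ (n : ℕ) := by
      filter_upwards [eventually_ge_atTop (⟨i + 1, i.succ_pos⟩ : ℕ+)] with n hn
      exact_mod_cast hn
    refine hered i _ _ (fun n => r (i + 1) n n) ?_ ?_ (hPG i)
    · refine tendsto_atTop_mono' _ ?_ tendsto_id
      filter_upwards [hle] with n hn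
      exact le_of_strictMono (hr1 _ _ hn) n
    · filter_upwards [hle] with n hn
      simp only [Function.comp_apply, hr2 _ _ hn]

variable {p : ℝ≥0∞} [Fact (1 ≤ p)]

/-- The sequences for which every sequence of indices has a good subsequence. -/
def Realizable (A : BddSeq p) : Prop :=
  ∀ g : ℕ+ → ℕ+, StrictMono g → ∃ k, StrictMono k ∧ Good (g ∘ k) (subseq A (g ∘ k))

lemma exists_joint_good {A : ℕ → BddSeq p} (hA : ∀ i, Realizable (A i)) {g : ℕ+ → ℕ+}
    (hg : StrictMono g) : ∃ k, StrictMono k ∧ ∀ i, Good (g ∘ k) (subseq (A i) (g ∘ k)) :=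
  exists_diagonal (P := fun i h => Good h (subseq (A i) h))
    (fun i h h' m hm he hgood => hgood.of_eventually hm (by
      filter_upwards [he] with n hn
      exact ⟨hn, by rw [subseq_apply, subseq_apply, hn]⟩)) (fun i => hA i) hg

lemma exists_joint_good_pair {A B : BddSeq p} (hA : Realizable A) (hB : Realizable B)
    {g : ℕ+ → ℕ+} (hg : StrictMono g) : ∃ k, StrictMono k ∧ Good (g ∘ k) (subseq A (g ∘ k)) ∧
      Good (g ∘ k) (subseq B (g ∘ k)) := by
  obtain ⟨k, hk, H⟩ := exists_joint_good (A := fun i => if i = 0 then A else B)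
    (fun i => by by_cases hi : i = 0 <;> simp [hi, hA, hB]) hg
  exact ⟨k, hk, by simpa using H 0, by simpa using H 1⟩

/-- The algebra of the realizable sequences. -/
def realizableAlg (p : ℝ≥0∞) [Fact (1 ≤ p)] (hp : 1 < p) (hp' : p ≠ ⊤) :
    Subalgebra ℂ (BddSeq p) where
  carrier := {A | Realizable A}
  mul_mem' := fun {A B} hA hB g hg => by
    obtain ⟨k, hk, h1, h2⟩ := exists_joint_good_pair hA hB hg
    exact ⟨k, hk, h1.mul hp hp' (tendsto_of_strictMono (hg.comp hk)) h2⟩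
  add_mem' := fun {A B} hA hB g hg => by
    obtain ⟨k, hk, h1, h2⟩ := exists_joint_good_pair hA hB hg
    exact ⟨k, hk, h1.add h2⟩
  algebraMap_mem' := fun c g hg => ⟨id, strictMono_id, by
    have e : subseq (algebraMap ℂ (BddSeq p) c) (g ∘ id) = c • (1 : BddSeq p) := by
      rw [Algebra.algebraMap_eq_smul_one]; rfl
    rw [e]
    exact good_smul_one c⟩

lemma isClosed_realizableAlg (hp : 1 < p) (hp' : p ≠ ⊤) :
    IsClosed (realizableAlg p hp hp' : Set (BddSeq p)) := by
  refine isClosed_of_closure_subset fun A hA g hg => ?_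
  have hpos : ∀ i : ℕ, (0 : ℝ) < 1 / ((i : ℝ) + 1) := fun i => Nat.one_div_pos_of_nat
  choose B hB hd using fun i : ℕ => Metric.mem_closure_iff.1 hA _ (hpos i)
  obtain ⟨k, hk, H⟩ := exists_joint_good hB hg
  refine ⟨k, hk, good_of_approx hp hp' fun ε hε => ?_⟩
  obtain ⟨i, hi⟩ := exists_nat_one_div_lt hε
  refine ⟨_, H i, norm_le_of_forall fun n => ?_⟩
  refine (norm_apply_sub_le A (B i) _).trans ?_
  rw [← bddSeq_dist]
  exact ((hd i).trans hi).le

end Diagonal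

section Localization

variable {p : ℝ≥0∞} [Fact (1 ≤ p)] {h : ℕ+ → ℕ+}

lemma liftSeq_pCompact_mem_structuredIdeal (hp : 1 < p) (hp' : p ≠ ⊤)
    (hh : Tendsto h atTop atTop) (d : Direction) {K : Op p} (hK : K ∈ pCompact p) :
    liftSeq (.inl d) h K ∈ structuredIdeal p h :=
  ⟨liftSeq_mem_compactSeq hK, liftSeq_pCompact_mem_structured hp hp' hh d hK⟩

/-- A regulariser of the describing operator provides a local regulariser of the sequence. -/
lemma Describes.exists_local_regulariser (hp : 1 < p) (hp' : p ≠ ⊤) (hh : Tendsto h atTop atTop)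
    {A : BddSeq p} (hA : Good h A) {d : Direction} {S B : Op p} (hS : Describes h A d S)
    (h1 : S * B - 1 ∈ pCompact p) (h2 : B * S - 1 ∈ pCompact p) {δ : ℝ} (hδ : 0 < δ) :
    ∃ BB ∈ FiniteSection.structured p h, ∃ ε : ℝ, 0 < ε ∧ ∀ φ, LocalTest d ε φ →
      (∃ j ∈ structuredIdeal p h, ‖A * (tst p h φ * BB) - tst p h φ - j‖ ≤ δ) ∧
      ∃ j ∈ structuredIdeal p h, ‖BB * tst p h φ * A - tst p h φ - j‖ ≤ δ := by
  have hBs : liftSeq (.inl d) h B ∈ FiniteSection.structured p h :=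
    liftSeq_regulariser_mem_structured hp hp' hh hS.limit.1 h1 h2 hS.structured
  obtain ⟨ε, hε, H⟩ := hS.locally (δ / (‖B‖ + 1)) (by positivity)
  refine ⟨liftSeq (.inl d) h B, hBs, ε, hε, fun φ hφ => ?_⟩
  obtain ⟨j, hj, hjd⟩ := H φ hφ
  have k1 := liftSeq_pCompact_mem_structuredIdeal hp hp' hh d h1
  have k2 := liftSeq_pCompact_mem_structuredIdeal hp hp' hh d h2
  rw [liftSeq_sub, liftSeq_mul, liftSeq_one] at k1 k2
  have c1 := hS.localType.mem hp hp' hh hS.structured φ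
  have c2 := hA.localType.mem hp hp' hh hA.structured φ
  have hf := tst_mem_structured hp hp' hh φ
  have hnB := norm_liftSeq_le (h := h) (.inl d) B
  have hle : δ / (‖B‖ + 1) * ‖B‖ ≤ δ := by
    rw [div_mul_eq_mul_div, div_le_iff₀ (by positivity)]
    nlinarith [norm_nonneg B]
  generalize liftSeq (.inl d) h B = BB at *
  generalize liftSeq (.inl d) h S = SS at *
  generalize tst p h φ = f at *
  refine ⟨⟨j * BB + (SS * f - f * SS) * BB + f * (SS * BB - 1), Submodule.add_mem _
    (Submodule.add_mem _ (structuredIdeal_mul_mem hBs hj) (structuredIdeal_mul_mem hBs c1))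
    (mul_mem_structuredIdeal hf k1), ?_⟩,
    ⟨BB * j + (BB * SS - 1) * f - BB * (A * f - f * A), Submodule.sub_mem _
    (Submodule.add_mem _ (mul_mem_structuredIdeal hBs hj) (structuredIdeal_mul_mem hf k2))
    (mul_mem_structuredIdeal hBs c2), ?_⟩⟩
  · have e : A * (f * BB) - f - (j * BB + (SS * f - f * SS) * BB + f * (SS * BB - 1)) =
        ((A - SS) * f - j) * BB := by noncomm_ring
    rw [e]
    exact (norm_mul_le_of_le hjd hnB).trans hle
  · have e : BB * f * A - f - (BB * j + (BB * SS - 1) * f - BB * (A * f - f * A)) =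
        BB * ((A - SS) * f - j) := by noncomm_ring
    rw [e]
    refine (norm_mul_le_of_le hnB hjd).trans ?_
    rwa [mul_comm]

/-- The test function with the values of a continuous function of compact support. -/
def realTest (f : ℝ → ℝ) (hf : Continuous f) (R : ℝ) (hR : ∀ x, R ≤ |x| → f x = 0) : Test :=
  OnePoint.continuousMapMk ⟨fun x => (f x : ℂ), by fun_prop⟩ 0 (by
    refine tendsto_const_nhds.congr' ?_
    rw [coclosedCompact_eq_cocompact]
    filter_upwards [(tendsto_norm_cocompact_atTop (E := ℝ)).eventually_ge_atTop R] with x hx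
    simp [hR x hx])

lemma realTest_apply {f : ℝ → ℝ} {hf : Continuous f} {R : ℝ} {hR : ∀ x, R ≤ |x| → f x = 0}
    (x : ℝ) : realTest f hf R hR (x : OnePoint ℝ) = f x := rfl

lemma realTest_localTest {d : Direction} {ε : ℝ} {f : ℝ → ℝ} {hf : Continuous f} {R : ℝ}
    {hR : ∀ x, R ≤ |x| → f x = 0} (h0 : ∀ x, |f x| ≤ 1) (hd : ∀ x ∉ d.nhd ε, f x = 0) :
    LocalTest d ε (realTest f hf R hR) := by
  refine ⟨(ContinuousMap.norm_le _ zero_le_one).2 fun x => ?_, fun x hx => ?_⟩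
  · induction x using OnePoint.rec with
    | infty => exact (norm_zero (E := ℂ)).trans_le zero_le_one
    | coe x => rw [realTest_apply, Complex.norm_real]; exact h0 x
  · rw [realTest_apply, hd x hx, Complex.ofReal_zero]

lemma exists_partition {ε : ℝ} (hε : 0 < ε) : ∃ fm fc fp fi : Test,
    LocalTest .minus ε fm ∧ LocalTest .center ε fc ∧ LocalTest .plus ε fp ∧
      (∀ x : ℝ, |x| ≤ 1 → fi x = 0) ∧ fm + fc + fp + fi = 1 := by
  wlog h1 : ε ≤ 1 generalizing ε
  · obtain ⟨fm, fc, fp, fi, a, b, c, d, e⟩ := this one_pos le_rfl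
    exact ⟨fm, fc, fp, fi, a.mono (le_of_not_ge h1), b.mono (le_of_not_ge h1),
      c.mono (le_of_not_ge h1), d, e⟩
  have tent : ∀ y : ℝ, |max 0 (1 - |y| / ε)| ≤ 1 := fun y => by
    rw [abs_of_nonneg (le_max_left _ _)]
    exact max_le zero_le_one (by linarith [div_nonneg (abs_nonneg y) hε.le])
  have tent0 : ∀ y : ℝ, ε ≤ |y| → max 0 (1 - |y| / ε) = 0 := fun y hy => by
    rw [max_eq_left]
    linarith [(one_le_div hε).2 hy]
  have plat0 : ∀ y : ℝ, 1 ≤ |y| → min 1 (max 0 ((1 - |y|) / ε)) = 0 := fun y hy => by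
    rw [max_eq_left (div_nonpos_of_nonpos_of_nonneg (by linarith) hε.le), min_eq_right zero_le_one]
  have hm0 : ∀ x : ℝ, x ∉ Ioo (-1 - ε) (-1 + ε) → max 0 (1 - |x + 1| / ε) = 0 := fun x hx => by
    refine tent0 _ (not_lt.1 fun h => hx ?_)
    rw [abs_lt] at h
    constructor <;> linarith [h.1, h.2]
  have hp0 : ∀ x : ℝ, x ∉ Ioo (1 - ε) (1 + ε) → max 0 (1 - |x - 1| / ε) = 0 := fun x hx => by
    refine tent0 _ (not_lt.1 fun h => hx ?_)
    rw [abs_lt] at h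
    constructor <;> linarith [h.1, h.2]
  have far : ∀ x : ℝ, 2 ≤ |x| → x ∉ Ioo (-1 - ε) (-1 + ε) ∧ x ∉ Ioo (1 - ε) (1 + ε) :=
    fun x hx => by
      refine ⟨fun h => ?_, fun h => ?_⟩ <;>
      · have : |x| < 2 := abs_lt.2 ⟨by linarith [h.1], by linarith [h.2]⟩
        linarith
  set fm := realTest (fun x => max 0 (1 - |x + 1| / ε)) (by fun_prop) 2
    fun x hx => hm0 x (far x hx).1
  set fp := realTest (fun x => max 0 (1 - |x - 1| / ε)) (by fun_prop) 2
    fun x hx => hp0 x (far x hx).2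
  set fc := realTest (fun x => min 1 (max 0 ((1 - |x|) / ε))) (by fun_prop) 2
    fun x hx => plat0 x (by linarith)
  refine ⟨fm, fc, fp, 1 - fm - fc - fp, realTest_localTest (fun x => tent _) hm0,
    realTest_localTest (fun x => ?_) (fun x hx => plat0 x (not_lt.1 fun h => hx (abs_lt.1 h))),
    realTest_localTest (fun x => tent _) hp0, fun x hx => ?_, by abel⟩
  · rw [abs_of_nonneg (le_min zero_le_one (le_max_left _ _))]
    exact min_le_left _ _
  · have e : (1 - fm - fc - fp) (x : OnePoint ℝ) = ((1 - max 0 (1 - |x + 1| / ε) -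
      min 1 (max 0 ((1 - |x|) / ε)) - max 0 (1 - |x - 1| / ε) : ℝ) : ℂ) := by
      push_cast; rfl
    rw [e, Complex.ofReal_eq_zero]
    have hx' := abs_le.1 hx
    rw [abs_of_nonneg (by linarith : 0 ≤ x + 1), abs_of_nonpos (by linarith : x - 1 ≤ 0),
      max_eq_right (div_nonneg (by linarith) hε.le : 0 ≤ (1 - |x|) / ε)]
    rcases le_total 0 x with h0 | h0
    · have e1 : 1 ≤ (x + 1) / ε := (one_le_div hε).2 (by linarith)
      rw [abs_of_nonneg h0, max_eq_left (by linarith : 1 - (x + 1) / ε ≤ 0)]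
      have e2 : -(x - 1) / ε = (1 - x) / ε := by ring
      rw [e2]
      rcases le_total ((1 - x) / ε) 1 with h2 | h2
      · rw [min_eq_right h2, max_eq_right (by linarith)]; ring
      · rw [min_eq_left h2, max_eq_left (by linarith)]; ring
    · have e1 : 1 ≤ -(x - 1) / ε := (one_le_div hε).2 (by linarith)
      rw [abs_of_nonpos h0, max_eq_left (by linarith : 1 - -(x - 1) / ε ≤ 0)]
      have e2 : (1 - -x) / ε = (x + 1) / ε := by ring
      rw [e2]
      rcases le_total ((x + 1) / ε) 1 with h2 | h2
      · rw [min_eq_right h2, max_eq_right (by linarith)]; ring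
      · rw [min_eq_left h2, max_eq_left (by linarith)]; ring

lemma proj_mul_tst {φ : Test} (hφ : ∀ x : ℝ, |x| ≤ 1 → φ x = 0) (n : ℕ+) :
    proj p (h n) * tst p h φ n = 0 := by
  rw [tst_apply, proj, mulOp_mul p _ _ (memLp_top_mul (memLp_indicator _ measurableSet_Icc)
    (memLp_test φ (h n))), ← mulOp_zero p (memLp_top_const 0)]
  refine mulOp_congr p _ _ (.of_forall fun x => ?_)
  simp only
  by_cases hx : x ∈ Icc (-((h n : ℕ+) : ℝ)) (h n)
  · rw [hφ, mul_zero]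
    rw [abs_div, abs_of_pos (index_pos (h n)), div_le_one (index_pos (h n))]
    exact abs_le.2 hx
  · rw [indicator_of_notMem hx, zero_mul]

lemma eq_smul_tst_of_outside {A : BddSeq p} {c : ℂ}
    (hc : ∀ n, A n * (1 - proj p (h n)) = c • (1 - proj p (h n))) {φ : Test}
    (hφ : ∀ x : ℝ, |x| ≤ 1 → φ x = 0) : A * tst p h φ = c • tst p h φ := by
  ext1 n
  have e : tst p h φ n = (1 - proj p (h n)) * tst p h φ n := by
    rw [sub_mul, one_mul, proj_mul_tst hφ, sub_zero]
  rw [bddSeq_mul_apply, bddSeq_smul_apply, e, ← mul_assoc, hc, smul_mul_assoc]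

/-- Good sequences which are a nonzero multiple of the identity outside the interval of the finite
sections are Fredholm as soon as their snapshots are. -/
lemma jFredholm_of_good (hp : 1 < p) (hp' : p ≠ ⊤) (hh : Tendsto h atTop atTop) {A : BddSeq p}
    (hA : Good h A) {c : ℂ} (hc0 : c ≠ 0)
    (hc : ∀ n, A n * (1 - proj p (h n)) = c • (1 - proj p (h n)))
    (hS : ∀ d S, IndexLimit (.inl d) (fun n => unlift (.inl d) (h n) (A n)) S → PFredholm p S) :
    JFredholm h A := by
  have key : ∀ d : Direction, ∃ BB ∈ structured p h, ∃ ε : ℝ, 0 < ε ∧ ∀ φ, LocalTest d ε φ →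
      (∃ j ∈ structuredIdeal p h, ‖A * (tst p h φ * BB) - tst p h φ - j‖ ≤ 1 / 4) ∧
      ∃ j ∈ structuredIdeal p h, ‖BB * tst p h φ * A - tst p h φ - j‖ ≤ 1 / 4 := fun d => by
    obtain ⟨S, hd⟩ := hA.describes d
    obtain ⟨-, B, h1, h2⟩ := hS d S hd.limit
    exact hd.exists_local_regulariser hp hp' hh hA h1 h2 (by norm_num)
  obtain ⟨Bm, hBm, εm, hεm, Hm⟩ := key .minus
  obtain ⟨Bc, hBc, εc, hεc, Hc⟩ := key .center
  obtain ⟨Bp, hBp, εp, hεp, Hp⟩ := key .plus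
  obtain ⟨fm, fc, fp, fi, tm, tc, tp, ti, hsum⟩ := exists_partition (lt_min hεm (lt_min hεc hεp))
  obtain ⟨⟨jm, hjm, njm⟩, km, hkm, nkm⟩ := Hm fm (tm.mono (min_le_left _ _))
  obtain ⟨⟨jc, hjc, njc⟩, kc, hkc, nkc⟩ := Hc fc
    (tc.mono ((min_le_right _ _).trans (min_le_left _ _)))
  obtain ⟨⟨jp, hjp, njp⟩, kp, hkp, nkp⟩ := Hp fp
    (tp.mono ((min_le_right _ _).trans (min_le_right _ _)))
  have hone : tst p h fm + tst p h fc + tst p h fp + tst p h fi = 1 := by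
    rw [← tst_add, ← tst_add, ← tst_add, hsum, tst_one]
  have hAi := eq_smul_tst_of_outside hc ti
  have hci := hA.localType.mem hp hp' hh hA.structured fi
  have sm := tst_mem_structured hp hp' hh fm
  have sc := tst_mem_structured hp hp' hh fc
  have sp := tst_mem_structured hp hp' hh fp
  have si := tst_mem_structured hp hp' hh fi
  have hAF : A ∈ structuredAlg p h := hA.structured
  refine ⟨hA.structured, ?_⟩
  clear Hm Hc Hp key
  generalize tst p h fm = gm at *
  generalize tst p h fc = gc at *
  generalize tst p h fp = gp at *
  generalize tst p h fi = gi at *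
  refine exists_inverse_mod (isClosed_structuredAlg (h := h) hp hp') (fun a ha x hx =>
    mul_mem_compactSeq ha hx) (fun a ha x hx => compactSeq_mul_mem ha hx)
    (X := gm * Bm + gc * Bc + gp * Bp + c⁻¹ • gi) (Y := Bm * gm + Bc * gc + Bp * gp + c⁻¹ • gi)
    (j := jm + jc + jp) (k := km + kc + kp - c⁻¹ • (A * gi - gi * A)) hAF ?_ ?_ ?_ ?_ ?_ ?_ ?_ ?_
  · exact add_mem (add_mem (add_mem (mul_mem sm hBm) (mul_mem sc hBc)) (mul_mem sp hBp))
      (Subalgebra.smul_mem _ si _)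
  · exact add_mem (add_mem (add_mem (mul_mem hBm sm) (mul_mem hBc sc)) (mul_mem hBp sp))
      (Subalgebra.smul_mem _ si _)
  · exact Submodule.add_mem _ (Submodule.add_mem _ hjm.1 hjc.1) hjp.1
  · exact add_mem (add_mem hjm.2 hjc.2) hjp.2
  · exact Submodule.sub_mem _ (Submodule.add_mem _ (Submodule.add_mem _ hkm.1 hkc.1) hkp.1)
      (Submodule.smul_mem _ _ hci.1)
  · exact sub_mem (add_mem (add_mem hkm.2 hkc.2) hkp.2) (Subalgebra.smul_mem _ hci.2 _)
  · have e : A * (gm * Bm + gc * Bc + gp * Bp + c⁻¹ • gi) - 1 - (jm + jc + jp) =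
        (A * (gm * Bm) - gm - jm) + (A * (gc * Bc) - gc - jc) + (A * (gp * Bp) - gp - jp) := by
      rw [mul_add, mul_smul_comm, hAi, smul_smul, inv_mul_cancel₀ hc0, one_smul, ← hone]
      noncomm_ring
    rw [e]
    exact (norm_add_le_of_le (norm_add_le_of_le njm njc) njp).trans_lt (by norm_num)
  · have e : (Bm * gm + Bc * gc + Bp * gp + c⁻¹ • gi) * A - 1 -
        (km + kc + kp - c⁻¹ • (A * gi - gi * A)) =
        (Bm * gm * A - gm - km) + (Bc * gc * A - gc - kc) + (Bp * gp * A - gp - kp) := by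
      rw [add_mul, smul_mul_assoc, smul_sub, hAi, smul_smul, inv_mul_cancel₀ hc0, one_smul, ← hone]
      noncomm_ring
    rw [e]
    exact (norm_add_le_of_le (norm_add_le_of_le nkm nkc) nkp).trans_lt (by norm_num)

lemma one_le_norm_chi (hp' : p ≠ ⊤) {s t : Set ℝ} (hs : MeasurableSet s) (ht : MeasurableSet t)
    (hts : t ⊆ s) (h0 : volume t ≠ 0) (htop : volume t ≠ ⊤) : 1 ≤ ‖chi p s hs‖ := by
  have hne : chi p s hs ≠ 0 := fun e => by
    have h1 : chi p s hs (indicatorConstLp p ht htop (1 : ℂ)) = indicatorConstLp p ht htop 1 := by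
      refine Lp.ext ?_
      filter_upwards [mulOp_coeFn p _ (memLp_indicator s hs) (indicatorConstLp p ht htop (1 : ℂ)),
        indicatorConstLp_coeFn (p := p) (hs := ht) (hμs := htop) (c := (1 : ℂ))] with x hx hx'
      refine hx.trans ?_
      rw [hx', indicator_one_mul, inter_eq_right.2 hts]
    rw [e, zero_apply] at h1
    have h2 := norm_indicatorConstLp (hs := ht) (hμs := htop) (c := (1 : ℂ))
      (exponent_ne_zero (p := p)) hp'
    rw [← h1, norm_zero, norm_one, one_mul] at h2
    have : 0 < volume.real t ^ (1 / p.toReal) := Real.rpow_pos_of_pos (ENNReal.toReal_pos h0 htop) _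
    exact this.ne h2
  have hpos := norm_pos_iff.2 hne
  have h2 : ‖chi p s hs‖ ≤ ‖chi p s hs‖ * ‖chi p s hs‖ := by
    conv_lhs => rw [chi_congr hs (hs.inter hs) (inter_self s).symm, ← chi_mul hs hs]
    exact norm_mul_le _ _
  nlinarith

lemma norm_one_sub_proj_pos (hp' : p ≠ ⊤) (n : ℕ+) : 0 < ‖1 - proj p n‖ := by
  rw [proj_eq_chi, one_sub_chi measurableSet_Icc]
  refine zero_lt_one.trans_le (one_le_norm_chi hp' _ (measurableSet_Ioc (a := (n : ℝ)) (b := n + 1))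
    (fun x hx hx' => absurd hx'.2 (not_le.2 hx.1)) ?_ ?_) <;> simp

/-- The sequences which are a multiple of the identity outside the interval `[-n, n]`. -/
def outsideAlg (p : ℝ≥0∞) [Fact (1 ≤ p)] : Subalgebra ℂ (BddSeq p) where
  carrier := {A | ∃ c : ℂ, ∀ n, A n * (1 - proj p n) = c • (1 - proj p n)}
  mul_mem' := by
    rintro A B ⟨c, hc⟩ ⟨d, hd⟩
    refine ⟨c * d, fun n => ?_⟩
    rw [bddSeq_mul_apply, mul_assoc, hd, mul_smul_comm, hc, smul_smul, mul_comm]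
  add_mem' := by
    rintro A B ⟨c, hc⟩ ⟨d, hd⟩
    refine ⟨c + d, fun n => ?_⟩
    rw [bddSeq_add_apply, add_mul, hc, hd, add_smul]
  algebraMap_mem' := fun c => ⟨c, fun n => by
    rw [Algebra.algebraMap_eq_smul_one, bddSeq_smul_apply, bddSeq_one_apply, smul_mul_assoc,
      one_mul]⟩

lemma isClosed_outsideAlg (hp' : p ≠ ⊤) : IsClosed (outsideAlg p : Set (BddSeq p)) := by
  refine isClosed_of_closure_subset fun A hA => ?_
  obtain ⟨B, hB, hlim⟩ := mem_closure_iff_seq_limit.1 hA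
  choose c hc using hB
  have hle : ∀ i j, ‖c i - c j‖ ≤ ‖B i - B j‖ := fun i j => by
    have e : (B i - B j) 1 * (1 - proj p 1) = (c i - c j) • (1 - proj p 1) := by
      rw [bddSeq_sub_apply, sub_mul, hc, hc, sub_smul]
    have h1 := congrArg norm e
    rw [norm_smul] at h1
    have h2 := norm_mul_le_of_le ((B i - B j).norm_coe_le_norm 1) (le_refl ‖1 - proj p 1‖)
    rw [h1] at h2
    exact le_of_mul_le_mul_right h2 (norm_one_sub_proj_pos hp' 1)
  have hcau : CauchySeq c := by
    have hB := hlim.cauchySeq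
    rw [Metric.cauchySeq_iff] at hB ⊢
    intro ε hε
    obtain ⟨N, hN⟩ := hB ε hε
    refine ⟨N, fun i hi j hj => ?_⟩
    have := hN i hi j hj
    rw [bddSeq_dist] at this
    rw [dist_eq_norm]
    exact (hle i j).trans_lt this
  obtain ⟨d, hd⟩ := cauchySeq_tendsto_of_complete hcau
  refine ⟨d, fun n => ?_⟩
  have hn : Tendsto (fun i => B i n) atTop (𝓝 (A n)) := by
    rw [tendsto_iff_norm_sub_tendsto_zero]
    refine squeeze_zero (fun _ => norm_nonneg _) (fun i => ?_) (tendsto_iff_dist_tendsto_zero.1 hlim)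
    rw [bddSeq_dist]
    exact norm_apply_sub_le _ _ n
  refine tendsto_nhds_unique (hn.mul_const (1 - proj p n)) ?_
  simp only [hc]
  exact hd.smul_const _

lemma limit_mul_chi {A : BddSeq p} {c : ℂ} {S : Op p}
    (hc : ∀ n, A n * (1 - proj p (h n)) = c • (1 - proj p (h n)))
    (hS : IndexLimit (.inl .plus) (fun n => unlift (.inl .plus) (h n) (A n)) S) (M : ℕ+) :
    S * chi p (Ioc 0 (M : ℝ)) measurableSet_Ioc = c • chi p (Ioc 0 (M : ℝ)) measurableSet_Ioc := by
  set q := chi p (Ioc 0 (M : ℝ)) measurableSet_Ioc with hq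
  have hq1 : proj p M * q = q := by
    rw [hq, proj_eq_chi, chi_mul]
    refine chi_congr _ _ (inter_eq_right.2 fun x hx => ⟨?_, hx.2⟩)
    have := index_pos M
    linarith [hx.1]
  have hq2 : ∀ n : ℕ+, unlift (.inl .plus) n (1 - proj p n) * q = q := fun n => by
    have z : unlift (.inl .plus) n (proj p n) * q = 0 := by
      rw [proj, unlift_inl_mulOp, hq, chi, mulOp_mul p _ _
        (memLp_top_mul (memLp_shift (memLp_indicator _ measurableSet_Icc) _)
          (memLp_indicator _ measurableSet_Ioc)), mulOp_congr p _ (memLp_top_const 0), mulOp_zero]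
      refine .of_forall fun x => ?_
      simp only
      by_cases hx : x ∈ Ioc 0 (M : ℝ)
      · rw [indicator_of_notMem, zero_mul]
        intro h'
        have := h'.2
        simp only [Direction.pos] at this
        linarith [hx.1]
      · rw [indicator_of_notMem hx, mul_zero]
    rw [unlift_sub, unlift_one, sub_mul, one_mul, z, sub_zero]
  have hB : ∀ n, unlift (.inl .plus) (h n) (A n) * q = c • q := fun n => by
    conv_lhs => rw [← hq2 (h n)]
    rw [← mul_assoc, ← unlift_mul, hc, unlift_smul, smul_mul_assoc, hq2]
  have hl := PStrongLimit.proj_right hS (proj_mem_pCompact M)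
  have hz : ‖S * q - c • q‖ ≤ 0 := by
    refine ge_of_tendsto' hl fun n => ?_
    have e : S * q - c • q = -((unlift (.inl .plus) (h n) (A n) - S) * proj p M * q) := by
      rw [mul_assoc, hq1, sub_mul, hB, neg_sub]
    rw [e, norm_neg]
    exact (norm_mul_le_of_le le_rfl (chi_norm_le _)).trans (mul_one _).le
  exact sub_eq_zero.1 (norm_le_zero_iff.1 hz)

lemma outside_ne_zero (hp' : p ≠ ⊤) {A : BddSeq p} {c : ℂ} {S : Op p}
    (hc : ∀ n, A n * (1 - proj p (h n)) = c • (1 - proj p (h n)))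
    (hS : IndexLimit (.inl .plus) (fun n => unlift (.inl .plus) (h n) (A n)) S)
    (hF : PFredholm p S) : c ≠ 0 := by
  rintro rfl
  obtain ⟨-, B, -, hK⟩ := hF
  obtain ⟨m, hm⟩ := (eventually_le_of_null hK.1 (show (0 : ℝ) < 1 / 2 by norm_num)).exists
  have h1 := limit_mul_chi hc hS (m + 1)
  rw [zero_smul] at h1
  have hpos := index_pos m
  set r := chi p (Ioc (m : ℝ) (m + 1)) measurableSet_Ioc with hr
  have hr1 : chi p (Ioc 0 ((m + 1 : ℕ+) : ℝ)) measurableSet_Ioc * r = r := by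
    rw [hr, chi_mul]
    refine chi_congr _ _ (inter_eq_right.2 fun x hx => ⟨hpos.trans hx.1, ?_⟩)
    rw [PNat.add_coe, Nat.cast_add, PNat.one_coe, Nat.cast_one]
    exact hx.2
  have hr2 : (1 - proj p m) * r = r := by
    rw [hr, proj_eq_chi, one_sub_chi measurableSet_Icc, chi_mul]
    exact chi_congr _ _ (inter_eq_right.2 fun x hx hx' => absurd hx'.2 (not_le.2 hx.1))
  have hSr : S * r = 0 := by rw [← hr1, ← mul_assoc, h1, zero_mul]
  have e : (B * S - 1) * (1 - proj p m) * r = -r := by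
    rw [mul_assoc, hr2, sub_mul, mul_assoc, hSr, mul_zero, one_mul, zero_sub]
  have h2 : ‖r‖ ≤ 1 / 2 * 1 := by
    rw [← norm_neg, ← e]
    exact norm_mul_le_of_le hm (chi_norm_le _)
  have h3 : 1 ≤ ‖r‖ := one_le_norm_chi hp' _ measurableSet_Ioc subset_rfl (by simp) (by simp)
  linarith

lemma finiteSectionAlg_le_outsideAlg (hp' : p ≠ ⊤) : finiteSectionAlg p ≤ outsideAlg p := by
  refine Subalgebra.topologicalClosure_minimal (Algebra.adjoin_le ?_) (isClosed_outsideAlg hp')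
  rintro B ⟨A, -, hB⟩
  refine ⟨1, fun n => ?_⟩
  have e : proj p n * (1 - proj p n) = 0 := proj_mul_one_sub le_rfl
  rw [hB, one_smul, add_mul, mul_assoc _ (proj p n), e, mul_zero, zero_add, mul_sub, mul_one,
    sub_mul, one_mul, proj_mul_proj le_rfl, sub_self, sub_zero]

lemma finiteSectionAlg_le_realizableAlg (hp : 1 < p) (hp' : p ≠ ⊤)
    (H : algOne p ≤ realizableAlg p hp hp') : finiteSectionAlg p ≤ realizableAlg p hp hp' := by
  refine Subalgebra.topologicalClosure_minimal (Algebra.adjoin_le ?_)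
    (isClosed_realizableAlg hp hp')
  rintro B ⟨A, hA, hB⟩
  set Q : BddSeq p := ofBounded (fun n => proj p n) 1 norm_proj_le with hQ
  have hQ1 : Q ∈ algOne p := Subalgebra.le_topologicalClosure _
    (Algebra.subset_adjoin (Or.inr fun n => rfl))
  have e : B = Q * A * Q + (1 - Q) := by
    ext1 n
    rw [hB, bddSeq_add_apply, bddSeq_mul_apply, bddSeq_mul_apply, bddSeq_sub_apply,
      bddSeq_one_apply]
    rfl
  rw [e]
  exact add_mem (mul_mem (mul_mem (H hQ1) (H hA)) (H hQ1)) (sub_mem (one_mem _) (H hQ1))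

lemma exists_jFredholm_subseq (hp : 1 < p) (hp' : p ≠ ⊤)
    (H : algOne p ≤ realizableAlg p hp hp') {A : BddSeq p} (hA : A ∈ finiteSectionAlg p)
    (hW : ∀ g : ℕ+ → ℕ+, StrictMono g → subseq A g ∈ structured p g →
      ∀ (t : Direction) (S : Op p), IsSnapshot g (subseq A g) S (Sum.inl t) → PFredholm p S)
    {g : ℕ+ → ℕ+} (hg : StrictMono g) :
    ∃ k : ℕ+ → ℕ+, StrictMono k ∧ JFredholm (g ∘ k) (subseq A (g ∘ k)) := by
  obtain ⟨k, hk, hgood⟩ := finiteSectionAlg_le_realizableAlg hp hp' H hA g hg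
  obtain ⟨c, hc⟩ := finiteSectionAlg_le_outsideAlg hp' hA
  have hF : ∀ d S, IndexLimit (.inl d) (fun n => unlift (.inl d) ((g ∘ k) n)
      (subseq A (g ∘ k) n)) S → PFredholm p S := fun d S hS =>
    hW _ (hg.comp hk) hgood.structured d S (isSnapshot_iff.2 hS)
  have hc' : ∀ n, subseq A (g ∘ k) n * (1 - proj p ((g ∘ k) n)) = c • (1 - proj p ((g ∘ k) n)) :=
    fun n => hc _
  obtain ⟨S, hS⟩ := hgood.describes .plus
  exact ⟨k, hk, jFredholm_of_good hp hp' (tendsto_of_strictMono (hg.comp hk)) hgood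
    (outside_ne_zero hp' hc' hS.limit (hF _ _ hS.limit)) hc' hF⟩

lemma indexLimit_zero_of_null {t : Index} {B : ℕ+ → Op p}
    (hB : Tendsto (fun n => ‖B n‖) atTop (𝓝 0)) : IndexLimit t B 0 := by
  cases t with
  | inl d =>
    rw [IndexLimit, pStrongLimit_iff]
    simp only [sub_zero]
    refine ⟨pCompact_subset_pBounded zero_mem_pCompact, fun K _ => ⟨?_, ?_⟩⟩
    · exact squeeze_zero (fun _ => norm_nonneg _) (fun n => norm_mul_le _ _)
        (by simpa using hB.const_mul ‖K‖)
    · exact squeeze_zero (fun _ => norm_nonneg _) (fun n => norm_mul_le _ _)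
        (by simpa using hB.mul_const ‖K‖)
  | inr t =>
    rw [IndexLimit, starStrongLimit_iff]
    simp only [sub_zero]
    refine ⟨fun u => tendsto_zero_iff_norm_tendsto_zero.2 ?_, fun φ => ?_⟩
    · exact squeeze_zero (fun _ => norm_nonneg _) (fun n => (B n).le_opNorm u)
        (by simpa using hB.mul_const ‖u‖)
    · exact squeeze_zero (fun _ => norm_nonneg _) (fun n => φ.opNorm_comp_le (B n))
        (by simpa using hB.const_mul ‖φ‖)

lemma mem_structuredIdeal_of_null {G : BddSeq p} (hG : Tendsto (fun n => ‖G n‖) atTop (𝓝 0)) :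
    G ∈ structuredIdeal p h :=
  ⟨mem_compactSeq_of_null hG, mem_structured_iff.2 fun t => ⟨0, indexLimit_zero_of_null
    (squeeze_zero (fun _ => norm_nonneg _) (fun n => norm_unlift_le t (h n) (G n)) hG)⟩⟩

lemma exists_structuredIdeal_of_eventually_le {X : BddSeq p} {δ : ℝ} (hδ : 0 ≤ δ)
    (hX : ∀ᶠ n in atTop, ‖X n‖ ≤ δ) : ∃ j ∈ structuredIdeal p h, ‖X - j‖ ≤ δ := by
  classical
  set j : BddSeq p := ofBounded (fun n => if ‖X n‖ ≤ δ then 0 else X n) ‖X‖ (fun n => by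
    split_ifs
    · rw [norm_zero]; exact norm_nonneg X
    · exact X.norm_coe_le_norm n) with hj
  refine ⟨j, mem_structuredIdeal_of_null (tendsto_const_nhds.congr' ?_),
    norm_le_of_forall fun n => ?_⟩
  · filter_upwards [hX] with n hn
    rw [hj, ofBounded_apply, if_pos hn, norm_zero]
  · rw [bddSeq_sub_apply, hj, ofBounded_apply]
    split_ifs with h1
    · rwa [sub_zero]
    · rwa [sub_self, norm_zero]

lemma localType_of_mem_structuredIdeal (hp : 1 < p) (hp' : p ≠ ⊤) (hh : Tendsto h atTop atTop)
    {A : BddSeq p} (hA : A ∈ compactSeq p h) : LocalType h A := fun φ =>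
  have ht := tst_mem_structured hp hp' hh φ
  (compactSeq p h).sub_mem (compactSeq_mul_mem ht hA) (mul_mem_compactSeq ht hA)

lemma locallyEquals_of_eq {A : BddSeq p} {d : Direction} {S : Op p}
    (hA : A = liftSeq (.inl d) h S) : LocallyEquals h A d S := fun δ hδ =>
  ⟨1, one_pos, fun φ _ => ⟨0, Submodule.zero_mem _, by
    rw [hA, sub_self, zero_mul, sub_zero, norm_zero]; exact hδ.le⟩⟩

lemma good_of_pCompact (hp : 1 < p) (hp' : p ≠ ⊤) (hh : Tendsto h atTop atTop) {K : Op p}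
    (hK : K ∈ pCompact p) {A : BddSeq p} (hA : ∀ n, A n = K) : Good h A := by
  have e : A = liftSeq (.inl .center) h K := by ext1 n; exact hA n
  subst e
  have hs := liftSeq_pCompact_mem_structuredIdeal hp hp' hh .center hK
  have hl := localType_of_mem_structuredIdeal hp hp' hh hs.1
  have z : ∀ d : Direction, liftSeq (.inl d) h (0 : Op p) = 0 := fun d => by
    simpa using liftSeq_smul (h := h) (.inl d) (0 : ℂ) (0 : Op p)
  refine ⟨hs.2, hl, fun d => ?_⟩
  by_cases hd : d = .center
  · subst hd
    exact ⟨K, indexLimit_unlift_lift_self (pCompact_subset_pBounded hK), hs.2, hl,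
      locallyEquals_of_eq rfl⟩
  · have hlim := indexLimit_unlift_lift_pCompact hp hp' hh (t := .inl d) (d := .center)
      (by simpa using hd) hK
    refine ⟨0, by simp only [liftSeq_apply]; exact hlim, ?_, ?_, ?_⟩
    · rw [z]; exact (structuredAlg p h).zero_mem
    · rw [z]
      exact localType_of_mem_structuredIdeal hp hp' hh (compactSeq p h).zero_mem
    · intro δ hδ
      refine ⟨1, one_pos, fun φ _ => ⟨_, structuredIdeal_mul_mem
        (tst_mem_structured hp hp' hh φ) hs, ?_⟩⟩
      rw [z, sub_zero, sub_self, norm_zero]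
      exact hδ.le

lemma lift_inl_mulOp (d : Direction) (n : ℕ+) {a : ℝ → ℂ} (ha : MemLp a ⊤) :
    lift (.inl d) n (mulOp p a ha) = mulOp p (fun x => a (x - d.pos * n)) (memLp_shift ha _) := by
  rw [lift_eq, conjR_inl, conjL_inl, shift_mulOp, mul_assoc, shift_mul_neg, mul_one]

lemma localType_of_mulOp {A : BddSeq p} (hA : ∀ n, ∃ (a : ℝ → ℂ) (ha : MemLp a ⊤),
    A n = mulOp p a ha) : LocalType h A := fun φ => by
  rw [mulOp_mul_tst φ hA, sub_self]
  exact (compactSeq p h).zero_mem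

lemma norm_mulOp_mul_tst_le {φ : Test} {n : ℕ+} {b : ℝ → ℂ} (hb : MemLp b ⊤) {δ : ℝ}
    (hδ : 0 ≤ δ) (hφ : ‖φ‖ ≤ 1) (H : ∀ᵐ x : ℝ, φ ((x / h n : ℝ) : OnePoint ℝ) ≠ 0 → ‖b x‖ ≤ δ) :
    ‖mulOp p b hb * tst p h φ n‖ ≤ δ := by
  rw [tst_apply, mulOp_mul p _ _ (memLp_top_mul hb (memLp_test φ (h n)))]
  refine mulOp_norm_le p _ hδ ?_
  filter_upwards [H] with x hx
  rw [norm_mul]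
  by_cases hz : φ ((x / h n : ℝ) : OnePoint ℝ) = 0
  · rw [hz, norm_zero, mul_zero]; exact hδ
  · exact (mul_le_mul (hx hz) ((φ.norm_coe_le_norm _).trans hφ) (norm_nonneg _) hδ).trans
      (mul_one _).le

/-- The half-line (the whole line for the central direction) seen from a direction. -/
def Direction.side (d : Direction) : Set ℝ := {x | d.pos * x ≤ 0}

lemma Direction.measurableSet_side (d : Direction) : MeasurableSet d.side :=
  measurableSet_le (by fun_prop) (by fun_prop)

lemma norm_indicator_sub_le {s t : Set ℝ} {x y : ℝ} {ε : ℝ} (hε : 0 ≤ ε) (hst : x ∈ s ↔ y ∈ t) :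
    ‖s.indicator (fun _ => (1 : ℂ)) x - t.indicator (fun _ => (1 : ℂ)) y‖ ≤ ε := by
  by_cases hx : x ∈ s
  · rw [indicator_of_mem hx, indicator_of_mem (hst.1 hx), sub_self, norm_zero]; exact hε
  · rw [indicator_of_notMem hx, indicator_of_notMem (fun h => hx (hst.2 h)), sub_self, norm_zero]
    exact hε

lemma good_proj (hp : 1 < p) (hp' : p ≠ ⊤) (hh : Tendsto h atTop atTop) {A : BddSeq p}
    (hA : ∀ n, A n = proj p (h n)) : Good h A := by
  classical
  have hr := tendsto_index hh
  have h1 : ∀ n, ∀ᵐ x, ‖(Icc (-((h n : ℕ+) : ℝ)) (h n)).indicator (fun _ => (1 : ℂ)) x‖ ≤ 1 :=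
    fun n => .of_forall fun x => norm_indicator_one_le _ _
  have hlim : ∀ d : Direction, ∀ m : ℕ+, ∀ ε : ℝ, 0 < ε → ∀ᶠ n in atTop, ∀ᵐ x : ℝ, |x| ≤ m →
      ‖(Icc (-((h n : ℕ+) : ℝ)) (h n)).indicator (fun _ => (1 : ℂ)) (x + d.pos * h n) -
        d.side.indicator (fun _ => (1 : ℂ)) x‖ ≤ ε := fun d m ε hε => by
    filter_upwards [hr.eventually_ge_atTop (m : ℝ)] with n hn
    refine .of_forall fun x hx => norm_indicator_sub_le hε.le ?_
    have hx' := abs_le.1 hx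
    have := index_pos m
    cases d <;> simp only [Direction.side, Direction.pos, mem_Icc, mem_ofPred_eq] <;>
      constructor <;> intro h <;>
      first
        | (constructor <;> linarith [h.1, h.2])
        | linarith [h.1, h.2]
        | (constructor <;> linarith)
  have hs : A ∈ structured p h := by
    refine mulSeq_mem_structured hp hp' (fun n => memLp_indicator _ measurableSet_Icc) h1 hA
      (fun d => ⟨_, memLp_indicator _ d.measurableSet_side, hlim d⟩)
      ⟨_, memLp_indicator (Icc (-1) 1) measurableSet_Icc, .of_forall fun x => ?_⟩
    refine tendsto_const_nhds.congr fun n => ?_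
    have hn := index_pos (h n)
    refine (sub_eq_zero.1 (norm_le_zero_iff.1 (norm_indicator_sub_le le_rfl ?_)))
    rw [mem_Icc, mem_Icc]
    constructor <;> intro hx <;> constructor <;> nlinarith [hx.1, hx.2]
  refine ⟨hs, localType_of_mulOp fun n => ⟨_, _, hA n⟩, fun d =>
    ⟨mulOp p _ (memLp_indicator _ d.measurableSet_side), ?_, ?_, ?_, fun δ hδ =>
      ⟨1, one_pos, fun φ hφ => ⟨0, Submodule.zero_mem _, norm_le_of_forall fun n => ?_⟩⟩⟩⟩
  · simp only [hA]
    exact indexLimit_inl_mulOp (fun n => memLp_indicator _ measurableSet_Icc) h1 _ (hlim d)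
  · refine mulSeq_mem_structured hp hp' (fun n => memLp_shift (memLp_indicator _
      d.measurableSet_side) _) (C := 1) (fun n => .of_forall fun x =>
      norm_indicator_one_le _ _) (fun n => lift_inl_mulOp d (h n) _) (fun e => ?_) ?_
    · refine ⟨_, memLp_indicator (if d = e then d.side else univ)
        (by split_ifs; exacts [d.measurableSet_side, MeasurableSet.univ]), fun m ε hε => ?_⟩
      filter_upwards [hr.eventually_ge_atTop (m : ℝ)] with n hn
      refine .of_forall fun x hx => norm_indicator_sub_le hε.le ?_
      have hx' := abs_le.1 hx
      have := index_pos m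
      split_ifs with hde
      · subst hde
        rw [add_sub_cancel_right]
      · refine iff_of_true ?_ (mem_univ _)
        cases d <;> cases e <;> simp only [Direction.side, Direction.pos, mem_ofPred_eq] <;>
          first
            | exact absurd rfl hde
            | linarith
    · refine ⟨_, memLp_indicator {x | d.pos * (x - d.pos) ≤ 0}
        (measurableSet_le (by fun_prop) (by fun_prop)), .of_forall fun x => ?_⟩
      refine tendsto_const_nhds.congr fun n => ?_
      have hn := index_pos (h n)
      refine (sub_eq_zero.1 (norm_le_zero_iff.1 (norm_indicator_sub_le le_rfl ?_)))
      rw [Direction.side, mem_ofPred_eq, mem_ofPred_eq, ← sub_mul, ← mul_assoc,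
        ← not_lt, ← not_lt,
        mul_pos_iff_of_pos_right hn]
  · exact localType_of_mulOp fun n => ⟨_, _, lift_inl_mulOp d (h n) _⟩
  · rw [sub_zero, bddSeq_mul_apply, bddSeq_sub_apply, hA, liftSeq_apply, lift_inl_mulOp, proj,
      mulOp_sub p _ _ ((memLp_indicator _ measurableSet_Icc).sub
        (memLp_shift (memLp_indicator _ d.measurableSet_side) _))]
    refine norm_mulOp_mul_tst_le _ hδ.le hφ.norm_le (.of_forall fun x hx =>
      norm_indicator_sub_le hδ.le ?_)
    have hn := index_pos (h n)
    have hx' : x / h n ∈ d.nhd 1 := by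
      by_contra hcon
      exact hx (hφ.eq_zero _ hcon)
    have e : x = x / h n * h n := by rw [div_mul_cancel₀ _ hn.ne']
    generalize x / h n = y at hx' e
    subst e
    cases d <;> simp only [Direction.nhd, Direction.side, Direction.pos, mem_Icc, mem_Ioo,
      mem_ofPred_eq] at hx' ⊢ <;>
      constructor <;> intro h <;>
      first
        | (constructor <;> nlinarith [h.1, h.2, hx'.1, hx'.2])
        | nlinarith [h.1, h.2, hx'.1, hx'.2]
        | (constructor <;> nlinarith [hx'.1, hx'.2])

/-- The functions `b n` tend to `α` on the negative and to `β` on the positive half-line, uniformly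
away from the points `0` and `∞`. -/
def ScaleLimits (b : ℕ+ → ℝ → ℂ) (α β : ℂ) : Prop :=
  ∀ R ε : ℝ, 1 < R → 0 < ε → ∀ᶠ n in atTop, ∀ᵐ x : ℝ,
    (R⁻¹ ≤ x → x ≤ R → ‖b n x - β‖ ≤ ε) ∧ (R⁻¹ ≤ -x → -x ≤ R → ‖b n x - α‖ ≤ ε)

lemma ScaleLimits.ae_tendsto {b : ℕ+ → ℝ → ℂ} {α β : ℂ} (hb : ScaleLimits b α β) :
    ∀ᵐ x : ℝ, Tendsto (fun n => b n x) atTop (𝓝 (if 0 < x then β else α)) := by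
  have hN : ∀ i : ℕ, ∃ N, ∀ n, N ≤ n → ∀ᵐ x : ℝ,
      ((i + 2 : ℝ)⁻¹ ≤ x → x ≤ i + 2 → ‖b n x - β‖ ≤ 1 / (i + 1)) ∧
      ((i + 2 : ℝ)⁻¹ ≤ -x → -x ≤ i + 2 → ‖b n x - α‖ ≤ 1 / (i + 1)) := fun i =>
    eventually_atTop.1 (hb (i + 2) (1 / (i + 1)) (by linarith [i.cast_nonneg (α := ℝ)])
      Nat.one_div_pos_of_nat)
  choose N hN using hN
  have hall : ∀ᵐ x : ℝ, ∀ (i : ℕ) (n : ℕ+), N i ≤ n →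
      ((i + 2 : ℝ)⁻¹ ≤ x → x ≤ i + 2 → ‖b n x - β‖ ≤ 1 / (i + 1)) ∧
      ((i + 2 : ℝ)⁻¹ ≤ -x → -x ≤ i + 2 → ‖b n x - α‖ ≤ 1 / (i + 1)) := by
    refine ae_all_iff.2 fun i => ae_all_iff.2 fun n => ?_
    by_cases hn : N i ≤ n
    · filter_upwards [hN i n hn] with x hx _ using hx
    · exact .of_forall fun x h' => absurd h' hn
  filter_upwards [hall, compl_mem_ae_iff.2 (measure_singleton (0 : ℝ))] with x hx hx0
  have hx0' : 0 < |x| := abs_pos.2 hx0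
  rw [tendsto_iff_norm_sub_tendsto_zero]
  refine null_of_eventually_le (fun _ => norm_nonneg _) fun ε hε => ?_
  obtain ⟨i1, hi1⟩ := exists_nat_one_div_lt hε
  obtain ⟨i2, hi2⟩ := exists_nat_ge |x|
  obtain ⟨i3, hi3⟩ := exists_nat_ge |x|⁻¹
  set i := max i1 (max i2 i3)
  have h1 : (i1 : ℝ) ≤ i := by exact_mod_cast le_max_left _ _
  have h2 : (i2 : ℝ) ≤ i := by exact_mod_cast (le_max_left _ _).trans (le_max_right _ _)
  have h3 : (i3 : ℝ) ≤ i := by exact_mod_cast (le_max_right _ _).trans (le_max_right _ _)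
  have hle : (1 : ℝ) / (i + 1) ≤ ε := (one_div_le_one_div_of_le (by positivity)
    (by linarith)).trans hi1.le
  have hup : |x| ≤ (i : ℝ) + 2 := by linarith
  have hlo : ((i : ℝ) + 2)⁻¹ ≤ |x| := inv_le_of_inv_le₀ hx0' (by linarith)
  filter_upwards [eventually_ge_atTop (N i)] with n hn
  obtain ⟨a1, a2⟩ := hx i n hn
  split_ifs with hpos
  · rw [abs_of_pos hpos] at hup hlo
    exact (a1 hlo hup).trans hle
  · rw [abs_of_nonpos (not_lt.1 hpos)] at hup hlo
    exact (a2 hlo hup).trans hle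

/-- Along `h`, the function `a` has limits at `±∞` on the scale of `h`. -/
def InftyLimits (h : ℕ+ → ℕ+) (a : ℝ → ℂ) : Prop :=
  MemLp a ⊤ ∧ ∃ α β : ℂ, ScaleLimits (fun n x => a (x * h n)) α β

lemma memLp_step (α β : ℂ) : MemLp (fun x : ℝ => if 0 < x then β else α) ⊤ :=
  memLp_top_of_norm_le (C := max ‖α‖ ‖β‖) ((Measurable.ite measurableSet_Ioi measurable_const
    measurable_const).aestronglyMeasurable) fun x => by
      split_ifs
      exacts [le_max_right _ _, le_max_left _ _]

lemma exists_essBound {a : ℝ → ℂ} (ha : MemLp a ⊤) : ∃ C : ℝ, 0 ≤ C ∧ ∀ᵐ x, ‖a x‖ ≤ C := by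
  refine ⟨(eLpNorm a ⊤).toReal, ENNReal.toReal_nonneg, ?_⟩
  have h1 := ha.2
  rw [eLpNorm_exponent_top] at h1 ⊢
  filter_upwards [ae_le_eLpNormEssSup (f := a) (μ := (volume : Measure ℝ))] with x hx
  have := ENNReal.toReal_mono h1.ne hx
  simpa using this

lemma InftyLimits.good (hp : 1 < p) (hp' : p ≠ ⊤) (hh : Tendsto h atTop atTop) {a : ℝ → ℂ}
    (ha : InftyLimits h a) {A : BddSeq p} (hA : ∀ n, A n = mulOp p a ha.1) : Good h A := by
  obtain ⟨hm, α, β, hsl⟩ := ha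
  have hl : ∀ R ε : ℝ, 1 < R → 0 < ε → ∀ᶠ n in atTop, ∀ᵐ x : ℝ,
      (R⁻¹ * h n ≤ x → x ≤ R * h n → ‖a x - β‖ ≤ ε) ∧
      (R⁻¹ * h n ≤ -x → -x ≤ R * h n → ‖a x - α‖ ≤ ε) := fun R ε hR hε => by
    filter_upwards [hsl R ε hR hε] with n hn
    have hpos := index_pos (h n)
    filter_upwards [(qmp_div _ hpos).ae hn] with x hx
    rw [div_mul_cancel₀ _ hpos.ne', ← neg_div, le_div_iff₀ hpos, le_div_iff₀ hpos,
      div_le_iff₀ hpos, div_le_iff₀ hpos] at hx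
    exact hx
  have hr := tendsto_index hh
  obtain ⟨C, hC0, hC⟩ := exists_essBound hm
  set s : Direction → ℝ → ℂ := fun d => match d with
    | .minus => fun _ => α
    | .center => a
    | .plus => fun _ => β with hs
  have hsm : ∀ d, MemLp (s d) ⊤ := fun d => by
    cases d
    exacts [memLp_top_const _, hm, memLp_top_const _]
  have hlim : ∀ d : Direction, ∀ m : ℕ+, ∀ ε : ℝ, 0 < ε → ∀ᶠ n in atTop, ∀ᵐ x : ℝ, |x| ≤ m →
      ‖a (x + d.pos * h n) - s d x‖ ≤ ε := fun d m ε hε => by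
    filter_upwards [hl 2 ε one_lt_two hε, hr.eventually_ge_atTop (2 * m : ℝ)] with n hn hmn
    have := index_pos m
    cases d with
    | center =>
      refine .of_forall fun x _ => ?_
      simp only [Direction.pos, zero_mul, add_zero, hs, sub_self, norm_zero]
      exact hε.le
    | minus =>
      filter_upwards [(qmp_sub ((h n : ℕ+) : ℝ)).ae hn] with x hx hxm
      have hxm' := abs_le.1 hxm
      have e : x + Direction.pos .minus * h n = x - h n := by simp only [Direction.pos]; ring
      rw [e]
      exact hx.2 (by linarith) (by linarith)
    | plus =>
      filter_upwards [(qmp_sub (-((h n : ℕ+) : ℝ))).ae hn] with x hx hxm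
      have hxm' := abs_le.1 hxm
      have e : x + Direction.pos .plus * h n = x - -h n := by simp only [Direction.pos]; ring
      rw [e]
      exact hx.1 (by linarith) (by linarith)
  have hA' : ∀ n, ∃ (a : ℝ → ℂ) (ha : MemLp a ⊤), A n = mulOp p a ha := fun n => ⟨_, _, hA n⟩
  have hstr : A ∈ structured p h := by
    refine mulSeq_mem_structured hp hp' (fun _ => hm) (fun _ => hC) hA
      (fun d => ⟨s d, hsm d, hlim d⟩) ⟨_, memLp_step α β, hsl.ae_tendsto⟩
  refine ⟨hstr, localType_of_mulOp hA', fun d => ⟨mulOp p _ (hsm d), ?_, ?_, ?_, ?_⟩⟩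
  · simp only [hA]
    exact indexLimit_inl_mulOp (fun _ => hm) (fun _ => hC) (hsm d) (hlim d)
  · cases d with
    | center =>
      have e : A = liftSeq (.inl .center) h (mulOp p _ (hsm .center)) := by ext1 n; exact hA n
      rw [← e]; exact hstr
    | minus =>
      simp only [hs]
      rw [mulOp_const, liftSeq_smul, liftSeq_one]
      exact (structuredAlg p h).smul_mem (structuredAlg p h).one_mem _
    | plus =>
      simp only [hs]
      rw [mulOp_const, liftSeq_smul, liftSeq_one]
      exact (structuredAlg p h).smul_mem (structuredAlg p h).one_mem _
  · exact localType_of_mulOp fun n => ⟨_, _, lift_inl_mulOp d (h n) _⟩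
  · by_cases hd : d = .center
    · subst hd
      exact locallyEquals_of_eq (by ext1 n; exact hA n)
    intro δ hδ
    refine ⟨1 / 2, by norm_num, fun φ hφ => exists_structuredIdeal_of_eventually_le hδ.le ?_⟩
    filter_upwards [hl 2 δ one_lt_two hδ] with n hn
    have hpos := index_pos (h n)
    rw [bddSeq_mul_apply, bddSeq_sub_apply, hA, liftSeq_apply, lift_inl_mulOp,
      mulOp_sub p _ _ (hm.sub (memLp_shift (hsm d) _))]
    refine norm_mulOp_mul_tst_le _ hδ.le hφ.norm_le ?_
    filter_upwards [hn] with x hx hφx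
    have hx' : x / h n ∈ d.nhd (1 / 2) := by
      by_contra hcon
      exact hφx (hφ.eq_zero _ hcon)
    cases d with
    | center => exact absurd rfl hd
    | minus =>
      rw [Direction.nhd, mem_Ioo, lt_div_iff₀ hpos, div_lt_iff₀ hpos] at hx'
      exact hx.2 (by linarith [hx'.1, hx'.2]) (by linarith [hx'.1, hx'.2])
    | plus =>
      rw [Direction.nhd, mem_Ioo, lt_div_iff₀ hpos, div_lt_iff₀ hpos] at hx'
      exact hx.1 (by linarith [hx'.1, hx'.2]) (by linarith [hx'.1, hx'.2])

end Localization

section SymbolAlgebras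

lemma eLpNorm_top_le_ofReal_iff {a : ℝ → ℂ} {ε : ℝ} (hε : 0 ≤ ε) :
    eLpNorm a ⊤ ≤ ofReal ε ↔ ∀ᵐ x, ‖a x‖ ≤ ε := by
  rw [eLpNorm_exponent_top]
  constructor
  · intro h
    filter_upwards [ae_le_eLpNormEssSup (f := a) (μ := (volume : Measure ℝ))] with x hx
    have := hx.trans h
    rwa [← ofReal_norm, ENNReal.ofReal_le_ofReal_iff hε] at this
  · exact eLpNormEssSup_le_of_ae_bound

/-- A property of functions along index sequences which is asymptotically hereditary, preserved by
the algebraic operations and by uniform limits, and which can be achieved for the generators by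
passing to subsequences, can be achieved for all elements of the generated closed algebra. -/
lemma linfAlg_induction {Q : (ℕ+ → ℕ+) → (ℝ → ℂ) → Prop}
    (hered : ∀ (a : ℝ → ℂ) (h h' m : ℕ+ → ℕ+), Tendsto m atTop atTop →
      (∀ᶠ n in atTop, h' n = h (m n)) → Q h a → Q h' a)
    (const : ∀ (h : ℕ+ → ℕ+) (c : ℂ), StrictMono h → Q h fun _ => c)
    (add : ∀ (h : ℕ+ → ℕ+) (a b : ℝ → ℂ), StrictMono h → Q h a → Q h b → Q h (a + b))
    (mul : ∀ (h : ℕ+ → ℕ+) (a b : ℝ → ℂ), StrictMono h → Q h a → Q h b → Q h (a * b))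
    (approx : ∀ (h : ℕ+ → ℕ+) (a : ℝ → ℂ), StrictMono h → MemLp a ⊤ →
      (∀ ε : ℝ, 0 < ε → ∃ b, Q h b ∧ ∀ᵐ x, ‖a x - b x‖ ≤ ε) → Q h a)
    {S : Set (ℝ → ℂ)}
    (hS : ∀ a ∈ S, ∀ g : ℕ+ → ℕ+, StrictMono g → ∃ k : ℕ+ → ℕ+, StrictMono k ∧ Q (g ∘ k) a) :
    ∀ a ∈ linfAlg S, ∀ g : ℕ+ → ℕ+, StrictMono g → ∃ k : ℕ+ → ℕ+, StrictMono k ∧ Q (g ∘ k) a := by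
  have pair : ∀ a b : ℝ → ℂ,
      (∀ g : ℕ+ → ℕ+, StrictMono g → ∃ k : ℕ+ → ℕ+, StrictMono k ∧ Q (g ∘ k) a) →
      (∀ g : ℕ+ → ℕ+, StrictMono g → ∃ k : ℕ+ → ℕ+, StrictMono k ∧ Q (g ∘ k) b) →
      ∀ g : ℕ+ → ℕ+, StrictMono g → ∃ k : ℕ+ → ℕ+, StrictMono k ∧ Q (g ∘ k) a ∧ Q (g ∘ k) b := by
    intro a b ha hb g hg
    obtain ⟨k, hk, h1⟩ := ha g hg
    obtain ⟨l, hl, h2⟩ := hb _ (hg.comp hk)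
    exact ⟨k ∘ l, hk.comp hl, hered a _ _ l (tendsto_of_strictMono hl)
      (.of_forall fun n => rfl) h1, h2⟩
  have hadj : ∀ a ∈ Algebra.adjoin ℂ S, ∀ g : ℕ+ → ℕ+, StrictMono g →
      ∃ k : ℕ+ → ℕ+, StrictMono k ∧ Q (g ∘ k) a := by
    intro a ha
    induction ha using Algebra.adjoin_induction with
    | mem a ha => exact hS a ha
    | algebraMap c => exact fun g hg => ⟨id, strictMono_id, const _ c hg⟩
    | add a b _ _ ha hb =>
      intro g hg
      obtain ⟨k, hk, h1, h2⟩ := pair a b ha hb g hg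
      exact ⟨k, hk, add _ a b (hg.comp hk) h1 h2⟩
    | mul a b _ _ ha hb =>
      intro g hg
      obtain ⟨k, hk, h1, h2⟩ := pair a b ha hb g hg
      exact ⟨k, hk, mul _ a b (hg.comp hk) h1 h2⟩
  rintro a ⟨ha, happ⟩ g hg
  have hpos : ∀ i : ℕ, (0 : ℝ) < 1 / ((i : ℝ) + 1) := fun i => Nat.one_div_pos_of_nat
  choose b hb hab using fun i : ℕ => happ _ (hpos i)
  obtain ⟨k, hk, H⟩ := exists_diagonal (P := fun i h => Q h (b i))
    (fun i h h' m hm he => hered (b i) h h' m hm he) (fun i => hadj _ (hb i)) hg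
  refine ⟨k, hk, approx _ a (hg.comp hk) ha fun ε hε => ?_⟩
  obtain ⟨i, hi⟩ := exists_nat_one_div_lt hε
  refine ⟨b i, H i, ?_⟩
  filter_upwards [(eLpNorm_top_le_ofReal_iff (hpos i).le).1 (hab i)] with x hx
  exact hx.trans hi.le

lemma ScaleLimits.of_eventually {b b' : ℕ+ → ℝ → ℂ} {m : ℕ+ → ℕ+} {α β : ℂ}
    (hm : Tendsto m atTop atTop) (he : ∀ᶠ n in atTop, b' n = b (m n)) (hb : ScaleLimits b α β) :
    ScaleLimits b' α β := fun R ε hR hε => by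
  filter_upwards [he, hm.eventually (hb R ε hR hε)] with n h1 h2
  rw [h1]; exact h2

lemma scaleLimits_const (c : ℂ) : ScaleLimits (fun _ _ => c) c c := fun R ε hR hε =>
  .of_forall fun n => .of_forall fun x => by simp [hε.le]

lemma ScaleLimits.add {a b : ℕ+ → ℝ → ℂ} {α β γ δ : ℂ} (ha : ScaleLimits a α β)
    (hb : ScaleLimits b γ δ) : ScaleLimits (fun n x => a n x + b n x) (α + γ) (β + δ) :=
  fun R ε hR hε => by
    filter_upwards [ha R (ε / 2) hR (half_pos hε), hb R (ε / 2) hR (half_pos hε)] with n h1 h2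
    filter_upwards [h1, h2] with x k1 k2
    refine ⟨fun r1 r2 => ?_, fun r1 r2 => ?_⟩
    · rw [add_sub_add_comm]
      exact (norm_add_le_of_le (k1.1 r1 r2) (k2.1 r1 r2)).trans (by linarith)
    · rw [add_sub_add_comm]
      exact (norm_add_le_of_le (k1.2 r1 r2) (k2.2 r1 r2)).trans (by linarith)

lemma norm_mul_sub_mul_le {x y α β : ℂ} {C η : ℝ} (hx : ‖x‖ ≤ C) (h1 : ‖x - α‖ ≤ η)
    (h2 : ‖y - β‖ ≤ η) : ‖x * y - α * β‖ ≤ (C + ‖β‖) * η := by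
  have e : x * y - α * β = x * (y - β) + (x - α) * β := by ring
  rw [e]
  refine (norm_add_le_of_le (norm_mul_le_of_le hx h2) (norm_mul_le_of_le h1 le_rfl)).trans ?_
  linarith [mul_comm η ‖β‖]

lemma ScaleLimits.mul {a b : ℕ+ → ℝ → ℂ} {α β γ δ : ℂ} {C : ℝ} (hC : ∀ n, ∀ᵐ x, ‖a n x‖ ≤ C)
    (ha : ScaleLimits a α β) (hb : ScaleLimits b γ δ) :
    ScaleLimits (fun n x => a n x * b n x) (α * γ) (β * δ) := fun R ε hR hε => by
  obtain ⟨x, hx⟩ := (hC 1).exists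
  have hC0 : 0 ≤ C := (norm_nonneg _).trans hx
  set D := C + ‖γ‖ + ‖δ‖ + 1
  have hD : 0 < D := by positivity
  filter_upwards [ha R (ε / D) hR (by positivity), hb R (ε / D) hR (by positivity)] with n h1 h2
  filter_upwards [h1, h2, hC n] with x k1 k2 k3
  have hη : 0 ≤ ε / D := by positivity
  refine ⟨fun r1 r2 => ?_, fun r1 r2 => ?_⟩
  · refine (norm_mul_sub_mul_le k3 (k1.1 r1 r2) (k2.1 r1 r2)).trans ?_
    rw [mul_div_assoc', div_le_iff₀ hD, mul_comm]
    exact mul_le_mul_of_nonneg_left (by simp only [D]; linarith [norm_nonneg γ]) hε.le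
  · refine (norm_mul_sub_mul_le k3 (k1.2 r1 r2) (k2.2 r1 r2)).trans ?_
    rw [mul_div_assoc', div_le_iff₀ hD, mul_comm]
    exact mul_le_mul_of_nonneg_left (by simp only [D]; linarith [norm_nonneg δ]) hε.le

/-- Uniform limits of functions with limits on the scale have such limits. -/
lemma exists_scaleLimits_of_approx {a : ℕ+ → ℝ → ℂ}
    (H : ∀ ε : ℝ, 0 < ε → ∃ (b : ℕ+ → ℝ → ℂ) (α β : ℂ), ScaleLimits b α β ∧
      ∀ n, ∀ᵐ x, ‖a n x - b n x‖ ≤ ε) : ∃ α β, ScaleLimits a α β := by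
  have hpos : ∀ i : ℕ, (0 : ℝ) < 1 / ((i : ℝ) + 1) := fun i => Nat.one_div_pos_of_nat
  choose b α β hb hab using fun i : ℕ => H _ (hpos i)
  have key : ∀ i j, ‖α i - α j‖ ≤ 2 * (1 / (i + 1) + 1 / (j + 1)) ∧
      ‖β i - β j‖ ≤ 2 * (1 / (i + 1) + 1 / (j + 1)) := fun i j => by
    obtain ⟨n, h1, h2⟩ := ((hb i 2 _ one_lt_two (hpos i)).and (hb j 2 _ one_lt_two (hpos j))).exists
    have hall : ∀ᵐ x : ℝ, ((2⁻¹ ≤ x → x ≤ 2 → ‖β i - β j‖ ≤ 2 * (1 / (i + 1) + 1 / (j + 1)))) ∧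
        (2⁻¹ ≤ -x → -x ≤ 2 → ‖α i - α j‖ ≤ 2 * (1 / (i + 1) + 1 / (j + 1))) := by
      filter_upwards [h1, h2, hab i n, hab j n] with x k1 k2 k3 k4
      have hd : ‖b i n x - b j n x‖ ≤ 1 / (j + 1) + 1 / (i + 1) := by
        have e : b i n x - b j n x = (a n x - b j n x) - (a n x - b i n x) := by ring
        rw [e]; exact norm_sub_le_of_le k4 k3
      refine ⟨fun r1 r2 => ?_, fun r1 r2 => ?_⟩
      · have e : β i - β j = (b i n x - b j n x) - (b i n x - β i) + (b j n x - β j) := by ring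
        rw [e]
        exact (norm_add_le_of_le (norm_sub_le_of_le hd (k1.1 r1 r2)) (k2.1 r1 r2)).trans (by linarith)
      · have e : α i - α j = (b i n x - b j n x) - (b i n x - α i) + (b j n x - α j) := by ring
        rw [e]
        exact (norm_add_le_of_le (norm_sub_le_of_le hd (k1.2 r1 r2)) (k2.2 r1 r2)).trans (by linarith)
    have pick : ∀ s : Set ℝ, 0 < volume s → ∃ x ∈ s, ((2⁻¹ ≤ x → x ≤ 2 →
        ‖β i - β j‖ ≤ 2 * (1 / (i + 1) + 1 / (j + 1)))) ∧
        (2⁻¹ ≤ -x → -x ≤ 2 → ‖α i - α j‖ ≤ 2 * (1 / (i + 1) + 1 / (j + 1))) := fun s hs => by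
      by_contra hcon
      push Not at hcon
      refine hs.ne' (measure_mono_null (fun x hx => ?_) hall)
      intro hx'
      exact absurd (hcon x hx hx'.1) (by
        rintro ⟨a1, a2, a3⟩; exact absurd (hx'.2 a1 a2) (not_le.2 a3))
    obtain ⟨x, hx, hx1⟩ := pick (Ioo 1 2) (by simp)
    obtain ⟨y, hy, hy1⟩ := pick (Ioo (-2) (-1)) (by norm_num)
    exact ⟨hy1.2 (by linarith [hy.2, hy.1]) (by linarith [hy.2, hy.1]),
      hx1.1 (by linarith [hx.1]) hx.2.le⟩
  have hc : ∀ γ : ℕ → ℂ, (∀ i j, ‖γ i - γ j‖ ≤ 2 * (1 / (i + 1) + 1 / (j + 1))) → ∃ l,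
      ∀ i, ‖γ i - l‖ ≤ 2 * (1 / (i + 1)) := fun γ hγ => by
    have hcau : CauchySeq γ := by
      rw [Metric.cauchySeq_iff']
      intro ε hε
      obtain ⟨N, hN⟩ := exists_nat_one_div_lt (show 0 < ε / 4 by positivity)
      refine ⟨N, fun n hn => ?_⟩
      rw [dist_eq_norm]
      have : (1 : ℝ) / (n + 1) ≤ 1 / (N + 1) :=
        one_div_le_one_div_of_le (by positivity) (by exact_mod_cast Nat.succ_le_succ hn)
      exact (hγ n N).trans_lt (by linarith)
    obtain ⟨l, hl⟩ := cauchySeq_tendsto_of_complete hcau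
    refine ⟨l, fun i => le_of_tendsto_of_tendsto ((hl.const_sub (γ i)).norm)
      (((tendsto_one_div_add_atTop_nhds_zero_nat (𝕜 := ℝ)).const_add _).const_mul 2)
      (.of_forall (hγ i)) |>.trans (by simp)⟩
  obtain ⟨lα, hlα⟩ := hc α fun i j => (key i j).1
  obtain ⟨lβ, hlβ⟩ := hc β fun i j => (key i j).2
  refine ⟨lα, lβ, fun R ε hR hε => ?_⟩
  obtain ⟨i, hi⟩ := exists_nat_one_div_lt (show 0 < ε / 4 by positivity)
  filter_upwards [hb i R _ hR (hpos i)] with n hn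
  filter_upwards [hn, hab i n] with x k1 k2
  refine ⟨fun r1 r2 => ?_, fun r1 r2 => ?_⟩
  · have e : a n x - lβ = (a n x - b i n x) + (b i n x - β i) + (β i - lβ) := by ring
    rw [e]
    exact (norm_add_le_of_le (norm_add_le_of_le k2 (k1.1 r1 r2)) (hlβ i)).trans (by linarith)
  · have e : a n x - lα = (a n x - b i n x) + (b i n x - α i) + (α i - lα) := by ring
    rw [e]
    exact (norm_add_le_of_le (norm_add_le_of_le k2 (k1.2 r1 r2)) (hlα i)).trans (by linarith)

lemma inftyLimits_of_tendsto {h : ℕ+ → ℕ+} (hh : Tendsto h atTop atTop) {a : ℝ → ℂ}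
    (ha : MemLp a ⊤) {α β : ℂ} (hα : Tendsto a atBot (𝓝 α)) (hβ : Tendsto a atTop (𝓝 β)) :
    InftyLimits h a := by
  refine ⟨ha, α, β, fun R ε hR hε => ?_⟩
  have hR0 : 0 < R := by linarith
  obtain ⟨M1, hM1⟩ := eventually_atTop.1 (Metric.tendsto_nhds.1 hβ ε hε)
  obtain ⟨M2, hM2⟩ := eventually_atBot.1 (Metric.tendsto_nhds.1 hα ε hε)
  filter_upwards [(tendsto_index hh).eventually_ge_atTop (R * max |M1| |M2|)] with n hn
  have hpos := index_pos (h n)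
  have hle : max |M1| |M2| ≤ R⁻¹ * h n := by
    rw [inv_mul_eq_div, le_div_iff₀ hR0, mul_comm]; exact hn
  refine .of_forall fun x => ⟨fun h1 _ => ?_, fun h1 _ => ?_⟩
  · rw [← dist_eq_norm]
    refine (hM1 _ ?_).le
    have := mul_le_mul_of_nonneg_right h1 hpos.le
    linarith [le_max_left |M1| |M2|, le_abs_self M1]
  · rw [← dist_eq_norm]
    refine (hM2 _ ?_).le
    have := mul_le_mul_of_nonneg_right h1 hpos.le
    linarith [le_max_right |M1| |M2|, neg_abs_le M2]

end SymbolAlgebras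

section InftyLimitsAlgebra

variable {h : ℕ+ → ℕ+}

lemma InftyLimits.of_eventually {h' m : ℕ+ → ℕ+} {a : ℝ → ℂ} (hm : Tendsto m atTop atTop)
    (he : ∀ᶠ n in atTop, h' n = h (m n)) (ha : InftyLimits h a) : InftyLimits h' a := by
  obtain ⟨h1, α, β, h2⟩ := ha
  refine ⟨h1, α, β, h2.of_eventually hm ?_⟩
  filter_upwards [he] with n hn
  rw [hn]

lemma exists_essBound_index {a : ℝ → ℂ} (ha : MemLp a ⊤) :
    ∃ C : ℝ, ∀ n, ∀ᵐ x : ℝ, ‖a (x * h n)‖ ≤ C := by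
  obtain ⟨C, -, hC⟩ := exists_essBound ha
  refine ⟨C, fun n => ?_⟩
  simpa only [div_inv_eq_mul] using (qmp_div _ (inv_pos.2 (index_pos (h n)))).ae hC

lemma exists_subseq_inftyLimits {S : Set (ℝ → ℂ)}
    (hS : ∀ a ∈ S, ∀ g : ℕ+ → ℕ+, StrictMono g →
      ∃ k : ℕ+ → ℕ+, StrictMono k ∧ InftyLimits (g ∘ k) a) :
    ∀ a ∈ linfAlg S, ∀ g : ℕ+ → ℕ+, StrictMono g →
      ∃ k : ℕ+ → ℕ+, StrictMono k ∧ InftyLimits (g ∘ k) a := by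
  refine linfAlg_induction (fun a h h' m hm he ha => ha.of_eventually hm he)
    (fun h c _ => ⟨memLp_top_const c, c, c, scaleLimits_const c⟩) ?_ ?_ ?_ hS
  · rintro h a b - ⟨ha, α, β, ha'⟩ ⟨hb, γ, δ, hb'⟩
    exact ⟨ha.add hb, _, _, ha'.add hb'⟩
  · rintro h a b - ⟨ha, α, β, ha'⟩ ⟨hb, γ, δ, hb'⟩
    obtain ⟨C, hC⟩ := exists_essBound_index (h := h) ha
    exact ⟨memLp_top_mul ha hb, _, _, ha'.mul hC hb'⟩
  · intro h a _ ha H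
    refine ⟨ha, exists_scaleLimits_of_approx fun ε hε => ?_⟩
    obtain ⟨b, ⟨-, α, β, hb⟩, hab⟩ := H ε hε
    refine ⟨_, α, β, hb, fun n => ?_⟩
    simpa only [div_inv_eq_mul] using (qmp_div _ (inv_pos.2 (index_pos (h n)))).ae hab

end InftyLimitsAlgebra

section Regularity

lemma tendsto_atTop_of_cocompact {f : ℝ → ℂ} {l : ℂ} (h : Tendsto f (cocompact ℝ) (𝓝 l)) :
    Tendsto f atTop (𝓝 l) := h.mono_left atTop_le_cocompact

lemma tendsto_atBot_of_cocompact {f : ℝ → ℂ} {l : ℂ} (h : Tendsto f (cocompact ℝ) (𝓝 l)) :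
    Tendsto f atBot (𝓝 l) := h.mono_left atBot_le_cocompact

lemma aestronglyMeasurable_of_continuousOn_compl {c : ℝ} {f : ℝ → ℂ}
    (hf : ContinuousOn f {c}ᶜ) : AEStronglyMeasurable f := by
  have := hf.aestronglyMeasurable (μ := volume) (measurableSet_singleton c).compl
  rwa [Measure.restrict_eq_self_of_ae_mem] at this
  exact compl_mem_ae_iff.2 (measure_singleton c)

lemma exists_bound_compact {f : ℝ → ℂ} {c : ℝ} {K : Set ℝ} (hK : IsCompact K)
    (hf : ∀ x ∈ K, ∃ C : ℝ, ∀ᶠ y in 𝓝[≠] x, ‖f y‖ ≤ C) :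
    ∃ C : ℝ, ∀ᵐ x : ℝ, x ∈ K → ‖f x‖ ≤ C := by
  refine hK.induction_on (p := fun s => ∃ C : ℝ, ∀ᵐ x : ℝ, x ∈ s → ‖f x‖ ≤ C) ?_ ?_ ?_ ?_
  · exact ⟨0, by simp⟩
  · rintro s t hst ⟨C, hC⟩
    exact ⟨C, hC.mono fun x hx hs => hx (hst hs)⟩
  · rintro s t ⟨C, hC⟩ ⟨D, hD⟩
    refine ⟨max C D, ?_⟩
    filter_upwards [hC, hD] with x h1 h2 hx
    exact hx.elim (fun h => (h1 h).trans (le_max_left _ _)) fun h => (h2 h).trans (le_max_right _ _)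
  · intro x hx
    obtain ⟨C, hC⟩ := hf x hx
    refine ⟨_, mem_nhdsWithin_of_mem_nhds (eventually_nhdsWithin_iff.1 hC), C, ?_⟩
    filter_upwards [compl_mem_ae_iff.2 (measure_singleton x)] with y hy h'
    exact h' hy

lemma eventually_norm_le_of_tendsto {ι : Type*} {l : Filter ι} {f : ι → ℂ} {a : ℂ}
    (h : Tendsto f l (𝓝 a)) : ∀ᶠ x in l, ‖f x‖ ≤ ‖a‖ + 1 :=
  (h.norm.eventually (gt_mem_nhds (lt_add_one _))).mono fun _ => le_of_lt

lemma memLp_of_locally_bounded {f : ℝ → ℂ} (hm : AEStronglyMeasurable f) {l l' : ℂ}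
    (h1 : Tendsto f atBot (𝓝 l)) (h2 : Tendsto f atTop (𝓝 l'))
    (hf : ∀ x, ∃ C : ℝ, ∀ᶠ y in 𝓝[≠] x, ‖f y‖ ≤ C) : MemLp f ⊤ := by
  obtain ⟨a, ha⟩ := eventually_atBot.1 (eventually_norm_le_of_tendsto h1)
  obtain ⟨b, hb⟩ := eventually_atTop.1 (eventually_norm_le_of_tendsto h2)
  obtain ⟨C, hC⟩ := exists_bound_compact (c := 0) (isCompact_Icc (a := a) (b := b)) fun x _ => hf x
  refine memLp_top_of_bound hm (max C (max (‖l‖ + 1) (‖l'‖ + 1))) ?_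
  filter_upwards [hC] with x hx
  by_cases h3 : x ≤ a
  · exact (ha x h3).trans ((le_max_left _ _).trans (le_max_right _ _))
  by_cases h4 : b ≤ x
  · exact (hb x h4).trans ((le_max_right _ _).trans (le_max_right _ _))
  · exact (hx ⟨by linarith, by linarith⟩).trans (le_max_left _ _)

lemma ContinuousOffPoint.continuousAt {c x : ℝ} {f : ℝ → ℂ} (hf : ContinuousOffPoint c f)
    (hx : x ≠ c) : ContinuousAt f x :=
  hf.1.continuousAt (isOpen_compl_singleton.mem_nhds hx)

lemma memLp_of_mem_pcAt {c : ℝ} {f : ℝ → ℂ} (hf : f ∈ pcAt c) : MemLp f ⊤ := by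
  obtain ⟨h1, ⟨l, hl⟩, ⟨l', hl'⟩⟩ := hf
  obtain ⟨l₀, hl₀⟩ := h1.2
  refine memLp_of_locally_bounded (aestronglyMeasurable_of_continuousOn_compl h1.1)
    (tendsto_atBot_of_cocompact hl₀) (tendsto_atTop_of_cocompact hl₀) fun x => ?_
  by_cases hx : x = c
  · subst hx
    refine ⟨max (‖l‖ + 1) (‖l'‖ + 1), ?_⟩
    rw [← Iio_union_Ioi, nhdsWithin_union, eventually_sup]
    exact ⟨(eventually_norm_le_of_tendsto hl).mono fun _ h => h.trans (le_max_left _ _),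
      (eventually_norm_le_of_tendsto hl').mono fun _ h => h.trans (le_max_right _ _)⟩
  · exact ⟨_, (eventually_norm_le_of_tendsto (h1.continuousAt hx)).filter_mono nhdsWithin_le_nhds⟩

lemma memLp_of_mem_pcInfty {f : ℝ → ℂ} (hf : f ∈ pcInfty) : MemLp f ⊤ := by
  obtain ⟨h1, ⟨l, hl⟩, ⟨l', hl'⟩⟩ := hf
  exact memLp_of_locally_bounded h1.aestronglyMeasurable hl hl' fun x =>
    ⟨_, (eventually_norm_le_of_tendsto h1.continuousAt).filter_mono nhdsWithin_le_nhds⟩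

/-- The essential oscillation bounds the oscillation at interior points of continuity. -/
lemma enorm_sub_le_essOsc {f : ℝ → ℂ} {I : Set ℝ} {s t : ℝ} (hs : s ∈ interior I)
    (ht : t ∈ interior I) (hfs : ContinuousAt f s) (hft : ContinuousAt f t) :
    ‖f s - f t‖ₑ ≤ essOsc f I := by
  by_contra hcon
  push Not at hcon
  have hc : ContinuousAt (fun z : ℝ × ℝ => ‖f z.1 - f z.2‖ₑ) (s, t) :=
    ((hfs.comp (x := (s, t)) continuousAt_fst).sub (hft.comp (x := (s, t)) continuousAt_snd)).enorm
  have hev := (hc.eventually (lt_mem_nhds hcon)).and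
    ((isOpen_interior.prod isOpen_interior).mem_nhds (⟨hs, ht⟩ : (s, t) ∈ interior I ×ˢ interior I))
  obtain ⟨U, hU, V, hV, hUV⟩ := mem_nhds_prod_iff.1 hev
  obtain ⟨U', hU', hUo, hsU⟩ := mem_nhds_iff.1 hU
  obtain ⟨V', hV', hVo, htV⟩ := mem_nhds_iff.1 hV
  have hae : ∀ᵐ z ∂(volume.restrict I).prod (volume.restrict I), ‖f z.1 - f z.2‖ₑ ≤ essOsc f I :=
    ae_le_essSup (f := fun z : ℝ × ℝ => ‖f z.1 - f z.2‖ₑ)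
  have hzero : ((volume.restrict I).prod (volume.restrict I)) (U' ×ˢ V') = 0 := by
    refine measure_mono_null (fun z hz => ?_) hae
    have := (hUV ⟨hU' hz.1, hV' hz.2⟩).1
    exact not_le.2 this
  rw [Measure.prod_prod, mul_eq_zero, Measure.restrict_apply hUo.measurableSet,
    Measure.restrict_apply hVo.measurableSet] at hzero
  have hUI : U' ⊆ I := fun x hx => interior_subset (hUV (⟨hU' hx, hV' htV⟩ : (x, t) ∈ U ×ˢ V)).2.1
  have hVI : V' ⊆ I := fun x hx => interior_subset (hUV (⟨hU' hsU, hV' hx⟩ : (s, x) ∈ U ×ˢ V)).2.2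
  rw [inter_eq_left.2 hUI, inter_eq_left.2 hVI] at hzero
  exact hzero.elim (hUo.measure_pos volume ⟨s, hsU⟩).ne' (hVo.measure_pos volume ⟨t, htV⟩).ne'

lemma soInfty_oscillation {f : ℝ → ℂ} (hf : f ∈ soInfty) {R : ℝ} (hR : 1 < R) {ε : ℝ}
    (hε : 0 < ε) : ∃ X : ℝ, 0 < X ∧ ∀ s t : ℝ, X ≤ |s| → |s| ≤ R * |t| → |t| ≤ R * |s| →
      ‖f s - f t‖ ≤ ε := by
  obtain ⟨hc, -, hosc⟩ := hf
  have hr : (4 * R ^ 2)⁻¹ ∈ Ioo (0 : ℝ) 1 := ⟨by positivity, inv_lt_one_of_one_lt₀ (by nlinarith)⟩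
  have hev := (hosc _ hr).eventually (ge_mem_nhds (show (0 : ℝ≥0∞) < ofReal ε by simpa))
  obtain ⟨X, hX⟩ := eventually_atTop.1 hev
  refine ⟨max X 1, by positivity, fun s t hs h1 h2 => ?_⟩
  have hs1 : 1 ≤ |s| := (le_max_right _ _).trans hs
  have hsX : X ≤ |s| := (le_max_left _ _).trans hs
  have hm := hX (2 * R * |s|) (by nlinarith)
  have hmem : ∀ y : ℝ, (2 * R)⁻¹ * |s| < |y| → |y| < 2 * R * |s| →
      y ∈ interior (Icc (-(2 * R * |s|)) (-((4 * R ^ 2)⁻¹ * (2 * R * |s|))) ∪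
        Icc ((4 * R ^ 2)⁻¹ * (2 * R * |s|)) (2 * R * |s|)) := fun y hy1 hy2 => by
    have e : (4 * R ^ 2)⁻¹ * (2 * R * |s|) = (2 * R)⁻¹ * |s| := by
      have : R ≠ 0 := by linarith
      field_simp; ring
    rw [e]
    rcases le_total 0 y with hy | hy
    · rw [abs_of_nonneg hy] at hy1 hy2
      refine interior_mono subset_union_right ?_
      rw [interior_Icc]; exact ⟨hy1, hy2⟩
    · rw [abs_of_nonpos hy] at hy1 hy2
      refine interior_mono subset_union_left ?_
      rw [interior_Icc]; exact ⟨by linarith, by linarith⟩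
  have hinv : (2 * R)⁻¹ * |s| * (2 * R) = |s| := by
    rw [mul_comm, ← mul_assoc, mul_inv_cancel₀ (by positivity), one_mul]
  have hbd := enorm_sub_le_essOsc (hmem s (by nlinarith) (by nlinarith))
    (hmem t (by nlinarith) (by nlinarith)) hc.continuousAt hc.continuousAt
  have := hbd.trans hm
  rwa [← ofReal_norm, ENNReal.ofReal_le_ofReal_iff hε.le] at this

lemma soAt_oscillation {c : ℝ} {f : ℝ → ℂ} (hf : f ∈ soAt c) {R : ℝ} (hR : 1 < R) {ε : ℝ}
    (hε : 0 < ε) : ∃ X : ℝ, 0 < X ∧ ∀ s t : ℝ, s ≠ c → |s - c| ≤ X → |s - c| ≤ R * |t - c| →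
      |t - c| ≤ R * |s - c| → ‖f s - f t‖ ≤ ε := by
  obtain ⟨hc, -, hosc⟩ := hf
  have hr : (4 * R ^ 2)⁻¹ ∈ Ioo (0 : ℝ) 1 := ⟨by positivity, inv_lt_one_of_one_lt₀ (by nlinarith)⟩
  have hev := (hosc _ hr).eventually (ge_mem_nhds (show (0 : ℝ≥0∞) < ofReal ε by simpa))
  obtain ⟨X, hX0, hX⟩ := mem_nhdsGT_iff_exists_Ioc_subset.1 hev
  have hX0' : 0 < X := hX0
  refine ⟨X / (2 * R), by positivity, fun s t hsc hs h1 h2 => ?_⟩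
  have hs0 : 0 < |s - c| := abs_pos.2 (sub_ne_zero.2 hsc)
  have ht0 : 0 < |t - c| := by nlinarith
  have hm : essOsc f (Icc (c - 2 * R * |s - c|) (c - (4 * R ^ 2)⁻¹ * (2 * R * |s - c|)) ∪
      Icc (c + (4 * R ^ 2)⁻¹ * (2 * R * |s - c|)) (c + 2 * R * |s - c|)) ≤ ofReal ε :=
    hX ⟨by positivity, by rwa [le_div_iff₀ (by positivity), mul_comm] at hs⟩
  have hmem : ∀ y : ℝ, (2 * R)⁻¹ * |s - c| < |y - c| → |y - c| < 2 * R * |s - c| →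
      y ∈ interior (Icc (c - 2 * R * |s - c|) (c - (4 * R ^ 2)⁻¹ * (2 * R * |s - c|)) ∪
      Icc (c + (4 * R ^ 2)⁻¹ * (2 * R * |s - c|)) (c + 2 * R * |s - c|)) := fun y hy1 hy2 => by
    have e : (4 * R ^ 2)⁻¹ * (2 * R * |s - c|) = (2 * R)⁻¹ * |s - c| := by
      have : R ≠ 0 := by linarith
      field_simp; ring
    rw [e]
    rcases le_total 0 (y - c) with hy | hy
    · rw [abs_of_nonneg hy] at hy1 hy2
      refine interior_mono subset_union_right ?_
      rw [interior_Icc]; exact ⟨by linarith, by linarith⟩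
    · rw [abs_of_nonpos hy] at hy1 hy2
      refine interior_mono subset_union_left ?_
      rw [interior_Icc]; exact ⟨by linarith, by linarith⟩
  have hinv : (2 * R)⁻¹ * |s - c| * (2 * R) = |s - c| := by
    rw [mul_comm, ← mul_assoc, mul_inv_cancel₀ (by positivity), one_mul]
  have htc : t ≠ c := fun e => by rw [e, sub_self, abs_zero] at ht0; exact ht0.false
  have hbd := enorm_sub_le_essOsc (hmem s (by nlinarith) (by nlinarith))
    (hmem t (by nlinarith) (by nlinarith)) (hc.continuousAt hsc) (hc.continuousAt htc)
  have := hbd.trans hm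
  rwa [← ofReal_norm, ENNReal.ofReal_le_ofReal_iff hε.le] at this

/-- Bounded sequences of complex numbers have convergent subsequences. -/
lemma exists_tendsto_subseq {v : ℕ+ → ℂ} {C : ℝ} (hv : ∀ n, ‖v n‖ ≤ C) :
    ∃ (l : ℂ) (k : ℕ+ → ℕ+), StrictMono k ∧ Tendsto (fun n => v (k n)) atTop (𝓝 l) := by
  obtain ⟨l, -, φ, hφ, hl⟩ := tendsto_subseq_of_bounded (Metric.isBounded_closedBall (x := (0 : ℂ))
    (r := C)) (x := fun i : ℕ => v i.succPNat) fun i => by simpa using hv _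
  refine ⟨l, fun n => (φ n).succPNat, fun a b hab => Nat.succPNat_lt_succPNat.2 (hφ (by exact_mod_cast hab)), ?_⟩
  exact hl.comp tendsto_PNat_val_atTop_atTop

end Regularity

section MultiplierCoefficients

lemma exists_inftyLimits_soInfty {f : ℝ → ℂ} (hf : f ∈ soInfty) {g : ℕ+ → ℕ+}
    (hg : StrictMono g) : ∃ k : ℕ+ → ℕ+, StrictMono k ∧ InftyLimits (g ∘ k) f := by
  obtain ⟨C, hC0, hC⟩ := exists_essBound hf.2.1
  have hC' : ∀ x, ‖f x‖ ≤ C := fun x =>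
    (isClosed_le (continuous_norm.comp hf.1) continuous_const).closure_subset_iff.2
      (fun _ h => h) (Measure.dense_of_ae hC x)
  obtain ⟨l, k, hk, hl⟩ := exists_tendsto_subseq (v := fun n => f (g n)) fun n => hC' _
  refine ⟨k, hk, hf.2.1, l, l, fun R ε hR hε => ?_⟩
  obtain ⟨X, hX, hosc⟩ := soInfty_oscillation hf hR (half_pos hε)
  filter_upwards [Metric.tendsto_nhds.1 hl _ (half_pos hε),
    (tendsto_index (tendsto_of_strictMono (hg.comp hk))).eventually_ge_atTop X] with n h1 h2
  have hpos := index_pos ((g ∘ k) n)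
  have hR0 : 0 < R := by linarith
  have key : ∀ x : ℝ, R⁻¹ ≤ |x| → |x| ≤ R → ‖f (x * (g ∘ k) n) - l‖ ≤ ε := fun x r1 r2 => by
    have e : f (x * (g ∘ k) n) - l = -(f ((g ∘ k) n) - f (x * (g ∘ k) n)) + (f ((g ∘ k) n) - l) := by
      ring
    rw [e]
    rw [dist_eq_norm] at h1
    have r1' : 1 ≤ R * |x| := by rwa [inv_le_iff_one_le_mul₀' hR0] at r1
    refine (norm_add_le_of_le ((norm_neg _).trans_le (hosc _ _ ?_ ?_ ?_)) h1.le).trans (by linarith)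
    · rwa [abs_of_pos hpos]
    · rw [abs_mul, abs_of_pos hpos, ← mul_assoc]; nlinarith
    · rw [abs_mul, abs_of_pos hpos]; nlinarith
  refine .of_forall fun x => ⟨fun r1 r2 => key x (r1.trans (le_abs_self x)) ?_,
    fun r1 r2 => key x (r1.trans (neg_le_abs x)) ?_⟩
  · rwa [abs_of_nonneg ((inv_pos.2 hR0).le.trans r1)]
  · rwa [← abs_neg, abs_of_nonneg ((inv_pos.2 hR0).le.trans r1)]

lemma exists_inftyLimits {a : ℝ → ℂ} (ha : a ∈ linfAlg (pc ∪ so ∪ linfZero)) :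
    ∀ g : ℕ+ → ℕ+, StrictMono g → ∃ k : ℕ+ → ℕ+, StrictMono k ∧ InftyLimits (g ∘ k) a := by
  refine exists_subseq_inftyLimits ?_ a ha
  rintro a ((ha | ha) | ha) g hg
  · refine exists_subseq_inftyLimits ?_ a ha g hg
    rintro a (ha | ha) g hg
    · obtain ⟨c, ha⟩ := mem_iUnion.1 ha
      obtain ⟨l, hl⟩ := ha.1.2
      exact ⟨id, strictMono_id, inftyLimits_of_tendsto (tendsto_of_strictMono hg)
        (memLp_of_mem_pcAt ha) (tendsto_atBot_of_cocompact hl) (tendsto_atTop_of_cocompact hl)⟩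
    · obtain ⟨l, hl⟩ := ha.2.1
      obtain ⟨l', hl'⟩ := ha.2.2
      exact ⟨id, strictMono_id, inftyLimits_of_tendsto (tendsto_of_strictMono hg)
        (memLp_of_mem_pcInfty ha) hl hl'⟩
  · refine exists_subseq_inftyLimits ?_ a ha g hg
    rintro a (ha | ha) g hg
    · obtain ⟨c, ha⟩ := mem_iUnion.1 ha
      obtain ⟨l, hl⟩ := ha.1.2
      exact ⟨id, strictMono_id, inftyLimits_of_tendsto (tendsto_of_strictMono hg)
        ha.2.1 (tendsto_atBot_of_cocompact hl) (tendsto_atTop_of_cocompact hl)⟩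
    · exact exists_inftyLimits_soInfty ha hg
  · exact ⟨id, strictMono_id, inftyLimits_of_tendsto (tendsto_of_strictMono hg) ha.1 ha.2.1 ha.2.2⟩

end MultiplierCoefficients

section Interpolation

lemma lintegral_rpow_below_le {p q y : ℝ} (hq : q < p) (hy : 0 ≤ y) :
    ofReal (y ^ q) * ∫⁻ s in Ioi (0 : ℝ), (Iio y).indicator (fun s => ofReal (s ^ (p - 1 - q))) s ≤
    ofReal (1 / (p - q)) * ofReal (y ^ p) := by
  have hpq : 0 < p - q := sub_pos.2 hq
  rcases hy.eq_or_lt with rfl | hy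
  · have : ∫⁻ s in Ioi (0 : ℝ),
        (Iio 0).indicator (fun s => ofReal (s ^ (p - 1 - q))) s = 0 := by
      rw [setLIntegral_congr_fun measurableSet_Ioi (g := fun _ => 0) fun s hs =>
        indicator_of_notMem (notMem_Iio.2 (le_of_lt hs)) _]
      simp
    rw [this, mul_zero]
    exact zero_le
  rw [lintegral_indicator measurableSet_Iio, Measure.restrict_restrict measurableSet_Iio, inter_comm,
    Ioi_inter_Iio, ← ofReal_integral_eq_lintegral_ofReal, ← integral_Ioc_eq_integral_Ioo,
    ← intervalIntegral.integral_of_le hy.le, integral_rpow (Or.inl (by linarith)),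
    ← ENNReal.ofReal_mul (by positivity), ← ENNReal.ofReal_mul (by positivity)]
  · refine ENNReal.ofReal_le_ofReal (le_of_eq ?_)
    rw [show p - 1 - q + 1 = p - q by ring, Real.zero_rpow hpq.ne', sub_zero, mul_div_assoc',
      ← Real.rpow_add hy, add_sub_cancel]
    ring
  · exact ((intervalIntegrable_iff_integrableOn_Ioo_of_le hy.le).1
      (intervalIntegral.intervalIntegrable_rpow' (by linarith)))
  · exact (ae_restrict_mem measurableSet_Ioo).mono fun s hs => Real.rpow_nonneg hs.1.le _

lemma lintegral_rpow_above_le {p q y : ℝ} (hp : 0 < p) (hq : p < q) (hy : 0 ≤ y) :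
    ofReal (y ^ q) * ∫⁻ s in Ioi (0 : ℝ), (Ici y).indicator (fun s => ofReal (s ^ (p - 1 - q))) s ≤
    ofReal (1 / (q - p)) * ofReal (y ^ p) := by
  have hpq : 0 < q - p := sub_pos.2 hq
  rcases hy.eq_or_lt with rfl | hy
  · rw [Real.zero_rpow (hp.trans hq).ne', ENNReal.ofReal_zero, zero_mul]
    exact zero_le
  rw [lintegral_indicator measurableSet_Ici, Measure.restrict_restrict measurableSet_Ici,
    inter_eq_left.2 (show Ici y ⊆ Ioi 0 from fun s hs => hy.trans_le hs), ← restrict_Ioi_eq_restrict_Ici,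
    ← ofReal_integral_eq_lintegral_ofReal, integral_Ioi_rpow_of_lt (by linarith) hy,
    ← ENNReal.ofReal_mul (by positivity), ← ENNReal.ofReal_mul (by positivity)]
  · refine ENNReal.ofReal_le_ofReal (le_of_eq ?_)
    rw [show p - 1 - q + 1 = p - q by ring, mul_div_assoc', mul_neg, ← Real.rpow_add hy,
      add_sub_cancel, neg_div, ← div_neg, neg_sub]
    ring
  · exact integrableOn_Ioi_rpow_of_lt (by linarith) hy
  · exact (ae_restrict_mem measurableSet_Ioi).mono fun s hs =>
      Real.rpow_nonneg (hy.trans hs).le _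

/-- The layer cake argument in the Marcinkiewicz interpolation theorem. -/
lemma lintegral_rpow_le_of_weak {F f : ℝ → ℝ} (hF : Measurable F) (hf : Measurable f)
    (hF0 : ∀ x, 0 ≤ F x) (hf0 : ∀ x, 0 ≤ f x) {p q r : ℝ} (hp : 0 < p) (hq : q < p) (hr : p < r)
    {A B : ℝ≥0∞}
    (h : ∀ s, 0 < s → volume {x | s < F x} ≤
      ofReal (s ^ (-q)) * (A * ∫⁻ x, {x | s < f x}.indicator (fun x => ofReal (f x ^ q)) x) +
      ofReal (s ^ (-r)) * (B * ∫⁻ x, {x | f x ≤ s}.indicator (fun x => ofReal (f x ^ r)) x)) :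
    ∫⁻ x, ofReal (F x ^ p) ≤
      ofReal p * ((A * ofReal (1 / (p - q)) + B * ofReal (1 / (r - p))) *
        ∫⁻ x, ofReal (f x ^ p)) := by
  have hswap : ∀ (t : ℝ) (S : Set (ℝ × ℝ)) (hS : MeasurableSet S),
      ∫⁻ s in Ioi (0 : ℝ), ofReal (s ^ (p - 1 - t)) *
        ∫⁻ x, {x | (s, x) ∈ S}.indicator (fun x => ofReal (f x ^ t)) x =
      ∫⁻ x, ofReal (f x ^ t) *
        ∫⁻ s in Ioi (0 : ℝ), {s | (s, x) ∈ S}.indicator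
          (fun s => ofReal (s ^ (p - 1 - t))) s := fun t S hS => by
    have hm : Measurable (fun z : ℝ × ℝ => S.indicator
        (fun z => ofReal (z.1 ^ (p - 1 - t)) * ofReal (f z.2 ^ t)) z) :=
      (Measurable.indicator (by fun_prop) hS)
    have e1 : ∀ s, ofReal (s ^ (p - 1 - t)) *
        ∫⁻ x, {x | (s, x) ∈ S}.indicator (fun x => ofReal (f x ^ t)) x =
        ∫⁻ x, S.indicator (fun z => ofReal (z.1 ^ (p - 1 - t)) *
          ofReal (f z.2 ^ t)) (s, x) := fun s => by
      rw [← lintegral_const_mul]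
      · refine lintegral_congr fun x => ?_
        by_cases hx : (s, x) ∈ S
        · simp [hx]
        · simp [hx]
      · exact Measurable.indicator (by fun_prop) (measurable_prodMk_left hS)
    have e2 : ∀ x, ofReal (f x ^ t) *
        ∫⁻ s in Ioi (0 : ℝ), {s | (s, x) ∈ S}.indicator (fun s => ofReal (s ^ (p - 1 - t))) s =
        ∫⁻ s in Ioi (0 : ℝ), S.indicator (fun z => ofReal (z.1 ^ (p - 1 - t)) *
          ofReal (f z.2 ^ t)) (s, x) := fun x => by
      rw [← lintegral_const_mul]
      · refine lintegral_congr fun s => ?_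
        by_cases hx : (s, x) ∈ S
        · simp [hx, mul_comm]
        · simp [hx]
      · exact Measurable.indicator (by fun_prop) (measurable_prodMk_right hS)
    simp only [e1, e2]
    exact lintegral_lintegral_swap hm.aemeasurable
  have hS1 : MeasurableSet {z : ℝ × ℝ | z.1 < f z.2} :=
    measurableSet_lt measurable_fst (hf.comp measurable_snd)
  have hS2 : MeasurableSet {z : ℝ × ℝ | f z.2 ≤ z.1} :=
    measurableSet_le (hf.comp measurable_snd) measurable_fst
  have hm : ∀ (t : ℝ) (S : Set (ℝ × ℝ)) (hS : MeasurableSet S), Measurable fun s =>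
      ofReal (s ^ (p - 1 - t)) * ∫⁻ x, {x | (s, x) ∈ S}.indicator (fun x => ofReal (f x ^ t)) x :=
    fun t S hS => by
    refine Measurable.mul (by fun_prop) (Measurable.lintegral_prod_right'
      (f := fun z : ℝ × ℝ => S.indicator (fun z => ofReal (f z.2 ^ t)) z) ?_)
    exact Measurable.indicator (by fun_prop) hS
  rw [lintegral_rpow_eq_lintegral_meas_lt_mul volume (.of_forall hF0) hF.aemeasurable hp]
  refine mul_le_mul_right ?_ _
  calc ∫⁻ s in Ioi (0 : ℝ), volume {x | s < F x} * ofReal (s ^ (p - 1))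
      ≤ ∫⁻ s in Ioi (0 : ℝ), (A * (ofReal (s ^ (p - 1 - q)) *
          ∫⁻ x, {x | (s, x) ∈ {z : ℝ × ℝ | z.1 < f z.2}}.indicator (fun x => ofReal (f x ^ q)) x) +
        B * (ofReal (s ^ (p - 1 - r)) *
          ∫⁻ x, {x | (s, x) ∈ {z : ℝ × ℝ | f z.2 ≤ z.1}}.indicator
            (fun x => ofReal (f x ^ r)) x)) := by
        refine setLIntegral_mono_ae' measurableSet_Ioi (.of_forall fun s hs => ?_)
        refine (mul_le_mul_left (h s hs) _).trans (le_of_eq ?_)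
        have e : ∀ t : ℝ, ofReal (s ^ (p - 1 - t)) =
            ofReal (s ^ (-t)) * ofReal (s ^ (p - 1)) := fun t => by
          rw [← ENNReal.ofReal_mul (Real.rpow_nonneg (le_of_lt hs) _), ← Real.rpow_add hs]
          congr 2; ring
        rw [e q, e r]
        simp only [mem_ofPred_eq]
        ring
    _ = A * (∫⁻ x, ofReal (f x ^ q) * ∫⁻ s in Ioi (0 : ℝ),
          (Iio (f x)).indicator (fun s => ofReal (s ^ (p - 1 - q))) s) +
        B * ∫⁻ x, ofReal (f x ^ r) * ∫⁻ s in Ioi (0 : ℝ),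
          (Ici (f x)).indicator (fun s => ofReal (s ^ (p - 1 - r))) s := by
        rw [lintegral_add_left ((hm q _ hS1).const_mul _), lintegral_const_mul _ (hm q _ hS1),
          lintegral_const_mul _ (hm r _ hS2), hswap q _ hS1, hswap r _ hS2]
        rfl
    _ ≤ A * (∫⁻ x, ofReal (1 / (p - q)) * ofReal (f x ^ p)) +
        B * ∫⁻ x, ofReal (1 / (r - p)) * ofReal (f x ^ p) := by
        exact add_le_add
          (mul_le_mul_right (lintegral_mono fun x => lintegral_rpow_below_le hq (hf0 x)) _)
          (mul_le_mul_right (lintegral_mono fun x => lintegral_rpow_above_le hp hr (hf0 x)) _)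
    _ = _ := by
        rw [lintegral_const_mul _ (by fun_prop), lintegral_const_mul _ (by fun_prop)]
        ring

end Interpolation

section Consistency

variable {p q r : ℝ≥0∞} [Fact (1 ≤ p)] [Fact (1 ≤ q)] [Fact (1 ≤ r)]

/-- Two operators, on `L^p` and on `L^q`, which agree on `L^p ∩ L^q`. -/
def Consistent (T : Op p) (T' : Op q) : Prop :=
  ∀ (u : X p) (v : X q), (u : ℝ → ℂ) =ᵐ[volume] v → (T u : ℝ → ℂ) =ᵐ[volume] T' v

lemma Consistent.sub {T S : Op p} {T' S' : Op q} (hT : Consistent T T') (hS : Consistent S S') :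
    Consistent (T - S) (T' - S') := fun u v h => by
  filter_upwards [hT u v h, hS u v h, Lp.coeFn_sub (T u) (S u), Lp.coeFn_sub (T' v) (S' v)]
    with x h1 h2 h3 h4
  rw [sub_apply, sub_apply, h3, h4, Pi.sub_apply, Pi.sub_apply, h1, h2]

lemma Consistent.smul (c : ℂ) {T : Op p} {T' : Op q} (hT : Consistent T T') :
    Consistent (c • T) (c • T') := fun u v h => by
  filter_upwards [hT u v h, Lp.coeFn_smul c (T u), Lp.coeFn_smul c (T' v)] with x h1 h3 h4
  rw [smul_apply, smul_apply, h3, h4, Pi.smul_apply, Pi.smul_apply, h1]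

lemma Consistent.mul {T S : Op p} {T' S' : Op q} (hT : Consistent T T') (hS : Consistent S S') :
    Consistent (T * S) (T' * S') := fun u v h => hT _ _ (hS u v h)

lemma consistent_mulOp {a : ℝ → ℂ} (ha : MemLp a ⊤) :
    Consistent (mulOp p a ha) (mulOp q a ha) := fun u v h => by
  filter_upwards [mulOp_coeFn p a ha u, mulOp_coeFn q a ha v, h] with x h1 h2 h3
  rw [h1, h2, h3]

lemma consistent_shift (s : ℝ) : Consistent (shift p s) (shift q s) := fun u v h => by
  filter_upwards [shift_coeFn p s u, shift_coeFn q s v, (qmp_sub s).ae h] with x h1 h2 h3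
  rw [h1, h2, h3]

/-- Conjugation with dilations does not depend on their normalization. -/
lemma Consistent.dilation_conj {T : Op p} {T' : Op q} (h : Consistent T T') {c d : ℝ}
    (hc : 0 < c) (hd : 0 < d) (hcd : c * d = 1) :
    Consistent (dilation p c hc * T * dilation p d hd)
      (dilation q c hc * T' * dilation q d hd) := by
  have key : ∀ (e : ℝ) (he : 0 < e), Consistent
      (((e ^ (1 / p.toReal) : ℝ) : ℂ) • dilation p e he)
      (((e ^ (1 / q.toReal) : ℝ) : ℂ) • dilation q e he) := fun e he u v h => by
    filter_upwards [dilation_coeFn p e he u, dilation_coeFn q e he v, (qmp_div e he).ae h,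
      Lp.coeFn_smul ((e ^ (1 / p.toReal) : ℝ) : ℂ) (dilation p e he u),
      Lp.coeFn_smul ((e ^ (1 / q.toReal) : ℝ) : ℂ) (dilation q e he v)] with x h1 h2 h3 h4 h5
    rw [smul_apply, smul_apply, h4, h5, Pi.smul_apply,
      Pi.smul_apply, h1, h2, h3, smul_eq_mul, smul_eq_mul, ← mul_assoc, ← mul_assoc,
      ← Complex.ofReal_mul, ← Complex.ofReal_mul, ← Real.rpow_add he, ← Real.rpow_add he,
      add_neg_cancel, add_neg_cancel]
  have h2 := ((key c hc).mul h).mul (key d hd)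
  have e : ∀ t : ℝ, ((d ^ t : ℝ) : ℂ) * ((c ^ t : ℝ) : ℂ) = 1 := fun t => by
    rw [← Complex.ofReal_mul, ← Real.mul_rpow hd.le hc.le, mul_comm d, hcd, Real.one_rpow,
      Complex.ofReal_one]
  simpa only [smul_mul_assoc, mul_smul_comm, smul_smul, e, one_smul] using h2

lemma consistent_modulation (t : ℝ) : Consistent (modulation p t) (modulation q t) :=
  consistent_mulOp _

lemma Consistent.lift_inr {T : Op p} {T' : Op q} (h : Consistent T T') (t : ℝ) (n : ℕ+) :
    Consistent (lift (.inr t) n T) (lift (.inr t) n T') := by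
  have h1 : Consistent (zOp p n * T * zInv p n) (zOp q n * T' * zInv q n) :=
    h.dilation_conj _ _ (mul_inv_cancel₀ (by exact_mod_cast n.pos.ne'))
  simpa only [lift, mul_assoc] using
    ((consistent_modulation (-t)).mul h1).mul (consistent_modulation t)

lemma Consistent.unlift_inr {T : Op p} {T' : Op q} (h : Consistent T T') (t : ℝ) (n : ℕ+) :
    Consistent (unlift (.inr t) n T) (unlift (.inr t) n T') := by
  have h2 := ((consistent_modulation (p := p) (q := q) t).mul h).mul (consistent_modulation (-t))
  have h1 : Consistent (zInv p n * (modulation p t * T * modulation p (-t)) * zOp p n)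
      (zInv q n * (modulation q t * T' * modulation q (-t)) * zOp q n) :=
    h2.dilation_conj _ _ (inv_mul_cancel₀ (by exact_mod_cast n.pos.ne'))
  simpa only [unlift, mul_assoc] using h1

/-- The bounded measurable functions with bounded support are dense. -/
lemma dense_nice (hp' : p ≠ ⊤) :
    Dense {u : X p | ∃ (g : ℝ → ℂ) (hg : NiceFun g), u = (hg.memLp p).toLp g} := by
  refine Metric.dense_iff.2 fun u ε hε => ?_
  obtain ⟨g, h1, h2, h3, h4⟩ := (Lp.memLp u).exists_hasCompactSupport_eLpNorm_sub_le hp'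
    (ε := ofReal (ε / 2)) (by simpa using hε)
  have hg : NiceFun g := by
    refine ⟨h3.stronglyMeasurable, ?_, ?_⟩
    · obtain ⟨C, hC⟩ := h1.exists_bound_of_continuous h3
      exact ⟨C, hC⟩
    · obtain ⟨R, hR⟩ := h1.isCompact.isBounded.exists_norm_le
      exact ⟨R, fun x hx => image_eq_zero_of_notMem_tsupport fun hm => (hR x hm).not_gt hx⟩
  refine ⟨(hg.memLp p).toLp g, ?_, g, hg, rfl⟩
  rw [Metric.mem_ball, dist_comm, dist_eq_norm, Lp.norm_def]
  have e : eLpNorm (⇑(u - (hg.memLp p).toLp g)) p = eLpNorm (⇑u - g) p := by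
    refine eLpNorm_congr_ae ?_
    filter_upwards [Lp.coeFn_sub u ((hg.memLp p).toLp g), (hg.memLp p).coeFn_toLp] with x h5 h6
    rw [h5, Pi.sub_apply, Pi.sub_apply, h6]
  rw [e]
  exact (ENNReal.toReal_le_of_le_ofReal (half_pos hε).le h2).trans_lt (half_lt_self hε)

lemma opNorm_le_of_nice (hp' : p ≠ ⊤) {T : Op p} {C : ℝ} (hC : 0 ≤ C)
    (h : ∀ g (hg : NiceFun g), ‖T ((hg.memLp p).toLp g)‖ ≤ C * ‖(hg.memLp p).toLp g‖) :
    ‖T‖ ≤ C := by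
  refine T.opNorm_le_bound hC fun u => ?_
  have hcl : IsClosed {u : X p | ‖T u‖ ≤ C * ‖u‖} := isClosed_le (by fun_prop) (by fun_prop)
  exact hcl.closure_subset_iff.2 (by rintro _ ⟨g, hg, rfl⟩; exact h g hg) (dense_nice hp' u)

lemma Consistent.toLp {T : Op p} {T' : Op q} (h : Consistent T T') {g : ℝ → ℂ}
    (hp : MemLp g p) (hq : MemLp g q) :
    (T (hp.toLp g) : ℝ → ℂ) =ᵐ[volume] T' (hq.toLp g) :=
  h _ _ (hp.coeFn_toLp.trans hq.coeFn_toLp.symm)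

/-- An operator on `L^p` is determined by any consistent operator. -/
lemma Consistent.unique (hp' : p ≠ ⊤) {T S : Op p} {T' : Op q} (hT : Consistent T T')
    (hS : Consistent S T') : T = S := by
  ext1 u
  have hcl : IsClosed {u : X p | T u = S u} := isClosed_eq (by fun_prop) (by fun_prop)
  refine hcl.closure_subset_iff.2 ?_ (dense_nice hp' u)
  rintro _ ⟨g, hg, rfl⟩
  exact Lp.ext ((hT.toLp (hg.memLp p) (hg.memLp q)).trans (hS.toLp (hg.memLp p) (hg.memLp q)).symm)

lemma NiceFun.indicator {g : ℝ → ℂ} (hg : NiceFun g) {S : Set ℝ} (hS : MeasurableSet S) :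
    NiceFun (S.indicator g) := by
  obtain ⟨C, hC⟩ := hg.bdd
  obtain ⟨R, hR⟩ := hg.supp
  exact ⟨hg.meas.indicator hS, ⟨C, fun x => (norm_indicator_le_norm_self _ _).trans (hC x)⟩,
    R, fun x hx => by rw [indicator_apply_eq_zero]; exact fun _ => hR x hx⟩

lemma enorm_toLp_rpow (hp' : p ≠ ⊤) {g : ℝ → ℂ} (hg : MemLp g p) {γ : ℝ} (hγ : 0 < γ) :
    ‖hg.toLp g‖ₑ ^ p.toReal = ofReal (γ ^ p.toReal) * ∫⁻ x, ofReal ((‖g x‖ / γ) ^ p.toReal) := by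
  have hpos := exponent_pos hp'
  rw [enorm_rpow_eq_lintegral hp', ← lintegral_const_mul' _ _ ENNReal.ofReal_ne_top]
  refine lintegral_congr_ae ?_
  filter_upwards [hg.coeFn_toLp] with x hx
  rw [hx, ← ENNReal.ofReal_mul (by positivity), ← Real.mul_rpow hγ.le (by positivity),
    mul_div_cancel₀ _ hγ.ne', ← ofReal_norm, ENNReal.ofReal_rpow_of_nonneg (norm_nonneg _) hpos.le]

lemma weak_type_bound (hp' : p ≠ ⊤) (T : Op p) {g : ℝ → ℂ} (hg : MemLp g p) {γ s : ℝ}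
    (hγ : 0 < γ) (hs : 0 < s) :
    volume {x | s / 2 ≤ ‖T (hg.toLp g) x‖} ≤ ofReal (s ^ (-p.toReal)) *
      (ofReal ((2 * ‖T‖ * γ) ^ p.toReal) * ∫⁻ x, ofReal ((‖g x‖ / γ) ^ p.toReal)) := by
  have hpos := exponent_pos hp'
  have h1 := meas_ge_le_mul_pow_eLpNorm_enorm (volume : Measure ℝ) exponent_ne_zero hp'
    (Lp.aestronglyMeasurable (T (hg.toLp g))) (ε := ofReal (s / 2)) (by simpa using hs)
    (fun h => absurd h ENNReal.ofReal_ne_top)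
  have e : {x | s / 2 ≤ ‖T (hg.toLp g) x‖} = {x | ofReal (s / 2) ≤ ‖T (hg.toLp g) x‖ₑ} := by
    ext x
    rw [mem_ofPred_eq, mem_ofPred_eq, ← ofReal_norm, ENNReal.ofReal_le_ofReal_iff (norm_nonneg _)]
  rw [e]
  refine h1.trans ?_
  rw [← Lp.enorm_def]
  have h2 : ‖T (hg.toLp g)‖ₑ ^ p.toReal ≤ (ofReal ‖T‖ * ‖hg.toLp g‖ₑ) ^ p.toReal := by
    gcongr
    rw [← ofReal_norm, ← ofReal_norm, ← ENNReal.ofReal_mul (norm_nonneg _)]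
    exact ENNReal.ofReal_le_ofReal (T.le_opNorm _)
  refine (mul_le_mul_right h2 _).trans (le_of_eq ?_)
  rw [ENNReal.mul_rpow_of_nonneg _ _ hpos.le, enorm_toLp_rpow hp' hg hγ, ← mul_assoc, ← mul_assoc,
    ← mul_assoc, ENNReal.ofReal_rpow_of_nonneg (norm_nonneg _) hpos.le,
    ← ENNReal.ofReal_inv_of_pos (half_pos hs), ENNReal.ofReal_rpow_of_nonneg (by positivity) hpos.le,
    ← ENNReal.ofReal_mul (by positivity), ← ENNReal.ofReal_mul (by positivity),
    ← ENNReal.ofReal_mul (by positivity)]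
  congr 2
  rw [← Real.mul_rpow (by positivity) (by positivity), ← Real.mul_rpow (by positivity) hγ.le,
    Real.rpow_neg hs.le, ← Real.inv_rpow hs.le, ← Real.mul_rpow (by positivity) (by positivity)]
  congr 1
  field_simp

/-- The Marcinkiewicz interpolation theorem. -/
lemma marcinkiewicz (hr' : r ≠ ⊤) (hqp : q < p) (hpr : p < r) {Tq : Op q} {T : Op p} {Tr : Op r}
    (hq : ∀ g (hg : NiceFun g), T ((hg.memLp p).toLp g) =ᵐ[volume] Tq ((hg.memLp q).toLp g))
    (hr : ∀ g (hg : NiceFun g), T ((hg.memLp p).toLp g) =ᵐ[volume] Tr ((hg.memLp r).toLp g))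
    {γ : ℝ} (hγ : 0 < γ) :
    ‖T‖ ^ p.toReal ≤ p.toReal * ((2 * ‖Tq‖ * γ) ^ q.toReal * (1 / (p.toReal - q.toReal)) +
      (2 * ‖Tr‖ * γ) ^ r.toReal * (1 / (r.toReal - p.toReal))) * (γ ^ p.toReal)⁻¹ := by
  have hp' : p ≠ ⊤ := (hpr.trans_le le_top).ne
  have hq' : q ≠ ⊤ := (hqp.trans_le le_top).ne
  have hpos := exponent_pos hp'
  have h1 : 0 < p.toReal - q.toReal := sub_pos.2 ((ENNReal.toReal_lt_toReal hq' hp').2 hqp)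
  have h2 : 0 < r.toReal - p.toReal := sub_pos.2 ((ENNReal.toReal_lt_toReal hp' hr').2 hpr)
  set K := p.toReal * ((2 * ‖Tq‖ * γ) ^ q.toReal * (1 / (p.toReal - q.toReal)) +
      (2 * ‖Tr‖ * γ) ^ r.toReal * (1 / (r.toReal - p.toReal))) * (γ ^ p.toReal)⁻¹ with hK
  have hK0 : 0 ≤ K := by positivity
  suffices ‖T‖ ≤ K ^ (p.toReal)⁻¹ from (Real.le_rpow_inv_iff_of_pos (norm_nonneg _) hK0 hpos).1 this
  refine opNorm_le_of_nice hp' (by positivity) fun g hg => ?_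
  set u := (hg.memLp p).toLp g
  have hfm : Measurable fun x => ‖g x‖ / γ := hg.meas.measurable.norm.div_const _
  have key := lintegral_rpow_le_of_weak (F := fun x => ‖T u x‖) (f := fun x => ‖g x‖ / γ)
    (Lp.stronglyMeasurable (T u)).measurable.norm hfm (fun _ => norm_nonneg _)
    (fun _ => by positivity) hpos (sub_pos.1 h1) (sub_pos.1 h2)
    (A := ofReal ((2 * ‖Tq‖ * γ) ^ q.toReal))
    (B := ofReal ((2 * ‖Tr‖ * γ) ^ r.toReal)) fun s hs => by
      have hS1 : MeasurableSet {x | s < ‖g x‖ / γ} := measurableSet_lt measurable_const hfm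
      have hS2 : MeasurableSet {x | ‖g x‖ / γ ≤ s} := measurableSet_le hfm measurable_const
      have hv := hg.indicator hS1
      have hw := hg.indicator hS2
      have hind : ∀ (S : Set ℝ) (t : ℝ), 0 < t → (fun x => ofReal
          ((‖S.indicator g x‖ / γ) ^ t)) =
          fun x => S.indicator (fun x => ofReal ((‖g x‖ / γ) ^ t)) x := fun S t ht => by
        ext x
        by_cases hx : x ∈ S
        · simp [hx]
        · simp [hx, Real.zero_rpow ht.ne']
      have b1 := weak_type_bound hq' Tq (hv.memLp q) hγ hs
      have b2 := weak_type_bound hr' Tr (hw.memLp r) hγ hs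
      rw [hind _ _ (exponent_pos hq')] at b1
      rw [hind _ _ (exponent_pos hr')] at b2
      refine le_trans ?_ (add_le_add b1 b2)
      refine (measure_mono_ae ?_).trans (measure_union_le _ _)
      have hsum : u = (hv.memLp p).toLp _ + (hw.memLp p).toLp _ := by
        rw [← MemLp.toLp_add]
        refine MemLp.toLp_congr _ _ (.of_forall fun x => ?_)
        by_cases hx : s < ‖g x‖ / γ
        · simp [hx]
        · simp [hx, not_lt.1 hx]
      filter_upwards [hq _ hv, hr _ hw,
        Lp.coeFn_add (T ((hv.memLp p).toLp _)) (T ((hw.memLp p).toLp _))] with x e1 e2 e3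
      intro (hx : s < ‖T u x‖)
      rw [hsum, map_add, e3, Pi.add_apply, e1, e2] at hx
      by_contra hcon
      have hcon' := not_or.1 hcon
      have n1 : _ < s / 2 := not_le.1 hcon'.1
      have n2 : _ < s / 2 := not_le.1 hcon'.2
      exact (hx.trans_le (norm_add_le _ _)).not_ge (by linarith)
  have e1 : ∫⁻ x, ofReal (‖T u x‖ ^ p.toReal) = ‖T u‖ₑ ^ p.toReal := by
    rw [enorm_rpow_eq_lintegral hp']
    refine lintegral_congr fun x => ?_
    rw [← ofReal_norm, ENNReal.ofReal_rpow_of_nonneg (norm_nonneg _) hpos.le]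
  have e2 : ∫⁻ x, ofReal ((‖g x‖ / γ) ^ p.toReal) =
      ofReal ((γ ^ p.toReal)⁻¹) * ‖u‖ₑ ^ p.toReal := by
    rw [enorm_toLp_rpow hp' (hg.memLp p) hγ, ← mul_assoc, ← ENNReal.ofReal_mul (by positivity),
      inv_mul_cancel₀ (by positivity), ENNReal.ofReal_one, one_mul]
  rw [e1, e2, ← ofReal_norm, ← ofReal_norm, ENNReal.ofReal_rpow_of_nonneg (norm_nonneg _) hpos.le,
    ENNReal.ofReal_rpow_of_nonneg (norm_nonneg _) hpos.le, ← ENNReal.ofReal_mul (by positivity),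
    ← ENNReal.ofReal_mul (by positivity), ← ENNReal.ofReal_add (by positivity) (by positivity),
    ← ENNReal.ofReal_mul (by positivity), ← ENNReal.ofReal_mul (by positivity),
    ← ENNReal.ofReal_mul (by positivity), ENNReal.ofReal_le_ofReal_iff (by positivity)] at key
  have key2 : ‖T u‖ ^ p.toReal ≤ K * ‖u‖ ^ p.toReal := key.trans (le_of_eq (by rw [hK]; ring))
  have := (Real.le_rpow_inv_iff_of_pos (norm_nonneg _) (by positivity) hpos).2 key2
  rwa [Real.mul_rpow hK0 (by positivity), Real.rpow_rpow_inv (norm_nonneg _) hpos.ne'] at this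

lemma exists_mul_rpow_lt {a : ℝ} (ha : a ≠ 0) (K : ℝ) {δ : ℝ} (hδ : 0 < δ) :
    ∃ γ : ℝ, 0 < γ ∧ K * γ ^ a < δ := by
  refine ⟨(δ / (|K| + 1)) ^ a⁻¹, by positivity, ?_⟩
  rw [Real.rpow_inv_rpow (by positivity) ha, mul_div_assoc', div_lt_iff₀ (by positivity), mul_comm]
  nlinarith [le_abs_self K]

/-- `r` is beyond `p`, as seen from `2`. -/
def Beyond (p r : ℝ≥0∞) : Prop := r ≠ ⊤ ∧ 1 < r ∧ (p = 2 ∨ (r < p ∧ p < 2) ∨ (2 < p ∧ p < r))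

lemma tendsto_norm_of_rpow_le {ι : Type*} {l : Filter ι} {T : ι → Op p} {T' : ι → Op 2}
    (hp' : p ≠ ⊤) {c₁ a c₂ b : ℝ} (ha : a ≠ 0) (hb : 0 < b) (h0 : Tendsto (fun i => ‖T' i‖) l (𝓝 0))
    (h : ∀ i γ, 0 < γ → ‖T i‖ ^ p.toReal ≤
      c₁ * γ ^ a + c₂ * (2 * ‖T' i‖ * γ) ^ b * (γ ^ p.toReal)⁻¹) :
    Tendsto (fun i => ‖T i‖) l (𝓝 0) := by
  have hpos := exponent_pos hp'
  refine null_of_eventually_le (fun _ => norm_nonneg _) fun ε hε => ?_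
  obtain ⟨γ, hγ, hγ'⟩ := exists_mul_rpow_lt ha c₁ (δ := ε ^ p.toReal) (by positivity)
  have h2 : Tendsto (fun i => c₁ * γ ^ a + c₂ * (2 * ‖T' i‖ * γ) ^ b * (γ ^ p.toReal)⁻¹) l
      (𝓝 (c₁ * γ ^ a + c₂ * (2 * 0 * γ) ^ b * (γ ^ p.toReal)⁻¹)) :=
    (((((h0.const_mul 2).mul_const γ).rpow_const (Or.inr hb.le)).const_mul c₂).mul_const _).const_add _
  rw [mul_zero, zero_mul, Real.zero_rpow hb.ne', mul_zero, zero_mul, add_zero] at h2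
  filter_upwards [h2.eventually (gt_mem_nhds hγ')] with i hi
  exact (Real.rpow_le_rpow_iff (norm_nonneg _) hε.le hpos).1 ((h i γ hγ).trans hi.le)

/-- Norm convergence on `L²` and boundedness beyond `p` imply norm convergence on `L^p`. -/
lemma tendsto_norm_of_consistent {ι : Type*} {l : Filter ι} {T : ι → Op p} {T' : ι → Op 2}
    {S : ι → Op r} (hr : Beyond p r) (hT : ∀ i, Consistent (T i) (T' i))
    (hS : ∀ i, Consistent (S i) (T' i)) {C : ℝ} (hC : ∀ i, ‖S i‖ ≤ C)
    (h0 : Tendsto (fun i => ‖T' i‖) l (𝓝 0)) : Tendsto (fun i => ‖T i‖) l (𝓝 0) := by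
  have h2t : (2 : ℝ≥0∞).toReal = 2 := by simp
  have n1 : ∀ i g (hg : NiceFun g), T i ((hg.memLp p).toLp g) =ᵐ[volume]
      T' i ((hg.memLp 2).toLp g) := fun i g hg => (hT i).toLp _ _
  have n2 : ∀ i g (hg : NiceFun g), T i ((hg.memLp p).toLp g) =ᵐ[volume]
      S i ((hg.memLp r).toLp g) := fun i g hg => (n1 i g hg).trans ((hS i).toLp _ _).symm
  obtain ⟨hr', -, rfl | ⟨hrp, hp2⟩ | ⟨hp2, hrp⟩⟩ := hr
  · have e : ∀ i, T i = T' i := fun i =>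
      (hT i).unique (by simp) (fun u v huv => by rw [Lp.ext huv])
    simpa only [e] using h0
  · have hp' : p ≠ ⊤ := (hp2.trans_le le_top).ne
    have hpos := exponent_pos hp'
    have hlt := (ENNReal.toReal_lt_toReal hr' hp').2 hrp
    have hlt2 := (ENNReal.toReal_lt_toReal hp' (by simp)).2 hp2
    rw [h2t] at hlt2
    refine tendsto_norm_of_rpow_le (T' := T') hp' (c₁ := p.toReal * ((2 * C) ^ r.toReal *
      (1 / (p.toReal - r.toReal)))) (a := r.toReal - p.toReal) (c₂ := p.toReal *
      (1 / (2 - p.toReal))) (b := 2) (by linarith) two_pos h0 fun i γ hγ => ?_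
    have hC0 : 0 ≤ C := (norm_nonneg _).trans (hC i)
    refine (marcinkiewicz (by simp) hrp hp2 (n2 i) (n1 i) hγ).trans ?_
    have h1 : (2 * ‖S i‖ * γ) ^ r.toReal ≤ (2 * C) ^ r.toReal * γ ^ r.toReal := by
      rw [← Real.mul_rpow (by positivity) hγ.le]
      gcongr
      exact hC i
    rw [h2t, mul_add, add_mul]
    refine add_le_add ?_ (le_of_eq (by ring))
    rw [Real.rpow_sub hγ]
    have : 0 ≤ 1 / (p.toReal - r.toReal) := by
      have := sub_pos.2 hlt
      positivity
    calc _ ≤ p.toReal * ((2 * C) ^ r.toReal * γ ^ r.toReal * (1 / (p.toReal - r.toReal))) *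
          (γ ^ p.toReal)⁻¹ := by gcongr
      _ = _ := by ring
  · have hp' : p ≠ ⊤ := (hrp.trans_le le_top).ne
    have hpos := exponent_pos hp'
    have hlt := (ENNReal.toReal_lt_toReal hp' hr').2 hrp
    have hlt2 := (ENNReal.toReal_lt_toReal (by simp) hp').2 hp2
    rw [h2t] at hlt2
    refine tendsto_norm_of_rpow_le (T' := T') hp' (c₁ := p.toReal * ((2 * C) ^ r.toReal *
      (1 / (r.toReal - p.toReal)))) (a := r.toReal - p.toReal) (c₂ := p.toReal *
      (1 / (p.toReal - 2))) (b := 2) (by linarith) two_pos h0 fun i γ hγ => ?_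
    have hC0 : 0 ≤ C := (norm_nonneg _).trans (hC i)
    refine (marcinkiewicz hr' hp2 hrp (n1 i) (n2 i) hγ).trans ?_
    have h1 : (2 * ‖S i‖ * γ) ^ r.toReal ≤ (2 * C) ^ r.toReal * γ ^ r.toReal := by
      rw [← Real.mul_rpow (by positivity) hγ.le]
      gcongr
      exact hC i
    rw [h2t, mul_add, add_mul, add_comm]
    refine add_le_add ?_ (le_of_eq (by ring))
    rw [Real.rpow_sub hγ]
    have : 0 ≤ 1 / (r.toReal - p.toReal) := by
      have := sub_pos.2 hlt
      positivity
    calc _ ≤ p.toReal * ((2 * C) ^ r.toReal * γ ^ r.toReal * (1 / (r.toReal - p.toReal))) *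
          (γ ^ p.toReal)⁻¹ := by gcongr
      _ = _ := by ring

end Consistency

section Convolution

variable {p : ℝ≥0∞} [Fact (1 ≤ p)]

/-- The convolution operator `F⁻¹ b F` as an operator on `L²(ℝ)`. -/
def convOp (b : ℝ → ℂ) (hb : MemLp b ⊤) : Op 2 :=
  (Lp.fourierTransformₗᵢ ℝ ℂ).symm.toContinuousLinearEquiv.toContinuousLinearMap.comp
    ((mulOp 2 (fun x : ℝ => b (-(2 * Real.pi * x))) (memLp_top_rescale hb)).comp
      (Lp.fourierTransformₗᵢ ℝ ℂ).toContinuousLinearEquiv.toContinuousLinearMap)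

lemma norm_le_of_multiplierBound (hp' : p ≠ ⊤) {b : ℝ → ℂ} {hb : MemLp b ⊤} {A : Op p}
    (hA : Consistent A (convOp b hb)) {C : ℝ} (hC : 0 ≤ C) (h : MultiplierBound p b C) :
    ‖A‖ ≤ C := by
  obtain ⟨_, h⟩ := h
  refine opNorm_le_of_nice hp' hC fun g hg => ?_
  have e : eLpNorm (convOp b hb ((hg.memLp 2).toLp g)) p ≤
      ofReal C * eLpNorm ((hg.memLp 2).toLp g) p :=
    h ((hg.memLp 2).toLp g) ((hg.memLp p).ae_eq (hg.memLp 2).coeFn_toLp.symm)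
  rw [← eLpNorm_congr_ae (hA.toLp (hg.memLp p) (hg.memLp 2)), eLpNorm_congr_ae
    ((hg.memLp 2).coeFn_toLp.trans (hg.memLp p).coeFn_toLp.symm), ← Lp.enorm_def, ← Lp.enorm_def,
    ← ofReal_norm, ← ofReal_norm, ← ENNReal.ofReal_mul hC] at e
  exact (ENNReal.ofReal_le_ofReal_iff (by positivity)).1 e

/-- A multiplier on `L^p` defines a convolution operator on `L^p`. -/
lemma exists_consistent_convOp (hp' : p ≠ ⊤) {b : ℝ → ℂ} (h : b ∈ multiplier p)
    (hb : MemLp b ⊤) : ∃ W : Op p, Consistent W (convOp b hb) := by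
  obtain ⟨C, _, hC⟩ := h
  let D : Submodule ℂ (X 2) :=
    { carrier := {v | MemLp v p volume}
      add_mem' := fun {u v} hu hv => (hu.add hv).ae_eq (Lp.coeFn_add u v).symm
      zero_mem' := (MemLp.zero (ε := ℂ)).ae_eq (Lp.coeFn_zero ℂ 2 volume).symm
      smul_mem' := fun c u hu => (hu.const_smul c).ae_eq (Lp.coeFn_smul c u).symm }
  let e : D →ₗ[ℂ] X p :=
    { toFun := fun v => MemLp.toLp (v : X 2) v.2
      map_add' := fun u v => by
        rw [← MemLp.toLp_add]
        exact MemLp.toLp_congr _ _ (Lp.coeFn_add (u : X 2) v)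
      map_smul' := fun c u => by
        rw [RingHom.id_apply, ← MemLp.toLp_const_smul]
        exact MemLp.toLp_congr _ _ (Lp.coeFn_smul c (u : X 2)) }
  have he : ∀ v : D, (e v : ℝ → ℂ) =ᵐ[volume] (v : X 2) := fun v => MemLp.coeFn_toLp v.2
  have hD : ∀ v ∈ D, (convOp b hb : X 2 →ₗ[ℂ] X 2) v ∈ D := fun v hv =>
    ⟨Lp.aestronglyMeasurable _, (hC v hv).trans_lt (ENNReal.mul_lt_top ENNReal.ofReal_lt_top hv.2)⟩
  let f : D →ₗ[ℂ] X p := e.comp ((convOp b hb : X 2 →ₗ[ℂ] X 2).restrict hD)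
  have hdense : DenseRange e := by
    refine (dense_nice hp').mono ?_
    rintro _ ⟨g, hg, rfl⟩
    have hm : (hg.memLp 2).toLp g ∈ D := (hg.memLp p).ae_eq (hg.memLp 2).coeFn_toLp.symm
    exact ⟨⟨_, hm⟩, Lp.ext ((he _).trans
      ((hg.memLp 2).coeFn_toLp.trans (hg.memLp p).coeFn_toLp.symm))⟩
  have hf : ∀ v : D, (f v : ℝ → ℂ) =ᵐ[volume] convOp b hb v := fun v => he _
  have hnorm : ∃ C, ∀ v, ‖f v‖ ≤ C * ‖e v‖ := by
    refine ⟨max C 0, fun v => ?_⟩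
    have h1 : eLpNorm (convOp b hb v) p ≤ ofReal C * eLpNorm (v : X 2) p := hC v v.2
    rw [← eLpNorm_congr_ae (hf v), ← eLpNorm_congr_ae (he v), ← Lp.enorm_def, ← Lp.enorm_def] at h1
    rw [← ENNReal.ofReal_le_ofReal_iff (by positivity), ENNReal.ofReal_mul (le_max_right _ _),
      ofReal_norm, ofReal_norm]
    exact h1.trans (mul_le_mul_left (ENNReal.ofReal_le_ofReal (le_max_left _ _)) _)
  refine ⟨f.extendOfNorm e, fun u v huv => ?_⟩
  have hv : (v : X 2) ∈ D := (Lp.memLp u).ae_eq huv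
  have hu : u = e ⟨v, hv⟩ := Lp.ext (huv.trans (he ⟨v, hv⟩).symm)
  rw [hu, LinearMap.extendOfNorm_eq hdense hnorm]
  exact hf ⟨v, hv⟩

/-- A multiplier near `p` defines convolution operators on `L^p` and beyond. -/
lemma exists_beyond (hp : 1 < p) (hp' : p ≠ ⊤) {b : ℝ → ℂ} (h : b ∈ stableMultiplier p)
    (hb : MemLp b ⊤) :
    ∃ r : ℝ≥0∞, ∃ _ : Fact (1 ≤ r), Beyond p r ∧ (∃ W : Op p, Consistent W (convOp b hb)) ∧
      ∃ W : Op r, Consistent W (convOp b hb) := by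
  have hp1 : 1 < p.toReal := by
    rw [← ENNReal.toReal_one]; exact (ENNReal.toReal_lt_toReal ENNReal.one_ne_top hp').2 hp
  have hpe : ofReal p.toReal = p := ENNReal.ofReal_toReal hp'
  by_cases hp2 : p = 2
  · subst hp2
    have := exists_consistent_convOp hp' (h.1 rfl) hb
    exact ⟨2, inferInstance, ⟨hp', hp, Or.inl rfl⟩, this, this⟩
  · obtain ⟨δ, hδ, hm⟩ := h.2 hp2
    have hW : ∃ W : Op p, Consistent W (convOp b hb) := by
      have := hm p.toReal hp1 (by simpa using hδ)
      rw [hpe] at this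
      exact exists_consistent_convOp hp' this hb
    have key : ∀ s : ℝ, 1 < s → |s - p.toReal| < δ → Beyond p (ofReal s) →
        ∃ r : ℝ≥0∞, ∃ _ : Fact (1 ≤ r), Beyond p r ∧ (∃ W : Op p, Consistent W (convOp b hb)) ∧
          ∃ W : Op r, Consistent W (convOp b hb) := fun s h1 h2 h3 =>
      have hs : Fact (1 ≤ ofReal s) := ⟨by simpa using h1.le⟩
      ⟨_, hs, h3, hW, exists_consistent_convOp ENNReal.ofReal_ne_top (hm s h1 h2) hb⟩
    rcases lt_or_gt_of_ne hp2 with hlt | hlt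
    · set s := max ((1 + p.toReal) / 2) (p.toReal - δ / 2) with hs
      have h1 : s < p.toReal := max_lt (by linarith) (by linarith)
      have h2 : 1 < s := lt_max_of_lt_left (by linarith)
      have h3 : p.toReal - δ / 2 ≤ s := le_max_right _ _
      refine key s h2 (by rw [abs_lt]; constructor <;> linarith)
        ⟨ENNReal.ofReal_ne_top, by simpa using h2, Or.inr (Or.inl ⟨?_, hlt⟩)⟩
      rw [← hpe]
      exact (ENNReal.ofReal_lt_ofReal_iff (by linarith)).2 h1
    · refine key (p.toReal + δ / 2) (by linarith) (by rw [abs_lt]; constructor <;> linarith)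
        ⟨ENNReal.ofReal_ne_top, by simpa using (by linarith : 1 < p.toReal + δ / 2),
          Or.inr (Or.inr ⟨hlt, ?_⟩)⟩
      refine (lt_of_eq_of_lt hpe.symm ?_)
      exact (ENNReal.ofReal_lt_ofReal_iff (by linarith)).2 (by linarith)

end Convolution

section SlowSymbols

lemma ae_comp_add {P : ℝ → Prop} (h : ∀ᵐ x, P x) (s : ℝ) : ∀ᵐ x, P (x + s) :=
  (measurePreserving_add_right volume s).quasiMeasurePreserving.ae h

lemma ae_comp_scale {P : ℝ → Prop} (h : ∀ᵐ x, P x) (t : ℝ) {c : ℝ} (hc : 0 < c) :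
    ∀ᵐ x, P (t + x / c) :=
  (qmp_div c hc).ae (p := fun x => P (t + x)) (by simpa only [add_comm t] using ae_comp_add h t)

/-- The oscillation of `b` on intervals which lie on one side of `c` and which are not large in
comparison with their distance from some finite set is small on small scales. -/
def SlowOff (c : ℝ) (b : ℝ → ℂ) : Prop :=
  ∀ ε : ℝ, 0 < ε → ∃ E : Finset ℝ, ∀ S : ℝ, 0 < S → ∃ η : ℝ, 0 < η ∧ ∀ ρ : ℝ, 0 < ρ → ρ < η →
    ∀ s : ℝ, |s| ≤ S * ρ → ∀ᵐ x : ℝ, (∀ e ∈ E, ρ ≤ |x - e|) → (∀ e ∈ E, ρ ≤ |x + s - e|) →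
      0 < (x - c) * (x + s - c) → ‖b x - b (x + s)‖ ≤ ε

variable {c : ℝ}

lemma SlowOff.pair {a b : ℝ → ℂ} (ha : SlowOff c a) (hb : SlowOff c b) {ε : ℝ} (hε : 0 < ε) :
    ∃ E : Finset ℝ, ∀ S : ℝ, 0 < S → ∃ η : ℝ, 0 < η ∧ ∀ ρ : ℝ, 0 < ρ → ρ < η →
    ∀ s : ℝ, |s| ≤ S * ρ → ∀ᵐ x : ℝ, (∀ e ∈ E, ρ ≤ |x - e|) → (∀ e ∈ E, ρ ≤ |x + s - e|) →
      0 < (x - c) * (x + s - c) → ‖a x - a (x + s)‖ ≤ ε ∧ ‖b x - b (x + s)‖ ≤ ε := by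
  obtain ⟨E, hE⟩ := ha ε hε
  obtain ⟨E', hE'⟩ := hb ε hε
  refine ⟨E ∪ E', fun S hS => ?_⟩
  obtain ⟨η, hη, h1⟩ := hE S hS
  obtain ⟨η', hη', h2⟩ := hE' S hS
  refine ⟨min η η', lt_min hη hη', fun ρ hρ hρη s hs => ?_⟩
  filter_upwards [h1 ρ hρ (hρη.trans_le (min_le_left _ _)) s hs,
    h2 ρ hρ (hρη.trans_le (min_le_right _ _)) s hs] with x k1 k2 x1 x2 x3
  exact ⟨k1 (fun e he => x1 e (Finset.mem_union_left _ he))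
      (fun e he => x2 e (Finset.mem_union_left _ he)) x3,
    k2 (fun e he => x1 e (Finset.mem_union_right _ he))
      (fun e he => x2 e (Finset.mem_union_right _ he)) x3⟩

lemma SlowOff.of_pair {a b d : ℝ → ℂ} (ha : SlowOff c a) (hb : SlowOff c b)
    (h : ∀ ε : ℝ, 0 < ε → ∃ ε' : ℝ, 0 < ε' ∧ ∀ s : ℝ, ∀ᵐ x : ℝ, ‖a x - a (x + s)‖ ≤ ε' →
      ‖b x - b (x + s)‖ ≤ ε' → ‖d x - d (x + s)‖ ≤ ε) : SlowOff c d := fun ε hε => by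
  obtain ⟨ε', hε', hd⟩ := h ε hε
  obtain ⟨E, hE⟩ := ha.pair hb hε'
  refine ⟨E, fun S hS => ?_⟩
  obtain ⟨η, hη, h1⟩ := hE S hS
  refine ⟨η, hη, fun ρ hρ hρη s hs => ?_⟩
  filter_upwards [h1 ρ hρ hρη s hs, hd s] with x k1 k2 x1 x2 x3
  exact k2 (k1 x1 x2 x3).1 (k1 x1 x2 x3).2

lemma SlowOff.add {a b : ℝ → ℂ} (ha : SlowOff c a) (hb : SlowOff c b) : SlowOff c (a + b) :=
  ha.of_pair hb fun ε hε => ⟨ε / 2, half_pos hε, fun s => .of_forall fun x h1 h2 => by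
    rw [Pi.add_apply, Pi.add_apply, add_sub_add_comm]
    exact (norm_add_le_of_le h1 h2).trans (add_halves ε).le⟩

lemma SlowOff.mul {a b : ℝ → ℂ} (ha' : MemLp a ⊤) (hb' : MemLp b ⊤)
    (ha : SlowOff c a) (hb : SlowOff c b) : SlowOff c (a * b) :=
  ha.of_pair hb fun ε hε => by
    obtain ⟨C, hC0, hC⟩ := exists_essBound ha'
    obtain ⟨D, hD0, hD⟩ := exists_essBound hb'
    refine ⟨ε / (C + D + 1), by positivity, fun s => ?_⟩
    filter_upwards [hC, ae_comp_add hD s] with x x1 x2 h1 h2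
    rw [norm_sub_rev] at h1 h2
    rw [Pi.mul_apply, Pi.mul_apply]
    have e : a x * b x - a (x + s) * b (x + s) =
        -(a x * (b (x + s) - b x) + (a (x + s) - a x) * b (x + s)) := by ring
    rw [e, norm_neg]
    refine (norm_add_le_of_le (norm_mul_le_of_le x1 h2) (norm_mul_le_of_le h1 x2)).trans ?_
    have h3 : (C + D + 1) * (ε / (C + D + 1)) = ε := mul_div_cancel₀ _ (by positivity)
    have h4 : 0 < ε / (C + D + 1) := by positivity
    nlinarith

lemma slowOff_of_approx {a : ℝ → ℂ}
    (h : ∀ ε : ℝ, 0 < ε → ∃ b, SlowOff c b ∧ ∀ᵐ x, ‖a x - b x‖ ≤ ε) : SlowOff c a :=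
  fun ε hε => by
  obtain ⟨b, hb, hab⟩ := h (ε / 3) (by positivity)
  obtain ⟨E, hE⟩ := hb (ε / 3) (by positivity)
  refine ⟨E, fun S hS => ?_⟩
  obtain ⟨η, hη, h1⟩ := hE S hS
  refine ⟨η, hη, fun ρ hρ hρη s hs => ?_⟩
  filter_upwards [h1 ρ hρ hρη s hs, hab, ae_comp_add hab s] with x k1 k2 k3 x1 x2 x3
  have e : a x - a (x + s) = (a x - b x) + (b x - b (x + s)) - (a (x + s) - b (x + s)) := by ring
  rw [e]
  exact (norm_sub_le_of_le (norm_add_le_of_le k2 (k1 x1 x2 x3)) k3).trans (by linarith)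

lemma slowOff_const (z : ℂ) : SlowOff c fun _ => z := fun ε hε =>
  ⟨∅, fun S hS => ⟨1, one_pos, fun ρ _ _ s _ => .of_forall fun x _ _ _ => by
    simpa using hε.le⟩⟩

lemma slowOff_of_oscillation {f : ℝ → ℂ} (c' : ℝ)
    (far : ∀ r ε : ℝ, 0 < r → 0 < ε → ∃ η : ℝ, 0 < η ∧ ∀ x y : ℝ, r ≤ |x - c'| → r ≤ |y - c'| →
      |x - y| ≤ η → ‖f x - f y‖ ≤ ε)
    (near : ∀ R ε : ℝ, 1 < R → 0 < ε → ∃ X : ℝ, 0 < X ∧ ∀ x y : ℝ, x ≠ c' → |x - c'| ≤ X →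
      |x - c'| ≤ R * |y - c'| → |y - c'| ≤ R * |x - c'| → 0 < (x - c) * (y - c) →
      ‖f x - f y‖ ≤ ε) : SlowOff c f := fun ε hε => by
  refine ⟨{c'}, fun S hS => ?_⟩
  obtain ⟨X, hX, hnear⟩ := near (1 + S) ε (by linarith) hε
  obtain ⟨η, hη, hfar⟩ := far (X / 2) ε (half_pos hX) hε
  refine ⟨min (η / S) (X / 2 / S), by positivity, fun ρ hρ hρη s hs =>
    .of_forall fun x x1 x2 x3 => ?_⟩
  have r1 := x1 c' (Finset.mem_singleton_self _)
  have r2 := x2 c' (Finset.mem_singleton_self _)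
  have r3 : ρ * S < η := (lt_div_iff₀ hS).1 (hρη.trans_le (min_le_left _ _))
  have r4 : ρ * S < X / 2 := (lt_div_iff₀ hS).1 (hρη.trans_le (min_le_right _ _))
  have t1 : |x - c'| ≤ |x + s - c'| + |s| := by
    rw [show x - c' = (x + s - c') - s by ring]; exact abs_sub _ _
  have t2 : |x + s - c'| ≤ |x - c'| + |s| := by
    rw [show x + s - c' = (x - c') + s by ring]; exact abs_add_le _ _
  by_cases hx : |x - c'| ≤ X
  · refine hnear x (x + s) ?_ hx (by nlinarith) (by nlinarith) x3
    rintro rfl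
    rw [sub_self, abs_zero] at r1
    linarith
  · push Not at hx
    refine hfar x (x + s) (by linarith) (by linarith) ?_
    rw [sub_add_cancel_left, abs_neg]
    linarith

lemma slowOff_of_mem_buc {f : ℝ → ℂ} (hf : UniformContinuous f) : SlowOff c f := by
  have h : ∀ ε : ℝ, 0 < ε → ∃ η : ℝ, 0 < η ∧ ∀ x y : ℝ, |x - y| ≤ η → ‖f x - f y‖ ≤ ε :=
    fun ε hε => by
    obtain ⟨η, hη, h⟩ := Metric.uniformContinuous_iff.1 hf ε hε
    refine ⟨η / 2, half_pos hη, fun x y hxy => ?_⟩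
    rw [← dist_eq_norm]
    exact (h (by rw [Real.dist_eq]; linarith)).le
  refine slowOff_of_oscillation 0 (fun r ε _ hε => ?_) fun R ε hR hε => ?_
  · obtain ⟨η, hη, h⟩ := h ε hε
    exact ⟨η, hη, fun x y _ _ => h x y⟩
  · obtain ⟨η, hη, h⟩ := h ε hε
    have hR0 : 0 < 1 + R := by linarith
    refine ⟨η / (1 + R), by positivity, fun x y _ h1 _ h2 _ => h x y ?_⟩
    have e : (1 + R) * (η / (1 + R)) = η := mul_div_cancel₀ _ hR0.ne'
    have t := abs_sub x y
    rw [sub_zero] at h1 h2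
    rw [sub_zero] at h2
    nlinarith

lemma ContinuousOffPoint.far {f : ℝ → ℂ} (hf : ContinuousOffPoint c f) (r ε : ℝ) (hr : 0 < r)
    (hε : 0 < ε) : ∃ η : ℝ, 0 < η ∧ ∀ x y : ℝ, r ≤ |x - c| → r ≤ |y - c| →
      |x - y| ≤ η → ‖f x - f y‖ ≤ ε := by
  obtain ⟨l, hl⟩ := hf.2
  have key : ∀ σ : ℝ, |σ| = 1 → ∃ η : ℝ, 0 < η ∧ ∀ x y : ℝ, r ≤ x → r ≤ y → |x - y| < η →
      ‖f (c + σ * x) - f (c + σ * y)‖ ≤ ε := fun σ hσ => by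
    have hmax : ∀ x : ℝ, 0 < max |x| r := fun x => lt_max_of_lt_right hr
    have hne : ∀ x : ℝ, c + σ * max |x| r ≠ c := fun x => by
      have : σ ≠ 0 := fun h => by simp [h] at hσ
      simpa [this] using (hmax x).ne'
    have hg : Continuous fun x : ℝ => f (c + σ * max |x| r) :=
      hf.1.comp_continuous (by fun_prop) hne
    have ht : Tendsto (fun x : ℝ => c + σ * max |x| r) (cocompact ℝ) (cocompact ℝ) := by
      rw [← Metric.cobounded_eq_cocompact, ← tendsto_norm_atTop_iff_cobounded]
      have h1 : Tendsto (fun x : ℝ => |x| - |c|) (Bornology.cobounded ℝ) atTop :=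
        tendsto_atTop_add_const_right _ _ tendsto_norm_cobounded_atTop
      refine tendsto_atTop_mono (fun x => ?_) h1
      have h2 : |σ * max |x| r| = max |x| r := by rw [abs_mul, hσ, one_mul, abs_of_pos (hmax x)]
      have h3 := abs_sub (c + σ * max |x| r) c
      rw [add_sub_cancel_left, h2] at h3
      have h4 := le_max_left |x| r
      rw [Real.norm_eq_abs]
      linarith
    obtain ⟨η, hη, h⟩ := Metric.uniformContinuous_iff.1
      (hg.uniformContinuous_of_tendsto_cocompact (hl.comp ht)) ε hε
    refine ⟨η, hη, fun x y hx hy hxy => ?_⟩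
    have := h (a := x) (b := y) (by rwa [Real.dist_eq])
    rw [abs_of_pos (hr.trans_le hx), abs_of_pos (hr.trans_le hy), max_eq_left hx, max_eq_left hy,
      dist_eq_norm] at this
    exact this.le
  obtain ⟨η, hη, h1⟩ := key 1 (by simp)
  obtain ⟨η', hη', h2⟩ := key (-1) (by simp)
  refine ⟨min r (min η η') / 2, by positivity, fun x y hx hy hxy => ?_⟩
  have l1 : |x - y| < η := by
    linarith [(min_le_right r (min η η')).trans (min_le_left _ _), half_lt_self hη]
  have l2 : |x - y| < η' := by
    linarith [(min_le_right r (min η η')).trans (min_le_right _ _), half_lt_self hη']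
  have l3 : |x - y| < r := by linarith [min_le_left r (min η η')]
  rcases le_abs.1 hx with hx | hx <;> rcases le_abs.1 hy with hy | hy
  · simpa using h1 (x - c) (y - c) hx hy (by simpa using l1)
  · linarith [le_abs_self (x - y)]
  · linarith [neg_le_abs (x - y)]
  · have := h2 (-(x - c)) (-(y - c)) hx hy (by
      rw [show -(x - c) - -(y - c) = -(x - y) by ring, abs_neg]; exact l2)
    simpa using this

lemma slowOff_of_mem_soAt {c' : ℝ} {f : ℝ → ℂ} (hf : f ∈ soAt c') : SlowOff c f :=
  slowOff_of_oscillation c' hf.1.far fun R ε hR hε => by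
    obtain ⟨X, hX, h⟩ := soAt_oscillation hf hR hε
    exact ⟨X, hX, fun x y h1 h2 h3 h4 _ => h x y h1 h2 h3 h4⟩

lemma slowOff_of_mem_pcAt {f : ℝ → ℂ} (hf : f ∈ pcAt c) : SlowOff c f :=
  slowOff_of_oscillation c hf.1.far fun R ε hR hε => by
    obtain ⟨-, ⟨l, hl⟩, ⟨l', hl'⟩⟩ := hf
    obtain ⟨u, hu, h1⟩ := mem_nhdsLT_iff_exists_Ioo_subset.1
      (Metric.tendsto_nhds.1 hl (ε / 2) (half_pos hε))
    obtain ⟨v, hv, h2⟩ := mem_nhdsGT_iff_exists_Ioo_subset.1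
      (Metric.tendsto_nhds.1 hl' (ε / 2) (half_pos hε))
    have hu' : 0 < c - u := sub_pos.2 hu
    have hv' : 0 < v - c := sub_pos.2 hv
    have hR0 : 0 < R := by linarith
    set X := min (c - u) (v - c) / (2 * R) with hXdef
    have hX : 0 < X := by positivity
    have e : X * (2 * R) = min (c - u) (v - c) := div_mul_cancel₀ _ (by positivity)
    have hXu : R * X < c - u := by nlinarith [min_le_left (c - u) (v - c)]
    have hXv : R * X < v - c := by nlinarith [min_le_right (c - u) (v - c)]
    refine ⟨X, hX, fun x y _ k1 k2 k3 k4 => ?_⟩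
    have k5 : |y - c| ≤ R * X := k3.trans (by gcongr)
    have k6 : |x - c| ≤ R * X := k1.trans (by nlinarith)
    rw [abs_le] at k5 k6
    have tri : ∀ z : ℂ, dist (f x) z < ε / 2 → dist (f y) z < ε / 2 → ‖f x - f y‖ ≤ ε :=
      fun z d1 d2 => by
      rw [← dist_eq_norm]
      exact (dist_triangle_right _ _ z).trans (by linarith)
    rcases pos_and_pos_or_neg_and_neg_of_mul_pos k4 with ⟨m1, m2⟩ | ⟨m1, m2⟩
    · exact tri l' (h2 ⟨by linarith, by linarith⟩) (h2 ⟨by linarith, by linarith⟩)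
    · exact tri l (h1 ⟨by linarith, by linarith⟩) (h1 ⟨by linarith, by linarith⟩)

lemma mem_buc_of_mem_soInfty {f : ℝ → ℂ} (hf : f ∈ soInfty) : UniformContinuous f := by
  refine Metric.uniformContinuous_iff.2 fun ε hε => ?_
  obtain ⟨X, hX, hosc⟩ := soInfty_oscillation hf (R := 2) one_lt_two (half_pos hε)
  obtain ⟨η, hη, h⟩ := Metric.uniformContinuousOn_iff.1 ((isCompact_Icc (a := -(2 * X))
    (b := 2 * X)).uniformContinuousOn_of_continuous hf.1.continuousOn) ε hε
  refine ⟨min η (X / 2), by positivity, fun x y hxy => ?_⟩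
  have h1 := hxy.trans_le (min_le_left _ _)
  have h2 := hxy.trans_le (min_le_right _ _)
  rw [Real.dist_eq] at h2
  have t1 := abs_sub_abs_le_abs_sub x y
  have t2 := abs_sub_abs_le_abs_sub y x
  rw [abs_sub_comm] at t2
  by_cases hx : X ≤ |x|
  · rw [dist_eq_norm]
    exact (hosc x y hx (by linarith) (by linarith)).trans_lt (half_lt_self hε)
  · push Not at hx
    exact h x (abs_le.1 (by linarith)) y (abs_le.1 (by linarith)) h1

end SlowSymbols

section SymbolLimits

variable {c : ℝ}

lemma scaleLimits_of_tendsto {h : ℕ+ → ℕ+} (hh : Tendsto h atTop atTop) {f : ℝ → ℂ} {t : ℝ}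
    {α β : ℂ} (hα : Tendsto f (𝓝[<] t) (𝓝 α)) (hβ : Tendsto f (𝓝[>] t) (𝓝 β)) :
    ScaleLimits (fun n x => f (t + x / h n)) α β := fun R ε hR hε => by
  have hR0 : 0 < R := by linarith
  obtain ⟨u, hu, h1⟩ := mem_nhdsLT_iff_exists_Ioo_subset.1 (Metric.tendsto_nhds.1 hα ε hε)
  obtain ⟨v, hv, h2⟩ := mem_nhdsGT_iff_exists_Ioo_subset.1 (Metric.tendsto_nhds.1 hβ ε hε)
  have hu' : 0 < t - u := sub_pos.2 hu
  have hv' : 0 < v - t := sub_pos.2 hv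
  filter_upwards [(tendsto_index hh).eventually_gt_atTop (R / (t - u)),
    (tendsto_index hh).eventually_gt_atTop (R / (v - t))] with n n1 n2
  have hn := index_pos (h n)
  rw [div_lt_comm₀ hu' hn] at n1
  rw [div_lt_comm₀ hv' hn] at n2
  refine .of_forall fun x => ⟨fun x1 x2 => ?_, fun x1 x2 => ?_⟩
  · have x0 : 0 < x := (inv_pos.2 hR0).trans_le x1
    have e : x / h n ≤ R / h n := by gcongr
    have e0 : 0 < x / h n := by positivity
    rw [← dist_eq_norm]
    exact (h2 ⟨by linarith, by linarith⟩ : dist _ _ < ε).le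
  · have x0 : 0 < -x := (inv_pos.2 hR0).trans_le x1
    have e : -x / h n ≤ R / h n := by gcongr
    have e0 : 0 < -x / h n := by positivity
    rw [neg_div] at e e0
    rw [← dist_eq_norm]
    exact (h1 ⟨by linarith, by linarith⟩ : dist _ _ < ε).le

/-- The symbols `b` for which the convolution operator `W⁰(b)` is treated below. -/
structure SymbolLimits (c : ℝ) (h : ℕ+ → ℕ+) (b : ℝ → ℂ) : Prop where
  memLp : MemLp b ⊤
  slowOff : SlowOff c b
  scaleLimits : ∀ t : ℝ, ∃ α β : ℂ, ScaleLimits (fun n x => b (t + x / h n)) α β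

lemma SymbolLimits.of_eventually {h h' m : ℕ+ → ℕ+} {b : ℝ → ℂ} (hm : Tendsto m atTop atTop)
    (he : ∀ᶠ n in atTop, h' n = h (m n)) (hb : SymbolLimits c h b) : SymbolLimits c h' b := by
  refine ⟨hb.1, hb.2, fun t => ?_⟩
  obtain ⟨α, β, h2⟩ := hb.3 t
  refine ⟨α, β, h2.of_eventually hm ?_⟩
  filter_upwards [he] with n hn
  rw [hn]

lemma exists_subseq_symbolLimits {S : Set (ℝ → ℂ)}
    (hS : ∀ a ∈ S, ∀ g : ℕ+ → ℕ+, StrictMono g →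
      ∃ k : ℕ+ → ℕ+, StrictMono k ∧ SymbolLimits c (g ∘ k) a) :
    ∀ a ∈ linfAlg S, ∀ g : ℕ+ → ℕ+, StrictMono g →
      ∃ k : ℕ+ → ℕ+, StrictMono k ∧ SymbolLimits c (g ∘ k) a := by
  refine linfAlg_induction (fun a h h' m hm he ha => ha.of_eventually hm he)
    (fun h c _ => ⟨memLp_top_const c, slowOff_const c, fun t => ⟨c, c, scaleLimits_const c⟩⟩)
    ?_ ?_ ?_ hS
  · rintro h a b - ⟨ha, ha1, ha2⟩ ⟨hb, hb1, hb2⟩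
    refine ⟨ha.add hb, ha1.add hb1, fun t => ?_⟩
    obtain ⟨α, β, h1⟩ := ha2 t
    obtain ⟨γ, δ, h2⟩ := hb2 t
    exact ⟨_, _, h1.add h2⟩
  · rintro h a b - ⟨ha, ha1, ha2⟩ ⟨hb, hb1, hb2⟩
    refine ⟨memLp_top_mul ha hb, ha1.mul ha hb hb1, fun t => ?_⟩
    obtain ⟨α, β, h1⟩ := ha2 t
    obtain ⟨γ, δ, h2⟩ := hb2 t
    obtain ⟨C, -, hC⟩ := exists_essBound ha
    exact ⟨_, _, h1.mul (fun n => ae_comp_scale hC t (index_pos (h n))) h2⟩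
  · intro h a _ ha H
    refine ⟨ha, slowOff_of_approx fun ε hε => ?_, fun t =>
      exists_scaleLimits_of_approx fun ε hε => ?_⟩
    · obtain ⟨b, hb, hab⟩ := H ε hε
      exact ⟨b, hb.2, hab⟩
    · obtain ⟨b, hb, hab⟩ := H ε hε
      obtain ⟨α, β, h1⟩ := hb.3 t
      exact ⟨_, α, β, h1, fun n => ae_comp_scale hab t (index_pos (h n))⟩

lemma symbolLimits_of_tendsto {h : ℕ+ → ℕ+} (hh : StrictMono h) {f : ℝ → ℂ}
    (h1 : MemLp f ⊤) (h2 : SlowOff c f)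
    (h3 : ∀ t, (∃ α, Tendsto f (𝓝[<] t) (𝓝 α)) ∧ ∃ β, Tendsto f (𝓝[>] t) (𝓝 β)) :
    SymbolLimits c h f := by
  refine ⟨h1, h2, fun t => ?_⟩
  obtain ⟨⟨α, hα⟩, β, hβ⟩ := h3 t
  exact ⟨α, β, scaleLimits_of_tendsto (tendsto_of_strictMono hh) hα hβ⟩

lemma symbolLimits_of_uniformContinuous {h : ℕ+ → ℕ+} (hh : StrictMono h) {f : ℝ → ℂ}
    (h1 : MemLp f ⊤) (h2 : UniformContinuous f) : SymbolLimits c h f :=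
  symbolLimits_of_tendsto hh h1 (slowOff_of_mem_buc h2) fun t =>
    ⟨⟨_, h2.continuous.continuousAt.tendsto.mono_left nhdsWithin_le_nhds⟩,
      _, h2.continuous.continuousAt.tendsto.mono_left nhdsWithin_le_nhds⟩

lemma norm_le_of_essBound {f : ℝ → ℂ} {C x : ℝ} (hC : ∀ᵐ x, ‖f x‖ ≤ C) (hf : ContinuousAt f x) :
    ‖f x‖ ≤ C :=
  le_of_tendsto_of_frequently hf.norm (mem_closure_iff_frequently.1 (Measure.dense_of_ae hC x))

lemma exists_symbolLimits_soAt {c' : ℝ} {f : ℝ → ℂ} (hf : f ∈ soAt c') {g : ℕ+ → ℕ+}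
    (hg : StrictMono g) : ∃ k : ℕ+ → ℕ+, StrictMono k ∧ SymbolLimits c (g ∘ k) f := by
  obtain ⟨C, -, hC⟩ := exists_essBound hf.2.1
  have hne : ∀ n : ℕ+, c' + 1 / (n : ℝ) ≠ c' := fun n => by
    have := index_pos n
    simp [this.ne']
  obtain ⟨l, k, hk, hl⟩ := exists_tendsto_subseq (v := fun n => f (c' + 1 / (g n : ℝ))) fun n =>
    norm_le_of_essBound hC (hf.1.continuousAt (hne _))
  have hgk := hg.comp hk
  refine ⟨k, hk, hf.2.1, slowOff_of_mem_soAt hf, fun t => ?_⟩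
  by_cases ht : t = c'
  · subst ht
    refine ⟨l, l, fun R ε hR hε => ?_⟩
    have hR0 : 0 < R := by linarith
    obtain ⟨X, hX, hosc⟩ := soAt_oscillation hf hR (half_pos hε)
    filter_upwards [Metric.tendsto_nhds.1 hl _ (half_pos hε),
      (tendsto_index (tendsto_of_strictMono hgk)).eventually_ge_atTop (1 / X)] with n h1 h2
    have hpos := index_pos ((g ∘ k) n)
    rw [div_le_comm₀ hX hpos] at h2
    have key : ∀ x : ℝ, R⁻¹ ≤ |x| → |x| ≤ R → ‖f (t + x / (g ∘ k) n) - l‖ ≤ ε := fun x r1 r2 => by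
      have r1' : 1 ≤ R * |x| := by rwa [inv_le_iff_one_le_mul₀' hR0] at r1
      have h3 := hosc (t + 1 / (g ∘ k) n) (t + x / (g ∘ k) n) (hne _)
      simp only [add_sub_cancel_left, abs_div, abs_one, abs_of_pos hpos] at h3
      have h4 := h3 h2 (by rw [mul_div_assoc']; gcongr) (by rw [mul_div_assoc', mul_one]; gcongr)
      rw [dist_eq_norm] at h1
      have e : f (t + x / (g ∘ k) n) - l = -(f (t + 1 / (g ∘ k) n) - f (t + x / (g ∘ k) n)) +
        (f (t + 1 / (g ∘ k) n) - l) := by ring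
      rw [e]
      exact (norm_add_le_of_le ((norm_neg _).trans_le h4) h1.le).trans (by linarith)
    refine .of_forall fun x => ⟨fun r1 r2 => key x (r1.trans (le_abs_self x)) ?_,
      fun r1 r2 => key x (r1.trans (neg_le_abs x)) ?_⟩
    · rwa [abs_of_nonneg ((inv_pos.2 hR0).le.trans r1)]
    · rwa [← abs_neg, abs_of_nonneg ((inv_pos.2 hR0).le.trans r1)]
  · have hc := (hf.1.continuousAt ht).tendsto
    exact ⟨_, _, scaleLimits_of_tendsto (tendsto_of_strictMono hgk)
      (hc.mono_left nhdsWithin_le_nhds) (hc.mono_left nhdsWithin_le_nhds)⟩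

lemma exists_symbolLimits {b : ℝ → ℂ} (hb : b ∈ linfAlg (pcAt c ∪ so ∪ buc)) :
    ∀ g : ℕ+ → ℕ+, StrictMono g → ∃ k : ℕ+ → ℕ+, StrictMono k ∧ SymbolLimits c (g ∘ k) b := by
  refine exists_subseq_symbolLimits ?_ b hb
  rintro a ((ha | ha) | ha) g hg
  · refine ⟨id, strictMono_id, symbolLimits_of_tendsto hg (memLp_of_mem_pcAt ha)
      (slowOff_of_mem_pcAt ha) fun t => ?_⟩
    by_cases ht : t = c
    · subst ht
      exact ha.2
    · have hc := (ha.1.continuousAt ht).tendsto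
      exact ⟨⟨_, hc.mono_left nhdsWithin_le_nhds⟩, _, hc.mono_left nhdsWithin_le_nhds⟩
  · refine exists_subseq_symbolLimits ?_ a ha g hg
    rintro a (ha | ha) g hg
    · obtain ⟨c', ha⟩ := mem_iUnion.1 ha
      exact exists_symbolLimits_soAt ha hg
    · exact ⟨id, strictMono_id,
        symbolLimits_of_uniformContinuous hg ha.2.1 (mem_buc_of_mem_soInfty ha)⟩
  · obtain ⟨h1, C, hC⟩ := ha
    exact ⟨id, strictMono_id, symbolLimits_of_uniformContinuous hg
      (memLp_top_of_norm_le h1.continuous.aestronglyMeasurable hC) h1⟩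

end SymbolLimits

section FourierIntegral

open scoped SchwartzMap ContDiff RealInnerProductSpace

lemma ae_eq_of_schwartz {f f' : ℝ → ℂ} (hf : LocallyIntegrable f volume)
    (hf' : LocallyIntegrable f' volume)
    (h : ∀ g : 𝓢(ℝ, ℂ), ∫ x, g x • f x = ∫ x, g x • f' x) : f =ᵐ[volume] f' := by
  refine ae_eq_of_integral_contDiff_smul_eq hf hf' fun g g_smooth g_cpt => ?_
  have hg₁ : HasCompactSupport (Complex.ofRealCLM ∘ g) := g_cpt.comp_left rfl
  have hg₂ : ContDiff ℝ ∞ (Complex.ofRealCLM ∘ g) := by fun_prop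
  simpa using h (hg₁.toSchwartzMap hg₂)

lemma locallyIntegrable_coeFn (u : X 2) : LocallyIntegrable u volume :=
  (Lp.memLp u).locallyIntegrable (by norm_num)

lemma fourier_coeFn (u : X 2) (hu : Integrable u) :
    (𝓕 u : X 2) =ᵐ[volume] 𝓕 (u : ℝ → ℂ) := by
  refine ae_eq_of_schwartz (locallyIntegrable_coeFn _)
    (VectorFourier.fourierIntegral_continuous Real.continuous_fourierChar
      continuous_inner hu).locallyIntegrable fun g => ?_
  have h1 := DFunLike.congr_fun (Lp.fourier_toTemperedDistribution_eq u) g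
  rw [TemperedDistribution.fourier_apply, Lp.toTemperedDistribution_apply,
    Lp.toTemperedDistribution_apply] at h1
  rw [← h1, SchwartzMap.fourier_coe]
  have h2 := VectorFourier.integral_fourierIntegral_smul_eq_flip (L := innerₗ ℝ)
    Real.continuous_fourierChar continuous_inner (g.integrable (μ := volume)) hu
  rw [flip_innerₗ] at h2
  exact h2

lemma fourierInv_coeFn (u : X 2) (hu : Integrable u) :
    (𝓕⁻ u : X 2) =ᵐ[volume] 𝓕⁻ (u : ℝ → ℂ) := by
  have hc : Continuous fun p : ℝ × ℝ => (-innerₗ ℝ) p.1 p.2 := (continuous_inner (𝕜 := ℝ)).neg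
  refine ae_eq_of_schwartz (locallyIntegrable_coeFn _)
    (VectorFourier.fourierIntegral_continuous Real.continuous_fourierChar
      hc hu).locallyIntegrable fun g => ?_
  have h1 := DFunLike.congr_fun (Lp.fourierInv_toTemperedDistribution_eq u) g
  rw [TemperedDistribution.fourierInv_apply, Lp.toTemperedDistribution_apply,
    Lp.toTemperedDistribution_apply] at h1
  rw [← h1, SchwartzMap.fourierInv_coe]
  have h2 := VectorFourier.integral_fourierIntegral_smul_eq_flip (L := -innerₗ ℝ)
    Real.continuous_fourierChar hc (g.integrable (μ := volume)) hu
  have h3 : (-innerₗ ℝ).flip = -innerₗ ℝ := by ext; simp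
  rw [h3] at h2
  exact h2

/-- The factor `(2π)^{-1/2}`. -/
def fourierConst : ℂ := (((2 * Real.pi) ^ (-(1 / (2 : ℝ≥0∞).toReal)) : ℝ) : ℂ)

lemma measurePreserving_neg' : MeasurePreserving (fun x : ℝ => -x) volume volume :=
  Measure.measurePreserving_neg volume

/-- The reflection `u ↦ u(-·)`. -/
def reflection : Op 2 :=
  (Lp.compMeasurePreservingₗᵢ ℂ (fun x : ℝ => -x) measurePreserving_neg').toContinuousLinearMap

lemma reflection_coeFn (u : X 2) : reflection u =ᵐ[volume] fun x => u (-x) :=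
  Lp.coeFn_compMeasurePreserving u measurePreserving_neg'

lemma reflection_mul_self : reflection * reflection = 1 := by
  ext u
  filter_upwards [reflection_coeFn (reflection u),
    measurePreserving_neg'.quasiMeasurePreserving.ae (reflection_coeFn u)] with x h1 h2
  rw [mul_apply_eq_comp, h1, h2, neg_neg, one_apply_eq_self]

lemma reflection_norm_le : ‖reflection‖ ≤ 1 := LinearIsometry.norm_toContinuousLinearMap_le _

lemma memLp_comp_neg {q : ℝ≥0∞} {a : ℝ → ℂ} (ha : MemLp a q) :
    MemLp (fun x => a (-x)) q := ha.comp_measurePreserving measurePreserving_neg'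

lemma reflection_mulOp {a : ℝ → ℂ} (ha : MemLp a ⊤) :
    reflection * mulOp 2 a ha = mulOp 2 (fun x => a (-x)) (memLp_comp_neg ha) * reflection := by
  ext u
  filter_upwards [reflection_coeFn (mulOp 2 a ha u), reflection_coeFn u,
    mulOp_coeFn 2 _ (memLp_comp_neg ha) (reflection u),
    measurePreserving_neg'.quasiMeasurePreserving.ae (mulOp_coeFn 2 a ha u)] with x h1 h2 h3 h4
  rw [mul_apply_eq_comp, mul_apply_eq_comp, h1, h4, h3, h2]

/-- The unitary Fourier transform `(2π)^{-1/2} ∫ u(t) e^{itx} dt` on `L²(ℝ)`. -/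
def gOp : Op 2 := reflection * dilation 2 (2 * Real.pi) two_pi_pos *
  (Lp.fourierTransformₗᵢ ℝ ℂ).toContinuousLinearEquiv.toContinuousLinearMap

/-- The inverse unitary Fourier transform. -/
def gInv : Op 2 := (Lp.fourierTransformₗᵢ ℝ ℂ).symm.toContinuousLinearEquiv.toContinuousLinearMap *
  (dilation 2 (2 * Real.pi)⁻¹ (inv_pos.2 two_pi_pos) * reflection)

lemma norm_isometryEquiv_le (e : X 2 ≃ₗᵢ[ℂ] X 2) :
    ‖(e.toContinuousLinearEquiv.toContinuousLinearMap : Op 2)‖ ≤ 1 :=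
  ContinuousLinearMap.opNorm_le_bound _ zero_le_one fun u => by
    rw [one_mul]; exact (e.norm_map u).le

lemma norm_gOp_le : ‖gOp‖ ≤ 1 := by
  refine (norm_mul_le_of_le (norm_mul_le_of_le reflection_norm_le (dilation_norm_le 2 _ _))
    (norm_isometryEquiv_le _)).trans ?_
  norm_num

lemma norm_gInv_le : ‖gInv‖ ≤ 1 := by
  refine (norm_mul_le_of_le (norm_isometryEquiv_le _)
    (norm_mul_le_of_le (dilation_norm_le 2 _ _) reflection_norm_le)).trans ?_
  norm_num

lemma gOp_mul_gInv : gOp * gInv = 1 := by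
  have h1 : (Lp.fourierTransformₗᵢ ℝ ℂ).toContinuousLinearEquiv.toContinuousLinearMap *
      (Lp.fourierTransformₗᵢ ℝ ℂ).symm.toContinuousLinearEquiv.toContinuousLinearMap =
      (1 : Op 2) := by
    ext1 u; exact (Lp.fourierTransformₗᵢ ℝ ℂ).apply_symm_apply u
  have h2 := dilation_comp 2 (2 * Real.pi) (2 * Real.pi)⁻¹ two_pi_pos
    (inv_pos.2 two_pi_pos) (mul_inv_cancel₀ Real.two_pi_pos.ne')
  rw [gOp, gInv]
  generalize (Lp.fourierTransformₗᵢ ℝ ℂ).toContinuousLinearEquiv.toContinuousLinearMap = a at *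
  generalize (Lp.fourierTransformₗᵢ ℝ ℂ).symm.toContinuousLinearEquiv.toContinuousLinearMap = b at *
  generalize dilation 2 (2 * Real.pi) two_pi_pos = d at *
  generalize dilation 2 (2 * Real.pi)⁻¹ (inv_pos.2 two_pi_pos) = d' at *
  calc reflection * d * a * (b * (d' * reflection)) =
      reflection * d * (a * b) * d' * reflection := by noncomm_ring
    _ = reflection * (d * d') * reflection := by rw [h1]; noncomm_ring
    _ = 1 := by rw [h2, mul_one, reflection_mul_self]

lemma gInv_mul_gOp : gInv * gOp = 1 := by
  have h1 : (Lp.fourierTransformₗᵢ ℝ ℂ).symm.toContinuousLinearEquiv.toContinuousLinearMap *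
      (Lp.fourierTransformₗᵢ ℝ ℂ).toContinuousLinearEquiv.toContinuousLinearMap =
      (1 : Op 2) := by
    ext1 u; exact (Lp.fourierTransformₗᵢ ℝ ℂ).symm_apply_apply u
  have h2 := dilation_comp 2 (2 * Real.pi)⁻¹ (2 * Real.pi) (inv_pos.2 two_pi_pos)
    two_pi_pos (inv_mul_cancel₀ Real.two_pi_pos.ne')
  rw [gOp, gInv]
  generalize (Lp.fourierTransformₗᵢ ℝ ℂ).toContinuousLinearEquiv.toContinuousLinearMap = a at *
  generalize (Lp.fourierTransformₗᵢ ℝ ℂ).symm.toContinuousLinearEquiv.toContinuousLinearMap = b at *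
  generalize dilation 2 (2 * Real.pi) two_pi_pos = d at *
  generalize dilation 2 (2 * Real.pi)⁻¹ (inv_pos.2 two_pi_pos) = d' at *
  calc b * (d' * reflection) * (reflection * d * a) =
      b * d' * (reflection * reflection) * d * a := by noncomm_ring
    _ = b * (d' * d) * a := by rw [reflection_mul_self]; noncomm_ring
    _ = 1 := by rw [h2, mul_one, h1]

lemma convOp_eq (b : ℝ → ℂ) (hb : MemLp b ⊤) :
    convOp b hb = gInv * mulOp 2 b hb * gOp := by
  have h1 : convOp b hb =
      (Lp.fourierTransformₗᵢ ℝ ℂ).symm.toContinuousLinearEquiv.toContinuousLinearMap *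
      (mulOp 2 _ (memLp_top_rescale hb) *
        (Lp.fourierTransformₗᵢ ℝ ℂ).toContinuousLinearEquiv.toContinuousLinearMap) := rfl
  have h2 := dilation_comp 2 (2 * Real.pi)⁻¹ (2 * Real.pi) (inv_pos.2 two_pi_pos)
    two_pi_pos (inv_mul_cancel₀ Real.two_pi_pos.ne')
  have h3 : dilation 2 (2 * Real.pi)⁻¹ (inv_pos.2 two_pi_pos) *
      (reflection * mulOp 2 b hb) = mulOp 2 _ (memLp_top_rescale hb) *
      (dilation 2 (2 * Real.pi)⁻¹ (inv_pos.2 two_pi_pos) * reflection) := by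
    rw [reflection_mulOp, ← mul_assoc, dilation_mulOp, mul_assoc]
    congr 1
    refine mulOp_congr 2 _ _ (.of_forall fun x => ?_)
    simp only [div_inv_eq_mul]
    rw [mul_comm x]
  rw [h1, gOp, gInv]
  generalize (Lp.fourierTransformₗᵢ ℝ ℂ).toContinuousLinearEquiv.toContinuousLinearMap = a at *
  generalize (Lp.fourierTransformₗᵢ ℝ ℂ).symm.toContinuousLinearEquiv.toContinuousLinearMap = c at *
  generalize dilation 2 (2 * Real.pi) two_pi_pos = d at *
  generalize dilation 2 (2 * Real.pi)⁻¹ (inv_pos.2 two_pi_pos) = d' at *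
  generalize mulOp 2 _ (memLp_top_rescale hb) = m' at *
  generalize mulOp 2 b hb = m at *
  calc c * (m' * a) = c * m' * (d' * (reflection * reflection) * d) * a := by
        rw [reflection_mul_self, mul_one, h2]; noncomm_ring
    _ = c * (m' * (d' * reflection)) * (reflection * d * a) := by noncomm_ring
    _ = _ := by rw [← h3]; noncomm_ring

lemma gOp_coeFn (u : X 2) (hu : Integrable u) :
    gOp u =ᵐ[volume] fun x => fourierConst * ∫ t : ℝ, exp (I * t * x) * u t := by
  have hq := measurePreserving_neg'.quasiMeasurePreserving
  filter_upwards [reflection_coeFn (dilation 2 (2 * Real.pi) two_pi_pos (𝓕 u)),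
    hq.ae (dilation_coeFn 2 (2 * Real.pi) two_pi_pos (𝓕 u)),
    hq.ae ((qmp_div _ two_pi_pos).ae (fourier_coeFn u hu))] with x h1 h2 h3
  refine h1.trans (h2.trans ?_)
  rw [h3, Real.fourier_real_eq_integral_exp_smul]
  congr 1
  refine integral_congr_ae (.of_forall fun t => ?_)
  simp only [smul_eq_mul]
  congr 2
  have : (Real.pi : ℂ) ≠ 0 := by exact_mod_cast Real.pi_ne_zero
  push_cast
  field_simp

lemma gInv_coeFn (w : X 2) (hw : Integrable w) :
    gInv w =ᵐ[volume] fun x => fourierConst * ∫ t : ℝ, exp (-(I * t * x)) * w t := by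
  set v := dilation 2 (2 * Real.pi)⁻¹ (inv_pos.2 two_pi_pos) (reflection w)
  set κ : ℂ := ((((2 * Real.pi)⁻¹ ^ (-(1 / (2 : ℝ≥0∞).toReal)) : ℝ)) : ℂ)
  have hv : v =ᵐ[volume] fun x => κ * w (-(2 * Real.pi) * x) := by
    filter_upwards [dilation_coeFn 2 (2 * Real.pi)⁻¹ (inv_pos.2 two_pi_pos) (reflection w),
      (qmp_div _ (inv_pos.2 two_pi_pos)).ae (reflection_coeFn w)] with x h1 h2
    rw [h1, h2, div_inv_eq_mul, mul_comm x, neg_mul]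
  have hvi : Integrable v := by
    refine Integrable.congr ?_ hv.symm
    exact (hw.comp_mul_left' (by simp [Real.pi_ne_zero])).const_mul _
  filter_upwards [fourierInv_coeFn v hvi] with x hx
  refine (show gInv w x = (𝓕⁻ v : X 2) x from rfl).trans (hx.trans ?_)
  rw [Real.fourierInv_eq']
  have e1 : ∀ t : ℝ, exp (↑(2 * Real.pi * ⟪t, x⟫) * I) • (κ * w (-(2 * Real.pi) * t)) =
      (fun s : ℝ => κ * (exp (-(I * s * x)) * w s)) (-(2 * Real.pi) * t) := by
    intro t
    simp only [smul_eq_mul, RCLike.inner_apply, conj_trivial]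
    rw [← mul_assoc, mul_comm _ κ, mul_assoc]
    congr 3
    push_cast
    ring
  rw [integral_congr_ae (g := fun t : ℝ => (fun s : ℝ => κ * (exp (-(I * s * x)) *
    w s)) (-(2 * Real.pi) * t)) (hv.mono fun t ht => by simp only [← e1 t, ht]),
    Measure.integral_comp_mul_left (fun s : ℝ => κ * (exp (-(I * s * x)) * w s)),
    integral_const_mul, Complex.real_smul, ← mul_assoc]
  congr 1
  rw [← Complex.ofReal_mul, fourierConst]
  congr 1
  have h2 : (0 : ℝ) < 2 * Real.pi := two_pi_pos
  rw [inv_neg, abs_neg, abs_of_pos (inv_pos.2 h2), Real.inv_rpow h2.le, ← Real.rpow_neg h2.le,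
    ← Real.rpow_neg_one, ← Real.rpow_add h2]
  congr 1
  norm_num

end FourierIntegral

section FourierRules

variable {p : ℝ≥0∞} [Fact (1 ≤ p)]

lemma op_ext_of_nice (hp' : p ≠ ⊤) {S T : Op p}
    (h : ∀ g (hg : NiceFun g), S ((hg.memLp p).toLp g) = T ((hg.memLp p).toLp g)) : S = T := by
  ext1 u
  have hcl : IsClosed {u : X p | S u = T u} := isClosed_eq (by fun_prop) (by fun_prop)
  exact hcl.closure_subset_iff.2 (by rintro _ ⟨g, hg, rfl⟩; exact h g hg) (dense_nice hp' u)

lemma NiceFun.integrable {g : ℝ → ℂ} (hg : NiceFun g) : Integrable g :=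
  memLp_one_iff_integrable.1 (hg.memLp 1)

lemma gOp_toLp {g : ℝ → ℂ} (hg : MemLp g 2) (hg1 : Integrable g) :
    gOp (hg.toLp g) =ᵐ[volume] fun x => fourierConst * ∫ t : ℝ, exp (I * t * x) * g t := by
  filter_upwards [gOp_coeFn _ (hg1.congr hg.coeFn_toLp.symm)] with x hx
  rw [hx]
  congr 1
  refine integral_congr_ae ?_
  filter_upwards [hg.coeFn_toLp] with t ht
  rw [ht]

lemma gInv_toLp {g : ℝ → ℂ} (hg : MemLp g 2) (hg1 : Integrable g) :
    gInv (hg.toLp g) =ᵐ[volume] fun x => fourierConst * ∫ t : ℝ, exp (-(I * t * x)) * g t := by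
  filter_upwards [gInv_coeFn _ (hg1.congr hg.coeFn_toLp.symm)] with x hx
  rw [hx]
  congr 1
  refine integral_congr_ae ?_
  filter_upwards [hg.coeFn_toLp] with t ht
  rw [ht]

lemma gOp_modulation (s : ℝ) : gOp * modulation 2 s = shift 2 (-s) * gOp := by
  refine op_ext_of_nice (by simp) fun g hg => Lp.ext ?_
  set e : ℝ → ℂ := fun x => exp (I * s * x)
  have he : ∀ x, ‖e x‖ = 1 := fun x => by rw [Complex.norm_exp]; simp
  have h1 : Integrable (fun x => e x * g x) volume :=
    hg.integrable.bdd_mul (by fun_prop) (.of_forall fun x => (he x).le)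
  have h2 : MemLp (fun x => e x * g x) 2 := by
    refine (hg.memLp 2).of_le h1.1 (.of_forall fun x => ?_)
    rw [norm_mul, he, one_mul]
  have h3 : modulation 2 s ((hg.memLp 2).toLp g) = h2.toLp _ := by
    refine Lp.ext ?_
    filter_upwards [modulation_coeFn 2 s ((hg.memLp 2).toLp g), (hg.memLp 2).coeFn_toLp,
      h2.coeFn_toLp] with x k1 k2 k3
    rw [k1, k2, k3]
  rw [mul_apply_eq_comp, mul_apply_eq_comp, h3]
  filter_upwards [gOp_toLp h2 h1, shift_coeFn 2 (-s) (gOp ((hg.memLp 2).toLp g)),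
    (qmp_sub (-s)).ae (gOp_toLp (hg.memLp 2) hg.integrable)] with x k1 k2 k3
  rw [k1, k2, k3]
  congr 1
  refine integral_congr_ae (.of_forall fun t => ?_)
  simp only [e]
  rw [← mul_assoc, ← Complex.exp_add]
  congr 2
  push_cast
  ring

lemma gOp_shift (s : ℝ) : gOp * shift 2 s = modulation 2 s * gOp := by
  refine op_ext_of_nice (by simp) fun g hg => Lp.ext ?_
  have h2 : MemLp (fun x => g (x - s)) 2 := memLp_shift (hg.memLp 2) s
  have h1 : Integrable (fun x => g (x - s)) volume := hg.integrable.comp_sub_right s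
  have h3 : shift 2 s ((hg.memLp 2).toLp g) = h2.toLp _ := by
    refine Lp.ext ?_
    filter_upwards [shift_coeFn 2 s ((hg.memLp 2).toLp g), (qmp_sub s).ae (hg.memLp 2).coeFn_toLp,
      h2.coeFn_toLp] with x k1 k2 k3
    rw [k1, k2, k3]
  rw [mul_apply_eq_comp, mul_apply_eq_comp, h3]
  filter_upwards [gOp_toLp h2 h1, modulation_coeFn 2 s (gOp ((hg.memLp 2).toLp g)),
    gOp_toLp (hg.memLp 2) hg.integrable] with x k1 k2 k3
  have e := integral_sub_right_eq_self (μ := (volume : Measure ℝ)) (fun t : ℝ =>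
    exp (I * s * x) * (exp (I * t * x) * g t)) s
  replace e := e.trans (integral_const_mul _ _)
  rw [k1, k2, k3, ← mul_assoc, mul_comm (exp _), mul_assoc, ← e]
  congr 1
  refine integral_congr_ae (.of_forall fun t => ?_)
  simp only
  rw [← mul_assoc, ← Complex.exp_add]
  congr 2
  push_cast
  ring

lemma gOp_dilation (c : ℝ) (hc : 0 < c) :
    gOp * dilation 2 c hc = dilation 2 c⁻¹ (inv_pos.2 hc) * gOp := by
  refine op_ext_of_nice (by simp) fun g hg => Lp.ext ?_
  set κ : ℂ := ((c ^ (-(1 / (2 : ℝ≥0∞).toReal)) : ℝ) : ℂ) with hκ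
  have h2 : MemLp (fun x => κ * g (x / c)) 2 := (memLp_dilate (hg.memLp 2) c hc).const_mul κ
  have h1 : Integrable (fun x => κ * g (x / c)) volume := (hg.integrable.comp_div hc.ne').const_mul κ
  have h3 : dilation 2 c hc ((hg.memLp 2).toLp g) = h2.toLp _ := by
    refine Lp.ext ?_
    filter_upwards [dilation_coeFn 2 c hc ((hg.memLp 2).toLp g),
      (qmp_div c hc).ae (hg.memLp 2).coeFn_toLp, h2.coeFn_toLp] with x k1 k2 k3
    rw [k1, k2, k3]
  rw [mul_apply_eq_comp, mul_apply_eq_comp, h3]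
  filter_upwards [gOp_toLp h2 h1, dilation_coeFn 2 c⁻¹ (inv_pos.2 hc) (gOp ((hg.memLp 2).toLp g)),
    (qmp_div c⁻¹ (inv_pos.2 hc)).ae (gOp_toLp (hg.memLp 2) hg.integrable)] with x k1 k2 k3
  have e : ∀ t : ℝ, exp (I * t * x) * (κ * g (t / c)) =
      κ * (fun y : ℝ => exp (I * y * ↑(x / c⁻¹)) * g y) (t / c) := fun t => by
    simp only
    rw [← mul_assoc, mul_comm _ κ, mul_assoc]
    congr 3
    have : (c : ℂ) ≠ 0 := by exact_mod_cast hc.ne'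
    push_cast
    field_simp
  rw [k1, k2, k3]
  simp only [e]
  rw [integral_const_mul, Measure.integral_comp_div (fun y : ℝ =>
    exp (I * y * ↑(x / c⁻¹)) * g y), Complex.real_smul, ← mul_assoc, ← mul_assoc,
    ← mul_assoc, mul_assoc fourierConst, mul_comm fourierConst]
  congr 2
  rw [hκ, ← Complex.ofReal_mul, abs_of_pos hc]
  congr 1
  rw [Real.inv_rpow hc.le, ← Real.rpow_neg hc.le]
  nth_rw 2 [← Real.rpow_one c]
  rw [← Real.rpow_add hc]
  congr 1
  norm_num

lemma mul_gInv_of {A B : Op 2} (h : gOp * A = B * gOp) : A * gInv = gInv * B := by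
  calc A * gInv = (gInv * gOp) * A * gInv := by rw [gInv_mul_gOp, one_mul]
    _ = gInv * (gOp * A) * gInv := by noncomm_ring
    _ = gInv * B * (gOp * gInv) := by rw [h]; noncomm_ring
    _ = gInv * B := by rw [gOp_mul_gInv, mul_one]

lemma conj_convOp {A A' B B' : Op 2} (h1 : gOp * A = B * gOp) (h2 : gOp * A' = B' * gOp)
    (b : ℝ → ℂ) (hb : MemLp b ⊤) :
    A * convOp b hb * A' = gInv * (B * mulOp 2 b hb * B') * gOp := by
  rw [convOp_eq]
  calc A * (gInv * mulOp 2 b hb * gOp) * A' = (A * gInv) * mulOp 2 b hb * (gOp * A') := by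
        noncomm_ring
    _ = _ := by rw [mul_gInv_of h1, h2]; noncomm_ring

lemma memLp_translate {b : ℝ → ℂ} (hb : MemLp b ⊤) (t : ℝ) :
    MemLp (fun x => b (x + t)) ⊤ := by
  simpa only [sub_neg_eq_add] using memLp_shift hb (-t)

lemma modulation_conj_convOp (t : ℝ) (b : ℝ → ℂ) (hb : MemLp b ⊤) :
    modulation 2 t * convOp b hb * modulation 2 (-t) =
      convOp (fun x => b (x + t)) (memLp_translate hb t) := by
  rw [conj_convOp (gOp_modulation t) (gOp_modulation (-t)), shift_mulOp, mul_assoc (mulOp 2 _ _),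
    neg_neg, shift_neg_mul, mul_one, convOp_eq]
  congr 2
  exact mulOp_congr 2 _ _ (.of_forall fun x => by simp only [sub_neg_eq_add])

lemma shift_comm_convOp (s : ℝ) (b : ℝ → ℂ) (hb : MemLp b ⊤) :
    shift 2 s * convOp b hb * shift 2 (-s) = convOp b hb := by
  rw [conj_convOp (gOp_shift s) (gOp_shift (-s)), modulation_mulOp, mul_assoc (mulOp 2 _ _),
    modulation_mul_neg, mul_one, convOp_eq]

lemma memLp_scale {b : ℝ → ℂ} (hb : MemLp b ⊤) (t : ℝ) (n : ℕ+) :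
    MemLp (fun x => b (t + x / n)) ⊤ := by
  simpa only [add_comm t] using memLp_dilate (memLp_translate hb t) (n : ℝ) (by exact_mod_cast n.pos)

lemma unlift_inr_convOp (t : ℝ) (n : ℕ+) (b : ℝ → ℂ) (hb : MemLp b ⊤) :
    unlift (.inr t) n (convOp b hb) = convOp (fun x => b (t + x / n)) (memLp_scale hb t n) := by
  have hn : (0 : ℝ) < n := by exact_mod_cast n.pos
  have e : unlift (.inr t) n (convOp b hb) = zInv 2 n *
      (modulation 2 t * convOp b hb * modulation 2 (-t)) * zOp 2 n := by
    simp only [unlift, mul_assoc]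
  have h1 : gOp * zInv 2 n = zOp 2 n * gOp := by
    rw [zInv, gOp_dilation, zOp]
    congr 2
    exact inv_inv _
  have h2 : gOp * zOp 2 n = zInv 2 n * gOp := gOp_dilation _ hn
  have h3 : zOp 2 n * mulOp 2 _ (memLp_translate hb t) = mulOp 2 _ (memLp_dilate
    (memLp_translate hb t) _ hn) * zOp 2 n := dilation_mulOp 2 _ hn _
  rw [e, modulation_conj_convOp, conj_convOp h1 h2, h3, mul_assoc (mulOp 2 _ _), zOp_mul_zInv,
    mul_one, convOp_eq]
  congr 2
  exact mulOp_congr 2 _ _ (.of_forall fun x => by simp only [add_comm t])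

end FourierRules

section Cayley

/-- The function `x ↦ 1 / (1 - iσx)`. -/
def cayley (σ : ℝ) (x : ℝ) : ℂ := (1 - I * σ * x)⁻¹

variable {σ : ℝ}

lemma one_sub_ne_zero (σ x : ℝ) : 1 - I * σ * x ≠ 0 := fun h => by
  simpa using congrArg Complex.re h

lemma continuous_cayley (σ : ℝ) : Continuous (cayley σ) :=
  Continuous.inv₀ (by fun_prop) (one_sub_ne_zero σ)

lemma norm_cayley_sq (σ x : ℝ) : ‖cayley σ x‖ ^ 2 = (1 + (σ * x) ^ 2)⁻¹ := by
  rw [cayley, norm_inv, inv_pow, Complex.sq_norm, Complex.normSq_apply]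
  simp
  ring

lemma norm_cayley_le_one (σ x : ℝ) : ‖cayley σ x‖ ≤ 1 := by
  rw [← sq_le_one_iff₀ (norm_nonneg _), norm_cayley_sq]
  exact inv_le_one_of_one_le₀ (by nlinarith [sq_nonneg (σ * x)])

lemma memLp_cayley_top (σ : ℝ) : MemLp (cayley σ) ⊤ :=
  memLp_top_of_norm_le (continuous_cayley σ).aestronglyMeasurable (norm_cayley_le_one σ)

lemma memLp_cayley (hσ : σ ^ 2 = 1) {q : ℝ≥0∞} (hq : 1 < q) : MemLp (cayley σ) q := by
  by_cases hq' : q = ⊤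
  · exact hq' ▸ memLp_cayley_top σ
  refine (integrable_norm_rpow_iff (continuous_cayley σ).aestronglyMeasurable
    (zero_lt_one.trans hq).ne' hq').1 ?_
  have hq1 : 1 < q.toReal := by
    rw [← ENNReal.toReal_one]; exact (ENNReal.toReal_lt_toReal ENNReal.one_ne_top hq').2 hq
  refine (integrable_rpow_neg_one_add_norm_sq (E := ℝ) (r := q.toReal) (by simpa using hq1)).congr
    (.of_forall fun x => ?_)
  have h0 : (0 : ℝ) ≤ 1 + x ^ 2 := by positivity
  simp only [Real.norm_eq_abs, sq_abs]
  rw [neg_div, Real.rpow_neg h0, ← Real.inv_rpow h0]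
  have := norm_cayley_sq σ x
  rw [mul_pow, hσ, one_mul] at this
  rw [← this, ← Real.rpow_natCast_mul (norm_nonneg _)]
  congr 1
  push_cast
  ring

/-- Multiplication by `1 / (1 - iσx)`. -/
def cayleyOp (p : ℝ≥0∞) [Fact (1 ≤ p)] (σ : ℝ) : Op p := mulOp p (cayley σ) (memLp_cayley_top σ)

lemma integral_exp_cayley (σ x : ℝ) :
    ∫ s in Ioi (0 : ℝ), exp (-(1 - I * σ * x) * s) = cayley σ x := by
  rw [integral_exp_mul_complex_Ioi (by simp) 0, cayley]
  simp only [Complex.ofReal_zero, mul_zero, Complex.exp_zero, neg_div_neg_eq, one_div]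

lemma inner_cayleyOp (σ : ℝ) (u v : X 2) :
    IntegrableOn (fun s : ℝ => exp (-s) * inner ℂ v (modulation 2 (σ * s) u)) (Ioi 0) ∧
    inner ℂ v (cayleyOp 2 σ u) =
      ∫ s in Ioi (0 : ℝ), exp (-s) * inner ℂ v (modulation 2 (σ * s) u) := by
  set F : ℝ → ℝ → ℂ := fun s x => exp (-(1 - I * σ * x) * s) * inner ℂ (v x) (u x)
  have hexp : Integrable (fun s : ℝ => exp (-s)) (volume.restrict (Ioi 0)) := by
    simpa [IntegrableOn] using integrableOn_exp_mul_complex_Ioi (a := -1) (by simp) 0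
  have hF : Integrable (Function.uncurry F) ((volume.restrict (Ioi 0)).prod volume) := by
    refine ((hexp.mul_prod (L2.integrable_inner (𝕜 := ℂ) v u)).bdd_mul (c := 1)
      (f := fun z : ℝ × ℝ => exp (I * σ * z.2 * z.1)) (by fun_prop)
      (.of_forall fun z => ?_)).congr (.of_forall fun z => ?_)
    · rw [Complex.norm_exp]; simp
    · simp only [F, Function.uncurry]
      rw [← mul_assoc, ← Complex.exp_add]
      congr 2
      ring
  have h1 : ∀ s : ℝ, ∫ x, F s x = exp (-s) * inner ℂ v (modulation 2 (σ * s) u) := fun s => by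
    rw [L2.inner_def, ← integral_const_mul]
    refine integral_congr_ae ?_
    filter_upwards [modulation_coeFn 2 (σ * s) u] with x hx
    rw [hx, ← smul_eq_mul (exp (I * _ * _)), inner_smul_right, ← mul_assoc, ← Complex.exp_add]
    simp only [F]
    congr 2
    push_cast
    ring
  have h2 : ∀ x, ∫ s in Ioi (0 : ℝ), F s x = cayley σ x * inner ℂ (v x) (u x) := fun x => by
    rw [← integral_exp_cayley, ← integral_mul_const]
  refine ⟨hF.integral_prod_left.congr (.of_forall h1), ?_⟩
  simp only [← h1]
  rw [integral_integral_swap hF, L2.inner_def]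
  refine integral_congr_ae ?_
  filter_upwards [mulOp_coeFn 2 _ (memLp_cayley_top σ) u] with x hx
  rw [h2, cayleyOp, hx, ← smul_eq_mul (cayley σ x) (u x), inner_smul_right]

lemma norm_cayleyOp_sub_le {A₁ A₂ B₁ B₂ : Op 2} {ε M S : ℝ} (hS : 0 ≤ S) (hε : 0 ≤ ε) (hM : 0 ≤ M)
    (h1 : ∀ s, 0 < s → s ≤ S →
      ‖A₁ * modulation 2 (σ * s) * A₂ - B₁ * modulation 2 (σ * s) * B₂‖ ≤ ε)
    (h2 : ∀ s, ‖A₁ * modulation 2 (σ * s) * A₂ - B₁ * modulation 2 (σ * s) * B₂‖ ≤ M) :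
    ‖A₁ * cayleyOp 2 σ * A₂ - B₁ * cayleyOp 2 σ * B₂‖ ≤ ε + M * Real.exp (-S) := by
  have hd : ∀ (T A B C D : Op 2) (x y : X 2), inner ℂ y ((A * T * B - C * T * D) x) =
      inner ℂ (ContinuousLinearMap.adjoint A y) (T (B x)) -
        inner ℂ (ContinuousLinearMap.adjoint C y) (T (D x)) := fun T A B C D x y => by
    rw [ContinuousLinearMap.adjoint_inner_left, ContinuousLinearMap.adjoint_inner_left,
      ← inner_sub_right]
    rfl
  refine ContinuousLinearMap.opNorm_le_of_re_inner_le (by positivity) fun x y hx hy => ?_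
  rw [inner_re_symm]
  refine (Complex.re_le_norm _).trans ?_
  obtain ⟨i1, e1⟩ := inner_cayleyOp σ (A₂ x) (ContinuousLinearMap.adjoint A₁ y)
  obtain ⟨i2, e2⟩ := inner_cayleyOp σ (B₂ x) (ContinuousLinearMap.adjoint B₁ y)
  rw [hd, e1, e2, ← integral_sub i1 i2]
  have hexp : ∀ c : ℝ, IntegrableOn (fun s : ℝ => Real.exp (-s)) (Ioi c) := fun c =>
    integrableOn_exp_neg_Ioi c
  have hg : IntegrableOn (fun s => ε * Real.exp (-s) +
      (Ioi S).indicator (fun s => M * Real.exp (-s)) s) (Ioi 0) :=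
    ((hexp 0).const_mul ε).add (((hexp 0).const_mul M).indicator measurableSet_Ioi)
  refine (norm_integral_le_of_norm_le hg ((ae_restrict_iff' measurableSet_Ioi).2
    (.of_forall fun s hs => ?_))).trans (le_of_eq ?_)
  · rw [← mul_sub, ← hd, norm_mul, Complex.norm_exp]
    simp only [Complex.neg_re, Complex.ofReal_re]
    have hb : ∀ C, ‖A₁ * modulation 2 (σ * s) * A₂ - B₁ * modulation 2 (σ * s) * B₂‖ ≤ C →
        Real.exp (-s) * ‖inner ℂ y
          ((A₁ * modulation 2 (σ * s) * A₂ - B₁ * modulation 2 (σ * s) * B₂) x)‖ ≤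
          C * Real.exp (-s) := fun C hC => by
      rw [mul_comm]
      refine mul_le_mul_of_nonneg_right ((norm_inner_le_norm _ _).trans ?_) (Real.exp_nonneg _)
      rw [hy, one_mul]
      exact (ContinuousLinearMap.le_of_opNorm_le _ hC x).trans (by rw [hx, mul_one])
    by_cases hsS : s ∈ Ioi S
    · rw [indicator_of_mem hsS]
      exact (hb M (h2 s)).trans (le_add_of_nonneg_left (by positivity))
    · rw [indicator_of_notMem hsS, add_zero]
      exact hb ε (h1 s hs (not_lt.1 hsS))
  · rw [integral_add ((hexp 0).const_mul ε) (((hexp 0).const_mul M).indicator measurableSet_Ioi),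
      setIntegral_indicator measurableSet_Ioi, Ioi_inter_Ioi, max_eq_right hS, integral_const_mul,
      integral_const_mul, integral_exp_neg_Ioi, integral_exp_neg_Ioi, neg_zero, Real.exp_zero,
      mul_one]

lemma eLpNorm_gOp_top {G : Op 2} {e : ℝ → ℝ → ℂ} (he : ∀ t x, ‖e t x‖ ≤ 1)
    (hG : ∀ u : X 2, Integrable u →
      G u =ᵐ[volume] fun x => fourierConst * ∫ t : ℝ, e t x * u t) (u : X 2) :
    eLpNorm (G u) ⊤ ≤ eLpNorm u 1 := by
  by_cases hu : Integrable u
  · rw [eLpNorm_exponent_top, eLpNorm_one_eq_lintegral_enorm]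
    refine essSup_le_of_ae_le _ ?_
    filter_upwards [hG u hu] with x hx
    rw [hx, enorm_mul]
    have hc : ‖fourierConst‖ₑ ≤ 1 := by
      rw [← ofReal_norm, ENNReal.ofReal_le_one, fourierConst, Complex.norm_real,
        Real.norm_of_nonneg (by positivity)]
      exact Real.rpow_le_one_of_one_le_of_nonpos (by linarith [Real.pi_gt_three]) (by norm_num)
    refine (mul_le_of_le_one_left' hc).trans ((enorm_integral_le_lintegral_enorm _).trans
      (lintegral_mono fun t => ?_))
    rw [enorm_mul]
    exact mul_le_of_le_one_left' (by rw [← ofReal_norm, ENNReal.ofReal_le_one]; exact he t x)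
  · have : eLpNorm u 1 = ⊤ := by
      by_contra h
      exact hu (memLp_one_iff_integrable.1 ⟨(Lp.memLp u).1, lt_top_iff_ne_top.2 h⟩)
    rw [this]
    exact le_top

lemma eLpNorm_mul_le {s q r : ℝ≥0∞} [s.HolderTriple q r] {a u : ℝ → ℂ}
    (ha : AEStronglyMeasurable a) (hu : AEStronglyMeasurable u) :
    eLpNorm (fun x => a x * u x) r ≤ eLpNorm a s volume * eLpNorm u q := by
  have h := eLpNorm_smul_le_mul_eLpNorm (p := s) (q := q) (r := r) hu ha
  exact (le_of_eq rfl).trans h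

lemma norm_mulOp_mul_le {G : Op 2} (hG : ∀ u, eLpNorm (G u) ⊤ ≤ eLpNorm u 1)
    {m a : ℝ → ℂ} (hm : MemLp m ⊤) (ha : MemLp a ⊤) (hm2 : MemLp m 2)
    (ha2 : MemLp a 2) : ‖mulOp 2 m hm * G * mulOp 2 a ha‖ ≤
      (eLpNorm m 2).toReal * (eLpNorm a 2).toReal := by
  refine ContinuousLinearMap.opNorm_le_bound _ (by positivity) fun u => ?_
  rw [mul_apply_eq_comp, mul_apply_eq_comp, Lp.norm_def, Lp.norm_def, ← ENNReal.toReal_mul,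
    ← ENNReal.toReal_mul]
  refine ENNReal.toReal_mono (ENNReal.mul_ne_top (ENNReal.mul_ne_top hm2.2.ne ha2.2.ne)
    (Lp.memLp u).2.ne) ?_
  have h1 : eLpNorm (mulOp 2 a ha u) 1 ≤ eLpNorm a 2 * eLpNorm u 2 := by
    rw [eLpNorm_congr_ae (mulOp_coeFn 2 a ha u)]
    exact eLpNorm_mul_le (s := 2) (q := 2) ha2.1 (Lp.memLp u).1
  rw [eLpNorm_congr_ae (mulOp_coeFn 2 m hm (G (mulOp 2 a ha u))), mul_assoc]
  exact (eLpNorm_mul_le (s := 2) (q := ⊤) hm2.1 (Lp.memLp (G (mulOp 2 a ha u))).1).trans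
    (mul_le_mul_right ((hG _).trans h1) _)

end Cayley

section Commutator

variable {σ : ℝ} {a b : ℝ → ℂ}

lemma convOp_mul (ha : MemLp a ⊤) (hb : MemLp b ⊤)
    (hab : MemLp (fun x => a x * b x) ⊤) :
    convOp a ha * convOp b hb = convOp (fun x => a x * b x) hab := by
  rw [convOp_eq, convOp_eq, convOp_eq, ← mulOp_mul 2 ha hb]
  calc gInv * mulOp 2 a ha * gOp * (gInv * mulOp 2 b hb * gOp) =
      gInv * mulOp 2 a ha * (gOp * gInv) * mulOp 2 b hb * gOp := by noncomm_ring
    _ = _ := by rw [gOp_mul_gInv]; noncomm_ring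

lemma convOp_sub (ha : MemLp a ⊤) (hb : MemLp b ⊤)
    (hab : MemLp (fun x => a x - b x) ⊤) :
    convOp a ha - convOp b hb = convOp (fun x => a x - b x) hab := by
  rw [convOp_eq, convOp_eq, convOp_eq, ← mulOp_sub 2 ha hb]
  noncomm_ring

lemma convOp_congr (ha : MemLp a ⊤) (hb : MemLp b ⊤) (h : a =ᵐ[volume] b) :
    convOp a ha = convOp b hb := by
  rw [convOp_eq, convOp_eq, mulOp_congr 2 ha hb h]

lemma norm_gInv_mul_mul_gOp_le (A : Op 2) : ‖gInv * A * gOp‖ ≤ ‖A‖ := by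
  refine (norm_mul_le_of_le (norm_mul_le_of_le norm_gInv_le le_rfl) norm_gOp_le).trans ?_
  rw [one_mul, mul_one]

lemma norm_convOp_le (hb : MemLp b ⊤) {C : ℝ} (hC : 0 ≤ C) (h : ∀ᵐ x, ‖b x‖ ≤ C) :
    ‖convOp b hb‖ ≤ C := by
  rw [convOp_eq]
  exact (norm_gInv_mul_mul_gOp_le _).trans (mulOp_norm_le 2 hb hC h)

lemma modulation_mul_convOp (t : ℝ) (hb : MemLp b ⊤) : modulation 2 t * convOp b hb =
    convOp (fun x => b (x + t)) (memLp_translate hb t) * modulation 2 t := by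
  rw [← modulation_conj_convOp, mul_assoc _ _ (modulation 2 t), modulation_neg_mul, mul_one]

lemma norm_exp_mul_le (t x : ℝ) : ‖exp (I * t * x)‖ ≤ 1 ∧
    ‖exp (-(I * t * x))‖ ≤ 1 := by
  constructor <;> · rw [Complex.norm_exp]; simp

lemma norm_convOp_mul_cayleyOp_le (hσ : σ ^ 2 = 1) (ha : MemLp a ⊤)
    (ha2 : MemLp a 2) :
    ‖convOp a ha * cayleyOp 2 σ‖ ≤
      (eLpNorm a 2).toReal * (eLpNorm (cayley σ) 2).toReal ∧
    ‖cayleyOp 2 σ * convOp a ha‖ ≤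
      (eLpNorm a 2).toReal * (eLpNorm (cayley σ) 2).toReal := by
  have hr := memLp_cayley hσ (q := 2) (by norm_num)
  rw [convOp_eq]
  constructor
  · rw [show gInv * mulOp 2 a ha * gOp * cayleyOp 2 σ =
      gInv * (mulOp 2 a ha * gOp * cayleyOp 2 σ) by noncomm_ring]
    refine (norm_mul_le_of_le norm_gInv_le (norm_mulOp_mul_le (eLpNorm_gOp_top
      (fun t x => (norm_exp_mul_le t x).1) gOp_coeFn) ha _ ha2 hr)).trans (one_mul _).le
  · rw [show cayleyOp 2 σ * (gInv * mulOp 2 a ha * gOp) =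
      (cayleyOp 2 σ * gInv * mulOp 2 a ha) * gOp by noncomm_ring]
    refine (norm_mul_le_of_le (norm_mulOp_mul_le (eLpNorm_gOp_top
      (fun t x => (norm_exp_mul_le t x).2) gInv_coeFn) _ ha hr ha2) norm_gOp_le).trans ?_
    rw [mul_one, mul_comm]

lemma commutator_split {R : Type*} [Ring R] {W r Q Q' : R} (h : Q + Q' = 1) (hQ : Q * W = W * Q)
    (hQ' : Q' * W = W * Q') : W * r - r * W = (Q' * W * r * Q' - Q' * r * (W * Q')) +
      (W * (Q * r) - Q * r * W) + Q' * (W * (r * Q) - r * Q * W) := by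
  have e : Q = 1 - Q' := eq_sub_of_add_eq h
  subst e
  have e1 : ∀ X, Q' * (W * X) = W * (Q' * X) := fun X => by rw [← mul_assoc, hQ', mul_assoc]
  simp only [mul_sub, sub_mul, one_mul, mul_one, mul_assoc, e1, hQ']
  abel

lemma norm_commutator_le (hσ : σ ^ 2 = 1) (hb : MemLp b ⊤) {M : ℝ} (hM0 : 0 ≤ M)
    (hM : ∀ᵐ x, ‖b x‖ ≤ M) (E : Finset ℝ) {δ S ε : ℝ} (hδ : 0 ≤ δ) (hS : 0 ≤ S) (hε : 0 ≤ ε)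
    (h : ∀ s, 0 < s → s ≤ S → ∀ᵐ x, (∀ e ∈ E, δ ≤ |x - e|) → (∀ e ∈ E, δ ≤ |x + σ * s - e|) →
      ‖b x - b (x + σ * s)‖ ≤ ε) :
    ‖convOp b hb * cayleyOp 2 σ - cayleyOp 2 σ * convOp b hb‖ ≤ ε + 2 * M * Real.exp (-S) +
      4 * M * (√(E.card * (2 * δ)) * (eLpNorm (cayley σ) 2).toReal) := by
  set N : Set ℝ := ⋃ e ∈ E, Metric.ball e δ
  have hN : MeasurableSet N := Finset.measurableSet_biUnion _ fun e _ => measurableSet_ball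
  have hvol : volume N ≤ ofReal (E.card * (2 * δ)) := by
    refine (measure_biUnion_finset_le _ _).trans (le_of_eq ?_)
    simp only [Real.volume_ball, Finset.sum_const, nsmul_eq_mul]
    rw [ENNReal.ofReal_mul (p := (E.card : ℝ)) (by positivity), ENNReal.ofReal_natCast]
  have hmem : ∀ x, x ∈ Nᶜ → ∀ e ∈ E, δ ≤ |x - e| := fun x hx e he => by
    by_contra hcon
    exact hx (mem_biUnion he (by rw [Metric.mem_ball, Real.dist_eq]; exact not_le.1 hcon))
  have m1 := memLp_indicator N hN
  have m2 := memLp_indicator Nᶜ hN.compl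
  have hQ2 : MemLp (N.indicator fun _ => (1 : ℂ)) 2 :=
    memLp_indicator_const 2 hN 1 (Or.inr (hvol.trans_lt ENNReal.ofReal_lt_top).ne)
  have hQn : (eLpNorm (N.indicator fun _ => (1 : ℂ)) 2).toReal ≤ √(E.card * (2 * δ)) := by
    have h2 := ENNReal.toReal_mono (b := ofReal (E.card * (2 * δ)) ^ (1 / 2 : ℝ))
      (ENNReal.rpow_ne_top_of_nonneg (by norm_num) ENNReal.ofReal_ne_top)
      (ENNReal.rpow_le_rpow hvol (by norm_num))
    rw [← ENNReal.toReal_rpow (ofReal _), ENNReal.toReal_ofReal (by positivity),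
      ← Real.sqrt_eq_rpow] at h2
    rw [eLpNorm_indicator_const hN (by norm_num) (by norm_num), enorm_one, one_mul]
    simpa using h2
  obtain ⟨c1, c2⟩ := norm_convOp_mul_cayleyOp_le hσ m1 hQ2
  replace c1 := c1.trans (mul_le_mul_of_nonneg_right hQn ENNReal.toReal_nonneg)
  replace c2 := c2.trans (mul_le_mul_of_nonneg_right hQn ENNReal.toReal_nonneg)
  have hW : ‖convOp b hb‖ ≤ M := norm_convOp_le hb hM0 hM
  have hQ' : ‖convOp _ m2‖ ≤ 1 :=
    norm_convOp_le m2 zero_le_one (.of_forall fun x => norm_indicator_one_le _ _)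
  have hcomm : ∀ {f : ℝ → ℂ} (hf : MemLp f ⊤), convOp f hf * convOp b hb =
      convOp b hb * convOp f hf := fun hf => by
    rw [convOp_mul hf hb (memLp_top_mul hf hb), convOp_mul hb hf (memLp_top_mul hb hf)]
    exact convOp_congr _ _ (.of_forall fun x => mul_comm _ _)
  have hadd : convOp _ m1 + convOp _ m2 = 1 := by
    rw [convOp_eq, convOp_eq, show gInv * mulOp 2 _ m1 * gOp + gInv * mulOp 2 _ m2 * gOp =
      gInv * (chi 2 N hN + chi 2 Nᶜ hN.compl) * gOp by rw [chi, chi]; noncomm_ring,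
      ← one_sub_chi (hs := hN), add_sub_cancel, mul_one, gInv_mul_gOp]
  have hmain : ‖convOp _ m2 * convOp b hb * cayleyOp 2 σ * convOp _ m2 -
      convOp _ m2 * cayleyOp 2 σ * (convOp b hb * convOp _ m2)‖ ≤ ε + 2 * M * Real.exp (-S) := by
    refine norm_cayleyOp_sub_le hS hε (by positivity) (fun s hs hsS => ?_) fun s => ?_
    · set t := σ * s
      have mt := memLp_translate m2 t
      have bt := memLp_translate hb t
      have d1 : MemLp (fun x => b x - b (x + t)) ⊤ := hb.sub bt
      have d2 := memLp_top_mul m2 d1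
      have d3 := memLp_top_mul d2 mt
      have e : convOp _ m2 * convOp b hb * modulation 2 t * convOp _ m2 -
          convOp _ m2 * modulation 2 t * (convOp b hb * convOp _ m2) =
          convOp _ d3 * modulation 2 t := by
        rw [← convOp_mul d2 mt, ← convOp_mul m2 d1, ← convOp_sub hb bt, mul_assoc _ (modulation 2 t),
          mul_assoc _ (modulation 2 t), ← mul_assoc (modulation 2 t) (convOp b hb),
          modulation_mul_convOp t hb, mul_assoc (convOp _ bt), modulation_mul_convOp t m2]
        noncomm_ring
      rw [e]
      refine (norm_mul_le_of_le (norm_convOp_le d3 hε ?_) (modulation_norm_le 2 t)).trans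
        (mul_one _).le
      filter_upwards [h s hs hsS] with x hx
      rw [norm_mul, norm_mul]
      by_cases h1 : x ∈ Nᶜ
      · by_cases h2 : x + t ∈ Nᶜ
        · have := hx (hmem x h1) (hmem _ h2)
          rw [indicator_of_mem h1, indicator_of_mem h2]
          simpa using this
        · rw [indicator_of_notMem h2, norm_zero, mul_zero]; exact hε
      · rw [indicator_of_notMem h1, norm_zero, zero_mul, zero_mul]; exact hε
    · have hm := modulation_norm_le 2 (σ * s)
      refine (norm_sub_le _ _).trans ((add_le_add (norm_mul_le_of_le (norm_mul_le_of_le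
        (norm_mul_le_of_le hQ' hW) hm) hQ') (norm_mul_le_of_le (norm_mul_le_of_le hQ' hm)
        (norm_mul_le_of_le hW hQ'))).trans (le_of_eq (by ring)))
  have hside : ∀ {X : Op 2} {D : ℝ}, ‖X‖ ≤ D →
      ‖convOp b hb * X - X * convOp b hb‖ ≤ 2 * M * D := fun hX =>
    (norm_sub_le _ _).trans ((add_le_add (norm_mul_le_of_le hW hX) (norm_mul_le_of_le hX hW)).trans
      (le_of_eq (by ring)))
  rw [commutator_split hadd (hcomm m1) (hcomm m2)]
  refine (norm_add₃_le).trans ((add_le_add (add_le_add hmain (hside c1))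
    (norm_mul_le_of_le hQ' (hside c2))).trans (le_of_eq (by ring)))

end Commutator

section Jump

variable {σ c : ℝ} {b : ℝ → ℂ} {h : ℕ+ → ℕ+}

/-- The characteristic function of the positive half-line. -/
def step : ℝ → ℂ := (Ioi (0 : ℝ)).indicator fun _ => 1

lemma memLp_step_top : MemLp step ⊤ := memLp_indicator _ measurableSet_Ioi

lemma ae_norm_sub_le_of_slow {α β κ : ℂ} (hκ : κ = β - α) {η δ S N : ℝ} (hN : 0 < N) (hδ : 0 < δ)
    {E : Finset ℝ} {R : ℝ} (hR : R⁻¹ ≤ δ) (hSR : S ≤ R) {t : ℝ} (ht : |t| ≤ S)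
    (h1 : ∀ᵐ x, (∀ e ∈ E, δ / N ≤ |x - e|) → (∀ e ∈ E, δ / N ≤ |x + t / N - e|) →
      0 < (x - c) * (x + t / N - c) → ‖b x - b (x + t / N)‖ ≤ 2 * η)
    (h2 : ∀ᵐ x : ℝ, (R⁻¹ ≤ x → x ≤ R → ‖b (c + x / N) - β‖ ≤ η) ∧
      (R⁻¹ ≤ -x → -x ≤ R → ‖b (c + x / N) - α‖ ≤ η)) :
    ∀ᵐ x : ℝ, (∀ e ∈ insert 0 (E.image fun e => N * (e - c)), δ ≤ |x - e|) →
      (∀ e ∈ insert 0 (E.image fun e => N * (e - c)), δ ≤ |x + t - e|) →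
      ‖(b (c + x / N) - κ * step x) - (b (c + (x + t) / N) - κ * step (x + t))‖ ≤ 2 * η := by
  filter_upwards [ae_comp_scale h1 c hN, h2, ae_comp_add h2 t] with x k1 k2 k3 a1 a2
  have hsc : ∀ y e : ℝ, c + y / N - e = (y - N * (e - c)) / N := fun y e => by field_simp; ring
  have hadd : c + x / N + t / N = c + (x + t) / N := by ring
  have himg : ∀ y, (∀ e ∈ insert 0 (E.image fun e => N * (e - c)), δ ≤ |y - e|) →
      ∀ e ∈ E, δ / N ≤ |c + y / N - e| := fun y hy e he => by
    rw [hsc, abs_div, abs_of_pos hN]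
    exact div_le_div_of_nonneg_right (hy _ (Finset.mem_insert_of_mem
      (Finset.mem_image_of_mem _ he))) hN.le
  have z1 := a1 0 (Finset.mem_insert_self _ _)
  have z2 := a2 0 (Finset.mem_insert_self _ _)
  rw [sub_zero] at z1 z2
  rw [hadd] at k1
  have k := k1 (himg x a1) (himg _ a2)
  have hcx : ∀ y, c + y / N - c = y / N := fun y => by ring
  rw [hcx, hcx, div_mul_div_comm] at k
  have ht' := abs_le.1 ht
  have s1 : ∀ y : ℝ, 0 < y → step y = 1 := fun y hy => indicator_of_mem hy _
  have s0 : ∀ y : ℝ, y < 0 → step y = 0 := fun y hy => indicator_of_notMem (not_lt.2 hy.le) _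
  have split : ∀ u v : ℂ, ‖u - α‖ ≤ η → ‖v - β‖ ≤ η →
      ‖u - (v - κ)‖ ≤ 2 * η ∧ ‖(v - κ) - u‖ ≤ 2 * η := fun u v hu hv => by
    have e : u - (v - κ) = (u - α) - (v - β) := by rw [hκ]; ring
    rw [norm_sub_rev (v - κ), e]
    exact ⟨(norm_sub_le _ _).trans (by linarith), (norm_sub_le _ _).trans (by linarith)⟩
  rcases le_abs.1 z1 with p1 | p1 <;> rcases le_abs.1 z2 with p2 | p2
  · rw [s1 x (by linarith), s1 _ (by linarith), sub_sub_sub_cancel_right]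
    exact k (div_pos (mul_pos (by linarith) (by linarith)) (mul_pos hN hN))
  · rw [s1 x (by linarith), s0 _ (by linarith), mul_one, mul_zero, sub_zero]
    exact (split _ _ (k3.2 (by linarith) (by linarith)) (k2.1 (by linarith) (by linarith))).2
  · rw [s0 x (by linarith), s1 _ (by linarith), mul_one, mul_zero, sub_zero]
    exact (split _ _ (k2.2 (by linarith) (by linarith)) (k3.1 (by linarith) (by linarith))).1
  · rw [s0 x (by linarith), s0 _ (by linarith), sub_sub_sub_cancel_right]
    exact k (div_pos (mul_pos_of_neg_of_neg (by linarith) (by linarith)) (mul_pos hN hN))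

lemma exists_jump (hσ : σ ^ 2 = 1) (hh : Tendsto h atTop atTop) (hb : SymbolLimits c h b) :
    ∃ κ : ℂ, Tendsto (fun n => ‖convOp _ (memLp_scale hb.memLp c (h n)) * cayleyOp 2 σ -
      cayleyOp 2 σ * convOp _ (memLp_scale hb.memLp c (h n)) -
      κ • (convOp step memLp_step_top * cayleyOp 2 σ - cayleyOp 2 σ * convOp step memLp_step_top)‖)
      atTop (𝓝 0) := by
  obtain ⟨α, β, hsl⟩ := hb.scaleLimits c
  obtain ⟨C, hC0, hC⟩ := exists_essBound hb.memLp
  refine ⟨β - α, null_of_eventually_le (fun _ => norm_nonneg _) fun ε hε => ?_⟩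
  set κ := β - α with hκ
  set M := C + ‖κ‖
  have hM0 : 0 ≤ M := by positivity
  obtain ⟨E, hE⟩ := hb.slowOff (2 * (ε / 8)) (by positivity)
  set r := (eLpNorm (cayley σ) 2).toReal
  have hr0 : 0 ≤ r := ENNReal.toReal_nonneg
  obtain ⟨S, hS1, hS0⟩ : ∃ S : ℝ, 2 * M * Real.exp (-S) < ε / 4 ∧ 0 ≤ S :=
    ((by simpa using Real.tendsto_exp_neg_atTop_nhds_zero.const_mul (2 * M) :
      Tendsto (fun S => 2 * M * Real.exp (-S)) atTop (𝓝 0)).eventually (gt_mem_nhds (by positivity))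
      |>.and (eventually_ge_atTop 0)).exists
  obtain ⟨δ, hδ1, hδ⟩ : ∃ δ : ℝ, 4 * M * (√((E.card + 1) * (2 * δ)) * r) < ε / 4 ∧ 0 < δ :=
    (((((by fun_prop : Continuous fun δ : ℝ => 4 * M * (√((E.card + 1) * (2 * δ)) * r)).tendsto' 0 0
      (by simp)).mono_left nhdsWithin_le_nhds).eventually (gt_mem_nhds (by positivity))).and
      (self_mem_nhdsWithin (s := Ioi (0 : ℝ)))).exists
  obtain ⟨η, hη, hE⟩ := hE (S / δ + 1) (by positivity)
  have hd0 : Tendsto (fun n => δ / (h n : ℝ)) atTop (𝓝 0) :=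
    tendsto_const_nhds.div_atTop (tendsto_index hh)
  filter_upwards [hd0.eventually (gt_mem_nhds hη), hsl (max δ⁻¹ S + 2) (ε / 8)
    (by have := le_max_right δ⁻¹ S; linarith) (by positivity)] with n h1 h2
  have hN := index_pos (h n)
  have mk : MemLp (fun x => κ * step x) ⊤ := memLp_step_top.const_mul κ
  have mb := (memLp_scale hb.memLp c (h n)).sub mk
  have e : convOp _ mb = convOp _ (memLp_scale hb.memLp c (h n)) -
      κ • convOp step memLp_step_top := by
    have e1 : convOp _ mk = κ • convOp step memLp_step_top := by
      rw [convOp_eq, convOp_eq, ← mulOp_smul 2 κ memLp_step_top, mul_smul_comm, smul_mul_assoc]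
    rw [← e1]
    exact (convOp_sub _ mk mb).symm
  have e2 : convOp _ (memLp_scale hb.memLp c (h n)) * cayleyOp 2 σ -
      cayleyOp 2 σ * convOp _ (memLp_scale hb.memLp c (h n)) -
      κ • (convOp step memLp_step_top * cayleyOp 2 σ - cayleyOp 2 σ * convOp step memLp_step_top) =
      convOp _ mb * cayleyOp 2 σ - cayleyOp 2 σ * convOp _ mb := by
    rw [e, sub_mul, mul_sub, smul_sub, smul_mul_assoc, mul_smul_comm]
    abel
  rw [e2]
  have hmax : δ⁻¹ ≤ max δ⁻¹ S + 2 := (le_max_left _ _).trans (by linarith)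
  have hcard : (((insert 0 (E.image fun e => (h n : ℝ) * (e - c))).card : ℕ) : ℝ) ≤ E.card + 1 := by
    exact_mod_cast (Finset.card_insert_le _ _).trans (Nat.succ_le_succ Finset.card_image_le)
  refine (norm_commutator_le hσ mb hM0 ?_ (insert 0 (E.image fun e => (h n : ℝ) * (e - c))) hδ.le hS0
    (by positivity : 0 ≤ 2 * (ε / 8)) fun s hs hsS => ?_).trans ?_
  · filter_upwards [ae_comp_scale hC c hN] with x hx
    refine (norm_sub_le _ _).trans (add_le_add hx ?_)
    rw [norm_mul]
    exact mul_le_of_le_one_right (norm_nonneg _) (norm_indicator_one_le _ _)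
  · have ht : |σ * s| ≤ S := by
      rw [abs_mul, abs_of_pos hs, (pow_eq_one_iff_of_nonneg (abs_nonneg σ)
        two_ne_zero).1 (by rwa [sq_abs]), one_mul]
      exact hsS
    refine ae_norm_sub_le_of_slow hκ hN hδ (inv_le_of_inv_le₀ hδ hmax)
      ((le_max_right _ _).trans (by linarith)) ht (hE _ (by positivity) h1 _ ?_) h2
    rw [abs_div, abs_of_pos hN, add_mul, one_mul, ← mul_div_assoc, div_mul_cancel₀ _ hδ.ne']
    exact (div_le_div_of_nonneg_right ht hN.le).trans (le_add_of_nonneg_right (by positivity))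
  · have : 4 * M * (√(((insert 0 (E.image fun e => (h n : ℝ) * (e - c))).card : ℝ) * (2 * δ)) * r) ≤
        4 * M * (√((E.card + 1) * (2 * δ)) * r) := by gcongr
    linarith

end Jump

section RankOne

variable {σ : ℝ}

lemma one_lt_conjExponent {q : ℝ≥0∞} (hq' : q ≠ ⊤) : 1 < ENNReal.conjExponent q :=
  ENNReal.lt_add_right ENNReal.one_ne_top (ENNReal.inv_ne_zero.2 (ENNReal.sub_ne_top hq'))

/-- The operator `u ↦ (∫ r u) r`, where `r(x) = 1 / (1 - iσx)`. -/
def cayleyRank (q : ℝ≥0∞) [Fact (1 ≤ q)] (hq : 1 < q) (hq' : q ≠ ⊤) (hσ : σ ^ 2 = 1) : Op q :=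
  (lpFunctional q (cayley σ) (memLp_cayley hσ (one_lt_conjExponent hq'))).smulRight
    ((memLp_cayley hσ hq).toLp _)

lemma isCompactOperator_smulRight {E : Type*} [NormedAddCommGroup E] [NormedSpace ℂ E]
    (ℓ : E →L[ℂ] ℂ) (v : E) : IsCompactOperator (ℓ.smulRight v) :=
  (isCompactOperator_of_locallyCompactSpace_dom ℓ).clm_comp ((1 : ℂ →L[ℂ] ℂ).smulRight v)

lemma consistent_smulRight {p q : ℝ≥0∞} [Fact (1 ≤ p)] [Fact (1 ≤ q)] {ℓ : X p →L[ℂ] ℂ}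
    {ℓ' : X q →L[ℂ] ℂ} {f g : ℝ → ℂ} (hℓ : ∀ u, ℓ u = ∫ x, f x * u x)
    (hℓ' : ∀ u, ℓ' u = ∫ x, f x * u x) (hp : MemLp g p) (hq : MemLp g q) :
    Consistent (ℓ.smulRight (hp.toLp g)) (ℓ'.smulRight (hq.toLp g)) := fun u v h => by
  have e : ℓ u = ℓ' v := by
    rw [hℓ, hℓ']
    exact integral_congr_ae (h.mono fun x hx => by simp only [hx])
  filter_upwards [Lp.coeFn_smul (ℓ u) (hp.toLp g), Lp.coeFn_smul (ℓ' v) (hq.toLp g),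
    hp.coeFn_toLp, hq.coeFn_toLp] with x h1 h2 h3 h4
  rw [ContinuousLinearMap.smulRight_apply, ContinuousLinearMap.smulRight_apply, h1, h2,
    Pi.smul_apply, Pi.smul_apply, h3, h4, e]

/-- The function `e^{-y}` on the positive half-line. -/
def expHalf : ℝ → ℂ := (Ioi (0 : ℝ)).indicator fun y => exp (-y)

lemma memLp_expHalf : MemLp expHalf 2 ∧ Integrable expHalf := by
  have h1 : Integrable expHalf := by
    rw [expHalf, integrable_indicator_iff measurableSet_Ioi]
    simpa using integrableOn_exp_mul_complex_Ioi (a := -1) (by simp) 0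
  refine ⟨(memLp_two_iff_integrable_sq_norm h1.1).2 (h1.norm.mono (h1.1.norm.pow 2)
    (.of_forall fun x => ?_)), h1⟩
  rw [norm_pow, norm_norm]
  refine pow_le_of_le_one (norm_nonneg _) ?_ two_ne_zero
  rw [expHalf, indicator_apply]
  split_ifs with hx
  · rw [Complex.norm_exp, Real.exp_le_one_iff]
    simpa using (mem_Ioi.1 hx).le
  · simp

lemma memLp_expHalf_mul (hσ : σ ^ 2 = 1) : MemLp (fun y => expHalf (σ * y)) 2 ∧
    Integrable (fun y => expHalf (σ * y)) volume := by
  rcases sq_eq_one_iff.1 hσ with rfl | rfl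
  · simpa using memLp_expHalf
  · simpa using And.intro (memLp_comp_neg memLp_expHalf.1) memLp_expHalf.2.comp_neg

lemma integral_exp_expHalf (hσ : σ ^ 2 = 1) (x : ℝ) :
    ∫ t : ℝ, exp (-(I * t * x)) * expHalf (σ * t) = cayley (-σ) x := by
  have key : ∀ y : ℝ, ∫ t : ℝ, exp (-(I * t * y)) * expHalf t = cayley (-1) y :=
    fun y => by
      rw [← integral_exp_cayley, ← integral_indicator measurableSet_Ioi]
      refine integral_congr_ae (.of_forall fun t => ?_)
      simp only [expHalf, indicator_apply]
      split_ifs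
      · rw [← Complex.exp_add]
        congr 1
        push_cast
        ring
      · rw [mul_zero]
  rcases sq_eq_one_iff.1 hσ with rfl | rfl
  · simpa only [one_mul] using key x
  · rw [← integral_neg_eq_self]
    have e : cayley (- -1) x = cayley (-1) (-x) := by
      simp only [cayley]
      push_cast
      ring
    rw [e, ← key (-x)]
    refine integral_congr_ae (.of_forall fun t => ?_)
    simp only [neg_one_mul, neg_neg]
    congr 2
    push_cast
    ring

/-- The function `expHalf (σ ·)` as an element of `L²`. -/
def expVec (hσ : σ ^ 2 = 1) : X 2 := (memLp_expHalf_mul hσ).1.toLp _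

lemma neg_sq_eq_one (hσ : σ ^ 2 = 1) : (-σ) ^ 2 = 1 := by rwa [neg_sq]

lemma gInv_expVec (hσ : σ ^ 2 = 1) : gInv (expVec hσ) =
    fourierConst • (memLp_cayley (neg_sq_eq_one hσ) (q := 2) (by norm_num)).toLp _ := by
  refine Lp.ext ?_
  have h := memLp_cayley (neg_sq_eq_one hσ) (q := 2) (by norm_num)
  filter_upwards [gInv_toLp (memLp_expHalf_mul hσ).1 (memLp_expHalf_mul hσ).2,
    Lp.coeFn_smul fourierConst (h.toLp _), h.coeFn_toLp] with x h1 h2 h3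
  rw [expVec, h1, h2, Pi.smul_apply, h3, smul_eq_mul, integral_exp_expHalf hσ]

lemma conj_cayley (σ x : ℝ) : starRingEnd ℂ (cayley (-σ) x) = cayley σ x := by
  simp [cayley, ← sub_eq_add_neg]

lemma expVec_coeFn (hσ : σ ^ 2 = 1) : expVec hσ =ᵐ[volume] fun y => expHalf (σ * y) :=
  (memLp_expHalf_mul hσ).1.coeFn_toLp

lemma inner_gInv (u v : X 2) : inner ℂ (gInv u) (gInv v) = inner ℂ u v := by
  refine (LinearMap.norm_map_iff_inner_map_map gInv).1 (fun u => le_antisymm ?_ ?_) u v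
  · simpa using gInv.le_of_opNorm_le norm_gInv_le u
  · have := gOp.le_of_opNorm_le norm_gOp_le (gInv u)
    rwa [← mul_apply_eq_comp, gOp_mul_gInv, one_apply_eq_self, one_mul] at this

lemma gOp_cayleyOp_gInv (hσ : σ ^ 2 = 1) (w : X 2) : gOp (cayleyOp 2 σ (gInv w)) =ᵐ[volume]
    fun x => inner ℂ (shift 2 x (expVec hσ)) w := by
  have h2 := memLp_cayley hσ (q := 2) (by norm_num)
  have hn := memLp_cayley (neg_sq_eq_one hσ) (q := 2) (by norm_num)
  have hr := mulOp_coeFn 2 _ (memLp_cayley_top σ) (gInv w)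
  have hi : Integrable (cayleyOp 2 σ (gInv w)) volume :=
    (h2.integrable_mul (Lp.memLp (gInv w))).congr hr.symm
  filter_upwards [gOp_coeFn _ hi] with x hx
  have e : gInv (shift 2 x (expVec hσ)) = modulation 2 (-x) (fourierConst • hn.toLp _) := by
    have := congrArg (fun T : Op 2 => T (expVec hσ)) (mul_gInv_of (gOp_modulation (-x)))
    simp only [mul_apply_eq_comp, neg_neg] at this
    rw [← this, gInv_expVec]
  rw [hx, ← inner_gInv, e, L2.inner_def, ← integral_const_mul]
  refine integral_congr_ae ?_
  filter_upwards [hr, modulation_coeFn 2 (-x) (fourierConst • hn.toLp _),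
    Lp.coeFn_smul fourierConst (hn.toLp _), hn.coeFn_toLp] with t k1 k2 k3 k4
  have c2 : starRingEnd ℂ fourierConst = fourierConst := Complex.conj_ofReal _
  rw [cayleyOp, k1, k2, k3, Pi.smul_apply, k4, RCLike.inner_apply', map_mul, smul_eq_mul, map_mul, conj_cayley,
    c2, ← Complex.exp_conj]
  simp only [map_mul, Complex.conj_I, Complex.conj_ofReal]
  rw [show -I * ((-x : ℝ) : ℂ) * t = I * t * x by push_cast; ring]
  ring

lemma step_sub_mul_expHalf (hσ : σ ^ 2 = 1) {x y : ℝ} (hx : x ≠ 0) (hy : y ≠ 0) :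
    (step x - step y) * expHalf (σ * (y - x)) = -σ * expHalf (-σ * x) * expHalf (σ * y) := by
  rcases sq_eq_one_iff.1 hσ with rfl | rfl <;> rcases hx.lt_or_gt with hx | hx <;>
    rcases hy.lt_or_gt with hy | hy <;> simp only [step, expHalf, indicator_apply, mem_Ioi] <;>
    split_ifs <;> first
      | (exfalso; linarith)
      | (simp; done)
      | (simp [← Complex.exp_add]; done)
      | (simp [← Complex.exp_add]; ring_nf)

lemma step_commutator (hσ : σ ^ 2 = 1) (w : X 2) :
    mulOp 2 step memLp_step_top (gOp (cayleyOp 2 σ (gInv w))) -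
      gOp (cayleyOp 2 σ (gInv (mulOp 2 step memLp_step_top w))) =
    (-σ * inner ℂ (expVec hσ) w : ℂ) • expVec (neg_sq_eq_one hσ) := by
  set T := mulOp 2 step memLp_step_top
  have hne : ∀ᵐ x : ℝ, x ≠ 0 := compl_mem_ae_iff.2 (measure_singleton (0 : ℝ))
  refine Lp.ext ?_
  filter_upwards [Lp.coeFn_sub (T (gOp (cayleyOp 2 σ (gInv w)))) (gOp (cayleyOp 2 σ (gInv (T w)))),
    mulOp_coeFn 2 _ memLp_step_top (gOp (cayleyOp 2 σ (gInv w))), gOp_cayleyOp_gInv hσ w,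
    gOp_cayleyOp_gInv hσ (T w), Lp.coeFn_smul (-σ * inner ℂ (expVec hσ) w : ℂ)
      (expVec (neg_sq_eq_one hσ)), expVec_coeFn (neg_sq_eq_one hσ), hne]
    with x h1 h2 h3 h4 h5 h6 hx
  rw [h1, Pi.sub_apply, h2, h3, h4, h5, Pi.smul_apply, h6, L2.inner_def, L2.inner_def,
    L2.inner_def, smul_eq_mul, ← integral_const_mul, ← integral_sub, mul_comm (_ * _),
    ← mul_assoc, ← integral_const_mul]
  · refine integral_congr_ae ?_
    filter_upwards [shift_coeFn 2 x (expVec hσ), expVec_coeFn hσ,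
      (qmp_sub x).ae (expVec_coeFn hσ), mulOp_coeFn 2 _ memLp_step_top w, hne]
      with y k1 k2 k3 k4 hy
    have hc : ∀ z, starRingEnd ℂ (expHalf z) = expHalf z := fun z => by
      rw [expHalf, indicator_apply]
      split_ifs
      · rw [← Complex.exp_conj]; simp
      · simp
    have := step_sub_mul_expHalf hσ hx hy
    rw [k1, k3, k2, k4, RCLike.inner_apply', RCLike.inner_apply', RCLike.inner_apply', hc, hc]
    linear_combination (w y) * this
  · exact (L2.integrable_inner _ _).const_mul _
  · exact L2.integrable_inner _ _

lemma commutator_step (hσ : σ ^ 2 = 1) :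
    convOp step memLp_step_top * cayleyOp 2 σ - cayleyOp 2 σ * convOp step memLp_step_top =
      (-σ * fourierConst ^ 2 : ℂ) • cayleyRank 2 (by norm_num) (by norm_num) hσ := by
  ext1 u
  have h := congrArg gInv (step_commutator hσ (gOp u))
  have e : ∀ v, gInv (gOp v) = v := fun v => by
    rw [← mul_apply_eq_comp, gInv_mul_gOp, one_apply_eq_self]
  have hn := memLp_cayley (neg_sq_eq_one hσ) (q := 2) (by norm_num)
  have hi : inner ℂ (expVec hσ) (gOp u) = fourierConst * ∫ x, cayley σ x * u x := by
    rw [← inner_gInv, e, gInv_expVec, L2.inner_def, ← integral_const_mul]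
    refine integral_congr_ae ?_
    filter_upwards [Lp.coeFn_smul fourierConst (hn.toLp _), hn.coeFn_toLp] with x k1 k2
    rw [k1, Pi.smul_apply, k2, RCLike.inner_apply', smul_eq_mul, map_mul,
      show starRingEnd ℂ fourierConst = fourierConst from Complex.conj_ofReal _,
      conj_cayley, mul_assoc]
  rw [map_sub, e, e, map_smul, gInv_expVec, hi] at h
  rw [convOp_eq, sub_apply, mul_apply_eq_comp, mul_apply_eq_comp, mul_apply_eq_comp,
    mul_apply_eq_comp, mul_apply_eq_comp, mul_apply_eq_comp, smul_apply, cayleyRank,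
    ContinuousLinearMap.smulRight_apply, lpFunctional_apply]
  refine h.trans ?_
  rw [smul_smul, smul_smul]
  simp only [neg_neg]
  congr 1
  ring

end RankOne

section Transfer

variable {p r : ℝ≥0∞} [Fact (1 ≤ p)] [Fact (1 ≤ r)]

lemma cauchySeq_apply_of_dense {E F : Type*} [NormedAddCommGroup E] [NormedSpace ℂ E]
    [NormedAddCommGroup F] [NormedSpace ℂ F] {L : ℕ+ → E →L[ℂ] F} {C : ℝ} (hL : ∀ n, ‖L n‖ ≤ C)
    {D : Set E} (hD : ∀ y ∈ D, CauchySeq fun n => L n y) {x : E} (hx : x ∈ closure D) :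
    CauchySeq fun n => L n x := by
  have hC : 0 ≤ C := (norm_nonneg _).trans (hL 1)
  rw [cauchySeq_iff_tendsto_dist_atTop_0]
  refine null_of_eventually_le (fun _ => dist_nonneg) fun ε hε => ?_
  obtain ⟨y, hy, hxy⟩ := Metric.mem_closure_iff.1 hx (ε / (4 * (C + 1))) (by positivity)
  have hb : ∀ n, dist (L n x) (L n y) ≤ ε / 4 := fun n => by
    rw [dist_eq_norm, ← map_sub]
    refine ((L n).le_of_opNorm_le (hL n) _).trans ?_
    rw [dist_eq_norm, lt_div_iff₀ (by positivity)] at hxy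
    nlinarith [norm_nonneg (x - y)]
  filter_upwards [(cauchySeq_iff_tendsto_dist_atTop_0.1 (hD y hy)).eventually
    (gt_mem_nhds (by positivity : 0 < ε / 4))] with n hn
  have h2 := hb n.2
  rw [dist_comm] at h2
  linarith [dist_triangle4 (L n.1 x) (L n.1 y) (L n.2 y) (L n.2 x), hb n.1]

lemma exists_starStrongLimit (hp : 1 < p) (hp' : p ≠ ⊤) (hr : Beyond p r) {A : ℕ+ → Op p}
    {A₂ : ℕ+ → Op 2} {B : ℕ+ → Op r} (h2 : ∀ n, Consistent (A n) (A₂ n))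
    (hB : ∀ n, Consistent (B n) (A₂ n)) {C D G : ℝ} (hAC : ∀ n, ‖A n‖ ≤ C) (hBD : ∀ n, ‖B n‖ ≤ D)
    (hAG : ∀ n, ‖A₂ n‖ ≤ G) {S₂ : Op 2} (hS : StarStrongLimit A₂ S₂) :
    ∃ S, StarStrongLimit A S := by
  obtain ⟨s1, s2⟩ := starStrongLimit_iff.1 hS
  let F : ∀ (q : ℝ≥0∞) [Fact (1 ≤ q)] {f g : ℝ → ℂ} (hf : NiceFun f) (hg : NiceFun g), Op q :=
    fun q _ _ _ hf hg => (pairing q _ hf).smulRight ((hg.memLp q).toLp _)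
  have hF : ∀ (q : ℝ≥0∞) [Fact (1 ≤ q)] {f g : ℝ → ℂ} (hf : NiceFun f) (hg : NiceFun g),
      Consistent (F q hf hg) (F 2 hf hg) := fun q _ _ _ hf hg =>
    consistent_smulRight (pairing_apply hf) (pairing_apply hf) _ _
  have hc : ∀ {f g : ℝ → ℂ} (hf : NiceFun f) (hg : NiceFun g), IsCompactOperator (F 2 hf hg) :=
    fun _ _ => isCompactOperator_smulRight _ _
  have htwo : ∀ {Y : ℕ+ → Op 2}, Tendsto (fun n => ‖Y n‖) atTop (𝓝 0) →
      Tendsto (fun n : ℕ+ × ℕ+ => ‖Y n.1 - Y n.2‖) atTop (𝓝 0) := fun {Y} hY => by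
    rw [← prod_atTop_atTop_eq]
    refine squeeze_zero (fun _ => norm_nonneg _) (fun n => norm_sub_le _ _) ?_
    simpa using (hY.comp tendsto_fst).add (hY.comp tendsto_snd)
  have hbd : ∀ n, ‖A₂ n - S₂‖ ≤ G + ‖S₂‖ := norm_sub_le_const hAG S₂
  have hBn : ∀ n : ℕ+ × ℕ+, ‖B n.1 - B n.2‖ ≤ D + D := fun n =>
    (norm_sub_le _ _).trans (add_le_add (hBD _) (hBD _))
  have hleft : ∀ {f g} (hf : NiceFun f) (hg : NiceFun g), Tendsto (fun n : ℕ+ × ℕ+ =>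
      ‖(A n.1 - A n.2) * F p hf hg‖) atTop (𝓝 0) := fun hf hg => by
    refine tendsto_norm_of_consistent hr (fun n => ((h2 n.1).sub (h2 n.2)).mul (hF p hf hg))
      (fun n => ((hB n.1).sub (hB n.2)).mul (hF r hf hg))
      (fun n => norm_mul_le_of_le (hBn n) le_rfl) ?_
    refine (htwo (norm_mul_compact_tendsto (hc hf hg) hbd s1)).congr fun n => ?_
    rw [← sub_mul, sub_sub_sub_cancel_right]
  have hright : ∀ {f g} (hf : NiceFun f) (hg : NiceFun g), Tendsto (fun n : ℕ+ × ℕ+ =>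
      ‖F p hf hg * (A n.1 - A n.2)‖) atTop (𝓝 0) := fun hf hg => by
    refine tendsto_norm_of_consistent hr (fun n => (hF p hf hg).mul ((h2 n.1).sub (h2 n.2)))
      (fun n => (hF r hf hg).mul ((hB n.1).sub (hB n.2)))
      (fun n => norm_mul_le_of_le le_rfl (hBn n)) ?_
    refine (htwo (norm_compact_mul_tendsto (hc hf hg) hbd s2)).congr fun n => ?_
    rw [← mul_sub, sub_sub_sub_cancel_right]
  have hn : NiceFun ((Icc (0 : ℝ) 1).indicator fun _ => (1 : ℂ)) :=
    ⟨stronglyMeasurable_const.indicator measurableSet_Icc, ⟨1, norm_indicator_one_le _⟩, 1,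
      fun x hx => indicator_of_notMem (fun h => (abs_of_nonneg h.1 ▸ hx).not_ge h.2) _⟩
  set e : X p := (hn.memLp p).toLp _
  have he : pairing p _ hn e = 1 := by
    rw [pairing_apply, integral_congr_ae (g := (Icc (0 : ℝ) 1).indicator fun _ => (1 : ℂ))
      ((hn.memLp p).coeFn_toLp.mono fun x hx => by
        simp only [e, hx, indicator_apply]; split_ifs <;> simp),
      integral_indicator measurableSet_Icc]
    simp
  have he0 : 0 < ‖e‖ := norm_pos_iff.2 fun h => by simp [h] at he
  have hc1 : ∀ u : X p, CauchySeq fun n => A n u := fun u => by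
    refine cauchySeq_apply_of_dense hAC ?_ (dense_nice hp' u)
    rintro _ ⟨g, hg, rfl⟩
    rw [cauchySeq_iff_tendsto_dist_atTop_0]
    refine squeeze_zero (fun _ => dist_nonneg) (fun n => ?_)
      (by simpa using (hleft hn hg).mul_const ‖e‖)
    have := ((A n.1 - A n.2) * F p hn hg).le_opNorm e
    rwa [mul_apply_eq_comp, ContinuousLinearMap.smulRight_apply, he, one_smul, sub_apply,
      ← dist_eq_norm] at this
  choose S₀ hS₀ using fun u => cauchySeq_tendsto_of_complete (hc1 u)
  let S : Op p := continuousLinearMapOfTendsto A (tendsto_pi_nhds.2 hS₀)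
  refine ⟨S, hS₀, fun φ => ?_⟩
  have hc2 : CauchySeq fun n => φ.comp (A n) := by
    refine cauchySeq_apply_of_dense
      (L := fun n => (ContinuousLinearMap.compL ℂ (X p) (X p) ℂ).flip (A n)) (fun n =>
        ContinuousLinearMap.opNorm_le_bound _ ((norm_nonneg _).trans (hAC 1)) fun ψ => ?_)
      (D := {ψ | ∃ (f : ℝ → ℂ) (hf : NiceFun f), ψ = pairing p f hf}) ?_
      (Metric.mem_closure_iff.2 fun ε hε => ?_)
    · rw [mul_comm]
      exact (ψ.opNorm_comp_le _).trans (mul_le_mul_of_nonneg_left (hAC n) (norm_nonneg _))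
    · rintro _ ⟨f, hf, rfl⟩
      rw [cauchySeq_iff_tendsto_dist_atTop_0]
      refine ((hright hf hn).div_const ‖e‖).congr' (.of_forall fun n => ?_) |>.trans
        (by rw [zero_div])
      have e1 : F p hf hn * (A n.1 - A n.2) =
          ((pairing p f hf).comp (A n.1) - (pairing p f hf).comp (A n.2)).smulRight e := by
        rw [← ContinuousLinearMap.comp_sub]; rfl
      rw [e1, ContinuousLinearMap.norm_smulRight_apply, mul_div_cancel_right₀ _ he0.ne', dist_eq_norm]
      rfl
    · obtain ⟨f, hf, hd⟩ := exists_pairing_approx hp hp' φ (half_pos hε)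
      exact ⟨_, ⟨f, hf, rfl⟩, by rw [dist_eq_norm]; linarith⟩
  obtain ⟨ψ, hψ⟩ := cauchySeq_tendsto_of_complete hc2
  have : ψ = φ.comp S := by
    ext1 u
    exact tendsto_nhds_unique (((ContinuousLinearMap.apply ℂ ℂ u).continuous.tendsto ψ).comp hψ)
      ((φ.continuous.tendsto _).comp (hS₀ u))
  exact this ▸ hψ

lemma starStrongLimit_convOp {a : ℕ+ → ℝ → ℂ} (ha : ∀ n, MemLp (a n) ⊤) {C : ℝ}
    (hC : ∀ n, ∀ᵐ x, ‖a n x‖ ≤ C) {s : ℝ → ℂ} (hs : MemLp s ⊤)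
    (hlim : ∀ᵐ x, Tendsto (fun n => a n x) atTop (𝓝 (s x))) :
    StarStrongLimit (fun n => convOp (a n) (ha n)) (convOp s hs) := by
  obtain ⟨h1, h2⟩ := starStrongLimit_mulOp (p := 2) (by norm_num) (by norm_num) ha hC hs hlim
  simp only [convOp_eq]
  refine ⟨fun u => (gInv.continuous.tendsto _).comp (h1 (gOp u)), fun φ => ?_⟩
  exact ((((ContinuousLinearMap.compL ℂ (X 2) (X 2) ℂ).flip gOp).continuous.tendsto _).comp
    (h2 (φ.comp gInv)))

end Transfer

section ConvolutionGood

variable {p r : ℝ≥0∞} [Fact (1 ≤ p)] [Fact (1 ≤ r)] {h : ℕ+ → ℕ+} {c σ : ℝ} {b : ℝ → ℂ}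

lemma norm_cayley_le (hσ : σ ^ 2 = 1) (x : ℝ) : ‖cayley σ x‖ * |x| ≤ 1 ∧ ‖1 - cayley σ x‖ ≤ |x| := by
  have h1 := norm_cayley_sq σ x
  rw [mul_pow, hσ, one_mul] at h1
  refine ⟨?_, ?_⟩
  · rw [← sq_le_one_iff₀ (by positivity), mul_pow, h1, sq_abs, inv_mul_le_one₀ (by positivity)]
    linarith
  · have e : 1 - cayley σ x = -(I * σ * x) * cayley σ x := by
      rw [cayley, eq_mul_inv_iff_mul_eq₀ (one_sub_ne_zero σ x), sub_mul,
        inv_mul_cancel₀ (one_sub_ne_zero σ x)]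
      ring
    rw [e, norm_mul]
    refine (mul_le_of_le_one_right (norm_nonneg _) (norm_cayley_le_one σ x)).trans (le_of_eq ?_)
    simp [(pow_eq_one_iff_of_nonneg (abs_nonneg σ) two_ne_zero).1 (by rwa [sq_abs])]

/-- The function `1 / (1 - iσx)` as a test function. -/
def cayleyTest (hσ : σ ^ 2 = 1) : Test :=
  OnePoint.continuousMapMk ⟨cayley σ, continuous_cayley σ⟩ 0 (by
    rw [coclosedCompact_eq_cocompact, tendsto_zero_iff_norm_tendsto_zero]
    have h0 : Tendsto (fun x : ℝ => ‖x‖⁻¹) (cocompact ℝ) (𝓝 0) :=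
      tendsto_inv_atTop_zero.comp tendsto_norm_cocompact_atTop
    refine squeeze_zero' (.of_forall fun _ => norm_nonneg _) ?_ h0
    filter_upwards [(tendsto_norm_cocompact_atTop (E := ℝ)).eventually_gt_atTop 0] with x hx
    exact by rw [inv_eq_one_div, le_div_iff₀ hx]; exact (norm_cayley_le hσ x).1)

lemma unlift_tst_cayleyTest (hσ : σ ^ 2 = 1) (n : ℕ+) :
    unlift (.inr c) (h n) (tst p h (cayleyTest hσ) n) = cayleyOp p σ := by
  rw [tst_apply, unlift_inr_mulOp, cayleyOp]
  refine mulOp_congr p _ _ (.of_forall fun x => ?_)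
  have := (index_pos (h n)).ne'
  exact congrArg (cayley σ) (by field_simp)

lemma exists_compact_commutator (hp : 1 < p) (hp' : p ≠ ⊤) (hr : Beyond p r) {W : Op p} {V : Op r}
    (hb : SymbolLimits c h b) (hW : Consistent W (convOp b hb.memLp))
    (hV : Consistent V (convOp b hb.memLp)) (hh : Tendsto h atTop atTop) (hσ : σ ^ 2 = 1) :
    ∃ K : Op p, IsCompactOperator K ∧ Tendsto (fun n => ‖W * tst p h (cayleyTest hσ) n -
      tst p h (cayleyTest hσ) n * W - lift (.inr c) (h n) K‖) atTop (𝓝 0) := by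
  obtain ⟨κ, hκ⟩ := exists_jump hσ hh hb
  set μ : ℂ := κ * (-σ * fourierConst ^ 2)
  have hT : ∀ {q : ℝ≥0∞} [Fact (1 ≤ q)] (h1 : 1 < q) (h2 : q ≠ ⊤) {Y : Op q},
      Consistent Y (convOp b hb.memLp) → ∀ n, Consistent
        (Y * tst q h (cayleyTest hσ) n - tst q h (cayleyTest hσ) n * Y -
          lift (.inr c) (h n) (μ • cayleyRank q h1 h2 hσ))
        (convOp b hb.memLp * tst 2 h (cayleyTest hσ) n - tst 2 h (cayleyTest hσ) n *
          convOp b hb.memLp - lift (.inr c) (h n) (μ • cayleyRank 2 (by norm_num) (by norm_num) hσ)) :=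
    fun h1 h2 _ hY n =>
      have ht := consistent_mulOp (memLp_test (cayleyTest hσ) (h n))
      ((hY.mul ht).sub (ht.mul hY)).sub (((consistent_smulRight (lpFunctional_apply _)
        (lpFunctional_apply _) _ _).smul μ).lift_inr c (h n))
  refine ⟨μ • cayleyRank p hp hp' hσ, ?_, ?_⟩
  · exact (isCompactOperator_smulRight _ _).smul μ
  refine tendsto_norm_of_consistent hr (hT hp hp' hW) (hT hr.2.1 hr.1 hV)
    (C := ‖V‖ + ‖V‖ + ‖μ • cayleyRank r hr.2.1 hr.1 hσ‖) (fun n => ?_) ?_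
  · have hn : ‖tst r h (cayleyTest hσ) n‖ ≤ 1 := by
      rw [tst_apply]
      exact mulOp_norm_le r _ zero_le_one (.of_forall fun x => norm_cayley_le_one σ _)
    refine (norm_sub_le _ _).trans (add_le_add ((norm_sub_le _ _).trans (add_le_add
      ((norm_mul_le_of_le le_rfl hn).trans (mul_one _).le)
      ((norm_mul_le_of_le hn le_rfl).trans (one_mul _).le))) (norm_lift_le _ _ _))
  · refine squeeze_zero (fun _ => norm_nonneg _) (fun n => ?_) hκ
    rw [commutator_step hσ, smul_smul, ← unlift_inr_convOp, ← unlift_tst_cayleyTest (c := c) hσ n,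
      ← unlift_mul, ← unlift_mul, ← unlift_sub]
    refine le_trans (le_of_eq ?_) (norm_lift_le (.inr c) (h n) _)
    rw [lift_sub, lift_unlift]

lemma tst_cayleyTest_approx (hσ : σ ^ 2 = 1) (hh : Tendsto h atTop atTop) (m : ℕ+) :
    Tendsto (fun n => ‖(1 - tst p h (cayleyTest hσ) n) * proj p m‖) atTop (𝓝 0) := by
  refine squeeze_zero (fun _ => norm_nonneg _) (fun n => ?_)
    (tendsto_const_nhds.div_atTop (tendsto_index hh) : Tendsto (fun n => (m : ℝ) / h n) atTop (𝓝 0))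
  have hN := index_pos (h n)
  rw [tst_apply, one_sub_mulOp p _ ((memLp_top_const 1).sub (memLp_test _ (h n)))]
  refine norm_mulOp_mul_proj_le _ (by positivity) (.of_forall fun x hx => ?_)
  refine (norm_cayley_le hσ (x / h n)).2.trans ?_
  rw [abs_div, abs_of_pos hN]
  gcongr

lemma tst_mul_proj (φ : Test) (n m : ℕ+) : tst p h φ n * proj p m = proj p m * tst p h φ n :=
  mulOp_comm p _ _

lemma tst_cayleyTest_mem_pCompact (hσ : σ ^ 2 = 1) (n : ℕ+) :
    tst p h (cayleyTest hσ) n ∈ pCompact p := by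
  have hN := index_pos (h n)
  have h1 : Tendsto (fun k => ‖tst p h (cayleyTest hσ) n * (1 - proj p k)‖) atTop (𝓝 0) := by
    refine squeeze_zero (fun _ => norm_nonneg _) (fun k => ?_) (tendsto_const_nhds.div_atTop
      (tendsto_index tendsto_id) : Tendsto (fun k : ℕ+ => (h n : ℝ) / (k : ℝ)) atTop (𝓝 0))
    have hk := index_pos k
    rw [proj_eq_chi, one_sub_chi measurableSet_Icc, chi, tst_apply, mulOp_mul p _ _
      (memLp_top_mul (memLp_test _ (h n)) (memLp_indicator _ measurableSet_Icc.compl))]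
    refine mulOp_norm_le p _ (by positivity) (.of_forall fun x => ?_)
    by_cases hx : x ∈ Icc (-(k : ℝ)) k
    · rw [indicator_of_notMem (not_not.2 hx), mul_zero, norm_zero]; positivity
    · rw [indicator_of_mem hx, mul_one]
      have hx' : (k : ℝ) < |x| := not_le.1 fun h => hx (abs_le.1 h)
      have := (norm_cayley_le hσ (x / h n)).1
      rw [abs_div, abs_of_pos hN, ← mul_div_assoc, div_le_one hN] at this
      change ‖cayley σ (x / h n)‖ ≤ _
      rw [le_div_iff₀ hk]
      exact (mul_le_mul_of_nonneg_left hx'.le (norm_nonneg _)).trans this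
  refine ⟨h1, h1.congr fun k => ?_⟩
  rw [mul_sub, sub_mul, tst_mul_proj, mul_one, one_mul]

lemma mem_pBounded_of_commutator (hp : 1 < p) (hp' : p ≠ ⊤) (hh : Tendsto h atTop atTop)
    (hσ : σ ^ 2 = 1) {W K : Op p} (hK : IsCompactOperator K)
    (hlim : Tendsto (fun n => ‖W * tst p h (cayleyTest hσ) n - tst p h (cayleyTest hσ) n * W -
      lift (.inr c) (h n) K‖) atTop (𝓝 0)) : W ∈ pBounded p := by
  set D := fun n => tst p h (cayleyTest hσ) n
  have hl : ∀ m, Tendsto (fun n => ‖proj p m * (W * D n - D n * W)‖) atTop (𝓝 0) ∧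
      Tendsto (fun n => ‖(W * D n - D n * W) * proj p m‖) atTop (𝓝 0) := fun m => by
    obtain ⟨l1, l2⟩ := starStrongLimit_iff.1 (indexLimit_unlift_lift_pCompact hp hp' hh
      (d := .center) (t := .inr c) (by simp) (proj_mem_pCompact m))
    simp only [sub_zero] at l1 l2
    have hn : ∀ n, ‖unlift (.inr c) (h n) (proj p m)‖ ≤ 1 := fun n =>
      (norm_unlift_le _ _ _).trans (norm_proj_le m)
    have a1 := norm_mul_compact_tendsto hK hn l1
    have a2 := norm_compact_mul_tendsto hK hn l2
    have hP := norm_proj_le (p := p) m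
    constructor
    · refine squeeze_zero (fun _ => norm_nonneg _) (fun n => ?_) (by simpa using hlim.add a1)
      have e : proj p m * (W * D n - D n * W) =
          proj p m * (W * D n - D n * W - lift (.inr c) (h n) K) +
          lift (.inr c) (h n) (unlift (.inr c) (h n) (proj p m) * K) := by
        rw [lift_mul, lift_unlift]; noncomm_ring
      rw [e]
      exact (norm_add_le _ _).trans (add_le_add ((norm_mul_le_of_le hP le_rfl).trans (one_mul _).le)
        (norm_lift_le _ _ _))
    · refine squeeze_zero (fun _ => norm_nonneg _) (fun n => ?_) (by simpa using hlim.add a2)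
      have e : (W * D n - D n * W) * proj p m =
          (W * D n - D n * W - lift (.inr c) (h n) K) * proj p m +
          lift (.inr c) (h n) (K * unlift (.inr c) (h n) (proj p m)) := by
        rw [lift_mul, lift_unlift]; noncomm_ring
      rw [e]
      exact (norm_add_le _ _).trans (add_le_add ((norm_mul_le_of_le le_rfl hP).trans (mul_one _).le)
        (norm_lift_le _ _ _))
  refine pBounded_iff.2 fun m => ?_
  have key : ∀ ε : ℝ, 0 < ε → ∃ T ∈ pCompact p, T * proj p m = proj p m * T ∧
      ‖(1 - T) * proj p m‖ * ‖W‖ < ε ∧ ‖proj p m * (W * T - T * W)‖ < ε ∧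
      ‖(W * T - T * W) * proj p m‖ < ε := fun ε hε => by
    obtain ⟨n, h1, h2, h3⟩ := (((by simpa using (tst_cayleyTest_approx hσ hh m).mul_const ‖W‖ :
      Tendsto (fun n => ‖(1 - D n) * proj p m‖ * ‖W‖) atTop (𝓝 0)).eventually (gt_mem_nhds hε)).and
      (((hl m).1.eventually (gt_mem_nhds hε)).and ((hl m).2.eventually (gt_mem_nhds hε)))).exists
    exact ⟨D n, tst_cayleyTest_mem_pCompact hσ n, tst_mul_proj _ _ _, h1, h2, h3⟩
  have hP := norm_proj_le (p := p) m
  have hQ := norm_one_sub_proj_le (p := p)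
  constructor <;> refine null_of_eventually_le (fun _ => norm_nonneg _) fun ε hε => ?_ <;>
    obtain ⟨T, hT, hc, h1, h2, h3⟩ := key (ε / 3) (by positivity)
  · filter_upwards [(by simpa using hT.2.mul_const ‖W‖ : Tendsto (fun n => ‖(1 - proj p n) * T‖ * ‖W‖)
      atTop (𝓝 0)).eventually (gt_mem_nhds (by positivity : 0 < ε / 3))] with n hn
    have e : (1 - proj p n) * W * proj p m = (1 - proj p n) * (W * ((1 - T) * proj p m)) +
        (1 - proj p n) * ((W * T - T * W) * proj p m) + (1 - proj p n) * T * W * proj p m := by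
      noncomm_ring
    rw [e]
    have b1 := norm_mul_le_of_le (hQ n) (norm_mul_le W ((1 - T) * proj p m))
    have b2 := norm_mul_le_of_le (hQ n) (le_refl ‖(W * T - T * W) * proj p m‖)
    have b3 := norm_mul_le_of_le (norm_mul_le ((1 - proj p n) * T) W) hP
    linarith [norm_add₃_le (a := (1 - proj p n) * (W * ((1 - T) * proj p m)))
      (b := (1 - proj p n) * ((W * T - T * W) * proj p m)) (c := (1 - proj p n) * T * W * proj p m)]
  · filter_upwards [(by simpa using hT.1.const_mul ‖W‖ : Tendsto (fun n => ‖W‖ * ‖T * (1 - proj p n)‖)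
      atTop (𝓝 0)).eventually (gt_mem_nhds (by positivity : 0 < ε / 3))] with n hn
    have e : proj p m * W * (1 - proj p n) = (1 - T) * proj p m * W * (1 - proj p n) -
        proj p m * (W * T - T * W) * (1 - proj p n) +
        proj p m * (W * (T * (1 - proj p n))) := by
      rw [show (1 - T) * proj p m = proj p m * (1 - T) by rw [sub_mul, mul_sub, hc, mul_one, one_mul]]
      noncomm_ring
    rw [e]
    have b1 := norm_mul_le_of_le (norm_mul_le ((1 - T) * proj p m) W) (hQ n)
    have b2 := norm_mul_le_of_le (le_refl ‖proj p m * (W * T - T * W)‖) (hQ n)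
    have b3 := norm_mul_le_of_le hP (norm_mul_le W (T * (1 - proj p n)))
    linarith [norm_add_le ((1 - T) * proj p m * W * (1 - proj p n) -
      proj p m * (W * T - T * W) * (1 - proj p n)) (proj p m * (W * (T * (1 - proj p n)))),
      norm_sub_le ((1 - T) * proj p m * W * (1 - proj p n))
        (proj p m * (W * T - T * W) * (1 - proj p n))]

/-- The test functions which commute with `A` up to `compactSeq`. -/
def commutingTests (hp : 1 < p) (hp' : p ≠ ⊤) (hh : Tendsto h atTop atTop) (A : BddSeq p) :
    Subalgebra ℂ Test where
  carrier := {φ | A * tst p h φ - tst p h φ * A ∈ compactSeq p h}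
  mul_mem' := fun {φ ψ} hφ hψ => by
    have e : A * tst p h (φ * ψ) - tst p h (φ * ψ) * A = (A * tst p h φ - tst p h φ * A) *
        tst p h ψ + tst p h φ * (A * tst p h ψ - tst p h ψ * A) := by
      rw [tst_mul]; noncomm_ring
    rw [mem_ofPred_eq, e]
    exact (compactSeq p h).add_mem (compactSeq_mul_mem (tst_mem_structured hp hp' hh ψ) hφ)
      (mul_mem_compactSeq (tst_mem_structured hp hp' hh φ) hψ)
  add_mem' := fun {φ ψ} hφ hψ => by
    have e : A * tst p h (φ + ψ) - tst p h (φ + ψ) * A = (A * tst p h φ - tst p h φ * A) +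
        (A * tst p h ψ - tst p h ψ * A) := by
      rw [tst_add]; noncomm_ring
    rw [mem_ofPred_eq, e]
    exact (compactSeq p h).add_mem hφ hψ
  algebraMap_mem' := fun z => by
    rw [mem_ofPred_eq, Algebra.algebraMap_eq_smul_one, tst_smul, tst_one, mul_smul_comm,
      smul_mul_assoc, mul_one, one_mul, sub_self]
    exact (compactSeq p h).zero_mem

lemma localType_of_cayleyTest (hp : 1 < p) (hp' : p ≠ ⊤) (hh : Tendsto h atTop atTop)
    {A : BddSeq p} (hA : ∀ {σ : ℝ} (hσ : σ ^ 2 = 1), A * tst p h (cayleyTest hσ) -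
      tst p h (cayleyTest hσ) * A ∈ compactSeq p h) : LocalType h A := fun φ => by
  set B := StarAlgebra.adjoin ℂ {cayleyTest (one_pow 2)}
  have hstar : star (cayleyTest (one_pow 2)) = cayleyTest (neg_one_sq (R := ℝ)) := by
    ext x
    induction x using OnePoint.rec with
    | infty => exact star_zero ℂ
    | coe x =>
      have h1 := conj_cayley (-1) x
      rwa [neg_neg] at h1
  have hB : B.toSubalgebra ≤ commutingTests hp hp' hh A := by
    rw [StarAlgebra.adjoin_toSubalgebra]
    refine Algebra.adjoin_le ?_
    rintro _ (rfl | hψ)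
    · exact hA (one_pow 2)
    · rw [Set.mem_star, mem_singleton_iff, star_eq_iff_star_eq, hstar] at hψ
      exact hψ ▸ hA (neg_one_sq (R := ℝ))
  have hinj : Function.Injective (cayleyTest (one_pow 2)) := fun x y hxy => by
    induction x using OnePoint.rec with
    | infty =>
      induction y using OnePoint.rec with
      | infty => rfl
      | coe y => exact absurd hxy.symm (inv_ne_zero (one_sub_ne_zero 1 y))
    | coe x =>
      induction y using OnePoint.rec with
      | infty => exact absurd hxy (inv_ne_zero (one_sub_ne_zero 1 x))
      | coe y =>
        have h1 := congrArg Complex.im (inv_injective hxy)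
        simp at h1
        rw [h1]
  have hden := ContinuousMap.starSubalgebra_topologicalClosure_eq_top_of_separatesPoints B
    fun x y hxy => ⟨_, ⟨cayleyTest (one_pow 2), StarAlgebra.subset_adjoin ℂ _ rfl, rfl⟩,
      fun h => hxy (hinj h)⟩
  have hφ : φ ∈ closure (B : Set Test) := by
    rw [← StarSubalgebra.topologicalClosure_coe, hden]; trivial
  refine mem_compactSeq_of_approx fun ε hε => ?_
  obtain ⟨ψ, hψ, hd⟩ := Metric.mem_closure_iff.1 hφ (ε / (2 * (‖A‖ + 1))) (by positivity)
  refine ⟨_, hB hψ, ?_⟩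
  have e : A * tst p h φ - tst p h φ * A - (A * tst p h ψ - tst p h ψ * A) =
      A * tst p h (φ - ψ) - tst p h (φ - ψ) * A := by
    rw [tst_sub]; noncomm_ring
  rw [e]
  rw [dist_eq_norm, lt_div_iff₀ (by positivity)] at hd
  have hn := norm_tst_le (p := p) (h := h) (φ - ψ)
  refine (norm_sub_le _ _).trans ((add_le_add (norm_mul_le_of_le le_rfl hn)
    (norm_mul_le_of_le hn le_rfl)).trans ?_)
  nlinarith [norm_nonneg (φ - ψ)]

end ConvolutionGood

section ConvolutionRealizable

variable {p r : ℝ≥0∞} [Fact (1 ≤ p)] [Fact (1 ≤ r)] {h : ℕ+ → ℕ+} {c : ℝ} {b : ℝ → ℂ}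

lemma good_convolution (hp : 1 < p) (hp' : p ≠ ⊤) (hr : Beyond p r) {W : Op p} {V : Op r}
    (hb : SymbolLimits c h b) (hW : Consistent W (convOp b hb.memLp))
    (hV : Consistent V (convOp b hb.memLp)) (hh : Tendsto h atTop atTop) {A : BddSeq p}
    (hA : ∀ n, A n = W) : Good h A := by
  have hB : W ∈ pBounded p := by
    obtain ⟨K, hK, hlim⟩ := exists_compact_commutator hp hp' hr hb hW hV hh (one_pow 2)
    exact mem_pBounded_of_commutator hp hp' hh (one_pow 2) hK hlim
  have hs : ∀ s : ℝ, shift p s * W * shift p (-s) = W := fun s => by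
    refine Consistent.unique hp' (T' := convOp b hb.memLp) ?_ hW
    rw [← shift_comm_convOp s b hb.memLp]
    exact ((consistent_shift s).mul hW).mul (consistent_shift (-s))
  have hl : ∀ (d : Direction) (n : ℕ+), lift (.inl d) n W = W := fun d n => by
    cases d with
    | minus => simpa [lift] using hs (-n)
    | center => rfl
    | plus => exact hs n
  have e : ∀ d, A = liftSeq (.inl d) h W := fun d => by
    ext1 n
    rw [liftSeq_apply, hl, hA]
  have hlim : ∀ d, IndexLimit (.inl d) (fun n => unlift (.inl d) (h n) (A n)) W := fun d => by
    have := indexLimit_unlift_lift_self (h := h) (d := d) hB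
    simp only [hl] at this
    simpa only [hA] using this
  have hst : A ∈ structured p h := by
    refine mem_structured_iff.2 fun t => ?_
    obtain d | t := t
    · exact ⟨W, hlim d⟩
    · obtain ⟨α, β, hsl⟩ := hb.scaleLimits t
      obtain ⟨C, hC0, hC⟩ := exists_essBound hb.memLp
      have hC' : ∀ n, ∀ᵐ x : ℝ, ‖b (t + x / h n)‖ ≤ C := fun n =>
        ae_comp_scale hC t (index_pos (h n))
      have hm : ∀ n, MemLp (fun x => b (t + x / h n)) ⊤ := fun n =>
        memLp_scale hb.memLp t (h n)
      have hcon : ∀ {q : ℝ≥0∞} [Fact (1 ≤ q)] {Y : Op q}, Consistent Y (convOp b hb.memLp) →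
          ∀ n, Consistent (unlift (.inr t) (h n) Y) (convOp _ (hm n)) := fun hY n => by
        rw [← unlift_inr_convOp]
        exact hY.unlift_inr t (h n)
      obtain ⟨S, hS⟩ := exists_starStrongLimit hp hp' hr (hcon hW) (hcon hV)
        (fun n => norm_unlift_le _ _ _) (fun n => norm_unlift_le _ _ _)
        (fun n => norm_convOp_le (hm n) hC0 (hC' n))
        (starStrongLimit_convOp hm hC' (memLp_step α β) hsl.ae_tendsto)
      simp only [hA]
      exact ⟨S, hS⟩
  have hloc : LocalType h A := by
    refine localType_of_cayleyTest hp hp' hh fun {σ} hσ => ?_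
    obtain ⟨K, hK, hlim⟩ := exists_compact_commutator hp hp' hr hb hW hV hh hσ
    refine mem_compactSeq_of_sub (B := liftSeq (.inr c) h K) (mem_compactSeq_of_null ?_)
      (liftSeq_mem_compactSeq hK)
    simpa only [bddSeq_sub_apply, bddSeq_mul_apply, hA, liftSeq_apply] using hlim
  exact ⟨hst, hloc, fun d => ⟨W, hlim d, e d ▸ hst, e d ▸ hloc, locallyEquals_of_eq (e d)⟩⟩

lemma realizable_convolution (hp : 1 < p) (hp' : p ≠ ⊤)
    (hb : b ∈ multClosure p (linfAlg (pcAt c ∪ so ∪ buc))) {W : Op p} (hW : IsConvolution p b W)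
    {A : BddSeq p} (hA : ∀ n, A n = W) : A ∈ realizableAlg p hp hp' := by
  obtain ⟨hbm, hW⟩ : ∃ hb : MemLp b ⊤ volume, Consistent W (convOp b hb) := hW
  refine (isClosed_realizableAlg hp hp').closure_subset_iff.2 subset_rfl
    (Metric.mem_closure_iff.2 fun ε hε => ?_)
  obtain ⟨b', ⟨hb', hst⟩, hbd⟩ := hb.2 (ε / 2) (half_pos hε)
  have hbm' : MemLp b' ⊤ := by
    obtain ⟨k, hk, hs⟩ := exists_symbolLimits hb' id strictMono_id
    exact hs.memLp
  obtain ⟨r, hr1, hr, ⟨W', hW'⟩, ⟨V, hV⟩⟩ := exists_beyond hp hp' hst hbm'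
  refine ⟨BoundedContinuousFunction.const ℕ+ W', fun g hg => ?_, ?_⟩
  · obtain ⟨k, hk, hs⟩ := exists_symbolLimits hb' g hg
    exact ⟨k, hk, good_convolution hp hp' hr hs hW' hV (tendsto_of_strictMono (hg.comp hk))
      fun n => rfl⟩
  · refine lt_of_le_of_lt ?_ (half_lt_self hε)
    refine (BoundedContinuousFunction.dist_le (half_pos hε).le).2 fun n => ?_
    rw [hA, BoundedContinuousFunction.const_apply, dist_eq_norm]
    refine norm_le_of_multiplierBound hp' (b := b - b') (hb := hbm.sub hbm') ?_ (half_pos hε).le hbd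
    have := hW.sub hW'
    rwa [convOp_sub hbm hbm' (hbm.sub hbm')] at this

lemma algOne_le_realizableAlg (hp : 1 < p) (hp' : p ≠ ⊤) : algOne p ≤ realizableAlg p hp hp' := by
  refine Subalgebra.topologicalClosure_minimal (Algebra.adjoin_le ?_) (isClosed_realizableAlg hp hp')
  rintro A (((⟨a, ha, ham, hA⟩ | ⟨c, b, hb, W, hW, hA⟩) | ⟨K, hK, hA⟩) | hA)
  · intro g hg
    obtain ⟨k, hk, hl⟩ := exists_inftyLimits ha g hg
    exact ⟨k, hk, hl.good hp hp' (tendsto_of_strictMono (hg.comp hk)) fun n => hA _⟩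
  · exact realizable_convolution hp hp' hb hW hA
  · exact fun g hg => ⟨id, strictMono_id, good_of_pCompact hp hp' (tendsto_of_strictMono hg) hK
      fun n => hA _⟩
  · exact fun g hg => ⟨id, strictMono_id, good_proj hp hp' (tendsto_of_strictMono hg) fun n => hA _⟩

end ConvolutionRealizable

end FiniteSection

end

theorem mainTheorem10 (p : ℝ≥0∞) [Fact (1 ≤ p)] (hp : 1 < p) (hp' : p ≠ ⊤)
    (A : FiniteSection.BddSeq p) (hA : A ∈ FiniteSection.finiteSectionAlg p)
    (hW : ∀ g : ℕ+ → ℕ+, StrictMono g →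
      FiniteSection.subseq A g ∈ FiniteSection.structured p g →
      ∀ (t : FiniteSection.Direction) (S : FiniteSection.Op p),
        FiniteSection.IsSnapshot g (FiniteSection.subseq A g) S (Sum.inl t) →
        FiniteSection.PFredholm p S) :
    ∀ g : ℕ+ → ℕ+, StrictMono g →
      FiniteSection.subseq A g ∈ FiniteSection.structured p g →
      ∃ k : ℕ+ → ℕ+, StrictMono k ∧
        FiniteSection.JFredholm (g ∘ k) (FiniteSection.subseq A (g ∘ k)) :=
  fun g hg _ => FiniteSection.exists_jFredholm_subseq hp hp'
    (FiniteSection.algOne_le_realizableAlg hp hp') hA hW hg
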